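/- **Setting.** Let $\Gamma$ be a finite metric graph: finitely many vertices, finitely many internal edges $e$ identified with intervals $I_e=[0,l_e]$, $l_e>0$, and finitely many external edges identified with $I_e=[0,\infty)$; let $L^p(\Gamma)=\bigoplus_e L^p(I_e)$ with $\|f\|_{L^p(\Gamma)}^p=\sum_e\|f_e\|_{L^p(I_e)}^p$ (supremum over $e$ if $p=\infty$). Let $\Delta_\Gamma f=(f_e'')_e$ with domain $\{f\in H^2(\Gamma): A_v f(v)+B_v f'(v)=0 \text{ for every vertex } v\}$, where $A_v,B_v\in\mathbb C^{n_v\times n_v}$, $n_v$ is the number of edge ends at $v$, and $f(v)$, $f'(v)$ are the vectors of the boundary values of $f$ and of its derivatives (taken in the direction from $v$ into the edge) at these ends. Assume that $\Delta_\Gamma$ is self-adjoint in $L^2(\Gamma)$, and let $(e^{it\Delta_\Gamma})_{t\in\mathbb R}$ be the strongly continuous group of isometries of $L^2(\Gamma)$ generated by $i\Delta_\Gamma$. Let $\beta=(\beta(t))_{t\ge0}$ be a standard one-dimensional Brownian motion on a filtered probability space $(\Omega,\mathcal F,(\mathcal F_t)_{t\ge 0},\mathbb P)$ satisfying the usual hypotheses,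 and put $S_\beta(t,s)=e^{i(\beta(t)-\beta(s))\Delta_\Gamma}$ for $0\le s\le t$. Assume **(H.1)** The number of eigenvalues of $-\Delta_\Gamma$, counted with multiplicity, is finite, and there is $C>0$ such that $$\|e^{it\Delta_\Gamma}P_cu_0\|_{L^\infty(\Gamma)}\le \frac{C}{\sqrt{|t|}}\,\|u_0\|_{L^1(\Gamma)}\qquad\text{for all }u_0\in L^1(\Gamma)\cap L^2(\Gamma),\ t\ne0,$$ where $P_c=I-P_p$ and $P_p$ is the orthogonal projection of $L^2(\Gamma)$ onto the span of the eigenfunctions. A pair $(r,p)$ is called admissible if $(r,p)=(\infty,2)$, or if $2\le r,p<\infty$ and $\frac2r+\frac1p>\frac12$. Write $q'$ for the conjugate exponent of $q$, and $L^\rho_\omega L^r_{[s,s+T]}L^p_x=L^\rho(\Omega;L^r([s,s+T];L^p(\Gamma)))$. For $f(\sigma)\in L^{q'}(\Gamma)$, $2\le q<\infty$, $S_\beta(t,\sigma)f(\sigma)\in L^q(\Gamma)$ is defined through the continuous extension of $S_\beta(t,\sigma)$ from $L^2(\Gamma)\cap L^{q'}(\Gamma)$ to a bounded operator $L^{q'}(\Gamma)\to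 L^q(\Gamma)$. **Theorem.** Let $(r,p)$ be an admissible pair, $\theta=\frac2r-\frac12\big(\frac12-\frac1p\big)$, and let $T_0\in[0,\infty]$, where $T_0=\infty$ is allowed only if $-\Delta_\Gamma$ has no eigenvalues. All constants $c$ below are positive and, apart from the fixed data $\Gamma,\Delta_\Gamma,\beta$, depend only on $T_0$ and on the exponents shown as indices; in particular they do not depend on $s$, $T$, $X_s$, $f$. (i) There is $c_{r,p}$ such that for all $s\ge0$, all $T$ with $0<T<\infty$ and $T\le T_0$, and all $\mathcal F_s$-measurable $X_s\in L^r(\Omega;L^2(\Gamma))$, the process $S_\beta(\cdot,s)X_s$ is jointly measurable and $$\|S_\beta(\cdot,s)X_s\|_{L^r_\omega L^r_{[s,s+T]}L^p_x}\le c_{r,p}\,T^{\theta/2}\,\|X_s\|_{L^r_\omega L^2_x}.$$ (ii) Let $(\gamma,\delta)$ be an admissible pair such that $\frac1\gamma=\frac{1-\lambda}r$ and $\frac1\delta=\frac\lambda2+\frac{1-\lambda}p$ for some $\lambda\in[0,1]$, let $\bar\theta=\theta\,(1-\frac\lambda2)$ and $1\le\rho\le\infty$. (ii.1) If $\max\{\rho,\rho'\}\le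 r$, there is $c_{r,p,\gamma,\delta,\rho}$ such that for all $s\ge0$, all $T$ with $0<T<\infty$ and $T\le T_0$, and all predictable $f\in L^\rho_\omega L^{\gamma'}_{[s,s+T]}L^{\delta'}_x$, almost surely for almost every $t\in[s,s+T]$ the integral $\int_s^tS_\beta(t,\sigma)f(\sigma)\,d\sigma$ exists as a Bochner integral in $L^\delta(\Gamma)$, it is jointly measurable in $(\omega,t)$, and $$\Big\|\int_s^\cdot S_\beta(\cdot,\sigma)f(\sigma)\,d\sigma\Big\|_{L^\rho_\omega L^r_{[s,s+T]}L^p_x}\le c_{r,p,\gamma,\delta,\rho}\,T^{\bar\theta}\,\|f\|_{L^\rho_\omega L^{\gamma'}_{[s,s+T]}L^{\delta'}_x}.$$ (ii.2) If $r'\le\rho\le r$, there is $c_{r,p,\gamma,\delta,\rho}$ such that for all $s\ge0$, all $T$ with $0<T<\infty$ and $T\le T_0$, and all predictable $f\in L^\rho_\omega L^{r'}_{[s,s+T]}L^{p'}_x$, almost surely for almost every $t\in[s,s+T]$ the integral exists as a Bochner integral in $L^p(\Gamma)$, it is jointly measurable in $(\omega,t)$, and $$\Big\|\int_s^\cdot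 S_\beta(\cdot,\sigma)f(\sigma)\,d\sigma\Big\|_{L^\rho_\omega L^\gamma_{[s,s+T]}L^\delta_x}\le c_{r,p,\gamma,\delta,\rho}\,T^{\bar\theta}\,\|f\|_{L^\rho_\omega L^{r'}_{[s,s+T]}L^{p'}_x}.$$ -/

import Mathlib

open MeasureTheory ProbabilityTheory Filter Topology
open scoped NNReal ENNReal

noncomputable section

/-- A finite metric graph: internal edges `e : I` run from `source e` to `target e` and have a
finite length; external edges `e : E` are half-lines attached to `base e`. Loops and multiple edges
are allowed. -/
structure MetricGraph.{u} where
  V : Type u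
  I : Type u
  E : Type u
  [finite_V : Finite V]
  [finite_I : Finite I]
  [finite_E : Finite E]
  source : I → V
  target : I → V
  base : E → V
  len : I → ℝ
  len_pos : ∀ e, 0 < len e

namespace MetricGraph

attribute [instance] finite_V finite_I finite_E

/-- The edges of the graph. -/
def Edge (G : MetricGraph) : Type _ := G.I ⊕ G.E

instance (G : MetricGraph) : Finite G.Edge := inferInstanceAs (Finite (G.I ⊕ G.E))

instance (G : MetricGraph) : MeasurableSpace G.Edge := ⊤

instance (G : MetricGraph) : DiscreteMeasurableSpace G.Edge := ⟨fun _ => trivial⟩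

/-- The interval `I_e`: `[0, l_e]` for an internal edge, `[0, ∞)` for an external one. -/
def interval (G : MetricGraph) : G.Edge → Set ℝ
  | Sum.inl i => Set.Icc 0 (G.len i)
  | Sum.inr _ => Set.Ici 0

/-- The Lebesgue measure of `Γ`. The point at position `x ∈ I_e` of the edge `e` is `(e, x)`, and
the pairs with `x ∉ I_e` form a null set, so that `Lp ℂ p G.measure` is `⨁ e, L^p(I_e)` with the
`ℓ^p` sum of the norms. -/
def measure (G : MetricGraph) : Measure (G.Edge × ℝ) :=
  Measure.sum fun e : G.Edge => (volume.restrict (G.interval e)).map (Prod.mk e)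

/-- The ends of the edges: `inl (e, false)` is the initial end of the internal edge `e`,
`inl (e, true)` its terminal end, and `inr e` the end of the external edge `e`. -/
def EdgeEnd (G : MetricGraph) : Type _ := (G.I × Bool) ⊕ G.E

instance (G : MetricGraph) : Finite G.EdgeEnd := inferInstanceAs (Finite ((G.I × Bool) ⊕ G.E))

/-- The vertex at which an edge end is attached. -/
def vertex (G : MetricGraph) : G.EdgeEnd → G.V
  | Sum.inl (e, false) => G.source e
  | Sum.inl (e, true) => G.target e
  | Sum.inr e => G.base e

/-- The edge ends at the vertex `v`; their number is `n_v` (a loop at `v` contributes two). -/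
def EndsAt (G : MetricGraph) (v : G.V) : Type _ := {a : G.EdgeEnd // G.vertex a = v}

instance (G : MetricGraph) (v : G.V) : Fintype (G.EndsAt v) :=
  @Fintype.ofFinite _ (inferInstanceAs (Finite {a : G.EdgeEnd // G.vertex a = v}))

/-- The boundary value of `f = (f_e)` at an edge end. -/
def endValue (G : MetricGraph) (f : G.Edge → ℝ → ℂ) : G.EdgeEnd → ℂ
  | Sum.inl (e, false) => f (Sum.inl e) 0
  | Sum.inl (e, true) => f (Sum.inl e) (G.len e)
  | Sum.inr e => f (Sum.inr e) 0

/-- The boundary value of the derivative at an edge end, in the direction from the vertex into the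
edge, where `g = (f_e')`. -/
def endDeriv (G : MetricGraph) (g : G.Edge → ℝ → ℂ) : G.EdgeEnd → ℂ
  | Sum.inl (e, false) => g (Sum.inl e) 0
  | Sum.inl (e, true) => - g (Sum.inl e) (G.len e)
  | Sum.inr e => g (Sum.inr e) 0

/-- Local coupling conditions: matrices `A_v, B_v ∈ ℂ^{n_v × n_v}` for every vertex `v`. -/
structure Coupling (G : MetricGraph) where
  A : ∀ v : G.V, Matrix (G.EndsAt v) (G.EndsAt v) ℂ
  B : ∀ v : G.V, Matrix (G.EndsAt v) (G.EndsAt v) ℂ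

/-- The coupling condition `A_v f(v) + B_v f'(v) = 0` at every vertex `v`. -/
def Coupling.Holds {G : MetricGraph} (K : G.Coupling) (f g : G.Edge → ℝ → ℂ) : Prop :=
  ∀ v : G.V, (K.A v).mulVec (fun a => G.endValue f a.1)
    + (K.B v).mulVec (fun a => G.endDeriv g a.1) = 0

/-- `f` is the `C¹` representative of an element of `H²(Γ)` with first derivative `g` and second
(weak) derivative `w`: on each `I_e`, `f_e` and `g_e` are the primitives of `g_e` and `w_e`
(square-integrability of `f` and `w` is imposed where this is used). -/
structure IsH2 (G : MetricGraph) (f g w : G.Edge → ℝ → ℂ) : Prop where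
  memLp_deriv : ∀ e, MemLp (g e) 2 (volume.restrict (G.interval e))
  eq_integral : ∀ e, ∀ x ∈ G.interval e, f e x = f e 0 + ∫ y in (0 : ℝ)..x, g e y
  deriv_eq_integral : ∀ e, ∀ x ∈ G.interval e, g e x = g e 0 + ∫ y in (0 : ℝ)..x, w e y

lemma ae_measure_iff (G : MetricGraph) {q : G.Edge × ℝ → Prop} (hq : MeasurableSet {z | q z}) :
    (∀ᵐ z ∂G.measure, q z) ↔ ∀ e, ∀ᵐ x ∂(volume.restrict (G.interval e)), q (e, x) := by
  rw [measure, Measure.ae_sum_iff' hq]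
  exact forall_congr' fun e => ae_map_iff (measurable_prodMk_left.aemeasurable) hq

lemma ae_edge (G : MetricGraph) {q : G.Edge × ℝ → Prop} (h : ∀ᵐ z ∂G.measure, q z) (e : G.Edge) :
    ∀ᵐ x ∂(volume.restrict (G.interval e)), q (e, x) := by
  have h1 : ∀ᵐ z ∂((volume.restrict (G.interval e)).map (Prod.mk e)), q z :=
    (Measure.absolutelyContinuous_sum_right e Measure.AbsolutelyContinuous.rfl) h
  exact ae_of_ae_map measurable_prodMk_left.aemeasurable h1

lemma memLp_edge (G : MetricGraph) {u : G.Edge × ℝ → ℂ} (h : MemLp u 2 G.measure) (e : G.Edge) :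
    MemLp (fun x => u (e, x)) 2 (volume.restrict (G.interval e)) := by
  have h1 : MemLp u 2 ((volume.restrict (G.interval e)).map (Prod.mk e)) :=
    h.mono_measure (Measure.le_sum _ e)
  exact (memLp_map_measure_iff h1.1 measurable_prodMk_left.aemeasurable).1 h1

lemma uIcc_subset_interval (G : MetricGraph) (e : G.Edge) {x : ℝ} (hx : x ∈ G.interval e) :
    Set.uIcc 0 x ⊆ G.interval e := by
  rcases e with i | j
  · have hx' : x ∈ Set.Icc 0 (G.len i) := hx
    rw [Set.uIcc_of_le hx'.1]
    exact Set.Icc_subset_Icc_right hx'.2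
  · have hx' : 0 ≤ x := hx
    rw [Set.uIcc_of_le hx']
    exact Set.Icc_subset_Ici_self

lemma intervalIntegrable_edge (G : MetricGraph) {e : G.Edge} {h : ℝ → ℂ}
    (hh : MemLp h 2 (volume.restrict (G.interval e))) {x : ℝ} (hx : x ∈ G.interval e) :
    IntervalIntegrable h volume 0 x := by
  have h1 : MemLp h 2 (volume.restrict (Set.uIcc 0 x)) :=
    hh.mono_measure (Measure.restrict_mono (G.uIcc_subset_interval e hx) le_rfl)
  have : IsFiniteMeasure ((volume : Measure ℝ).restrict (Set.uIcc 0 x)) :=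
    ⟨by simp⟩
  have : IntegrableOn h (Set.uIcc 0 x) volume := h1.integrable (by norm_num)
  exact this.intervalIntegrable

lemma ae_uIoc_edge (G : MetricGraph) {e : G.Edge} {q : ℝ → Prop}
    (hh : ∀ᵐ y ∂(volume.restrict (G.interval e)), q y) {x : ℝ} (hx : x ∈ G.interval e) :
    ∀ᵐ y ∂(volume.restrict (Set.uIoc 0 x)), q y :=
  ae_mono (Measure.restrict_mono
    (Set.uIoc_subset_uIcc.trans (G.uIcc_subset_interval e hx)) le_rfl) hh

/-- `L²(Γ)`. -/
abbrev L2 (G : MetricGraph) : Type _ := Lp ℂ 2 G.measure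

/-- The graph of `Δ_Γ`: the pairs `(u, u'')` with `u ∈ H²(Γ)` satisfying the coupling conditions. -/
def Coupling.laplacianGraph {G : MetricGraph} (K : G.Coupling) : Submodule ℂ (G.L2 × G.L2) where
  carrier := {z | ∃ f g : G.Edge → ℝ → ℂ, (∀ᵐ x ∂G.measure, z.1 x = f x.1 x.2) ∧
    G.IsH2 f g (fun e x => z.2 (e, x)) ∧ K.Holds f g}
  zero_mem' := by
    refine ⟨0, 0, ?_, ⟨fun e => MemLp.zero, fun e x _ => by simp, fun e x hx => ?_⟩, fun v => ?_⟩
    · filter_upwards [Lp.coeFn_zero ℂ 2 G.measure] with x hx using by simpa using hx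
    · have h0 := G.ae_uIoc_edge (G.ae_edge (Lp.coeFn_zero ℂ 2 G.measure) e) hx
      have := intervalIntegral.integral_congr_ae_restrict (g := fun _ => (0 : ℂ)) h0
      simp only [Prod.snd_zero, Pi.zero_apply, zero_add]
      rw [this]; simp
    · have h1 : (fun a : G.EndsAt v => G.endValue 0 a.1) = 0 := by
        funext ⟨a, _⟩; rcases a with ⟨i, b⟩ | j
        · cases b <;> rfl
        · rfl
      have h2 : (fun a : G.EndsAt v => G.endDeriv 0 a.1) = 0 := by
        funext ⟨a, _⟩; rcases a with ⟨i, b⟩ | j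
        · cases b
          · rfl
          · exact neg_zero
        · rfl
      rw [h1, h2]; simp
  add_mem' := by
    rintro ⟨u₁, w₁⟩ ⟨u₂, w₂⟩ ⟨f₁, g₁, hu₁, h₁, c₁⟩ ⟨f₂, g₂, hu₂, h₂, c₂⟩
    refine ⟨f₁ + f₂, g₁ + g₂, ?_, ⟨fun e => (h₁.1 e).add (h₂.1 e), fun e x hx => ?_,
      fun e x hx => ?_⟩, fun v => ?_⟩
    · filter_upwards [Lp.coeFn_add u₁ u₂, hu₁, hu₂] with x hx hx1 hx2
      have hx' : (↑(u₁ + u₂) : G.Edge × ℝ → ℂ) x = u₁ x + u₂ x := hx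
      simpa [hx1, hx2] using hx'
    · have := intervalIntegral.integral_add (G.intervalIntegrable_edge (h₁.1 e) hx)
        (G.intervalIntegrable_edge (h₂.1 e) hx)
      simp only [Pi.add_apply]
      rw [this, h₁.2 e x hx, h₂.2 e x hx]; ring
    · have h0 := G.ae_uIoc_edge (G.ae_edge (Lp.coeFn_add w₁ w₂) e) hx
      have h3 := intervalIntegral.integral_congr_ae_restrict h0
      have h4 := intervalIntegral.integral_add
        (G.intervalIntegrable_edge (G.memLp_edge (Lp.memLp w₁) e) hx)
        (G.intervalIntegrable_edge (G.memLp_edge (Lp.memLp w₂) e) hx)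
      simp only [Pi.add_apply, Prod.mk_add_mk] at h3 ⊢
      rw [h3, h4, h₁.3 e x hx, h₂.3 e x hx]; ring
    · have e1 : (fun a : G.EndsAt v => G.endValue (f₁ + f₂) a.1)
          = (fun a => G.endValue f₁ a.1) + fun a => G.endValue f₂ a.1 := by
        funext ⟨a, _⟩; rcases a with ⟨i, b⟩ | j
        · cases b <;> rfl
        · rfl
      have e2 : (fun a : G.EndsAt v => G.endDeriv (g₁ + g₂) a.1)
          = (fun a => G.endDeriv g₁ a.1) + fun a => G.endDeriv g₂ a.1 := by
        funext ⟨a, _⟩; rcases a with ⟨i, b⟩ | j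
        · cases b
          · rfl
          · exact neg_add _ _
        · rfl
      rw [e1, e2, Matrix.mulVec_add, Matrix.mulVec_add]
      have := congrArg₂ (· + ·) (c₁ v) (c₂ v)
      simp only [add_zero] at this
      rw [← this]; abel
  smul_mem' := by
    rintro c ⟨u, w⟩ ⟨f, g, hu, h, hc⟩
    refine ⟨c • f, c • g, ?_, ⟨fun e => (h.1 e).const_smul c, fun e x hx => ?_,
      fun e x hx => ?_⟩, fun v => ?_⟩
    · filter_upwards [Lp.coeFn_smul c u, hu] with x hx hx1
      have hx' : (↑(c • u) : G.Edge × ℝ → ℂ) x = c • u x := hx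
      simpa [hx1] using hx'
    · simp only [Pi.smul_apply, smul_eq_mul]
      rw [intervalIntegral.integral_const_mul, h.2 e x hx]; ring
    · have h0 := G.ae_uIoc_edge (G.ae_edge (Lp.coeFn_smul c w) e) hx
      have h3 := intervalIntegral.integral_congr_ae_restrict h0
      simp only [Pi.smul_apply, smul_eq_mul, Prod.smul_mk] at h3 ⊢
      rw [h3, intervalIntegral.integral_const_mul, h.3 e x hx]; ring
    · have e1 : (fun a : G.EndsAt v => G.endValue (c • f) a.1)
          = c • fun a => G.endValue f a.1 := by
        funext ⟨a, _⟩; rcases a with ⟨i, b⟩ | j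
        · cases b <;> rfl
        · rfl
      have e2 : (fun a : G.EndsAt v => G.endDeriv (c • g) a.1)
          = c • fun a => G.endDeriv g a.1 := by
        funext ⟨a, _⟩; rcases a with ⟨i, b⟩ | j
        · cases b
          · rfl
          · exact (smul_neg c _).symm
        · rfl
      rw [e1, e2, Matrix.mulVec_smul, Matrix.mulVec_smul, ← smul_add, hc v, smul_zero]

lemma convex_interval (G : MetricGraph) (e : G.Edge) : Convex ℝ (G.interval e) := by
  rcases e with i | j
  · exact convex_Icc 0 (G.len i)
  · exact convex_Ici 0

lemma measurableSet_interval (G : MetricGraph) (e : G.Edge) : MeasurableSet (G.interval e) := by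
  rcases e with i | j
  · exact measurableSet_Icc (a := (0 : ℝ)) (b := G.len i)
  · exact measurableSet_Ici (a := (0 : ℝ))

lemma subset_closure_interior_interval (G : MetricGraph) (e : G.Edge) :
    G.interval e ⊆ closure (interior (G.interval e)) := by
  rcases e with i | j
  · change Set.Icc 0 (G.len i) ⊆ closure (interior (Set.Icc 0 (G.len i)))
    rw [interior_Icc, closure_Ioo (G.len_pos i).ne]
  · change Set.Ici (0 : ℝ) ⊆ closure (interior (Set.Ici 0))
    rw [interior_Ici, closure_Ioi]

lemma ae_eq_zero_of_primitive (G : MetricGraph) {e : G.Edge} {h : ℝ → ℂ}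
    (hh : MemLp h 2 (volume.restrict (G.interval e)))
    (h0 : ∀ x ∈ G.interval e, ∫ y in (0 : ℝ)..x, h y = 0) :
    h =ᵐ[volume.restrict (G.interval e)] 0 := by
  have hm := G.measurableSet_interval e
  have hloc : LocallyIntegrable ((G.interval e).indicator h) volume :=
    ((memLp_indicator_iff_restrict hm).2 hh).locallyIntegrable (by norm_num)
  have hfr : ∀ᵐ x : ℝ, x ∉ frontier (G.interval e) :=
    measure_eq_zero_iff_ae_notMem.1 ((G.convex_interval e).addHaar_frontier volume)
  refine (ae_restrict_iff' hm).2 ?_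
  filter_upwards [LocallyIntegrable.ae_hasDerivAt_integral hloc, hfr] with x hx hxf hxm
  have hxi : x ∈ interior (G.interval e) := by
    by_contra hcon
    exact hxf ⟨subset_closure hxm, hcon⟩
  have hev : (fun x => ∫ y in (0 : ℝ)..x, (G.interval e).indicator h y) =ᶠ[𝓝 x] fun _ => 0 := by
    filter_upwards [mem_interior_iff_mem_nhds.1 hxi] with z hz
    rw [← h0 z hz]
    refine intervalIntegral.integral_congr fun y hy => ?_
    exact Set.indicator_of_mem (G.uIcc_subset_interval e hz hy) h
  have h1 := (hx 0).unique ((hasDerivAt_const x (0 : ℂ)).congr_of_eventuallyEq hev)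
  rwa [Set.indicator_of_mem hxm] at h1

lemma continuousOn_of_primitive (G : MetricGraph) {e : G.Edge} {F h : ℝ → ℂ}
    (hh : MemLp h 2 (volume.restrict (G.interval e)))
    (hF : ∀ x ∈ G.interval e, F x = F 0 + ∫ y in (0 : ℝ)..x, h y) :
    ContinuousOn F (G.interval e) := by
  have hm := G.measurableSet_interval e
  have hloc : LocallyIntegrable ((G.interval e).indicator h) volume :=
    ((memLp_indicator_iff_restrict hm).2 hh).locallyIntegrable (by norm_num)
  have hc : Continuous fun x => F 0 + ∫ y in (0 : ℝ)..x, (G.interval e).indicator h y :=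
    continuous_const.add (intervalIntegral.continuous_primitive
      (fun a b => (hloc.integrableOn_isCompact isCompact_uIcc).intervalIntegrable) 0)
  refine hc.continuousOn.congr fun x hx => ?_
  rw [hF x hx]
  congr 1
  exact intervalIntegral.integral_congr fun y hy =>
    (Set.indicator_of_mem (G.uIcc_subset_interval e hx hy) h).symm

/-- The second derivative is determined by the function: the set `laplacianGraph` is a graph. -/
lemma Coupling.laplacianGraph_snd_eq_zero {G : MetricGraph} (K : G.Coupling)
    (z : G.L2 × G.L2) (hz : z ∈ K.laplacianGraph) (h0 : z.1 = 0) : z.2 = 0 := by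
  obtain ⟨f, g, hu, h, -⟩ := hz
  have hf : ∀ e, Set.EqOn (f e) 0 (G.interval e) := fun e => by
    refine Measure.eqOn_of_ae_eq (μ := volume) ?_ (G.continuousOn_of_primitive (h.1 e) (h.2 e))
      continuousOn_const (G.subset_closure_interior_interval e)
    have h1 := G.ae_edge (Lp.coeFn_zero ℂ 2 G.measure) e
    filter_upwards [G.ae_edge hu e, h1] with x hx hx1
    rw [h0] at hx
    exact hx.symm.trans hx1
  have hzero : ∀ e, ∀ x ∈ G.interval e, (0 : ℝ) ∈ G.interval e := fun e x hx =>
    G.uIcc_subset_interval e hx Set.left_mem_uIcc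
  have hg : ∀ e, Set.EqOn (g e) 0 (G.interval e) := fun e => by
    refine Measure.eqOn_of_ae_eq (μ := volume) (G.ae_eq_zero_of_primitive (h.1 e) fun x hx => ?_)
      (G.continuousOn_of_primitive (G.memLp_edge (Lp.memLp z.2) e) (h.3 e))
      continuousOn_const (G.subset_closure_interior_interval e)
    have h1 := h.2 e x hx
    rw [hf e hx, hf e (hzero e x hx)] at h1
    simpa using h1.symm
  refine Lp.ext ((?_ : (z.2 : G.Edge × ℝ → ℂ) =ᵐ[G.measure] 0).trans
    (Lp.coeFn_zero ℂ 2 G.measure).symm)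
  refine (G.ae_measure_iff (measurableSet_eq_fun (Lp.stronglyMeasurable z.2).measurable
    measurable_const)).2 fun e => ?_
  refine G.ae_eq_zero_of_primitive (G.memLp_edge (Lp.memLp z.2) e) fun x hx => ?_
  have h1 := h.3 e x hx
  rw [hg e hx, hg e (hzero e x hx)] at h1
  simpa using h1.symm

/-- The Laplacian `Δ_Γ` on `L²(Γ)`, with domain
`{u ∈ H²(Γ) : A_v u(v) + B_v u'(v) = 0 for every vertex v}`. -/
def Coupling.laplacian {G : MetricGraph} (K : G.Coupling) : G.L2 →ₗ.[ℂ] G.L2 :=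
  K.laplacianGraph.toLinearPMap

lemma Coupling.laplacian_graph {G : MetricGraph} (K : G.Coupling) :
    K.laplacian.graph = K.laplacianGraph :=
  Submodule.toLinearPMap_graph_eq _ K.laplacianGraph_snd_eq_zero

/-- The linear span of the eigenfunctions of `-Δ_Γ`. -/
def Coupling.pointSpace {G : MetricGraph} (K : G.Coupling) : Submodule ℂ G.L2 :=
  Submodule.span ℂ {u | ∃ (hu : u ∈ K.laplacian.domain) (l : ℂ), -K.laplacian ⟨u, hu⟩ = l • u}

/-- The projection `P_c = I - P_p`, with `P_p` the orthogonal projection onto the (closed) span of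
the eigenfunctions. -/
def Coupling.Pc {G : MetricGraph} (K : G.Coupling) : G.L2 →L[ℂ] G.L2 :=
  1 - K.pointSpace.topologicalClosure.starProjection

end MetricGraph

/-- `U` is the strongly continuous group of isometries generated by `i A`. -/
structure IsUnitaryGroup {H : Type*} [NormedAddCommGroup H] [InnerProductSpace ℂ H]
    (A : H →ₗ.[ℂ] H) (U : ℝ → H →L[ℂ] H) : Prop where
  zero : U 0 = 1
  add : ∀ s t, U (s + t) = U s * U t
  norm_eq : ∀ t u, ‖U t u‖ = ‖u‖
  continuous : ∀ u, Continuous fun t => U t u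
  generator : ∀ u v, (u, v) ∈ A.graph ↔
    Tendsto (fun h : ℝ => (h : ℂ)⁻¹ • (U h u - u)) (𝓝[≠] 0) (𝓝 (Complex.I • v))

open Classical in
/-- The group `t ↦ e^{itA}` generated by `i A`; it exists (and is unique) when `A` is
self-adjoint. -/
def unitaryGroup {H : Type*} [NormedAddCommGroup H] [InnerProductSpace ℂ H]
    (A : H →ₗ.[ℂ] H) : ℝ → H →L[ℂ] H :=
  if h : ∃ U : ℝ → H →L[ℂ] H, IsUnitaryGroup A U then h.choose else 0

instance fact_one_le_conjExponent (q : ℝ≥0∞) : Fact (1 ≤ q.conjExponent) :=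
  ⟨le_self_add⟩

open Classical in
/-- The continuous extension to `L^a → L^b` of the restriction to `L² ∩ L^a` of an operator `R` on
`L²` (zero if there is none). -/
def extendLp {X : Type*} [MeasurableSpace X] {μ : Measure X} (R : Lp ℂ 2 μ →L[ℂ] Lp ℂ 2 μ)
    (a b : ℝ≥0∞) [Fact (1 ≤ a)] [Fact (1 ≤ b)] : Lp ℂ a μ →L[ℂ] Lp ℂ b μ :=
  if h : ∃ L : Lp ℂ a μ →L[ℂ] Lp ℂ b μ, ∀ (u : Lp ℂ a μ) (v : Lp ℂ 2 μ),
      u =ᵐ[μ] v → L u =ᵐ[μ] R v then h.choose else 0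

namespace MetricGraph

/-- The deterministic group `e^{itΔ_Γ}` on `L²(Γ)`. -/
def Coupling.group {G : MetricGraph} (K : G.Coupling) : ℝ → G.L2 →L[ℂ] G.L2 :=
  unitaryGroup K.laplacian

/-- Hypothesis (H.1): `-Δ_Γ` has finitely many eigenvalues, counted with multiplicity, and
`e^{itΔ_Γ} P_c` satisfies the dispersive estimate. -/
def Coupling.H1 {G : MetricGraph} (K : G.Coupling) : Prop :=
  FiniteDimensional ℂ K.pointSpace ∧
  ∃ C : ℝ, 0 < C ∧ ∀ (u : G.L2), MemLp u 1 G.measure → ∀ t : ℝ, t ≠ 0 →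
    eLpNorm (K.group t (K.Pc u)) ∞ G.measure
      ≤ ENNReal.ofReal (C / √|t|) * eLpNorm u 1 G.measure

/-- The propagator `S_β(t, s) = e^{i(β(t) - β(s))Δ_Γ}` on `L²(Γ)`. -/
def Coupling.propagator {G : MetricGraph} (K : G.Coupling) {Ω : Type*} (β : ℝ≥0 → Ω → ℝ)
    (t s : ℝ≥0) (ω : Ω) : G.L2 →L[ℂ] G.L2 :=
  K.group (β t ω - β s ω)

/-- The integrand `S_β(t, σ) f(σ)` for `f(σ) ∈ L^{q'}(Γ)`, where `S_β(t, σ)` is extended from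
`L² ∩ L^{q'}` to a bounded operator `L^{q'}(Γ) → L^q(Γ)`. -/
def Coupling.duhamelIntegrand {G : MetricGraph} (K : G.Coupling) {Ω : Type*} (β : ℝ≥0 → Ω → ℝ)
    (q : ℝ≥0∞) [Fact (1 ≤ q)] (f : ℝ≥0 → Ω → Lp ℂ q.conjExponent G.measure)
    (ω : Ω) (t σ : ℝ≥0) : Lp ℂ q G.measure :=
  extendLp (K.propagator β t σ ω) q.conjExponent q (f σ ω)

/-- The Duhamel integral `∫_s^t S_β(t, σ) f(σ) dσ`, a Bochner integral in `L^q(Γ)`. -/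
def Coupling.duhamel {G : MetricGraph} (K : G.Coupling) {Ω : Type*} (β : ℝ≥0 → Ω → ℝ)
    (q : ℝ≥0∞) [Fact (1 ≤ q)] (f : ℝ≥0 → Ω → Lp ℂ q.conjExponent G.measure)
    (s t : ℝ≥0) (ω : Ω) : Lp ℂ q G.measure :=
  ∫ σ in Set.Ioc (s : ℝ) t, K.duhamelIntegrand β q f ω t σ.toNNReal

/-- The norm of `L^ρ_ω L^r_{[s,s+T]} L^p_x`. -/
def mixedNorm (G : MetricGraph) {Ω : Type*} [MeasurableSpace Ω] (P : Measure Ω) (ρ r p : ℝ≥0∞)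
    (s T : ℝ≥0) (u : ℝ≥0 → Ω → G.Edge × ℝ → ℂ) : ℝ≥0∞ :=
  eLpNorm (fun ω => eLpNorm (fun t : ℝ => eLpNorm (u t.toNNReal ω) p G.measure) r
    (volume.restrict (Set.Icc (s : ℝ) (s + T)))) ρ P

/-- The Duhamel integral of `f`, with values in `L^q(Γ)`, is well defined on `[s, s+T]`: almost
surely, for almost every `t`, the integrand is Bochner integrable on `(s, t]`, and the integral is
jointly measurable in `(ω, t)`. -/
def Coupling.DuhamelWellDefined {G : MetricGraph} (K : G.Coupling) {Ω : Type*} [MeasurableSpace Ω]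
    (P : Measure Ω) (β : ℝ≥0 → Ω → ℝ) (q : ℝ≥0∞) [Fact (1 ≤ q)]
    (f : ℝ≥0 → Ω → Lp ℂ q.conjExponent G.measure) (s T : ℝ≥0) : Prop :=
  (∀ᵐ ω ∂P, ∀ᵐ t ∂(volume.restrict (Set.Icc (s : ℝ) (s + T))),
    IntegrableOn (fun σ : ℝ => K.duhamelIntegrand β q f ω t.toNNReal σ.toNNReal)
      (Set.Ioc (s : ℝ) t)) ∧
  AEStronglyMeasurable (fun z : Ω × ℝ => K.duhamel β q f s z.2.toNNReal z.1)
    (P.prod (volume.restrict (Set.Icc (s : ℝ) (s + T))))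

end MetricGraph

/-- The usual hypotheses: the filtered probability space is complete, `ℱ 0` contains the null sets
and the filtration is right-continuous. -/
structure UsualHypotheses {Ω : Type*} {mΩ : MeasurableSpace Ω} (ℱ : Filtration ℝ≥0 mΩ)
    (P : Measure Ω) : Prop where
  complete : ∀ N : Set Ω, P N = 0 → MeasurableSet[ℱ 0] N
  rightContinuous : ℱ.IsRightContinuous

/-- `β` is a standard one-dimensional Brownian motion relative to the filtration `ℱ`. -/
structure IsFilteredBrownian {Ω : Type*} {mΩ : MeasurableSpace Ω} (ℱ : Filtration ℝ≥0 mΩ)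
    (P : Measure Ω) (β : ℝ≥0 → Ω → ℝ) : Prop where
  brownian : IsBrownianReal β P
  adapted : ∀ t, Measurable[ℱ t] (β t)
  indep : ∀ s t, s ≤ t →
    Indep (MeasurableSpace.comap (fun ω => β t ω - β s ω) inferInstance) (ℱ s) P

/-- Admissible exponent pairs: `(r, p) = (∞, 2)`, or `2 ≤ r, p < ∞` and `2/r + 1/p > 1/2`. -/
def Admissible (r p : ℝ≥0∞) : Prop :=
  (r = ∞ ∧ p = 2) ∨ (2 ≤ r ∧ r < ∞ ∧ 2 ≤ p ∧ p < ∞ ∧ 2⁻¹ < 2 * r⁻¹ + p⁻¹)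

/-- The exponent `2/r - (1/2)(1/2 - 1/p)`. -/
def strichartzExponent (r p : ℝ≥0∞) : ℝ :=
  2 * (r⁻¹).toReal - 1 / 2 * (1 / 2 - (p⁻¹).toReal)

end

section LpToolkit

variable {X : Type*} [MeasurableSpace X] {μ : Measure X}

/-- Hölder's inequality for the inner product of `L²`. -/
lemma enorm_inner_le_eLpNorm_mul (p q : ℝ≥0∞) [hpq : p.HolderConjugate q] (g V : Lp ℂ 2 μ) :
    ‖inner ℂ g V‖ₑ ≤ eLpNorm g q μ * eLpNorm V p μ := by
  rw [L2.inner_def]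
  refine (enorm_integral_le_lintegral_enorm _).trans ?_
  have h := eLpNorm_le_eLpNorm_mul_eLpNorm_of_nnnorm (p := q) (q := p) (r := 1)
    (Lp.aestronglyMeasurable g) (Lp.aestronglyMeasurable V) (fun x y => inner ℂ x y) 1
    (ae_of_all _ fun x => by simpa using nnnorm_inner_le_nnnorm (𝕜 := ℂ) (g x) (V x))
    (hpqr := hpq.symm)
  simpa [eLpNorm_one_eq_lintegral_enorm] using h

/-- Converse Hölder inequality on `L²`. -/
lemma eLpNorm_le_of_forall_enorm_inner_le {p q : ℝ≥0∞} (hpq : p.HolderConjugate q) (hp : 2 ≤ p)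
    (hp' : p ≠ ∞) (V : Lp ℂ 2 μ) (C : ℝ≥0∞)
    (h : ∀ g : Lp ℂ 2 μ, eLpNorm g q μ ≠ ∞ → ‖inner ℂ g V‖ₑ ≤ C * eLpNorm g q μ) :
    eLpNorm V p μ ≤ C := by
  have hp0 : p ≠ 0 := (lt_of_lt_of_le (by norm_num) hp).ne'
  have hpr : 2 ≤ p.toReal := by
    have := (ENNReal.toReal_le_toReal (by norm_num) hp').2 hp; simpa using this
  have hq0 : q ≠ 0 := hpq.symm.ne_zero
  have hq' : q ≠ ∞ := by
    rintro rfl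
    have h1 := hpq.inv_add_inv_eq_inv
    simp only [ENNReal.inv_top, add_zero, inv_inj] at h1
    rw [h1] at hp; norm_num at hp
  have hRC : p.toReal.HolderConjugate q.toReal :=
    ENNReal.HolderConjugate.toReal (by linarith)
  let V' : X → ℂ := fun x => V x
  have hVm : StronglyMeasurable V' := Lp.stronglyMeasurable V
  let E : ℕ → Set X := fun n => {x | ‖V' x‖ ≤ n}
  have hE : ∀ n, MeasurableSet (E n) := fun n =>
    measurableSet_le hVm.norm.measurable measurable_const
  let I : ℕ → ℝ≥0∞ := fun n => ∫⁻ x in E n, ‖V' x‖ₑ ^ p.toReal ∂μ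
  have hIle : ∀ n, I n ≤ C ^ p.toReal := by
    intro n
    let φ : X → ℂ := (E n).indicator fun x => ((‖V' x‖ ^ (p.toReal - 2) : ℝ) : ℂ) * V' x
    have hφm : StronglyMeasurable φ := by
      refine StronglyMeasurable.indicator ?_ (hE n)
      refine StronglyMeasurable.mul ?_ hVm
      exact (Complex.measurable_ofReal.comp
        (hVm.norm.measurable.pow_const _)).stronglyMeasurable
    have hφn : ∀ x, ‖φ x‖ = (E n).indicator (fun x => ‖V' x‖ ^ (p.toReal - 1)) x := by
      intro x
      by_cases hx : x ∈ E n
      · simp only [φ, Set.indicator_of_mem hx, norm_mul, Complex.norm_real, Real.norm_eq_abs]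
        rw [abs_of_nonneg (by positivity)]
        rcases eq_or_lt_of_le (norm_nonneg (V' x)) with h0 | h0
        · rw [← h0, mul_zero, Real.zero_rpow (by linarith)]
        · rw [show p.toReal - 1 = (p.toReal - 2) + 1 by ring, Real.rpow_add h0, Real.rpow_one]
      · simp [φ, Set.indicator_of_notMem hx]
    have hφ2 : MemLp φ 2 μ := by
      refine (Lp.memLp V).of_le_mul (c := (n : ℝ) ^ (p.toReal - 2)) hφm.aestronglyMeasurable
        (ae_of_all _ fun x => ?_)
      by_cases hx : x ∈ E n
      · simp only [φ, Set.indicator_of_mem hx, norm_mul, Complex.norm_real, Real.norm_eq_abs]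
        rw [abs_of_nonneg (by positivity)]
        gcongr
        exact hx
      · simp only [φ, Set.indicator_of_notMem hx, norm_zero]; positivity
    have hfin : I n ≠ ∞ := by
      have h2 : ∫⁻ x, ‖V' x‖ₑ ^ (2 : ℝ) ∂μ ≠ ∞ := by
        have := (lintegral_rpow_enorm_lt_top_of_eLpNorm_lt_top (p := 2) (by norm_num)
          (by norm_num) (Lp.memLp V).2).ne
        simpa using this
      refine ne_top_of_le_ne_top (ENNReal.mul_ne_top
        (ENNReal.ofReal_ne_top (r := (n : ℝ) ^ (p.toReal - 2))) h2) ?_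
      rw [← lintegral_const_mul' _ _ ENNReal.ofReal_ne_top]
      refine (setLIntegral_mono' (hE n) fun x hx => ?_).trans (setLIntegral_le_lintegral _ _)
      have hx' : ‖V' x‖ₑ ≤ ENNReal.ofReal n := by
        rw [← ofReal_norm]; exact ENNReal.ofReal_le_ofReal hx
      rw [show p.toReal = (p.toReal - 2) + 2 by ring,
        ENNReal.rpow_add_of_nonneg _ _ (by linarith) (by norm_num),
        ← ENNReal.ofReal_rpow_of_nonneg (by positivity) (by linarith)]
      have : p.toReal - 2 + 2 - 2 = p.toReal - 2 := by ring
      rw [this]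
      gcongr
    have hLq : eLpNorm φ q μ = I n ^ (1 / q.toReal) := by
      rw [eLpNorm_eq_lintegral_rpow_enorm_toReal hq0 hq']
      congr 1
      simp only [I]
      rw [← lintegral_indicator (hE n)]
      refine lintegral_congr fun x => ?_
      rw [← ofReal_norm, hφn]
      by_cases hx : x ∈ E n
      · simp only [Set.indicator_of_mem hx]
        rw [← ENNReal.ofReal_rpow_of_nonneg (norm_nonneg _) (by linarith), ofReal_norm,
          ← ENNReal.rpow_mul]
        congr 1
        have := hRC.sub_one_mul_conj
        linarith
      · simp only [Set.indicator_of_notMem hx]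
        simp [hRC.symm.pos]
    have hin : ‖inner ℂ (hφ2.toLp φ) V‖ₑ = I n := by
      have h1 : inner ℂ (hφ2.toLp φ) V = ∫ x, (((E n).indicator (fun x => ‖V' x‖ ^ p.toReal) x : ℝ) : ℂ) ∂μ := by
        rw [L2.inner_def]
        refine integral_congr_ae ?_
        filter_upwards [hφ2.coeFn_toLp] with x hx
        rw [hx]
        by_cases hx : x ∈ E n
        · simp only [φ, Set.indicator_of_mem hx]
          rw [RCLike.inner_apply, map_mul, Complex.conj_ofReal, mul_left_comm]
          have : V' x * (starRingEnd ℂ) (V' x) = ((‖V' x‖ ^ 2 : ℝ) : ℂ) := by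
            rw [Complex.mul_conj, Complex.normSq_eq_norm_sq]
          change _ * (V' x * (starRingEnd ℂ) (V' x)) = _
          rw [this, ← Complex.ofReal_mul]
          congr 1
          rcases eq_or_lt_of_le (norm_nonneg (V' x)) with h0 | h0
          · rw [← h0, Real.zero_rpow (x := p.toReal) (by linarith)]; simp
          · rw [← Real.rpow_natCast, ← Real.rpow_add h0]; congr 1; push_cast; ring
        · simp [φ, Set.indicator_of_notMem hx]
      rw [h1, integral_complex_ofReal]
      have h2 : ∫ x, (E n).indicator (fun x => ‖V' x‖ ^ p.toReal) x ∂μ = (I n).toReal := by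
        rw [integral_eq_lintegral_of_nonneg_ae]
        · congr 1
          simp only [I]
          rw [← lintegral_indicator (hE n)]
          refine lintegral_congr fun x => ?_
          by_cases hx : x ∈ E n
          · simp only [Set.indicator_of_mem hx]
            rw [← ENNReal.ofReal_rpow_of_nonneg (norm_nonneg _) (by linarith),
              ofReal_norm]
          · simp [Set.indicator_of_notMem hx]
        · exact ae_of_all _ fun x => Set.indicator_nonneg (fun x _ => by positivity) x
        · exact ((hVm.norm.measurable.pow_const _).indicator (hE n)).aestronglyMeasurable
      rw [h2]
      have : ‖((I n).toReal : ℂ)‖ₑ = ENNReal.ofReal (I n).toReal := by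
        rw [← ofReal_norm, Complex.norm_real, Real.norm_of_nonneg ENNReal.toReal_nonneg]
      exact this.trans (ENNReal.ofReal_toReal hfin)
    have hφLq : eLpNorm (hφ2.toLp φ) q μ = I n ^ (1 / q.toReal) := by
      rw [eLpNorm_congr_ae hφ2.coeFn_toLp, hLq]
    have key := h (hφ2.toLp φ) (by
      rw [hφLq]; exact ENNReal.rpow_ne_top_of_nonneg (by simp) hfin)
    rw [hin, hφLq] at key
    rcases eq_or_ne (I n) 0 with h0 | h0
    · rw [h0]; exact zero_le
    · have hx0 : I n ^ (1 / q.toReal) ≠ 0 := by simp [h0, hfin]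
      have hxt : I n ^ (1 / q.toReal) ≠ ∞ := ENNReal.rpow_ne_top_of_nonneg (by simp) hfin
      have h3 : I n ^ (1 / p.toReal) ≤ C := by
        have h4 : I n = I n ^ (1 / p.toReal) * I n ^ (1 / q.toReal) := by
          rw [← ENNReal.rpow_add _ _ h0 hfin]
          have := hRC.inv_add_inv_eq_one
          rw [one_div, one_div, this, ENNReal.rpow_one]
        nth_rewrite 1 [h4] at key
        exact (ENNReal.mul_le_mul_iff_left hx0 hxt).1 key
      calc I n = (I n ^ (1 / p.toReal)) ^ p.toReal := by
            rw [← ENNReal.rpow_mul, one_div, inv_mul_cancel₀ (by linarith), ENNReal.rpow_one]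
        _ ≤ _ := by gcongr
  rw [eLpNorm_eq_lintegral_rpow_enorm_toReal hp0 hp']
  have hsup : ∫⁻ x, ‖V' x‖ₑ ^ p.toReal ∂μ ≤ C ^ p.toReal := by
    have h1 : ∫⁻ x, ‖V' x‖ₑ ^ p.toReal ∂μ
        = ⨆ n, ∫⁻ x, (E n).indicator (fun x => ‖V' x‖ₑ ^ p.toReal) x ∂μ := by
      rw [← lintegral_iSup]
      · refine lintegral_congr fun x => ?_
        refine le_antisymm ?_ (iSup_le fun n => Set.indicator_le_self _ _ _)
        obtain ⟨n, hn⟩ := exists_nat_ge ‖V' x‖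
        refine le_iSup_of_le n ?_
        rw [Set.indicator_of_mem (show x ∈ E n from hn)]
      · exact fun n => (hVm.enorm.pow_const _).indicator (hE n)
      · intro n m hnm
        refine Set.indicator_le_indicator_of_subset (fun x (hx : ‖V' x‖ ≤ n) => ?_)
          (fun _ => zero_le)
        exact hx.trans (by exact_mod_cast hnm)
    rw [h1]
    refine iSup_le fun n => ?_
    rw [lintegral_indicator (hE n)]
    exact hIle n
  calc _ ≤ (C ^ p.toReal) ^ (1 / p.toReal) := by gcongr
    _ = C := by
      rw [← ENNReal.rpow_mul, one_div, mul_inv_cancel₀ (by linarith), ENNReal.rpow_one]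

/-- A countable norming family for the `L^p` norm on `L²`. -/
lemma exists_norming_seq {p q : ℝ≥0∞} (hpq : p.HolderConjugate q) (hp : 2 ≤ p)
    (hp' : p ≠ ∞) [Fact (1 ≤ q)] [SecondCountableTopology (Lp ℂ 2 μ)] [SecondCountableTopology (Lp ℂ q μ)] :
    ∃ g : ℕ → Lp ℂ 2 μ, (∀ j, eLpNorm (g j) q μ ≤ 1) ∧
      ∀ V : Lp ℂ 2 μ, eLpNorm V p μ = ⨆ j, ‖inner ℂ (g j) V‖ₑ := by
  let S : Set (Lp ℂ 2 μ × Lp ℂ q μ) := {z | z.1 =ᵐ[μ] z.2 ∧ ‖z.2‖ ≤ 1}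
  have hne : Nonempty S := ⟨⟨0, by
    refine ⟨?_, by simp⟩
    exact (Lp.coeFn_zero ℂ 2 μ).trans (Lp.coeFn_zero ℂ q μ).symm⟩⟩
  let d : ℕ → S := TopologicalSpace.denseSeq S
  have hS : ∀ z : S, eLpNorm z.1.1 q μ ≤ 1 := fun z => by
    rw [eLpNorm_congr_ae z.2.1, ← Lp.enorm_def, ← ofReal_norm]
    exact ENNReal.ofReal_le_one.2 z.2.2
  refine ⟨fun j => (d j).1.1, fun j => hS _, fun V => le_antisymm ?_ ?_⟩
  · refine eLpNorm_le_of_forall_enorm_inner_le hpq hp hp' V _ fun g hg => ?_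
    have hgm : MemLp g q μ := ⟨Lp.aestronglyMeasurable g, hg.lt_top⟩
    rcases eq_or_ne (eLpNorm g q μ) 0 with h0 | h0
    · have : g = 0 := by
        rw [eLpNorm_eq_zero_iff (Lp.aestronglyMeasurable g) hpq.symm.ne_zero] at h0
        exact (Lp.eq_zero_iff_ae_eq_zero).2 h0
      simp [this]
    set c : ℝ := (eLpNorm g q μ).toReal with hc
    have hcpos : 0 < c := ENNReal.toReal_pos h0 hg
    have hmem : (((c⁻¹ : ℝ) : ℂ) • g, ((c⁻¹ : ℝ) : ℂ) • hgm.toLp g) ∈ S := by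
      constructor
      · refine (Lp.coeFn_smul _ _).trans (EventuallyEq.trans ?_ (Lp.coeFn_smul _ _).symm)
        filter_upwards [hgm.coeFn_toLp] with x hx
        simp [hx]
      · rw [norm_smul, Lp.norm_toLp, Complex.norm_real, Real.norm_of_nonneg (by positivity), ← hc,
          inv_mul_cancel₀ hcpos.ne']
    have hcl : ∀ z : S, ‖inner ℂ z.1.1 V‖ₑ ≤ ⨆ j, ‖inner ℂ (d j).1.1 V‖ₑ := by
      have hclosed : IsClosed {z : S | ‖inner ℂ z.1.1 V‖ₑ ≤ ⨆ j, ‖inner ℂ (d j).1.1 V‖ₑ} := by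
        refine isClosed_le ?_ continuous_const
        fun_prop
      intro z
      have hd : DenseRange d := TopologicalSpace.denseRange_denseSeq S
      exact hd.induction_on (p := fun z => ‖inner ℂ z.1.1 V‖ₑ ≤ ⨆ j, ‖inner ℂ (d j).1.1 V‖ₑ) z
        hclosed fun j => le_iSup (fun j => ‖inner ℂ (d j).1.1 V‖ₑ) j
    have h1 := hcl ⟨_, hmem⟩
    simp only [inner_smul_left, enorm_mul] at h1
    have h2 : ‖(starRingEnd ℂ) ((c⁻¹ : ℝ) : ℂ)‖ₑ = (eLpNorm g q μ)⁻¹ := by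
      rw [Complex.conj_ofReal, ← ofReal_norm, Complex.norm_real,
        Real.norm_of_nonneg (by positivity), ENNReal.ofReal_inv_of_pos hcpos, hc,
        ENNReal.ofReal_toReal hg]
    rw [h2] at h1
    rw [mul_comm]
    calc _ = eLpNorm g q μ * ((eLpNorm g q μ)⁻¹ * ‖inner ℂ g V‖ₑ) := by
          rw [← mul_assoc, ENNReal.mul_inv_cancel h0 hg, one_mul]
      _ ≤ _ := by gcongr
  · refine iSup_le fun j => ?_
    refine (enorm_inner_le_eLpNorm_mul p q _ V).trans ?_
    calc _ ≤ 1 * eLpNorm V p μ := by gcongr; exact hS _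
      _ = _ := one_mul _

/-- The `L^p` norm is a measurable function on `L^q`. -/
lemma lowerSemicontinuous_eLpNorm (p q : ℝ≥0∞) [Fact (1 ≤ q)] :
    LowerSemicontinuous fun V : Lp ℂ q μ => eLpNorm V p μ := by
  refine lowerSemicontinuous_iff_isClosed_preimage.2 fun c => ?_
  refine IsSeqClosed.isClosed fun V W hV hW => ?_
  have h1 := tendstoInMeasure_of_tendsto_Lp hW
  obtain ⟨ns, -, hns⟩ := h1.exists_seq_tendsto_ae
  have h2 := Lp.eLpNorm_lim_le_liminf_eLpNorm (p := p) (f := fun n => (V (ns n) : X → ℂ))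
    (fun n => Lp.aestronglyMeasurable _) W hns
  refine h2.trans ?_
  refine (liminf_le_liminf (v := fun _ => c) (Eventually.of_forall fun n => hV _)).trans ?_
  simp

lemma eLpNorm_le_of_tendsto {p q : ℝ≥0∞} [Fact (1 ≤ q)] {V : ℕ → Lp ℂ q μ} {W : Lp ℂ q μ}
    (h : Tendsto V atTop (𝓝 W)) :
    eLpNorm W p μ ≤ liminf (fun n => eLpNorm (V n) p μ) atTop :=
  (lowerSemicontinuousAt_iff_le_liminf.1 (lowerSemicontinuous_eLpNorm p q W)).trans
    (liminf_le_liminf_of_le h)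

end LpToolkit

section RieszThorin

/-- `|a|^w · a/|a|`, the analytic family used to interpolate between powers of `|a|`. -/
noncomputable def phasePow (w a : ℂ) : ℂ := if a = 0 then 0 else (‖a‖ : ℂ) ^ w * (a / ‖a‖)

lemma phasePow_zero (w : ℂ) : phasePow w 0 = 0 := by simp [phasePow]

lemma phasePow_one (a : ℂ) : phasePow 1 a = a := by
  by_cases h : a = 0
  · simp [phasePow, h]
  · have : (‖a‖ : ℂ) ≠ 0 := by simpa using h
    simp only [phasePow, h, if_false, Complex.cpow_one]
    field_simp

lemma norm_phasePow {w : ℂ} (hw : 0 < w.re) (a : ℂ) : ‖phasePow w a‖ = ‖a‖ ^ w.re := by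
  by_cases h : a = 0
  · simp [phasePow, h, Real.zero_rpow hw.ne']
  · have h' : 0 < ‖a‖ := norm_pos_iff.2 h
    simp only [phasePow, h, if_false, norm_mul, norm_div, Complex.norm_real, norm_norm]
    rw [div_self h'.ne', mul_one, Complex.norm_cpow_eq_rpow_re_of_pos h']

lemma conj_phasePow (w a : ℂ) :
    (starRingEnd ℂ) (phasePow ((starRingEnd ℂ) w) a) = phasePow w ((starRingEnd ℂ) a) := by
  by_cases h : a = 0
  · simp [phasePow, h]
  · have h' : (‖a‖ : ℂ) ≠ 0 := by simpa using h
    have h3 : (starRingEnd ℂ) a ≠ 0 := by simpa using h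
    simp only [phasePow, h, h3, if_false, map_mul, map_div₀, Complex.conj_ofReal, RCLike.norm_conj]
    congr 1
    rw [Complex.cpow_def_of_ne_zero h', Complex.cpow_def_of_ne_zero h', ← Complex.exp_conj,
      map_mul, ← Complex.ofReal_log (norm_nonneg a), Complex.conj_ofReal, Complex.conj_conj]

lemma differentiable_phasePow (a : ℂ) : Differentiable ℂ fun w => phasePow w a := by
  by_cases h : a = 0
  · simp [phasePow, h]
  · have h' : (‖a‖ : ℂ) ≠ 0 := by simpa using h
    simp only [phasePow, h, if_false]
    refine Differentiable.mul_const (fun w => ?_) _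
    exact DifferentiableAt.const_cpow differentiableAt_id (Or.inl h')

variable {X : Type*} [MeasurableSpace X] {μ : Measure X}

/-- The element `ψ ∘ φ` of `L²` for a simple function `φ` of finite measure support. -/
noncomputable def liftSimple (φ : SimpleFunc X ℂ) (hφ : φ.FinMeasSupp μ) (ψ : ℂ → ℂ)
    (hψ : ψ 0 = 0) : Lp ℂ 2 μ :=
  ((SimpleFunc.memLp_iff_finMeasSupp (by norm_num) (by norm_num)).2 (hφ.map hψ)).toLp (φ.map ψ)

lemma coeFn_liftSimple (φ : SimpleFunc X ℂ) (hφ : φ.FinMeasSupp μ) (ψ : ℂ → ℂ) (hψ : ψ 0 = 0) :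
    liftSimple φ hφ ψ hψ =ᵐ[μ] fun x => ψ (φ x) :=
  MemLp.coeFn_toLp _

open Classical in
lemma liftSimple_eq_sum (φ : SimpleFunc X ℂ) (hφ : φ.FinMeasSupp μ) (ψ : ℂ → ℂ) (hψ : ψ 0 = 0) :
    liftSimple φ hφ ψ hψ = ∑ a ∈ φ.range, ψ a •
      liftSimple φ hφ (fun b => if b = a ∧ b ≠ 0 then 1 else 0) (by simp) := by
  refine Lp.ext ((coeFn_liftSimple φ hφ ψ hψ).trans ?_)
  refine EventuallyEq.trans ?_ (Lp.coeFn_finsetSum _ _).symm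
  have h1 : ∀ᵐ x ∂μ, ∀ a ∈ φ.range, (ψ a • liftSimple φ hφ
      (fun b => if b = a ∧ b ≠ 0 then 1 else 0) (by simp) : Lp ℂ 2 μ) x
      = ψ a * (if φ x = a ∧ φ x ≠ 0 then 1 else 0) := by
    refine (ae_ball_iff φ.range.countable_toSet).2 fun a _ => ?_
    filter_upwards [Lp.coeFn_smul (ψ a) (liftSimple φ hφ
      (fun b => if b = a ∧ b ≠ 0 then 1 else 0) (by simp)), coeFn_liftSimple φ hφ
      (fun b => if b = a ∧ b ≠ 0 then 1 else 0) (by simp)] with x hx hx'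
    rw [hx, Pi.smul_apply, hx', smul_eq_mul]
  filter_upwards [h1] with x hx
  rw [Finset.sum_apply, Finset.sum_congr rfl hx]
  by_cases h0 : φ x = 0
  · simp [h0, hψ]
  · rw [Finset.sum_eq_single (φ x)]
    · simp [h0]
    · intro b _ hb
      simp [hb.symm]
    · intro h
      exact absurd (φ.mem_range_self x) h

lemma eLpNorm_liftSimple_phasePow (φ : SimpleFunc X ℂ) (hφ : φ.FinMeasSupp μ) {w : ℂ}
    (hw : 0 < w.re) {s : ℝ≥0∞} (hs : s ≠ 0) (hs' : s ≠ ∞) :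
    eLpNorm (liftSimple φ hφ (phasePow w) (phasePow_zero w)) s μ
      = (∫⁻ x, ‖φ x‖ₑ ^ (w.re * s.toReal) ∂μ) ^ (1 / s.toReal) := by
  rw [eLpNorm_congr_ae (coeFn_liftSimple _ _ _ _),
    eLpNorm_eq_lintegral_rpow_enorm_toReal hs hs']
  congr 1
  refine lintegral_congr fun x => ?_
  rw [← ofReal_norm, norm_phasePow hw, ← ENNReal.ofReal_rpow_of_nonneg (norm_nonneg _) hw.le,
    ofReal_norm, ← ENNReal.rpow_mul]

/-- The interpolated bound for normalized simple functions. -/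
lemma norm_inner_le_of_simple {p q : ℝ} (hpq : p.HolderConjugate q) (hp : 2 ≤ p)
    (R : Lp ℂ 2 μ →L[ℂ] Lp ℂ 2 μ) {D : ℝ} (hD : 0 < D) (h2 : ∀ u, ‖R u‖ ≤ ‖u‖)
    (hinf : ∀ u, eLpNorm (R u) ∞ μ ≤ ENNReal.ofReal D * eLpNorm u 1 μ)
    (φ χ : SimpleFunc X ℂ) (hφ : φ.FinMeasSupp μ) (hχ : χ.FinMeasSupp μ)
    (hφ1 : ∫⁻ x, ‖φ x‖ₑ ^ q ∂μ = 1) (hχ1 : ∫⁻ x, ‖χ x‖ₑ ^ q ∂μ = 1) :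
    ‖inner ℂ (liftSimple χ hχ id rfl) (R (liftSimple φ hφ id rfl))‖ ≤ D ^ (1 - 2 / p) := by
  classical
  have hq : 0 < q := hpq.symm.pos
  let P : ℂ → ℂ := fun z => q * (1 + z) / 2
  have hPre : ∀ z, (P z).re = q * (1 + z.re) / 2 := fun z => by
    have : P z = ((q / 2 : ℝ) : ℂ) * (1 + z) := by simp only [P]; push_cast; ring
    rw [this, Complex.re_ofReal_mul]; simp; ring
  have hPconj : ∀ z, P ((starRingEnd ℂ) z) = (starRingEnd ℂ) (P z) := fun z => by
    simp only [P, map_div₀, map_mul, map_add, map_one, Complex.conj_ofReal]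
    rw [show (2 : ℂ) = ((2 : ℝ) : ℂ) by simp, Complex.conj_ofReal]
  let u : ℂ → Lp ℂ 2 μ := fun z => liftSimple φ hφ (phasePow (P z)) (phasePow_zero _)
  let g : ℂ → Lp ℂ 2 μ := fun z => liftSimple χ hχ (phasePow (P z)) (phasePow_zero _)
  let F : ℂ → ℂ := fun z => inner ℂ (g ((starRingEnd ℂ) z)) (R (u z))
  let eφ : ℂ → Lp ℂ 2 μ := fun a =>
    liftSimple φ hφ (fun b => if b = a ∧ b ≠ 0 then 1 else 0) (by simp)
  let eχ : ℂ → Lp ℂ 2 μ := fun a =>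
    liftSimple χ hχ (fun b => if b = a ∧ b ≠ 0 then 1 else 0) (by simp)
  have hF : ∀ z, F z = ∑ b ∈ χ.range, ∑ a ∈ φ.range,
      phasePow (P z) ((starRingEnd ℂ) b) * (phasePow (P z) a * inner ℂ (eχ b) (R (eφ a))) := by
    intro z
    have h1 : u z = ∑ a ∈ φ.range, phasePow (P z) a • eφ a := liftSimple_eq_sum _ _ _ _
    have h2 : g ((starRingEnd ℂ) z)
        = ∑ b ∈ χ.range, phasePow ((starRingEnd ℂ) (P z)) b • eχ b := by
      rw [← hPconj]; exact liftSimple_eq_sum _ _ _ _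
    simp only [F]
    rw [h1, h2, map_sum, sum_inner]
    refine Finset.sum_congr rfl fun b _ => ?_
    rw [inner_sum]
    refine Finset.sum_congr rfl fun a _ => ?_
    rw [map_smul, inner_smul_left, inner_smul_right, conj_phasePow]
  have hFd : Differentiable ℂ F := by
    have hP : Differentiable ℂ P := by simp only [P]; fun_prop
    rw [show F = _ from funext hF]
    refine Differentiable.fun_sum fun b _ => Differentiable.fun_sum fun a _ => ?_
    exact ((differentiable_phasePow _).comp hP).mul
      (((differentiable_phasePow _).comp hP).mul_const _)
  have hbd : BddAbove ((norm ∘ F) '' Complex.HadamardThreeLines.verticalClosedStrip 0 1) := by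
    have hc : ∀ a : ℂ, ∀ z ∈ Complex.HadamardThreeLines.verticalClosedStrip 0 1,
        ‖phasePow (P z) a‖ ≤ (1 + ‖a‖) ^ q := by
      intro a z hz
      have hz' : z.re ∈ Set.Icc (0 : ℝ) 1 := hz
      rw [norm_phasePow (by rw [hPre]; nlinarith [hz'.1]), hPre]
      calc ‖a‖ ^ (q * (1 + z.re) / 2) ≤ (1 + ‖a‖) ^ (q * (1 + z.re) / 2) := by
            gcongr
            · nlinarith [hz'.1]
            · linarith
        _ ≤ _ := by
            refine Real.rpow_le_rpow_of_exponent_le (by linarith [norm_nonneg a]) ?_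
            nlinarith [hz'.2]
    refine ⟨∑ b ∈ χ.range, ∑ a ∈ φ.range, (1 + ‖(starRingEnd ℂ) b‖) ^ q *
      ((1 + ‖a‖) ^ q * ‖inner ℂ (eχ b) (R (eφ a))‖), ?_⟩
    rintro _ ⟨z, hz, rfl⟩
    rw [Function.comp_apply, hF]
    refine (norm_sum_le _ _).trans (Finset.sum_le_sum fun b _ => (norm_sum_le _ _).trans
      (Finset.sum_le_sum fun a _ => ?_))
    rw [norm_mul, norm_mul]
    gcongr
    · exact hc _ z hz
    · exact hc _ z hz
  have hnorm2 : ∀ (θ : SimpleFunc X ℂ) (hθ : θ.FinMeasSupp μ), ∫⁻ x, ‖θ x‖ₑ ^ q ∂μ = 1 →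
      ∀ z : ℂ, z.re = 0 → ‖liftSimple θ hθ (phasePow (P z)) (phasePow_zero _)‖ = 1 := by
    intro θ hθ h1 z hz
    rw [Lp.norm_def, eLpNorm_liftSimple_phasePow θ hθ (by rw [hPre, hz]; linarith) (by norm_num)
      (by norm_num), hPre, hz]
    have : q * (1 + 0) / 2 * ENNReal.toReal 2 = q := by simp
    rw [this, h1]; simp
  have hnorm1 : ∀ (θ : SimpleFunc X ℂ) (hθ : θ.FinMeasSupp μ), ∫⁻ x, ‖θ x‖ₑ ^ q ∂μ = 1 →
      ∀ z : ℂ, z.re = 1 → eLpNorm (liftSimple θ hθ (phasePow (P z)) (phasePow_zero _)) 1 μ = 1 := by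
    intro θ hθ h1 z hz
    rw [eLpNorm_liftSimple_phasePow θ hθ (by rw [hPre, hz]; linarith) (by norm_num)
      (by norm_num), hPre, hz]
    have : q * (1 + 1) / 2 * ENNReal.toReal 1 = q := by simp; ring
    rw [this, h1]; simp
  have ha : ∀ z ∈ Complex.re ⁻¹' {0}, ‖F z‖ ≤ 1 := by
    intro z hz
    have hz' : z.re = 0 := hz
    refine (norm_inner_le_norm _ _).trans ?_
    have e1 : ‖g ((starRingEnd ℂ) z)‖ = 1 := hnorm2 χ hχ hχ1 _ (by simpa using hz')
    have e2 : ‖u z‖ = 1 := hnorm2 φ hφ hφ1 _ hz'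
    rw [e1, one_mul]
    exact (h2 _).trans e2.le
  have hb : ∀ z ∈ Complex.re ⁻¹' {1}, ‖F z‖ ≤ D := by
    intro z hz
    have hz' : z.re = 1 := hz
    have e1 : eLpNorm (g ((starRingEnd ℂ) z)) 1 μ = 1 := hnorm1 χ hχ hχ1 _ (by simpa using hz')
    have e2 : eLpNorm (u z) 1 μ = 1 := hnorm1 φ hφ hφ1 _ hz'
    have e3 := enorm_inner_le_eLpNorm_mul (hpq := ENNReal.HolderConjugate.top_one) ∞ 1
      (g ((starRingEnd ℂ) z)) (R (u z))
    have e4 := hinf (u z)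
    rw [e2, mul_one] at e4
    rw [e1, one_mul] at e3
    have e5 := e3.trans e4
    rw [← ofReal_norm] at e5
    exact (ENNReal.ofReal_le_ofReal_iff hD.le).1 e5
  have hθ : 0 ≤ 1 - 2 / p := by
    rw [sub_nonneg, div_le_one (by linarith)]; exact hp
  have hθ1 : 1 - 2 / p ≤ 1 := by
    have : 0 ≤ 2 / p := by positivity
    linarith
  have key := Complex.HadamardThreeLines.norm_le_interp_of_mem_verticalClosedStrip₀₁' F
    (z := ((1 - 2 / p : ℝ) : ℂ)) (a := 1) (b := D)
    (by rw [Complex.HadamardThreeLines.verticalClosedStrip, Set.mem_preimage, Complex.ofReal_re]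
        exact ⟨hθ, hθ1⟩)
    hFd.diffContOnCl hbd ha hb
  rw [Complex.ofReal_re, Real.one_rpow, one_mul] at key
  have hP1 : P ((1 - 2 / p : ℝ) : ℂ) = 1 := by
    have e : q * (1 + (1 - 2 / p)) / 2 = 1 := by
      have h := hpq.inv_add_inv_eq_one
      have hp0 : p ≠ 0 := by linarith
      field_simp at h ⊢
      linarith
    simp only [P]
    rw [← Complex.ofReal_one, ← Complex.ofReal_add, ← Complex.ofReal_mul]
    rw [show (2 : ℂ) = ((2 : ℝ) : ℂ) by simp, ← Complex.ofReal_div, e]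
  have hid : phasePow (P ((1 - 2 / p : ℝ) : ℂ)) = id := by
    rw [hP1]; funext a; exact phasePow_one a
  have hFe : F ((1 - 2 / p : ℝ) : ℂ)
      = inner ℂ (liftSimple χ hχ id rfl) (R (liftSimple φ hφ id rfl)) := by
    simp only [F, g, u, Complex.conj_ofReal]
    congr 1
    · congr 1
    · congr 2
  rwa [hFe] at key

/-- Interpolation between `L² → L²` and `L¹ → L^∞`. -/
lemma eLpNorm_apply_le_interpolate {p q : ℝ≥0∞} (hpq : p.HolderConjugate q) (hp : 2 ≤ p)
    (hp' : p ≠ ∞) (R : Lp ℂ 2 μ →L[ℂ] Lp ℂ 2 μ) {D : ℝ} (hD : 0 < D) (h2 : ∀ u, ‖R u‖ ≤ ‖u‖)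
    (hinf : ∀ u, eLpNorm (R u) ∞ μ ≤ ENNReal.ofReal D * eLpNorm u 1 μ) (u : Lp ℂ 2 μ) :
    eLpNorm (R u) p μ ≤ ENNReal.ofReal (D ^ (1 - 2 / p.toReal)) * eLpNorm u q μ := by
  have hpr : 2 ≤ p.toReal := by
    have := (ENNReal.toReal_le_toReal (by norm_num) hp').2 hp; simpa using this
  have hq0 : q ≠ 0 := hpq.symm.ne_zero
  have hq' : q ≠ ∞ := by
    rintro rfl
    have h1 := hpq.inv_add_inv_eq_inv
    simp only [ENNReal.inv_top, add_zero, inv_inj] at h1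
    rw [h1] at hp; norm_num at hp
  have hRC : p.toReal.HolderConjugate q.toReal :=
    ENNReal.HolderConjugate.toReal (by linarith)
  have hDp : 0 < D ^ (1 - 2 / p.toReal) := Real.rpow_pos_of_pos hD _
  set M : ℝ := D ^ (1 - 2 / p.toReal)
  -- simple functions
  have hsimple : ∀ (φ χ : SimpleFunc X ℂ) (hφ : φ.FinMeasSupp μ) (hχ : χ.FinMeasSupp μ),
      ‖inner ℂ (liftSimple χ hχ id rfl) (R (liftSimple φ hφ id rfl))‖
        ≤ M * (eLpNorm φ q μ).toReal * (eLpNorm χ q μ).toReal := by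
    intro φ χ hφ hχ
    have hnf : ∀ (θ : SimpleFunc X ℂ) (hθ : θ.FinMeasSupp μ), eLpNorm θ q μ ≠ ∞ := fun θ hθ =>
      ((SimpleFunc.memLp_iff_finMeasSupp hq0 hq').2 hθ).2.ne
    have hz : ∀ (θ : SimpleFunc X ℂ) (hθ : θ.FinMeasSupp μ), eLpNorm θ q μ = 0 →
        liftSimple θ hθ id rfl = 0 := by
      intro θ hθ h0
      rw [eLpNorm_eq_zero_iff θ.aestronglyMeasurable hq0] at h0
      exact (Lp.eq_zero_iff_ae_eq_zero).2 ((coeFn_liftSimple θ hθ id rfl).trans h0)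
    by_cases h0 : eLpNorm φ q μ = 0
    · rw [hz φ hφ h0]; simp; positivity
    by_cases h0' : eLpNorm χ q μ = 0
    · rw [hz χ hχ h0']; simp; positivity
    have hscale : ∀ (θ : SimpleFunc X ℂ) (hθ : θ.FinMeasSupp μ), eLpNorm θ q μ ≠ 0 →
        ∃ (θ' : SimpleFunc X ℂ) (hθ' : θ'.FinMeasSupp μ), ∫⁻ x, ‖θ' x‖ₑ ^ q.toReal ∂μ = 1 ∧
          liftSimple θ hθ id rfl
            = (((eLpNorm θ q μ).toReal : ℝ) : ℂ) • liftSimple θ' hθ' id rfl := by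
      intro θ hθ hne
      set c : ℝ := (eLpNorm θ q μ).toReal with hc
      have hcpos : 0 < c := ENNReal.toReal_pos hne (hnf θ hθ)
      refine ⟨θ.map fun a => ((c⁻¹ : ℝ) : ℂ) * a, hθ.map (by simp), ?_, ?_⟩
      · have e1 : eLpNorm (((c⁻¹ : ℝ) : ℂ) • (θ : X → ℂ)) q μ = 1 := by
          rw [eLpNorm_const_smul]
          have : ‖((c⁻¹ : ℝ) : ℂ)‖ₑ = (eLpNorm θ q μ)⁻¹ := by
            rw [← ofReal_norm, Complex.norm_real, Real.norm_of_nonneg (by positivity),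
              ENNReal.ofReal_inv_of_pos hcpos, hc, ENNReal.ofReal_toReal (hnf θ hθ)]
          rw [this, ENNReal.inv_mul_cancel hne (hnf θ hθ)]
        rw [eLpNorm_eq_lintegral_rpow_enorm_toReal hq0 hq'] at e1
        have e2 := congrArg (fun x => x ^ q.toReal) e1
        simp only [ENNReal.one_rpow] at e2
        rw [← ENNReal.rpow_mul, one_div, inv_mul_cancel₀ hRC.symm.ne_zero, ENNReal.rpow_one] at e2
        exact e2
      · refine Lp.ext ((coeFn_liftSimple _ _ _ _).trans ?_)
        refine EventuallyEq.trans ?_ (Lp.coeFn_smul _ _).symm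
        filter_upwards [coeFn_liftSimple (θ.map fun a => ((c⁻¹ : ℝ) : ℂ) * a)
          (hθ.map (by simp)) id rfl] with x hx
        rw [Pi.smul_apply, hx]
        have : (c : ℂ) ≠ 0 := by exact_mod_cast hcpos.ne'
        simp [this]
    obtain ⟨φ', hφ', n1, e1⟩ := hscale φ hφ h0
    obtain ⟨χ', hχ', n2, e2⟩ := hscale χ hχ h0'
    have key := norm_inner_le_of_simple hRC hpr R hD h2 hinf φ' χ' hφ' hχ' n1 n2
    rw [e1, e2, map_smul, inner_smul_left, inner_smul_right, norm_mul, norm_mul,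
      Complex.conj_ofReal, Complex.norm_real, Complex.norm_real,
      Real.norm_of_nonneg ENNReal.toReal_nonneg, Real.norm_of_nonneg ENNReal.toReal_nonneg]
    calc _ ≤ (eLpNorm χ q μ).toReal * ((eLpNorm φ q μ).toReal * M) := by gcongr
      _ = _ := by ring
  by_cases hu : eLpNorm u q μ = ∞
  · rw [hu, ENNReal.mul_top (by simpa using hDp)]; exact le_top
  have happrox : ∀ w : Lp ℂ 2 μ, eLpNorm w q μ ≠ ∞ → ∃ (φ : ℕ → SimpleFunc X ℂ)
      (hφ : ∀ n, (φ n).FinMeasSupp μ),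
      Tendsto (fun n => liftSimple (φ n) (hφ n) id rfl) atTop (𝓝 w) ∧
      Tendsto (fun n => (eLpNorm (φ n) q μ).toReal) atTop (𝓝 (eLpNorm w q μ).toReal) := by
    intro w hw
    have hwm : Measurable w := (Lp.stronglyMeasurable w).measurable
    let φ : ℕ → SimpleFunc X ℂ := fun n =>
      SimpleFunc.approxOn w hwm (Set.range w ∪ {0}) 0 (by simp) n
    have hφ : ∀ n, (φ n).FinMeasSupp μ := fun n =>
      (SimpleFunc.memLp_iff_finMeasSupp (p := 2) (by norm_num) (by norm_num)).1
        (SimpleFunc.memLp_approxOn_range hwm (Lp.memLp w) n)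
    have hwq : MemLp w q μ := ⟨Lp.aestronglyMeasurable w, hw.lt_top⟩
    have h1 := SimpleFunc.tendsto_approxOn_range_Lp_eLpNorm (p := 2) (by norm_num) hwm
      (Lp.memLp w).2
    have h3 := SimpleFunc.tendsto_approxOn_range_Lp_eLpNorm (p := q) hq' hwm hwq.2
    refine ⟨φ, hφ, ?_, ?_⟩
    · refine (Lp.tendsto_Lp_iff_tendsto_eLpNorm' _ _).2 ?_
      refine h1.congr fun n => ?_
      refine eLpNorm_congr_ae ?_
      filter_upwards [coeFn_liftSimple (φ n) (hφ n) id rfl] with x hx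
      simp only [Pi.sub_apply, hx, id, φ]
    · have hq1 : 1 ≤ q := hpq.symm.one_le
      have h4 : Tendsto (fun n => (eLpNorm (⇑(φ n) - ⇑w) q μ).toReal) atTop (𝓝 0) :=
        (ENNReal.tendsto_toReal ENNReal.zero_ne_top).comp h3
      have hm : ∀ n, MemLp (φ n) q μ := fun n =>
        (SimpleFunc.memLp_iff_finMeasSupp hq0 hq').2 (hφ n)
      rw [tendsto_iff_norm_sub_tendsto_zero]
      refine squeeze_zero (fun _ => norm_nonneg _) (fun n => ?_) h4
      have : Fact (1 ≤ q) := ⟨hq1⟩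
      have h5 := norm_sub_norm_le ((hm n).toLp) (hwq.toLp)
      have h6 := norm_sub_norm_le (hwq.toLp) ((hm n).toLp)
      rw [norm_sub_rev] at h6
      rw [← MemLp.toLp_sub] at h5 h6
      rw [Lp.norm_toLp, Lp.norm_toLp, Lp.norm_toLp] at h5 h6
      rw [Real.norm_eq_abs]
      exact abs_le.2 ⟨by linarith, by linarith⟩
  refine eLpNorm_le_of_forall_enorm_inner_le hpq hp hp' _ _ fun g hg => ?_
  obtain ⟨φ, hφ, t1, t2⟩ := happrox u hu
  obtain ⟨χ, hχ, t3, t4⟩ := happrox g hg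
  have hlim : ‖inner ℂ g (R u)‖ ≤ M * (eLpNorm u q μ).toReal * (eLpNorm g q μ).toReal := by
    refine le_of_tendsto_of_tendsto' ?_ ((t2.const_mul M).mul t4) (fun n =>
      hsimple (φ n) (χ n) (hφ n) (hχ n))
    exact ((t3.inner (𝕜 := ℂ) ((R.continuous.tendsto u).comp t1))).norm
  rw [← ofReal_norm]
  refine (ENNReal.ofReal_le_ofReal hlim).trans ?_
  rw [ENNReal.ofReal_mul (by positivity), ENNReal.ofReal_mul hDp.le, ENNReal.ofReal_toReal hu,
    ENNReal.ofReal_toReal hg]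

end RieszThorin

section Young

variable {Z : Type*} [MeasurableSpace Z] {ν : Measure Z}

lemma two_le_toReal {r : ℝ≥0∞} (hr : 2 ≤ r) (hr' : r ≠ ∞) : 2 ≤ r.toReal := by
  have := (ENNReal.toReal_le_toReal (by norm_num) hr').2 hr
  simpa using this

lemma holderConjugate_ne_top {p q : ℝ≥0∞} (hpq : p.HolderConjugate q) (hp : 2 ≤ p) : q ≠ ∞ := by
  rintro rfl
  have h1 := hpq.inv_add_inv_eq_inv
  simp only [ENNReal.inv_top, add_zero, inv_inj] at h1
  rw [h1] at hp; norm_num at hp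

lemma eLpNorm_ennreal_eq {r : ℝ≥0∞} (hr : r ≠ 0) (hr' : r ≠ ∞) (b : Z → ℝ≥0∞) :
    eLpNorm b r ν = (∫⁻ z, b z ^ r.toReal ∂ν) ^ (1 / r.toReal) := by
  rw [eLpNorm_eq_lintegral_rpow_enorm_toReal hr hr']; simp

/-- Hölder's inequality for functions with values in `[0, ∞]`. -/
lemma lintegral_mul_le_eLpNorm_mul_eLpNorm (p q : ℝ≥0∞) [hpq : p.HolderConjugate q]
    {a b : Z → ℝ≥0∞} (ha : AEMeasurable a ν) (hb : AEMeasurable b ν) :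
    ∫⁻ z, a z * b z ∂ν ≤ eLpNorm a p ν * eLpNorm b q ν := by
  have htop : ∀ {a b : Z → ℝ≥0∞}, AEMeasurable b ν →
      ∫⁻ z, a z * b z ∂ν ≤ eLpNorm a ∞ ν * eLpNorm b 1 ν := by
    intro a b hb
    rw [eLpNorm_one_eq_lintegral_enorm, eLpNorm_exponent_top]
    simp only [enorm_eq_self]
    rw [← lintegral_const_mul'' _ hb]
    refine lintegral_mono_ae ?_
    filter_upwards [enorm_ae_le_eLpNormEssSup a ν] with z hz
    gcongr
    simpa using hz
  rcases eq_or_ne p ∞ with rfl | hp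
  · have : q = 1 := ENNReal.HolderConjugate.unique ∞ q 1 (hq' := ENNReal.HolderConjugate.top_one)
    subst this
    exact htop hb
  rcases eq_or_ne q ∞ with rfl | hq
  · have : p = 1 := by
      have := hpq.symm
      exact ENNReal.HolderConjugate.unique ∞ p 1 (hq' := ENNReal.HolderConjugate.top_one)
    subst this
    rw [mul_comm]
    simp_rw [mul_comm (a _)]
    exact htop ha
  have hp1 : 1 < p.toReal := by
    have h1 : 1 ≤ p := hpq.one_le
    have h2 : p ≠ 1 := by
      rintro rfl
      exact hq (ENNReal.HolderConjugate.unique 1 q ∞ (hq' := ENNReal.HolderConjugate.one_top))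
    have := (ENNReal.toReal_lt_toReal ENNReal.one_ne_top hp).2 (lt_of_le_of_ne h1 h2.symm)
    simpa using this
  rw [eLpNorm_ennreal_eq hpq.ne_zero hp, eLpNorm_ennreal_eq hpq.symm.ne_zero hq]
  exact ENNReal.lintegral_mul_le_Lp_mul_Lq ν (ENNReal.HolderConjugate.toReal hp1) ha hb

/-- Young's inequality for an integral operator from `L^{r'}` to `L^r`. -/
lemma eLpNorm_lintegral_kernel_le [SFinite ν] {r r' : ℝ≥0∞} (hr : 2 ≤ r) (hrt : r ≠ ∞)
    (hrr : r.HolderConjugate r') {K : Z → Z → ℝ≥0∞} (hK : Measurable (Function.uncurry K))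
    {A : ℝ≥0∞} (h1 : ∀ z, ∫⁻ z', K z z' ^ (r.toReal / 2) ∂ν ≤ A)
    (h2 : ∀ z', ∫⁻ z, K z z' ^ (r.toReal / 2) ∂ν ≤ A) {b : Z → ℝ≥0∞} (hb : Measurable b) :
    eLpNorm (fun z => ∫⁻ z', K z z' * b z' ∂ν) r ν
      ≤ A ^ (2 / r.toReal) * eLpNorm b r' ν := by
  have hr2 := two_le_toReal hr hrt
  have hr't := holderConjugate_ne_top hrr hr
  have hRC : r.toReal.HolderConjugate r'.toReal := ENNReal.HolderConjugate.toReal (by linarith)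
  have hr0 : r ≠ 0 := hrr.ne_zero
  set x := r.toReal with hx
  set y := r'.toReal with hy
  have hx0 : 0 < x := by linarith
  have hy0 : 0 < y := hRC.symm.pos
  have hxy : y * (1 - 1 / x) = 1 := by
    have := hRC.inv_add_inv_eq_one
    have h3 : 1 - 1 / x = y⁻¹ := by rw [one_div]; linarith
    rw [h3, mul_inv_cancel₀ hy0.ne']
  set J := ∫⁻ z', b z' ^ y ∂ν with hJ
  have hKm : ∀ z, Measurable (K z) := fun z => hK.comp measurable_prodMk_left
  have hpt : ∀ z, (∫⁻ z', K z z' * b z' ∂ν) ^ x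
      ≤ (∫⁻ z', K z z' ^ (x / 2) * b z' ^ y ∂ν) * A * J ^ (x - 2) := by
    intro z
    have key := ENNReal.lintegral_prod_norm_pow_le (μ := ν) (Finset.univ : Finset (Fin 3))
      (f := ![fun z' => K z z' ^ (x / 2) * b z' ^ y, fun z' => K z z' ^ (x / 2),
        fun z' => b z' ^ y]) (p := ![1 / x, 1 / x, 1 - 2 / x])
      (by
        intro i _
        fin_cases i
        · exact (((hKm z).pow_const _).mul (hb.pow_const _)).aemeasurable
        · exact ((hKm z).pow_const _).aemeasurable
        · exact (hb.pow_const _).aemeasurable)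
      (by simp [Fin.sum_univ_three]; ring)
      (by
        intro i _
        fin_cases i
        · simp; positivity
        · simp; positivity
        · simp; rw [div_le_one hx0]; exact hr2)
    simp only [Fin.prod_univ_three, Matrix.cons_val_zero, Matrix.cons_val_one,
      Matrix.cons_val_two, Matrix.head_cons, Matrix.tail_cons] at key
    have hw : 0 ≤ 1 - 2 / x := by rw [sub_nonneg, div_le_one hx0]; exact hr2
    have e1 : ∀ z', (K z z' ^ (x / 2) * b z' ^ y) ^ (1 / x) * (K z z' ^ (x / 2)) ^ (1 / x)
        * (b z' ^ y) ^ (1 - 2 / x) = K z z' * b z' := by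
      intro z'
      rw [ENNReal.mul_rpow_of_nonneg _ _ (by positivity)]
      simp only [← ENNReal.rpow_mul]
      have e2 : x / 2 * (1 / x) = 1 / 2 := by field_simp
      rw [e2]
      calc _ = (K z z' ^ (1 / 2 : ℝ) * K z z' ^ (1 / 2 : ℝ))
            * (b z' ^ (y * (1 / x)) * b z' ^ (y * (1 - 2 / x))) := by ring
        _ = _ := by
          rw [← ENNReal.rpow_add_of_nonneg _ _ (by norm_num) (by norm_num),
            ← ENNReal.rpow_add_of_nonneg _ _ (by positivity) (by positivity)]
          have e3 : y * (1 / x) + y * (1 - 2 / x) = 1 := Eq.trans (by ring) hxy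
          rw [e3]; norm_num
    simp only [e1] at key
    calc (∫⁻ z', K z z' * b z' ∂ν) ^ x
        ≤ ((∫⁻ z', K z z' ^ (x / 2) * b z' ^ y ∂ν) ^ (1 / x)
          * (∫⁻ z', K z z' ^ (x / 2) ∂ν) ^ (1 / x) * J ^ (1 - 2 / x)) ^ x := by gcongr
      _ = (∫⁻ z', K z z' ^ (x / 2) * b z' ^ y ∂ν) * (∫⁻ z', K z z' ^ (x / 2) ∂ν)
          * J ^ (x - 2) := by
        rw [ENNReal.mul_rpow_of_nonneg _ _ hx0.le, ENNReal.mul_rpow_of_nonneg _ _ hx0.le]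
        simp only [← ENNReal.rpow_mul]
        rw [show 1 / x * x = 1 by field_simp, show (1 - 2 / x) * x = x - 2 by field_simp]
        simp
      _ ≤ _ := by gcongr; exact h1 z
  have hint : ∫⁻ z, (∫⁻ z', K z z' * b z' ∂ν) ^ x ∂ν ≤ A ^ (2 : ℝ) * J ^ (x - 1) := by
    have hm : Measurable fun z => ∫⁻ z', K z z' ^ (x / 2) * b z' ^ y ∂ν := by
      have : Measurable (Function.uncurry fun z z' => K z z' ^ (x / 2) * b z' ^ y) :=
        (hK.pow_const _).mul ((hb.comp measurable_snd).pow_const _)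
      exact this.lintegral_prod_right
    calc _ ≤ ∫⁻ z, (∫⁻ z', K z z' ^ (x / 2) * b z' ^ y ∂ν) * A * J ^ (x - 2) ∂ν :=
          lintegral_mono hpt
      _ = (∫⁻ z, ∫⁻ z', K z z' ^ (x / 2) * b z' ^ y ∂ν ∂ν) * A * J ^ (x - 2) := by
        rw [lintegral_mul_const _ (hm.mul_const _), lintegral_mul_const _ hm]
      _ ≤ (A * J) * A * J ^ (x - 2) := by
        gcongr
        rw [lintegral_lintegral_swap]
        · have e4 : ∀ z', ∫⁻ z, K z z' ^ (x / 2) * b z' ^ y ∂ν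
              = (∫⁻ z, K z z' ^ (x / 2) ∂ν) * b z' ^ y := fun z' =>
            lintegral_mul_const _ ((hK.comp (measurable_id.prodMk measurable_const)).pow_const _)
          simp only [e4]
          rw [hJ, ← lintegral_const_mul _ (hb.pow_const _)]
          refine lintegral_mono fun z' => ?_
          gcongr
          exact h2 z'
        · exact ((hK.pow_const _).mul ((hb.comp measurable_snd).pow_const _)).aemeasurable
      _ = A ^ (2 : ℝ) * (J ^ (1 : ℝ) * J ^ (x - 2)) := by
        rw [ENNReal.rpow_two, ENNReal.rpow_one]; ring
      _ = _ := by
        rw [← ENNReal.rpow_add_of_nonneg _ _ (by norm_num) (by linarith)]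
        congr 2; ring
  rw [eLpNorm_ennreal_eq hr0 hrt, eLpNorm_ennreal_eq hrr.symm.ne_zero hr't]
  calc _ ≤ (A ^ (2 : ℝ) * J ^ (x - 1)) ^ (1 / x) := by gcongr
    _ = A ^ (2 / x) * J ^ (1 / y) := by
      rw [ENNReal.mul_rpow_of_nonneg _ _ (by positivity), ← ENNReal.rpow_mul, ← ENNReal.rpow_mul]
      congr 2
      · ring
      · rw [eq_div_iff hy0.ne']; field_simp; field_simp at hxy; linarith

/-- The bilinear form of Young's inequality. -/
lemma lintegral_lintegral_kernel_le [SFinite ν] {r r' : ℝ≥0∞} (hr : 2 ≤ r) (hrt : r ≠ ∞)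
    (hrr : r.HolderConjugate r') {K : Z → Z → ℝ≥0∞} (hK : Measurable (Function.uncurry K))
    {A : ℝ≥0∞} (h1 : ∀ z, ∫⁻ z', K z z' ^ (r.toReal / 2) ∂ν ≤ A)
    (h2 : ∀ z', ∫⁻ z, K z z' ^ (r.toReal / 2) ∂ν ≤ A) {a b : Z → ℝ≥0∞} (ha : Measurable a)
    (hb : Measurable b) :
    ∫⁻ z, a z * ∫⁻ z', K z z' * b z' ∂ν ∂ν
      ≤ A ^ (2 / r.toReal) * eLpNorm a r' ν * eLpNorm b r' ν := by
  have hm : Measurable fun z => ∫⁻ z', K z z' * b z' ∂ν := by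
    have : Measurable (Function.uncurry fun z z' => K z z' * b z') :=
      hK.mul (hb.comp measurable_snd)
    exact this.lintegral_prod_right
  have := hrr.symm
  calc _ ≤ eLpNorm a r' ν * eLpNorm (fun z => ∫⁻ z', K z z' * b z' ∂ν) r ν :=
        lintegral_mul_le_eLpNorm_mul_eLpNorm r' r ha.aemeasurable hm.aemeasurable
    _ ≤ eLpNorm a r' ν * (A ^ (2 / r.toReal) * eLpNorm b r' ν) := by
      gcongr
      exact eLpNorm_lintegral_kernel_le hr hrt hrr hK h1 h2 hb
    _ = _ := by ring

end Young

section Interpolation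

variable {X : Type*} [MeasurableSpace X] {μ : Measure X}

/-- Logarithmic convexity of the `L^p` norms between `2` and `p`. -/
lemma eLpNorm_le_rpow_mul_rpow {p d : ℝ≥0∞} (hp : 2 ≤ p) (hpt : p ≠ ∞) (hd : 2 ≤ d) (hdt : d ≠ ∞)
    {l : ℝ} (hl : l ∈ Set.Icc (0 : ℝ) 1)
    (h : (d⁻¹).toReal = l / 2 + (1 - l) * (p⁻¹).toReal) {f : X → ℂ}
    (hf : AEStronglyMeasurable f μ) :
    eLpNorm f d μ ≤ eLpNorm f p μ ^ (1 - l) * eLpNorm f 2 μ ^ l := by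
  have hp2 := two_le_toReal hp hpt
  have hd2 := two_le_toReal hd hdt
  have hp0 : p ≠ 0 := (lt_of_lt_of_le (by norm_num) hp).ne'
  have hd0 : d ≠ 0 := (lt_of_lt_of_le (by norm_num) hd).ne'
  rw [ENNReal.toReal_inv, ENNReal.toReal_inv] at h
  rw [eLpNorm_eq_lintegral_rpow_enorm_toReal hp0 hpt,
    eLpNorm_eq_lintegral_rpow_enorm_toReal hd0 hdt,
    eLpNorm_eq_lintegral_rpow_enorm_toReal (by norm_num) (by norm_num)]
  set x := p.toReal
  set y := d.toReal
  rw [ENNReal.toReal_ofNat]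
  have hx0 : 0 < x := by linarith
  have hy0 : 0 < y := by linarith
  have hl0 := hl.1
  have hl1 : 0 ≤ 1 - l := by linarith [hl.2]
  have hw : y * (1 - l) / x + y * l / 2 = 1 := by
    have : y * (l / 2 + (1 - l) * x⁻¹) = 1 := by rw [← h]; exact mul_inv_cancel₀ hy0.ne'
    exact Eq.trans (by ring) this
  have key := ENNReal.lintegral_mul_norm_pow_le (μ := μ) (f := fun a => ‖f a‖ₑ ^ x)
    (g := fun a => ‖f a‖ₑ ^ (2 : ℝ)) (hf.enorm.pow_const _) (hf.enorm.pow_const _)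
    (p := y * (1 - l) / x) (q := y * l / 2) (by positivity) (by positivity) hw
  have e1 : ∀ a, (‖f a‖ₑ ^ x) ^ (y * (1 - l) / x) * (‖f a‖ₑ ^ (2 : ℝ)) ^ (y * l / 2)
      = ‖f a‖ₑ ^ y := by
    intro a
    rw [← ENNReal.rpow_mul, ← ENNReal.rpow_mul,
      ← ENNReal.rpow_add_of_nonneg _ _ (by positivity) (by positivity)]
    congr 1
    field_simp
    ring
  simp only [e1] at key
  calc _ ≤ ((∫⁻ a, ‖f a‖ₑ ^ x ∂μ) ^ (y * (1 - l) / x)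
        * (∫⁻ a, ‖f a‖ₑ ^ (2 : ℝ) ∂μ) ^ (y * l / 2)) ^ (1 / y) := by gcongr
    _ = _ := by
      rw [ENNReal.mul_rpow_of_nonneg _ _ (by positivity)]
      simp only [← ENNReal.rpow_mul]
      congr 2
      · field_simp
      · field_simp

lemma measurable_eLpNorm_comp {Z : Type*} [MeasurableSpace Z] {q : ℝ≥0∞} [Fact (1 ≤ q)]
    (p : ℝ≥0∞) {f : Z → Lp ℂ q μ} (hf : StronglyMeasurable f) :
    Measurable fun z => eLpNorm (f z) p μ := by
  let : MeasurableSpace (Lp ℂ q μ) := borel _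
  have : BorelSpace (Lp ℂ q μ) := ⟨rfl⟩
  exact (lowerSemicontinuous_eLpNorm p q).measurable.comp hf.measurable

/-- Minkowski's inequality for the `L^p` norm of an `L²`-valued integral. -/
lemma eLpNorm_integral_le {Z : Type*} [MeasurableSpace Z] {ν : Measure Z} [IsSeparable μ]
    {p q : ℝ≥0∞} (hpq : p.HolderConjugate q) (hp : 2 ≤ p) (hp' : p ≠ ∞) (f : Z → Lp ℂ 2 μ)
    (hf : Integrable f ν) :
    eLpNorm (∫ z, f z ∂ν : Lp ℂ 2 μ) p μ ≤ ∫⁻ z, eLpNorm (f z) p μ ∂ν := by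
  have : Fact ((2 : ℝ≥0∞) ≠ ∞) := ⟨by norm_num⟩
  have : Fact (q ≠ ∞) := ⟨holderConjugate_ne_top hpq hp⟩
  have : Fact (1 ≤ q) := ⟨hpq.symm.one_le⟩
  obtain ⟨g, hg1, hg⟩ := exists_norming_seq (μ := μ) hpq hp hp'
  rw [hg]
  refine iSup_le fun j => ?_
  rw [← integral_inner hf]
  refine (enorm_integral_le_lintegral_enorm _).trans (lintegral_mono fun z => ?_)
  rw [hg]
  exact le_iSup (fun j => ‖inner ℂ (g j) (f z)‖ₑ) j

end Interpolation

section Flow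

/-- A strongly continuous one-parameter group of isometries. -/
structure IsIsometricFlow {H : Type*} [NormedAddCommGroup H] [InnerProductSpace ℂ H]
    (U : ℝ → H →L[ℂ] H) : Prop where
  zero : U 0 = 1
  add : ∀ s t, U (s + t) = U s * U t
  norm_eq : ∀ t u, ‖U t u‖ = ‖u‖
  continuous : ∀ u, Continuous fun t => U t u

lemma IsUnitaryGroup.isIsometricFlow {H : Type*} [NormedAddCommGroup H] [InnerProductSpace ℂ H]
    {A : H →ₗ.[ℂ] H} {U : ℝ → H →L[ℂ] H} (h : IsUnitaryGroup A U) : IsIsometricFlow U :=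
  ⟨h.zero, h.add, h.norm_eq, h.continuous⟩

namespace IsIsometricFlow

variable {H : Type*} [NormedAddCommGroup H] [InnerProductSpace ℂ H] {U : ℝ → H →L[ℂ] H}

lemma add_apply (hU : IsIsometricFlow U) (s t : ℝ) (u : H) : U (s + t) u = U s (U t u) := by
  rw [hU.add]; rfl

lemma inner_map_map (hU : IsIsometricFlow U) (t : ℝ) (u v : H) :
    inner ℂ (U t u) (U t v) = inner ℂ u v :=
  (LinearIsometry.mk (U t).toLinearMap (hU.norm_eq t)).inner_map_map u v

lemma inner_apply (hU : IsIsometricFlow U) (t : ℝ) (u v : H) :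
    inner ℂ u (U t v) = inner ℂ (U (-t) u) v := by
  have h : u = U t (U (-t) u) := by rw [← hU.add_apply]; simp [hU.zero]
  conv_lhs => rw [h]
  exact hU.inner_map_map t _ v

lemma continuous_uncurry (hU : IsIsometricFlow U) :
    Continuous fun z : ℝ × H => U z.1 z.2 := by
  refine continuous_iff_continuousAt.2 fun z => ?_
  rw [ContinuousAt, tendsto_iff_norm_sub_tendsto_zero]
  have h1 : Tendsto (fun w : ℝ × H => ‖w.2 - z.2‖ + ‖U w.1 z.2 - U z.1 z.2‖) (𝓝 z) (𝓝 0) := by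
    have e : Continuous fun w : ℝ × H => ‖w.2 - z.2‖ + ‖U w.1 z.2 - U z.1 z.2‖ := by
      have := (hU.continuous z.2).comp (continuous_fst (X := ℝ) (Y := H))
      exact (continuous_snd.sub continuous_const).norm.add (this.sub continuous_const).norm
    simpa using e.tendsto z
  refine squeeze_zero (fun _ => norm_nonneg _) (fun w => ?_) h1
  calc ‖U w.1 w.2 - U z.1 z.2‖ = ‖U w.1 (w.2 - z.2) + (U w.1 z.2 - U z.1 z.2)‖ := by
        rw [map_sub]; congr 1; abel
    _ ≤ _ := (norm_add_le _ _).trans (by rw [hU.norm_eq])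

end IsIsometricFlow

end Flow

section Duality

variable {X Z : Type*} [MeasurableSpace X] [MeasurableSpace Z] {μ : Measure X} {ν : Measure Z}

/-- Selection of a measurable almost optimal dual element. -/
lemma exists_norming_selection [IsSeparable μ] {p q : ℝ≥0∞} (hpq : p.HolderConjugate q)
    (hp : 2 ≤ p) (hp' : p ≠ ∞) {W : Z → Lp ℂ 2 μ} (hW : StronglyMeasurable W) :
    ∃ G : ℕ → Z → Lp ℂ 2 μ, (∀ n, StronglyMeasurable (G n)) ∧ (∀ n, ∃ B, ∀ z, ‖G n z‖ ≤ B) ∧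
      (∀ n z, eLpNorm (G n z) q μ ≤ 1) ∧ (∀ z, Monotone fun n => ‖inner ℂ (G n z) (W z)‖ₑ) ∧
      ∀ z, eLpNorm (W z) p μ = ⨆ n, ‖inner ℂ (G n z) (W z)‖ₑ := by
  classical
  have : Fact ((2 : ℝ≥0∞) ≠ ∞) := ⟨by norm_num⟩
  have : Fact (q ≠ ∞) := ⟨holderConjugate_ne_top hpq hp⟩
  have : Fact (1 ≤ q) := ⟨hpq.symm.one_le⟩
  obtain ⟨g, hg1, hg⟩ := exists_norming_seq (μ := μ) hpq hp hp'
  let G : ℕ → Z → Lp ℂ 2 μ := fun n => Nat.rec (fun _ => g 0)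
    (fun n Gn z => if ‖inner ℂ (Gn z) (W z)‖ₑ < ‖inner ℂ (g (n + 1)) (W z)‖ₑ then g (n + 1)
      else Gn z) n
  have hG0 : ∀ z, G 0 z = g 0 := fun z => rfl
  have hGs : ∀ n z, G (n + 1) z = if ‖inner ℂ (G n z) (W z)‖ₑ < ‖inner ℂ (g (n + 1)) (W z)‖ₑ
      then g (n + 1) else G n z := fun n z => rfl
  have hGm : ∀ n, StronglyMeasurable (G n) := by
    intro n
    induction n with
    | zero => exact stronglyMeasurable_const
    | succ n ih =>
      refine StronglyMeasurable.ite ?_ stronglyMeasurable_const ih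
      exact measurableSet_lt (ih.inner hW).enorm (stronglyMeasurable_const.inner hW).enorm
  have hmono : ∀ z, Monotone fun n => ‖inner ℂ (G n z) (W z)‖ₑ := by
    refine fun z => monotone_nat_of_le_succ fun n => ?_
    simp only [hGs]
    split_ifs with h
    · exact h.le
    · exact le_rfl
  have hval : ∀ n z, ∃ j, G n z = g j := by
    intro n z
    induction n with
    | zero => exact ⟨0, rfl⟩
    | succ n ih =>
      rw [hGs]
      split_ifs
      · exact ⟨_, rfl⟩
      · exact ih
  refine ⟨G, hGm, ?_, ?_, hmono, ?_⟩
  · intro n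
    induction n with
    | zero => exact ⟨‖g 0‖, fun z => le_rfl⟩
    | succ n ih =>
      obtain ⟨B, hB⟩ := ih
      refine ⟨max B ‖g (n + 1)‖, fun z => ?_⟩
      rw [hGs]
      split_ifs
      · exact le_max_right _ _
      · exact (hB z).trans (le_max_left _ _)
  · intro n z
    obtain ⟨j, hj⟩ := hval n z
    rw [hj]; exact hg1 j
  · intro z
    rw [hg]
    refine le_antisymm (iSup_le fun j => ?_) (iSup_le fun n => ?_)
    · refine le_iSup_of_le j ?_
      cases j with
      | zero => exact le_rfl
      | succ n =>
        rw [hGs]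
        split_ifs with h
        · exact le_rfl
        · exact not_lt.1 h
    · obtain ⟨j, hj⟩ := hval n z
      rw [hj]
      exact le_iSup (fun j => ‖inner ℂ (g j) (W z)‖ₑ) j

/-- Duality for the mixed norm of `L^r(Z; L^p(X))`. -/
lemma eLpNorm_eLpNorm_le_of_dual [IsFiniteMeasure ν] [IsSeparable μ] {p q r r' : ℝ≥0∞}
    (hpq : p.HolderConjugate q) (hp : 2 ≤ p) (hp' : p ≠ ∞) (hrr : r.HolderConjugate r')
    (hr : 2 ≤ r) (hrt : r ≠ ∞) {W : Z → Lp ℂ 2 μ} (hW : StronglyMeasurable W) {C : ℝ≥0∞}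
    (h : ∀ g : Z → Lp ℂ 2 μ, StronglyMeasurable g → (∃ B, ∀ z, ‖g z‖ ≤ B) →
      ‖∫ z, inner ℂ (g z) (W z) ∂ν‖ₑ ≤ C * eLpNorm (fun z => eLpNorm (g z) q μ) r' ν) :
    eLpNorm (fun z => eLpNorm (W z) p μ) r ν ≤ C := by
  obtain ⟨G, hGm, hGb, hG1, hGmono, hGsup⟩ := exists_norming_selection hpq hp hp' hW
  have hr2 := two_le_toReal hr hrt
  have hr't := holderConjugate_ne_top hrr hr
  have hRC : r.toReal.HolderConjugate r'.toReal := ENNReal.HolderConjugate.toReal (by linarith)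
  have hr0 : r ≠ 0 := hrr.ne_zero
  set x := r.toReal with hx
  set y := r'.toReal with hy
  have hx0 : 0 < x := by linarith
  have hy0 : 0 < y := hRC.symm.pos
  let S : ℕ → Set Z := fun m => {z | ‖W z‖ ≤ m}
  have hS : ∀ m, MeasurableSet (S m) := fun m =>
    measurableSet_le hW.norm.measurable measurable_const
  have key : ∀ n m, ∫⁻ z in S m, ‖inner ℂ (G n z) (W z)‖ₑ ^ x ∂ν ≤ C ^ x := by
    intro n m
    obtain ⟨B, hB⟩ := hGb n
    set I := ∫⁻ z in S m, ‖inner ℂ (G n z) (W z)‖ₑ ^ x ∂ν with hI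
    let i : Z → ℂ := fun z => inner ℂ (G n z) (W z)
    have him : StronglyMeasurable i := (hGm n).inner hW
    have hib : ∀ z ∈ S m, ‖i z‖ ≤ |B| * m := fun z hz => by
      refine (norm_inner_le_norm _ _).trans ?_
      gcongr
      · exact (hB z).trans (le_abs_self B)
      · exact hz
    let c : Z → ℂ := (S m).indicator fun z => ((‖i z‖ ^ (x - 2) : ℝ) : ℂ) * i z
    have hcm : StronglyMeasurable c := by
      refine StronglyMeasurable.indicator ?_ (hS m)
      refine StronglyMeasurable.mul ?_ him
      exact (Complex.measurable_ofReal.comp (him.norm.measurable.pow_const _)).stronglyMeasurable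
    have hcn : ∀ z, ‖c z‖ = (S m).indicator (fun z => ‖i z‖ ^ (x - 1)) z := by
      intro z
      by_cases hz : z ∈ S m
      · simp only [c, Set.indicator_of_mem hz, norm_mul, Complex.norm_real, Real.norm_eq_abs]
        rw [abs_of_nonneg (by positivity)]
        rcases eq_or_lt_of_le (norm_nonneg (i z)) with h0 | h0
        · rw [← h0, mul_zero, Real.zero_rpow (by linarith)]
        · rw [show x - 1 = (x - 2) + 1 by ring, Real.rpow_add h0, Real.rpow_one]
      · simp [c, Set.indicator_of_notMem hz]
    have hfin : I ≠ ∞ := by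
      refine ne_top_of_le_ne_top (b := ∫⁻ _, ENNReal.ofReal ((|B| * m) ^ x) ∂ν) ?_ ?_
      · rw [lintegral_const]
        exact ENNReal.mul_ne_top ENNReal.ofReal_ne_top (measure_ne_top ν _)
      · refine (setLIntegral_mono' (hS m) fun z hz => ?_).trans (setLIntegral_le_lintegral _ _)
        rw [← ofReal_norm, ENNReal.ofReal_rpow_of_nonneg (norm_nonneg _) hx0.le]
        gcongr
        exact hib z hz
    have h1 := h (fun z => c z • G n z) (hcm.smul (hGm n)) ⟨(|B| * m) ^ (x - 1) * |B|, fun z => by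
      rw [norm_smul, hcn]
      gcongr
      · refine Set.indicator_apply_le' (fun hz => ?_) (fun _ => by positivity)
        gcongr
        · linarith
        · exact hib z hz
      · exact (hB z).trans (le_abs_self B)⟩
    have h2 : ‖∫ z, inner ℂ (c z • G n z) (W z) ∂ν‖ₑ = I := by
      have e1 : ∀ z, inner ℂ (c z • G n z) (W z)
          = (((S m).indicator (fun z => ‖i z‖ ^ x) z : ℝ) : ℂ) := by
        intro z
        rw [inner_smul_left]
        by_cases hz : z ∈ S m
        · simp only [c, Set.indicator_of_mem hz]
          rw [map_mul, Complex.conj_ofReal]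
          have e2 : (starRingEnd ℂ) (i z) * i z = ((‖i z‖ ^ 2 : ℝ) : ℂ) := by
            rw [mul_comm, Complex.mul_conj, Complex.normSq_eq_norm_sq]
          change _ * (starRingEnd ℂ) (i z) * i z = _
          rw [mul_assoc, e2, ← Complex.ofReal_mul]
          congr 1
          rcases eq_or_lt_of_le (norm_nonneg (i z)) with h0 | h0
          · rw [← h0, Real.zero_rpow (x := x) (by linarith)]; simp
          · rw [← Real.rpow_natCast, ← Real.rpow_add h0]; congr 1; push_cast; ring
        · simp [c, Set.indicator_of_notMem hz]
      simp only [e1]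
      rw [integral_complex_ofReal]
      have h3 : ∫ z, (S m).indicator (fun z => ‖i z‖ ^ x) z ∂ν = I.toReal := by
        rw [integral_eq_lintegral_of_nonneg_ae]
        · congr 1
          rw [hI, ← lintegral_indicator (hS m)]
          refine lintegral_congr fun z => ?_
          by_cases hz : z ∈ S m
          · simp only [Set.indicator_of_mem hz]
            rw [← ENNReal.ofReal_rpow_of_nonneg (norm_nonneg _) (by linarith), ofReal_norm]
          · simp [Set.indicator_of_notMem hz]
        · exact ae_of_all _ fun x => Set.indicator_nonneg (fun x _ => by positivity) x
        · exact ((him.norm.measurable.pow_const _).indicator (hS m)).aestronglyMeasurable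
      rw [h3]
      have : ‖((I).toReal : ℂ)‖ₑ = ENNReal.ofReal (I).toReal := by
        rw [← ofReal_norm, Complex.norm_real, Real.norm_of_nonneg ENNReal.toReal_nonneg]
      exact this.trans (ENNReal.ofReal_toReal hfin)
    have h3 : eLpNorm (fun z => eLpNorm (c z • G n z : Lp ℂ 2 μ) q μ) r' ν ≤ I ^ (1 / y) := by
      rw [eLpNorm_ennreal_eq hrr.symm.ne_zero hr't]
      gcongr
      rw [hI, ← lintegral_indicator (hS m)]
      refine lintegral_mono fun z => ?_
      have e1 : eLpNorm (c z • G n z : Lp ℂ 2 μ) q μ ≤ ‖c z‖ₑ := by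
        rw [eLpNorm_congr_ae (Lp.coeFn_smul _ _), eLpNorm_const_smul]
        calc _ ≤ ‖c z‖ₑ * 1 := by gcongr; exact hG1 n z
          _ = _ := mul_one _
      have e2 : ‖c z‖ₑ ^ y = (S m).indicator (fun z => ‖i z‖ₑ ^ x) z := by
        rw [← ofReal_norm, hcn]
        by_cases hz : z ∈ S m
        · simp only [Set.indicator_of_mem hz]
          rw [← ENNReal.ofReal_rpow_of_nonneg (norm_nonneg _) (by linarith), ofReal_norm,
            ← ENNReal.rpow_mul]
          congr 1
          have := hRC.sub_one_mul_conj
          linarith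
        · simp only [Set.indicator_of_notMem hz]
          simp [hy0]
      change _ ≤ (S m).indicator (fun z => ‖i z‖ₑ ^ x) z
      rw [← e2]
      gcongr
    rw [h2] at h1
    have h4 : I ≤ C * I ^ (1 / y) := h1.trans (by gcongr)
    rcases eq_or_ne I 0 with h0 | h0
    · rw [h0]; exact zero_le
    · have hx0' : I ^ (1 / y) ≠ 0 := by simp [h0, hfin]
      have hxt : I ^ (1 / y) ≠ ∞ := ENNReal.rpow_ne_top_of_nonneg (by positivity) hfin
      have h5 : I ^ (1 / x) ≤ C := by
        have h6 : I = I ^ (1 / x) * I ^ (1 / y) := by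
          rw [← ENNReal.rpow_add _ _ h0 hfin]
          have := hRC.inv_add_inv_eq_one
          rw [one_div, one_div, this, ENNReal.rpow_one]
        nth_rewrite 1 [h6] at h4
        exact (ENNReal.mul_le_mul_iff_left hx0' hxt).1 h4
      calc I = (I ^ (1 / x)) ^ x := by
            rw [← ENNReal.rpow_mul, one_div, inv_mul_cancel₀ (by linarith), ENNReal.rpow_one]
        _ ≤ _ := by gcongr
  have hsup : ∫⁻ z, eLpNorm (W z) p μ ^ x ∂ν ≤ C ^ x := by
    have h1 : ∀ z, eLpNorm (W z) p μ ^ x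
        = ⨆ n, (S n).indicator (fun z => ‖inner ℂ (G n z) (W z)‖ₑ ^ x) z := by
      intro z
      rw [hGsup z]
      refine le_antisymm ?_ (iSup_le fun n => ?_)
      · have e := (ENNReal.orderIsoRpow x hx0).map_iSup (fun n => ‖inner ℂ (G n z) (W z)‖ₑ)
        simp only [ENNReal.orderIsoRpow_apply] at e
        rw [e]
        refine iSup_le fun n => ?_
        obtain ⟨m, hm⟩ := exists_nat_ge ‖W z‖
        refine le_iSup_of_le (max n m) ?_
        rw [Set.indicator_of_mem (show z ∈ S (max n m) from hm.trans (by simp))]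
        gcongr
        exact hGmono z (le_max_left n m)
      · refine (Set.indicator_le_self _ _ _).trans ?_
        gcongr
        exact le_iSup (fun n => ‖inner ℂ (G n z) (W z)‖ₑ) n
    simp only [h1]
    rw [lintegral_iSup]
    · refine iSup_le fun n => ?_
      rw [lintegral_indicator (hS n)]
      exact key n n
    · exact fun n => (((hGm n).inner hW).enorm.pow_const _).indicator (hS n)
    · intro n m hnm z
      by_cases hz : z ∈ S n
      · have hz' : z ∈ S m := le_trans (show ‖W z‖ ≤ n from hz) (by exact_mod_cast hnm)
        simp only [Set.indicator_of_mem hz, Set.indicator_of_mem hz']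
        gcongr
        exact hGmono z hnm
      · simp [Set.indicator_of_notMem hz]
  rw [eLpNorm_ennreal_eq hr0 hrt]
  calc _ ≤ (C ^ x) ^ (1 / x) := by gcongr
    _ = C := by
      rw [← ENNReal.rpow_mul, one_div, mul_inv_cancel₀ hx0.ne', ENNReal.rpow_one]

end Duality

section PathStrichartz

variable {X Z : Type*} [MeasurableSpace X] [MeasurableSpace Z] {μ : Measure X} {ν : Measure Z}
  {U : ℝ → Lp ℂ 2 μ →L[ℂ] Lp ℂ 2 μ} {β : Z → ℝ} {k : ℝ → ℝ≥0∞} {p q r r' : ℝ≥0∞} {A : ℝ≥0∞}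

lemma enorm_apply_eq (hU : IsIsometricFlow U) (t : ℝ) (u : Lp ℂ 2 μ) : ‖U t u‖ₑ = ‖u‖ₑ := by
  rw [← ofReal_norm, hU.norm_eq, ofReal_norm]

/-- The `TT*` bound for the flow along a path. -/
lemma enorm_sq_integral_flow_le [SFinite ν] (hU : IsIsometricFlow U) (hpq : p.HolderConjugate q)
    (hk : ∀ t u, eLpNorm (U t u) p μ ≤ k t * eLpNorm u q μ) (hkm : Measurable k)
    (hβ : Measurable β) {F : Z → Lp ℂ 2 μ} (hF : StronglyMeasurable F) (hFi : Integrable F ν) :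
    ‖∫ z, U (-β z) (F z) ∂ν‖ₑ ^ 2 ≤ ∫⁻ z, eLpNorm (F z) q μ *
      ∫⁻ z', k (β z - β z') * eLpNorm (F z') q μ ∂ν ∂ν := by
  have hGm : StronglyMeasurable fun z => U (-β z) (F z) :=
    hU.continuous_uncurry.comp_stronglyMeasurable
      (hβ.neg.stronglyMeasurable.prodMk hF)
  have hGi : Integrable (fun z => U (-β z) (F z)) ν :=
    hFi.mono hGm.aestronglyMeasurable (ae_of_all _ fun z => by rw [hU.norm_eq])
  set I := ∫ z, U (-β z) (F z) ∂ν with hI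
  have h1 : ‖I‖ₑ ^ 2 = ‖inner ℂ I I‖ₑ := by
    rw [inner_self_eq_norm_sq_to_K, enorm_pow]
    congr 1
    rw [← ofReal_norm, ← ofReal_norm]; simp
  have h2 : ∀ z, ‖inner ℂ I (U (-β z) (F z))‖ₑ
      ≤ eLpNorm (F z) q μ * ∫⁻ z', k (β z - β z') * eLpNorm (F z') q μ ∂ν := by
    intro z
    have e1 : ‖inner ℂ I (U (-β z) (F z))‖ₑ = ‖inner ℂ (U (-β z) (F z)) I‖ₑ := by
      rw [← ofReal_norm, norm_inner_symm, ofReal_norm]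
    rw [e1, hI, ← integral_inner hGi]
    refine (enorm_integral_le_lintegral_enorm _).trans ?_
    have hm : Measurable fun z' => eLpNorm (F z') q μ := measurable_eLpNorm_comp q hF
    calc ∫⁻ z', ‖inner ℂ (U (-β z) (F z)) (U (-β z') (F z'))‖ₑ ∂ν
        ≤ ∫⁻ z', eLpNorm (F z) q μ * (k (β z - β z') * eLpNorm (F z') q μ) ∂ν := by
          refine lintegral_mono fun z' => ?_
          rw [← neg_neg (-β z), ← neg_neg (-β z), neg_neg (-β z), ← hU.inner_apply, neg_neg,
            ← hU.add_apply]
          refine (enorm_inner_le_eLpNorm_mul p q _ _).trans ?_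
          gcongr
          simpa [sub_eq_add_neg] using hk (β z + -β z') (F z')
      _ = _ := lintegral_const_mul _ ((hkm.comp (measurable_const.sub hβ)).mul hm)
  rw [h1]
  nth_rewrite 2 [hI]
  rw [← integral_inner hGi]
  exact (enorm_integral_le_lintegral_enorm _).trans (lintegral_mono h2)

/-- The dual homogeneous estimate along a path. -/
lemma enorm_integral_flow_le [SFinite ν] (hU : IsIsometricFlow U) (hpq : p.HolderConjugate q)
    (hk : ∀ t u, eLpNorm (U t u) p μ ≤ k t * eLpNorm u q μ) (hkm : Measurable k)
    (hke : ∀ t, k (-t) = k t) (hβ : Measurable β) (hr : 2 ≤ r) (hrt : r ≠ ∞)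
    (hrr : r.HolderConjugate r') (hA : ∀ y, ∫⁻ z, k (β z - y) ^ (r.toReal / 2) ∂ν ≤ A)
    {F : Z → Lp ℂ 2 μ} (hF : StronglyMeasurable F) (hFi : Integrable F ν) :
    ‖∫ z, U (-β z) (F z) ∂ν‖ₑ
      ≤ A ^ (1 / r.toReal) * eLpNorm (fun z => eLpNorm (F z) q μ) r' ν := by
  have hr2 := two_le_toReal hr hrt
  have hm : Measurable fun z' => eLpNorm (F z') q μ := measurable_eLpNorm_comp q hF
  have h1 := enorm_sq_integral_flow_le hU hpq hk hkm hβ hF hFi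
  have h2 := lintegral_lintegral_kernel_le (ν := ν) hr hrt hrr (K := fun z z' => k (β z - β z'))
    (hkm.comp ((hβ.comp measurable_fst).sub (hβ.comp measurable_snd))) (A := A)
    (fun z => by
      have := hA (β z)
      refine le_trans (lintegral_mono fun z' => ?_) this
      rw [← hke (β z - β z'), neg_sub])
    (fun z' => hA (β z')) hm hm
  have h3 := h1.trans h2
  set I := ‖∫ z, U (-β z) (F z) ∂ν‖ₑ
  set N := eLpNorm (fun z => eLpNorm (F z) q μ) r' ν
  have e : A ^ (2 / r.toReal) * N * N = (A ^ (1 / r.toReal) * N) ^ 2 := by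
    rw [mul_pow, ← ENNReal.rpow_natCast, ← ENNReal.rpow_mul, pow_two, mul_assoc]
    congr 2; push_cast; ring
  rw [e] at h3
  exact (ENNReal.pow_le_pow_left_iff two_ne_zero).1 h3

/-- The homogeneous estimate along a path. -/
lemma eLpNorm_flow_le [IsFiniteMeasure ν] [IsSeparable μ] (hU : IsIsometricFlow U)
    (hpq : p.HolderConjugate q) (hp : 2 ≤ p) (hp' : p ≠ ∞)
    (hk : ∀ t u, eLpNorm (U t u) p μ ≤ k t * eLpNorm u q μ) (hkm : Measurable k)
    (hke : ∀ t, k (-t) = k t) (hβ : Measurable β) (hr : 2 ≤ r) (hrt : r ≠ ∞)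
    (hA : ∀ y, ∫⁻ z, k (β z - y) ^ (r.toReal / 2) ∂ν ≤ A) (b : ℝ) (x : Lp ℂ 2 μ) :
    eLpNorm (fun z => eLpNorm (U (β z - b) x) p μ) r ν ≤ A ^ (1 / r.toReal) * ‖x‖ₑ := by
  have hr1 : 1 ≤ r := le_trans (by norm_num) hr
  have hrr : r.HolderConjugate r.conjExponent := ENNReal.HolderConjugate.conjExponent hr1
  have hβ' : Measurable fun z => β z - b := hβ.sub_const b
  have hW : StronglyMeasurable fun z => U (β z - b) x :=
    hU.continuous_uncurry.comp_stronglyMeasurable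
      (hβ'.stronglyMeasurable.prodMk stronglyMeasurable_const)
  refine eLpNorm_eLpNorm_le_of_dual hpq hp hp' hrr hr hrt hW fun g hg hgb => ?_
  obtain ⟨B, hB⟩ := hgb
  have hgi : Integrable g ν :=
    Integrable.of_bound hg.aestronglyMeasurable B (ae_of_all _ hB)
  have hGm : StronglyMeasurable fun z => U (-(β z - b)) (g z) :=
    hU.continuous_uncurry.comp_stronglyMeasurable (hβ'.neg.stronglyMeasurable.prodMk hg)
  have hGi : Integrable (fun z => U (-(β z - b)) (g z)) ν :=
    hgi.mono hGm.aestronglyMeasurable (ae_of_all _ fun z => by rw [hU.norm_eq])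
  have h1 := enorm_integral_flow_le (β := fun z => β z - b) hU hpq hk hkm hke hβ' hr hrt hrr
    (A := A) (fun y => by simpa [sub_sub] using hA (b + y)) hg hgi
  have h2 : ∫ z, inner ℂ (g z) (U (β z - b) x) ∂ν
      = inner ℂ (∫ z, U (-(β z - b)) (g z) ∂ν) x := by
    rw [← inner_conj_symm, ← integral_inner hGi, ← integral_conj]
    refine integral_congr_ae (ae_of_all _ fun z => ?_)
    simp only [inner_conj_symm]
    exact hU.inner_apply _ _ _
  rw [h2]
  refine (enorm_inner_le_eLpNorm_mul 2 2 (hpq := ⟨by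
    rw [ENNReal.inv_two_add_inv_two, inv_one]⟩) _ _).trans ?_
  rw [← Lp.enorm_def, ← Lp.enorm_def]
  calc _ ≤ A ^ (1 / r.toReal) * eLpNorm (fun z => eLpNorm (g z) q μ) r.conjExponent ν * ‖x‖ₑ := by
        gcongr
    _ = _ := by ring

/-- The integral operator `f ↦ ∫ 1_E(t, σ) U(β t - β σ) f(σ) dν(σ)`. -/
noncomputable def pathInt (U : ℝ → Lp ℂ 2 μ →L[ℂ] Lp ℂ 2 μ) (β : Z → ℝ) (ν : Measure Z)
    (E : Set (Z × Z)) (f : Z → Lp ℂ 2 μ) (t : Z) : Lp ℂ 2 μ :=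
  ∫ σ, E.indicator (fun z => U (β z.1 - β z.2) (f z.2)) (t, σ) ∂ν

section pathInt

variable {E : Set (Z × Z)} {f : Z → Lp ℂ 2 μ}

lemma stronglyMeasurable_pathInt_integrand (hU : IsIsometricFlow U) (hβ : Measurable β)
    (hE : MeasurableSet E) (hf : StronglyMeasurable f) :
    StronglyMeasurable (E.indicator fun z => U (β z.1 - β z.2) (f z.2)) := by
  refine StronglyMeasurable.indicator ?_ hE
  exact hU.continuous_uncurry.comp_stronglyMeasurable
    (((hβ.comp measurable_fst).sub (hβ.comp measurable_snd)).stronglyMeasurable.prodMk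
      (hf.comp_measurable measurable_snd))

lemma stronglyMeasurable_pathInt [SFinite ν] (hU : IsIsometricFlow U) (hβ : Measurable β)
    (hE : MeasurableSet E) (hf : StronglyMeasurable f) :
    StronglyMeasurable (pathInt U β ν E f) :=
  (stronglyMeasurable_pathInt_integrand hU hβ hE hf).integral_prod_right'

lemma norm_pathInt_integrand_le (hU : IsIsometricFlow U) (t σ : Z) :
    ‖E.indicator (fun z => U (β z.1 - β z.2) (f z.2)) (t, σ)‖ ≤ ‖f σ‖ := by
  refine (norm_indicator_le_norm_self _ _).trans ?_
  rw [hU.norm_eq]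

lemma integrable_pathInt_integrand (hU : IsIsometricFlow U) (hβ : Measurable β)
    (hE : MeasurableSet E) (hf : StronglyMeasurable f) (hfi : Integrable f ν) (t : Z) :
    Integrable (fun σ => E.indicator (fun z => U (β z.1 - β z.2) (f z.2)) (t, σ)) ν :=
  hfi.mono ((stronglyMeasurable_pathInt_integrand hU hβ hE hf).comp_measurable
    measurable_prodMk_left).aestronglyMeasurable
    (ae_of_all _ fun σ => norm_pathInt_integrand_le hU t σ)

/-- Retarded inhomogeneous estimate, diagonal exponents. -/
lemma eLpNorm_pathInt_le [SFinite ν] [IsSeparable μ] (hU : IsIsometricFlow U)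
    (hpq : p.HolderConjugate q) (hp : 2 ≤ p) (hp' : p ≠ ∞)
    (hk : ∀ t u, eLpNorm (U t u) p μ ≤ k t * eLpNorm u q μ) (hkm : Measurable k)
    (hke : ∀ t, k (-t) = k t) (hβ : Measurable β) (hr : 2 ≤ r) (hrt : r ≠ ∞)
    (hrr : r.HolderConjugate r')
    (hA : ∀ y, ∫⁻ z, k (β z - y) ^ (r.toReal / 2) ∂ν ≤ A) (hE : MeasurableSet E)
    (hf : StronglyMeasurable f) (hfi : Integrable f ν) :
    eLpNorm (fun t => eLpNorm (pathInt U β ν E f t) p μ) r ν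
      ≤ A ^ (2 / r.toReal) * eLpNorm (fun z => eLpNorm (f z) q μ) r' ν := by
  have hm : Measurable fun z' => eLpNorm (f z') q μ := measurable_eLpNorm_comp q hf
  have h2 := eLpNorm_lintegral_kernel_le (ν := ν) hr hrt hrr (K := fun z z' => k (β z - β z'))
    (hkm.comp ((hβ.comp measurable_fst).sub (hβ.comp measurable_snd))) (A := A)
    (fun z => by
      have := hA (β z)
      refine le_trans (lintegral_mono fun z' => ?_) this
      rw [← hke (β z - β z'), neg_sub])
    (fun z' => hA (β z')) hm
  refine le_trans (eLpNorm_mono_enorm fun t => ?_) h2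
  simp only [enorm_eq_self]
  refine (eLpNorm_integral_le hpq hp hp' _
    (integrable_pathInt_integrand hU hβ hE hf hfi t)).trans (lintegral_mono fun σ => ?_)
  by_cases h : (t, σ) ∈ E
  · rw [Set.indicator_of_mem h]
    exact hk _ _
  · rw [Set.indicator_of_notMem h, eLpNorm_congr_ae (Lp.coeFn_zero _ _ _)]
    simp

/-- Retarded inhomogeneous estimate in `L^∞ L²`. -/
lemma enorm_pathInt_le [SFinite ν] (hU : IsIsometricFlow U)
    (hpq : p.HolderConjugate q)
    (hk : ∀ t u, eLpNorm (U t u) p μ ≤ k t * eLpNorm u q μ) (hkm : Measurable k)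
    (hke : ∀ t, k (-t) = k t) (hβ : Measurable β) (hr : 2 ≤ r) (hrt : r ≠ ∞)
    (hrr : r.HolderConjugate r')
    (hA : ∀ y, ∫⁻ z, k (β z - y) ^ (r.toReal / 2) ∂ν ≤ A) (hE : MeasurableSet E)
    (hf : StronglyMeasurable f) (hfi : Integrable f ν) (t : Z) :
    ‖pathInt U β ν E f t‖ₑ
      ≤ A ^ (1 / r.toReal) * eLpNorm (fun z => eLpNorm (f z) q μ) r' ν := by
  let S : Set Z := {σ | (t, σ) ∈ E}
  have hS : MeasurableSet S := measurable_prodMk_left hE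
  have hf' : StronglyMeasurable (S.indicator f) := hf.indicator hS
  have hfi' : Integrable (S.indicator f) ν := hfi.indicator hS
  have h1 := enorm_integral_flow_le hU hpq hk hkm hke hβ hr hrt hrr hA hf' hfi'
  have hGi : Integrable (fun z => U (-β z) (S.indicator f z)) ν :=
    hfi'.mono (hU.continuous_uncurry.comp_stronglyMeasurable
      (hβ.neg.stronglyMeasurable.prodMk hf')).aestronglyMeasurable
      (ae_of_all _ fun z => by rw [hU.norm_eq])
  have h2 : pathInt U β ν E f t = U (β t) (∫ σ, U (-β σ) (S.indicator f σ) ∂ν) := by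
    rw [← ContinuousLinearMap.integral_comp_comm _ hGi, pathInt]
    refine integral_congr_ae (ae_of_all _ fun σ => ?_)
    simp only
    rw [← hU.add_apply, ← sub_eq_add_neg]
    by_cases h : (t, σ) ∈ E
    · rw [Set.indicator_of_mem h, Set.indicator_of_mem (show σ ∈ S from h)]
    · rw [Set.indicator_of_notMem h, Set.indicator_of_notMem (show σ ∉ S from h), map_zero]
  rw [h2, enorm_apply_eq hU]
  refine h1.trans ?_
  gcongr
  refine eLpNorm_mono_enorm fun z => ?_
  simp only [enorm_eq_self]
  by_cases h : z ∈ S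
  · rw [Set.indicator_of_mem h]
  · rw [Set.indicator_of_notMem h, eLpNorm_congr_ae (Lp.coeFn_zero _ _ _)]
    simp

/-- Retarded inhomogeneous estimate from `L^{r'} L^{p'}` to the interpolated space `L^γ L^δ`. -/
lemma eLpNorm_pathInt_le_interpolate [SFinite ν] [IsSeparable μ] (hU : IsIsometricFlow U)
    (hpq : p.HolderConjugate q) (hp : 2 ≤ p) (hp' : p ≠ ∞)
    (hk : ∀ t u, eLpNorm (U t u) p μ ≤ k t * eLpNorm u q μ) (hkm : Measurable k)
    (hke : ∀ t, k (-t) = k t) (hβ : Measurable β) (hr : 2 ≤ r) (hrt : r ≠ ∞)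
    (hrr : r.HolderConjugate r')
    (hA : ∀ y, ∫⁻ z, k (β z - y) ^ (r.toReal / 2) ∂ν ≤ A) (hE : MeasurableSet E)
    {g d : ℝ≥0∞} (hg0 : g ≠ 0) (hd : 2 ≤ d) (hdt : d ≠ ∞) {l : ℝ} (hl : l ∈ Set.Icc (0 : ℝ) 1)
    (hg : (g⁻¹).toReal = (1 - l) * (r⁻¹).toReal)
    (hdl : (d⁻¹).toReal = l / 2 + (1 - l) * (p⁻¹).toReal)
    (hf : StronglyMeasurable f) (hfi : Integrable f ν) :
    eLpNorm (fun t => eLpNorm (pathInt U β ν E f t) d μ) g ν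
      ≤ A ^ (2 / r.toReal * (1 - l / 2)) * eLpNorm (fun z => eLpNorm (f z) q μ) r' ν := by
  have hr2 := two_le_toReal hr hrt
  have hl0 := hl.1
  have hl1 : 0 ≤ 1 - l := by linarith [hl.2]
  set N := eLpNorm (fun z => eLpNorm (f z) q μ) r' ν
  have h2 := enorm_pathInt_le hU hpq hk hkm hke hβ hr hrt hrr hA hE hf hfi
  have h1 := eLpNorm_pathInt_le hU hpq hp hp' hk hkm hke hβ hr hrt hrr hA hE hf hfi
  have hpt : ∀ t, eLpNorm (pathInt U β ν E f t) d μ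
      ≤ eLpNorm (pathInt U β ν E f t) p μ ^ (1 - l) * (A ^ (1 / r.toReal) * N) ^ l := by
    intro t
    refine (eLpNorm_le_rpow_mul_rpow hp hp' hd hdt hl hdl (Lp.aestronglyMeasurable _)).trans ?_
    gcongr
    rw [← Lp.enorm_def]
    exact h2 t
  have hVm : Measurable fun t => eLpNorm (pathInt U β ν E f t) p μ :=
    measurable_eLpNorm_comp p (stronglyMeasurable_pathInt hU hβ hE hf)
  have hfin : (A ^ (2 / r.toReal) * N) ^ (1 - l) * (A ^ (1 / r.toReal) * N) ^ l
      = A ^ (2 / r.toReal * (1 - l / 2)) * N := by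
    rw [ENNReal.mul_rpow_of_nonneg _ _ hl1, ENNReal.mul_rpow_of_nonneg _ _ hl0,
      ← ENNReal.rpow_mul, ← ENNReal.rpow_mul]
    calc _ = (A ^ (2 / r.toReal * (1 - l)) * A ^ (1 / r.toReal * l)) * (N ^ (1 - l) * N ^ l) := by
          ring
      _ = _ := by
        rw [← ENNReal.rpow_add_of_nonneg _ _ (by positivity) (by positivity),
          ← ENNReal.rpow_add_of_nonneg _ _ hl1 hl0, sub_add_cancel, ENNReal.rpow_one]
        congr 2; ring
  rw [← hfin]
  rw [ENNReal.toReal_inv, ENNReal.toReal_inv] at hg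
  rcases eq_or_ne g ∞ with rfl | hgt
  · have hl' : l = 1 := by
      have hx : (r.toReal)⁻¹ ≠ 0 := by positivity
      simp only [ENNReal.toReal_top, inv_zero] at hg
      rcases mul_eq_zero.1 hg.symm with h | h
      · linarith
      · exact absurd h hx
    subst hl'
    simp only [sub_self, ENNReal.rpow_zero, one_mul, ENNReal.rpow_one] at hpt ⊢
    rw [eLpNorm_exponent_top]
    exact essSup_le_of_ae_le _ (ae_of_all _ fun t => by simpa using hpt t)
  · have hgr : 0 < g.toReal := ENNReal.toReal_pos hg0 hgt
    have hl1' : 0 < 1 - l := by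
      rcases hl1.lt_or_eq with h | h
      · exact h
      · rw [← h, zero_mul] at hg
        exact absurd hg (by positivity)
    calc _ ≤ eLpNorm (fun t => eLpNorm (pathInt U β ν E f t) p μ ^ (1 - l)
          * (A ^ (1 / r.toReal) * N) ^ l) g ν := eLpNorm_mono_enorm fun t => by simpa using hpt t
      _ = eLpNorm (fun t => eLpNorm (pathInt U β ν E f t) p μ) r ν ^ (1 - l)
          * (A ^ (1 / r.toReal) * N) ^ l := by
        rw [eLpNorm_ennreal_eq hg0 hgt, eLpNorm_ennreal_eq hrr.ne_zero hrt]
        simp_rw [ENNReal.mul_rpow_of_nonneg _ _ hgr.le]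
        rw [lintegral_mul_const _ ((hVm.pow_const _).pow_const _),
          ENNReal.mul_rpow_of_nonneg _ _ (by positivity), ← ENNReal.rpow_mul (_ ^ l),
          mul_one_div_cancel hgr.ne', ENNReal.rpow_one]
        congr 1
        simp_rw [← ENNReal.rpow_mul]
        have e1 : (1 - l) * g.toReal = r.toReal := by
          have : r.toReal ≠ 0 := by linarith
          field_simp at hg
          linarith
        have e2 : 1 / g.toReal = 1 / r.toReal * (1 - l) := by
          rw [one_div, hg]; ring
        rw [e1, e2]
      _ ≤ _ := by gcongr

/-- Retarded inhomogeneous estimate from `L^{γ'} L^{δ'}` to `L^r L^p`. -/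
lemma eLpNorm_pathInt_le_dual [IsFiniteMeasure ν] [IsSeparable μ] (hU : IsIsometricFlow U)
    (hpq : p.HolderConjugate q) (hp : 2 ≤ p) (hp' : p ≠ ∞)
    (hk : ∀ t u, eLpNorm (U t u) p μ ≤ k t * eLpNorm u q μ) (hkm : Measurable k)
    (hke : ∀ t, k (-t) = k t) (hβ : Measurable β) (hr : 2 ≤ r) (hrt : r ≠ ∞)
    (hA : ∀ y, ∫⁻ z, k (β z - y) ^ (r.toReal / 2) ∂ν ≤ A) (hE : MeasurableSet E)
    {g g' d d' : ℝ≥0∞} (hgg : g.HolderConjugate g') (hdd : d.HolderConjugate d')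
    (hd : 2 ≤ d) (hdt : d ≠ ∞) {l : ℝ} (hl : l ∈ Set.Icc (0 : ℝ) 1)
    (hg : (g⁻¹).toReal = (1 - l) * (r⁻¹).toReal)
    (hdl : (d⁻¹).toReal = l / 2 + (1 - l) * (p⁻¹).toReal)
    (hf : StronglyMeasurable f) (hfi : Integrable f ν) :
    eLpNorm (fun t => eLpNorm (pathInt U β ν E f t) p μ) r ν
      ≤ A ^ (2 / r.toReal * (1 - l / 2)) * eLpNorm (fun z => eLpNorm (f z) d' μ) g' ν := by
  have hr1 : 1 ≤ r := le_trans (by norm_num) hr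
  have hrr : r.HolderConjugate r.conjExponent := ENNReal.HolderConjugate.conjExponent hr1
  refine eLpNorm_eLpNorm_le_of_dual hpq hp hp' hrr hr hrt
    (stronglyMeasurable_pathInt hU hβ hE hf) fun w hw hwb => ?_
  obtain ⟨B, hB⟩ := hwb
  have hwi : Integrable w ν :=
    Integrable.of_bound hw.aestronglyMeasurable B (ae_of_all _ hB)
  have hE' : MeasurableSet (Prod.swap ⁻¹' E) := measurable_swap hE
  have h1 := eLpNorm_pathInt_le_interpolate (ν := ν) hU hpq hp hp' hk hkm hke hβ hr hrt hrr hA hE'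
    hgg.ne_zero hd hdt hl hg hdl hw hwi
  have hswap : ∀ t σ, inner ℂ (w t) (E.indicator (fun z => U (β z.1 - β z.2) (f z.2)) (t, σ))
      = inner ℂ ((Prod.swap ⁻¹' E).indicator (fun z => U (β z.1 - β z.2) (w z.2)) (σ, t)) (f σ) := by
    intro t σ
    by_cases h : (t, σ) ∈ E
    · rw [Set.indicator_of_mem h, Set.indicator_of_mem (show (σ, t) ∈ Prod.swap ⁻¹' E from h),
        hU.inner_apply, neg_sub]
    · rw [Set.indicator_of_notMem h,
        Set.indicator_of_notMem (show (σ, t) ∉ Prod.swap ⁻¹' E from h)]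
      simp
  have hint : Integrable (fun z : Z × Z =>
      inner ℂ (w z.1) (E.indicator (fun z => U (β z.1 - β z.2) (f z.2)) z)) (ν.prod ν) := by
    refine Integrable.mono' (g := fun z : Z × Z => ‖w z.1‖ * ‖f z.2‖) (hwi.norm.mul_prod hfi.norm)
      (((hw.comp_measurable measurable_fst).inner
        (stronglyMeasurable_pathInt_integrand hU hβ hE hf)).aestronglyMeasurable)
      (ae_of_all _ fun z => ?_)
    refine (norm_inner_le_norm _ _).trans ?_
    gcongr
    exact norm_pathInt_integrand_le hU z.1 z.2
  have h2 : ∫ t, inner ℂ (w t) (pathInt U β ν E f t) ∂ν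
      = ∫ σ, inner ℂ (pathInt U β ν (Prod.swap ⁻¹' E) w σ) (f σ) ∂ν := by
    calc _ = ∫ t, ∫ σ, inner ℂ (w t)
          (E.indicator (fun z => U (β z.1 - β z.2) (f z.2)) (t, σ)) ∂ν ∂ν := by
          refine integral_congr_ae (ae_of_all _ fun t => ?_)
          simp only [pathInt]
          rw [integral_inner (integrable_pathInt_integrand hU hβ hE hf hfi t)]
      _ = ∫ σ, ∫ t, inner ℂ (w t)
          (E.indicator (fun z => U (β z.1 - β z.2) (f z.2)) (t, σ)) ∂ν ∂ν :=
        integral_integral_swap hint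
      _ = _ := by
        refine integral_congr_ae (ae_of_all _ fun σ => ?_)
        simp only [hswap]
        rw [← inner_conj_symm, pathInt,
          ← integral_inner (integrable_pathInt_integrand hU hβ hE' hw hwi σ), ← integral_conj]
        simp only [inner_conj_symm]
  rw [h2]
  have := hdd.symm
  have hWm := stronglyMeasurable_pathInt (ν := ν) hU hβ hE' hw
  calc _ ≤ ∫⁻ σ, ‖inner ℂ (pathInt U β ν (Prod.swap ⁻¹' E) w σ) (f σ)‖ₑ ∂ν :=
        enorm_integral_le_lintegral_enorm _
    _ ≤ ∫⁻ σ, eLpNorm (pathInt U β ν (Prod.swap ⁻¹' E) w σ) d μ * eLpNorm (f σ) d' μ ∂ν :=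
        lintegral_mono fun σ => enorm_inner_le_eLpNorm_mul d' d _ _
    _ ≤ eLpNorm (fun σ => eLpNorm (pathInt U β ν (Prod.swap ⁻¹' E) w σ) d μ) g ν
        * eLpNorm (fun σ => eLpNorm (f σ) d' μ) g' ν :=
        lintegral_mul_le_eLpNorm_mul_eLpNorm g g' (measurable_eLpNorm_comp d hWm).aemeasurable
          (measurable_eLpNorm_comp d' hf).aemeasurable
    _ ≤ A ^ (2 / r.toReal * (1 - l / 2)) * eLpNorm (fun z => eLpNorm (w z) q μ) r.conjExponent ν
        * eLpNorm (fun σ => eLpNorm (f σ) d' μ) g' ν := by gcongr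
    _ = _ := by ring

end pathInt

end PathStrichartz

section Compatible

variable {X : Type*} [MeasurableSpace X] {μ : Measure X} {a b : ℝ≥0∞}

/-- The pairs of elements of `L^a × L^b` represented by the same function. -/
def compatiblePairs (μ : Measure X) (a b : ℝ≥0∞) [Fact (1 ≤ a)] [Fact (1 ≤ b)] :
    Submodule ℂ (Lp ℂ a μ × Lp ℂ b μ) where
  carrier := {z | z.1 =ᵐ[μ] z.2}
  zero_mem' := (Lp.coeFn_zero ℂ a μ).trans (Lp.coeFn_zero ℂ b μ).symm
  add_mem' := by
    intro z w hz hw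
    refine (Lp.coeFn_add z.1 w.1).trans (EventuallyEq.trans ?_ (Lp.coeFn_add z.2 w.2).symm)
    exact EventuallyEq.add hz hw
  smul_mem' := by
    intro c z hz
    refine (Lp.coeFn_smul c z.1).trans (EventuallyEq.trans ?_ (Lp.coeFn_smul c z.2).symm)
    have hz' : z.1 =ᵐ[μ] z.2 := hz
    filter_upwards [hz'] with x hx
    simp [hx]

variable [Fact (1 ≤ a)] [Fact (1 ≤ b)]

lemma isClosed_compatiblePairs : IsClosed (compatiblePairs μ a b : Set (Lp ℂ a μ × Lp ℂ b μ)) := by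
  refine IsSeqClosed.isClosed fun z w hz hw => ?_
  have h1 := tendstoInMeasure_of_tendsto_Lp ((continuous_fst.tendsto w).comp hw)
  have h2 := tendstoInMeasure_of_tendsto_Lp ((continuous_snd.tendsto w).comp hw)
  refine tendstoInMeasure_ae_unique h1 (h2.congr_left fun n => ?_)
  have hn : (z n).1 =ᵐ[μ] (z n).2 := hz n
  exact hn.symm

/-- Bochner integrals in `L^a` and `L^b` of compatible functions are compatible. -/
lemma integral_compatible {Z : Type*} [MeasurableSpace Z] {ν : Measure Z} {f : Z → Lp ℂ a μ}
    {g : Z → Lp ℂ b μ} (hf : Integrable f ν) (hg : Integrable g ν)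
    (h : ∀ᵐ z ∂ν, f z =ᵐ[μ] g z) : (∫ z, f z ∂ν : Lp ℂ a μ) =ᵐ[μ] (∫ z, g z ∂ν : Lp ℂ b μ) := by
  have hcl : IsClosed (compatiblePairs μ a b : Set (Lp ℂ a μ × Lp ℂ b μ)) :=
    isClosed_compatiblePairs
  have h1 : (compatiblePairs μ a b).mkQL (∫ z, (f z, g z) ∂ν) = 0 := by
    rw [← ContinuousLinearMap.integral_comp_comm _ (hf.prodMk hg)]
    rw [integral_congr_ae (g := fun _ => 0), integral_zero]
    filter_upwards [h] with z hz
    exact (Submodule.Quotient.mk_eq_zero _).2 hz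
  have h2 : (∫ z, (f z, g z) ∂ν) ∈ compatiblePairs μ a b :=
    (Submodule.Quotient.mk_eq_zero _).1 h1
  rw [integral_pair hf hg] at h2
  exact h2

/-- A function into `L^a` is measurable if it is compatible with a measurable function into
`L^b`. -/
lemma stronglyMeasurable_of_compatible [IsSeparable μ] [Fact (a ≠ ∞)] [Fact (b ≠ ∞)]
    {Z : Type*} [MeasurableSpace Z] {f : Z → Lp ℂ a μ} {g : Z → Lp ℂ b μ}
    (hg : StronglyMeasurable g) (h : ∀ z, f z =ᵐ[μ] g z) : StronglyMeasurable f := by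
  let : MeasurableSpace (Lp ℂ a μ) := borel _
  have : BorelSpace (Lp ℂ a μ) := ⟨rfl⟩
  let : MeasurableSpace (Lp ℂ b μ) := borel _
  have : BorelSpace (Lp ℂ b μ) := ⟨rfl⟩
  let S : Set (Lp ℂ a μ × Lp ℂ b μ) := compatiblePairs μ a b
  have : PolishSpace S := isClosed_compatiblePairs.polishSpace
  have hemb : MeasurableEmbedding fun z : S => z.1.2 := by
    refine Continuous.measurableEmbedding (by fun_prop) fun z w hzw => ?_
    have hz : z.1.1 =ᵐ[μ] z.1.2 := z.2
    have hw : w.1.1 =ᵐ[μ] w.1.2 := w.2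
    have hzw' : z.1.2 = w.1.2 := hzw
    rw [hzw'] at hz
    exact Subtype.ext (Prod.ext (Lp.ext (hz.trans hw.symm)) hzw)
  let F : Z → S := fun z => ⟨(f z, g z), h z⟩
  have hF : Measurable F := hemb.measurable_comp_iff.1 hg.measurable
  have hf : Measurable f := measurable_fst.comp (measurable_subtype_coe.comp hF)
  exact hf.stronglyMeasurable

/-- `L^a ∩ L^b` is dense in `L^a`. -/
lemma exists_compatible_norm_sub_lt (ha : a ≠ ∞) (hb : b ≠ ∞) (v : Lp ℂ a μ) {ε : ℝ} (hε : 0 < ε) :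
    ∃ (w : Lp ℂ a μ) (u : Lp ℂ b μ), w =ᵐ[μ] u ∧ ‖v - w‖ < ε := by
  have ha0 : a ≠ 0 := (lt_of_lt_of_le one_pos (Fact.out : 1 ≤ a)).ne'
  have hb0 : b ≠ 0 := (lt_of_lt_of_le one_pos (Fact.out : 1 ≤ b)).ne'
  obtain ⟨φ, hφ, hφm⟩ := (Lp.memLp v).exists_simpleFunc_eLpNorm_sub_lt ha
    (ε := ENNReal.ofReal ε) (by simpa using hε)
  have hφb : MemLp φ b μ := (SimpleFunc.memLp_iff_finMeasSupp hb0 hb).2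
    ((SimpleFunc.memLp_iff_finMeasSupp ha0 ha).1 hφm)
  refine ⟨hφm.toLp φ, hφb.toLp φ, hφm.coeFn_toLp.trans hφb.coeFn_toLp.symm, ?_⟩
  have h1 : eLpNorm (v - hφm.toLp φ : Lp ℂ a μ) a μ < ENNReal.ofReal ε := by
    rw [eLpNorm_congr_ae (Lp.coeFn_sub _ _)]
    rwa [eLpNorm_congr_ae (EventuallyEq.rfl.sub hφm.coeFn_toLp)]
  rw [Lp.norm_def]
  exact (ENNReal.lt_ofReal_iff_toReal_lt (ne_top_of_lt h1)).1 h1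

end Compatible

section ExtendLp

variable {X : Type*} [MeasurableSpace X] {μ : Measure X} {a b : ℝ≥0∞} [Fact (1 ≤ a)]
  [Fact (1 ≤ b)] {R : Lp ℂ 2 μ →L[ℂ] Lp ℂ 2 μ} {c : ℝ≥0∞}

lemma exists_extension (ha : a ≠ ∞) (hc : c ≠ ∞)
    (hR : ∀ u, eLpNorm (R u) b μ ≤ c * eLpNorm u a μ) :
    ∃ L : Lp ℂ a μ →L[ℂ] Lp ℂ b μ, ∀ (u : Lp ℂ a μ) (v : Lp ℂ 2 μ),
      u =ᵐ[μ] v → L u =ᵐ[μ] R v := by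
  let E := compatiblePairs μ a 2
  have hmem : ∀ z : E, MemLp (R z.1.2) b μ := fun z => by
    refine ⟨Lp.aestronglyMeasurable _, (hR _).trans_lt ?_⟩
    rw [← eLpNorm_congr_ae (show z.1.1 =ᵐ[μ] z.1.2 from z.2)]
    exact ENNReal.mul_lt_top hc.lt_top (Lp.eLpNorm_lt_top _)
  let e : E →ₗ[ℂ] Lp ℂ a μ := (LinearMap.fst ℂ _ _).comp E.subtype
  let f : E →ₗ[ℂ] Lp ℂ b μ :=
    { toFun := fun z => (hmem z).toLp (R z.1.2)
      map_add' := fun z w => by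
        rw [← MemLp.toLp_add]
        refine MemLp.toLp_congr _ _ ?_
        have : R (z + w).1.2 = R z.1.2 + R w.1.2 := by rw [← map_add]; rfl
        rw [this]
        exact Lp.coeFn_add _ _
      map_smul' := fun s z => by
        rw [RingHom.id_apply, ← MemLp.toLp_const_smul]
        refine MemLp.toLp_congr _ _ ?_
        have : R (s • z).1.2 = s • R z.1.2 := by rw [← map_smul]; rfl
        rw [this]
        exact Lp.coeFn_smul _ _ }
  have hdense : DenseRange e := by
    refine Metric.denseRange_iff.2 fun v ε hε => ?_
    obtain ⟨w, u, hwu, hlt⟩ := exists_compatible_norm_sub_lt (b := 2) ha (by norm_num) v hε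
    exact ⟨⟨(w, u), hwu⟩, by rw [dist_eq_norm]; exact hlt⟩
  have hnorm : ∀ z, ‖f z‖ ≤ c.toReal * ‖e z‖ := fun z => by
    have h1 := hR z.1.2
    rw [← eLpNorm_congr_ae (show z.1.1 =ᵐ[μ] z.1.2 from z.2)] at h1
    have h2 := ENNReal.toReal_mono (ENNReal.mul_ne_top hc (Lp.eLpNorm_ne_top _)) h1
    rw [ENNReal.toReal_mul] at h2
    change ‖(hmem z).toLp (R z.1.2)‖ ≤ _
    rw [Lp.norm_toLp]
    exact h2
  refine ⟨f.extendOfNorm e, fun u v huv => ?_⟩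
  have h3 := LinearMap.extendOfNorm_eq hdense ⟨_, hnorm⟩ (⟨(u, v), huv⟩ : E)
  have h4 : e ⟨(u, v), huv⟩ = u := rfl
  rw [h4] at h3
  rw [h3]
  exact (hmem ⟨(u, v), huv⟩).coeFn_toLp

lemma extendLp_compatible (ha : a ≠ ∞) (hc : c ≠ ∞)
    (hR : ∀ u, eLpNorm (R u) b μ ≤ c * eLpNorm u a μ) {u : Lp ℂ a μ} {v : Lp ℂ 2 μ}
    (huv : u =ᵐ[μ] v) : extendLp R a b u =ᵐ[μ] R v := by
  have h := exists_extension ha hc hR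
  rw [extendLp, dif_pos h]
  exact h.choose_spec u v huv

lemma enorm_extendLp_le (ha : a ≠ ∞) (hR : ∀ u, eLpNorm (R u) b μ ≤ c * eLpNorm u a μ)
    (u : Lp ℂ a μ) : ‖extendLp R a b u‖ₑ ≤ c * ‖u‖ₑ := by
  rcases eq_or_ne c ∞ with rfl | hc
  · rcases eq_or_ne u 0 with rfl | hu
    · simp
    · rw [ENNReal.top_mul (by simpa using hu)]; exact le_top
  have hclosed : IsClosed {u : Lp ℂ a μ | ‖extendLp R a b u‖ ≤ c.toReal * ‖u‖} :=
    isClosed_le (by fun_prop) (by fun_prop)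
  have key : ‖extendLp R a b u‖ ≤ c.toReal * ‖u‖ := by
    have hd : Dense {w : Lp ℂ a μ | ∃ v : Lp ℂ 2 μ, w =ᵐ[μ] v} := by
      refine Metric.dense_iff.2 fun v ε hε => ?_
      obtain ⟨w, u, hwu, hlt⟩ := exists_compatible_norm_sub_lt (b := 2) ha (by norm_num) v hε
      exact ⟨w, by rw [Metric.mem_ball, dist_comm, dist_eq_norm]; exact hlt, u, hwu⟩
    refine hd.induction (P := fun u => ‖extendLp R a b u‖ ≤ c.toReal * ‖u‖) ?_ hclosed u
    rintro w ⟨v, hwv⟩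
    have h1 := hR v
    rw [← eLpNorm_congr_ae hwv, ← eLpNorm_congr_ae (extendLp_compatible ha hc hR hwv)] at h1
    have h2 := ENNReal.toReal_mono (ENNReal.mul_ne_top hc (Lp.eLpNorm_ne_top _)) h1
    rwa [ENNReal.toReal_mul] at h2
  rw [← ofReal_norm, ← ofReal_norm, ← ENNReal.ofReal_toReal hc,
    ← ENNReal.ofReal_mul ENNReal.toReal_nonneg]
  exact ENNReal.ofReal_le_ofReal key

lemma stronglyMeasurable_extendLp_of_compatible [IsSeparable μ]
    {U : ℝ → Lp ℂ 2 μ →L[ℂ] Lp ℂ 2 μ}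
    (hU : IsIsometricFlow U) (ha : a ≠ ∞) (hb : b ≠ ∞) {k : ℝ → ℝ≥0∞}
    (hk : ∀ t u, eLpNorm (U t u) b μ ≤ k t * eLpNorm u a μ) (hkt : ∀ t, t ≠ 0 → k t ≠ ∞)
    {w : Lp ℂ a μ} {u : Lp ℂ 2 μ} (hwu : w =ᵐ[μ] u) :
    StronglyMeasurable fun t => extendLp (U t) a b w := by
  have : Fact ((2 : ℝ≥0∞) ≠ ∞) := ⟨by norm_num⟩
  have : Fact (b ≠ ∞) := ⟨hb⟩
  have h1 : StronglyMeasurable (({0}ᶜ : Set ℝ).indicator fun t => U t u) :=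
    (hU.continuous u).stronglyMeasurable.indicator (measurableSet_singleton 0).compl
  have h2 : StronglyMeasurable (({0}ᶜ : Set ℝ).indicator fun t => extendLp (U t) a b w) := by
    refine stronglyMeasurable_of_compatible h1 fun t => ?_
    by_cases ht : t ∈ ({0}ᶜ : Set ℝ)
    · rw [Set.indicator_of_mem ht, Set.indicator_of_mem ht]
      exact extendLp_compatible ha (hkt t ht) (hk t) hwu
    · rw [Set.indicator_of_notMem ht, Set.indicator_of_notMem ht]
      exact (Lp.coeFn_zero ℂ b μ).trans (Lp.coeFn_zero ℂ 2 μ).symm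
  have h3 : (fun t : ℝ => extendLp (U t) a b w)
      = (({0}ᶜ : Set ℝ).indicator fun t => extendLp (U t) a b w)
        + ({0} : Set ℝ).indicator fun _ => extendLp (U 0) a b w := by
    funext t
    rw [Pi.add_apply]
    by_cases ht : t = 0
    · subst ht
      rw [Set.indicator_of_notMem (by simp), Set.indicator_of_mem (by simp), zero_add]
    · rw [Set.indicator_of_mem (by simpa using ht), Set.indicator_of_notMem (by simpa using ht),
        add_zero]
  rw [h3]
  exact h2.add (stronglyMeasurable_const.indicator (measurableSet_singleton 0))

lemma stronglyMeasurable_extendLp_const [IsSeparable μ]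
    {U : ℝ → Lp ℂ 2 μ →L[ℂ] Lp ℂ 2 μ}
    (hU : IsIsometricFlow U) (ha : a ≠ ∞) (hb : b ≠ ∞) {k : ℝ → ℝ≥0∞}
    (hk : ∀ t u, eLpNorm (U t u) b μ ≤ k t * eLpNorm u a μ) (hkt : ∀ t, t ≠ 0 → k t ≠ ∞)
    (v : Lp ℂ a μ) : StronglyMeasurable fun t => extendLp (U t) a b v := by
  have h1 : ∀ n : ℕ, ∃ (w : Lp ℂ a μ) (u : Lp ℂ 2 μ), w =ᵐ[μ] u ∧ ‖v - w‖ < 1 / ((n : ℝ) + 1) :=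
    fun n => exists_compatible_norm_sub_lt ha (by norm_num) v (by positivity)
  choose w u hwu hlt using h1
  have hw : Tendsto w atTop (𝓝 v) := by
    rw [tendsto_iff_norm_sub_tendsto_zero]
    refine squeeze_zero (fun _ => norm_nonneg _) (fun n => ?_)
      tendsto_one_div_add_atTop_nhds_zero_nat
    rw [norm_sub_rev]
    exact (hlt n).le
  refine stronglyMeasurable_of_tendsto atTop
    (fun n => stronglyMeasurable_extendLp_of_compatible hU ha hb hk hkt (hwu n)) ?_
  rw [tendsto_pi_nhds]
  exact fun t => ((extendLp (U t) a b).continuous.tendsto v).comp hw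

lemma stronglyMeasurable_clm_apply {V W Z : Type*} [NormedAddCommGroup V] [NormedSpace ℂ V]
    [SecondCountableTopology V] [NormedAddCommGroup W] [NormedSpace ℂ W] [MeasurableSpace Z]
    {L : ℝ → V →L[ℂ] W} (hL : ∀ v, StronglyMeasurable fun t => L t v) {τ : Z → ℝ}
    (hτ : Measurable τ) {f : Z → V} (hf : StronglyMeasurable f) :
    StronglyMeasurable fun z => L (τ z) (f z) := by
  let : MeasurableSpace V := borel _
  have : BorelSpace V := ⟨rfl⟩
  have huc : StronglyMeasurable (Function.uncurry fun (v : V) (t : ℝ) => L t v) :=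
    stronglyMeasurable_uncurry_of_continuous_of_stronglyMeasurable
      (fun t => (L t).continuous) hL
  exact huc.comp_measurable (hf.measurable.prodMk hτ)

/-- Joint measurability of the extended flow. -/
lemma stronglyMeasurable_extendLp [IsSeparable μ] {U : ℝ → Lp ℂ 2 μ →L[ℂ] Lp ℂ 2 μ}
    (hU : IsIsometricFlow U) (ha : a ≠ ∞) (hb : b ≠ ∞) {k : ℝ → ℝ≥0∞}
    (hk : ∀ t u, eLpNorm (U t u) b μ ≤ k t * eLpNorm u a μ) (hkt : ∀ t, t ≠ 0 → k t ≠ ∞)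
    {Z : Type*} [MeasurableSpace Z] {τ : Z → ℝ} (hτ : Measurable τ) {f : Z → Lp ℂ a μ}
    (hf : StronglyMeasurable f) :
    StronglyMeasurable fun z => extendLp (U (τ z)) a b (f z) := by
  have : Fact (a ≠ ∞) := ⟨ha⟩
  exact stronglyMeasurable_clm_apply (L := fun t => extendLp (U t) a b)
    (stronglyMeasurable_extendLp_const hU ha hb hk hkt) hτ hf

end ExtendLp

section Closing

variable {X Z : Type*} [MeasurableSpace X] [MeasurableSpace Z] {μ : Measure X} {ν : Measure Z}
  {U : ℝ → Lp ℂ 2 μ →L[ℂ] Lp ℂ 2 μ} {β : Z → ℝ} {k : ℝ → ℝ≥0∞} {E : Set (Z × Z)}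

/-- Fatou's lemma for `L^R` norms of functions with values in `[0, ∞]`. -/
lemma eLpNorm_liminf_le_of_tendsto {R : ℝ≥0∞} {F : ℕ → Z → ℝ≥0∞} (hF : ∀ n, Measurable (F n))
    {c : ℕ → ℝ≥0∞} {C : ℝ≥0∞} (hc : ∀ n, eLpNorm (F n) R ν ≤ c n) (hcC : Tendsto c atTop (𝓝 C)) :
    eLpNorm (fun z => liminf (fun n => F n z) atTop) R ν ≤ C := by
  rcases eq_or_ne R 0 with rfl | hR0
  · simp
  rcases eq_or_ne R ∞ with rfl | hR
  · simp only [eLpNorm_exponent_top] at hc ⊢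
    refine essSup_le_of_ae_le _ ?_
    have h1 : ∀ n, ∀ᵐ z ∂ν, F n z ≤ c n := fun n => by
      filter_upwards [ae_le_eLpNormEssSup (f := F n) (μ := ν)] with z hz
      exact (by simpa using hz : F n z ≤ _).trans (hc n)
    filter_upwards [ae_all_iff.2 h1] with z hz
    simp only [enorm_eq_self]
    rw [← hcC.liminf_eq]
    exact liminf_le_liminf (Eventually.of_forall hz)
  · have hRp : 0 < R.toReal := ENNReal.toReal_pos hR0 hR
    simp only [eLpNorm_ennreal_eq hR0 hR] at hc ⊢
    have h1 : ∀ z, (liminf (fun n => F n z) atTop) ^ R.toReal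
        = liminf (fun n => F n z ^ R.toReal) atTop := fun z =>
      (ENNReal.orderIsoRpow R.toReal hRp).liminf_apply (u := fun n => F n z) (f := atTop)
    simp only [h1]
    have h2 : ∀ n, ∫⁻ z, F n z ^ R.toReal ∂ν ≤ c n ^ R.toReal := fun n => by
      have := ENNReal.rpow_le_rpow (hc n) hRp.le
      rwa [← ENNReal.rpow_mul, one_div_mul_cancel hRp.ne', ENNReal.rpow_one] at this
    have h3 : ∫⁻ z, liminf (fun n => F n z ^ R.toReal) atTop ∂ν ≤ C ^ R.toReal := by
      refine (lintegral_liminf_le fun n => (hF n).pow_const _).trans ?_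
      refine (liminf_le_liminf (Eventually.of_forall h2)).trans_eq ?_
      exact ((ENNReal.continuous_rpow_const.tendsto C).comp hcC).liminf_eq
    refine (ENNReal.rpow_le_rpow h3 (by positivity)).trans_eq ?_
    rw [← ENNReal.rpow_mul, mul_one_div_cancel hRp.ne', ENNReal.rpow_one]

variable {a d : ℝ≥0∞} [Fact (1 ≤ a)] [Fact (1 ≤ d)]

/-- The integral operator `f ↦ ∫ 1_E(t, σ) U(β t - β σ) f(σ) dν(σ)` for `L^a`-valued `f`, with
values in `L^d`. -/
noncomputable def extInt (U : ℝ → Lp ℂ 2 μ →L[ℂ] Lp ℂ 2 μ) (β : Z → ℝ) (ν : Measure Z)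
    (E : Set (Z × Z)) (a d : ℝ≥0∞) [Fact (1 ≤ a)] [Fact (1 ≤ d)] (f : Z → Lp ℂ a μ) (t : Z) :
    Lp ℂ d μ :=
  ∫ σ, E.indicator (fun z => extendLp (U (β z.1 - β z.2)) a d (f z.2)) (t, σ) ∂ν

/-- Compatibility of the exponents of `f` with the kernel `k (β t - β σ)`. -/
def KernelBound (k : ℝ → ℝ≥0∞) (β : Z → ℝ) (ν : Measure Z) (g' : ℝ≥0∞) : Prop :=
  ∃ A : ℝ≥0∞, A ≠ ∞ ∧ ∀ b : Z → ℝ≥0∞, Measurable b →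
    ∫⁻ t, ∫⁻ σ, k (β t - β σ) * b σ ∂ν ∂ν ≤ A * eLpNorm b g' ν

variable {f : Z → Lp ℂ a μ} {g' : ℝ≥0∞}

lemma stronglyMeasurable_extInt_integrand [IsSeparable μ] (hU : IsIsometricFlow U)
    (hβ : Measurable β) (hE : MeasurableSet E) (ha : a ≠ ∞) (hd : d ≠ ∞)
    (hk : ∀ t u, eLpNorm (U t u) d μ ≤ k t * eLpNorm u a μ) (hkt : ∀ t, t ≠ 0 → k t ≠ ∞)
    (hf : StronglyMeasurable f) :
    StronglyMeasurable (E.indicator fun z => extendLp (U (β z.1 - β z.2)) a d (f z.2)) :=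
  (stronglyMeasurable_extendLp hU ha hd hk hkt
    ((hβ.comp measurable_fst).sub (hβ.comp measurable_snd))
    (hf.comp_measurable measurable_snd)).indicator hE

lemma enorm_extInt_integrand_le (ha : a ≠ ∞)
    (hk : ∀ t u, eLpNorm (U t u) d μ ≤ k t * eLpNorm u a μ) (t σ : Z) :
    ‖E.indicator (fun z => extendLp (U (β z.1 - β z.2)) a d (f z.2)) (t, σ)‖ₑ
      ≤ k (β t - β σ) * ‖f σ‖ₑ := by
  by_cases h : (t, σ) ∈ E
  · rw [Set.indicator_of_mem h]
    exact enorm_extendLp_le ha (hk _) _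
  · rw [Set.indicator_of_notMem h, enorm_zero]
    exact zero_le

lemma measurable_lintegral_kernel [SFinite ν] (hkm : Measurable k) (hβ : Measurable β)
    {b : Z → ℝ≥0∞} (hb : Measurable b) : Measurable fun t => ∫⁻ σ, k (β t - β σ) * b σ ∂ν := by
  have : Measurable (Function.uncurry fun t σ => k (β t - β σ) * b σ) :=
    (hkm.comp ((hβ.comp measurable_fst).sub (hβ.comp measurable_snd))).mul
      (hb.comp measurable_snd)
  exact this.lintegral_prod_right'

lemma ae_integrable_extInt_integrand [SFinite ν] [IsSeparable μ] (hU : IsIsometricFlow U)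
    (hβ : Measurable β) (hE : MeasurableSet E) (ha : a ≠ ∞) (hd : d ≠ ∞) (hkm : Measurable k)
    (hk : ∀ t u, eLpNorm (U t u) d μ ≤ k t * eLpNorm u a μ) (hkt : ∀ t, t ≠ 0 → k t ≠ ∞)
    (hY : KernelBound k β ν g') (hf : StronglyMeasurable f) (hfi : eLpNorm f g' ν ≠ ∞) :
    ∀ᵐ t ∂ν, Integrable (fun σ =>
      E.indicator (fun z => extendLp (U (β z.1 - β z.2)) a d (f z.2)) (t, σ)) ν := by
  obtain ⟨A, hA, hY⟩ := hY
  have hm : Measurable fun σ => ‖f σ‖ₑ := hf.enorm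
  have h1 : ∀ᵐ t ∂ν, ∫⁻ σ, k (β t - β σ) * ‖f σ‖ₑ ∂ν < ∞ := by
    refine ae_lt_top (measurable_lintegral_kernel hkm hβ hm) (ne_top_of_le_ne_top ?_ (hY _ hm))
    rw [eLpNorm_enorm]
    exact ENNReal.mul_ne_top hA hfi
  filter_upwards [h1] with t ht
  refine ⟨((stronglyMeasurable_extInt_integrand hU hβ hE ha hd hk hkt hf).comp_measurable
    measurable_prodMk_left).aestronglyMeasurable, ?_⟩
  exact (lintegral_mono fun σ => enorm_extInt_integrand_le ha hk t σ).trans_lt ht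

lemma enorm_extInt_sub_le (ha : a ≠ ∞)
    (hk : ∀ t u, eLpNorm (U t u) d μ ≤ k t * eLpNorm u a μ) {φ : Z → Lp ℂ a μ} {t : Z}
    (h1 : Integrable (fun σ =>
      E.indicator (fun z => extendLp (U (β z.1 - β z.2)) a d (f z.2)) (t, σ)) ν)
    (h2 : Integrable (fun σ =>
      E.indicator (fun z => extendLp (U (β z.1 - β z.2)) a d (φ z.2)) (t, σ)) ν) :
    ‖extInt U β ν E a d φ t - extInt U β ν E a d f t‖ₑ
      ≤ ∫⁻ σ, k (β t - β σ) * ‖φ σ - f σ‖ₑ ∂ν := by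
  rw [extInt, extInt, ← integral_sub h2 h1]
  refine (enorm_integral_le_lintegral_enorm _).trans (lintegral_mono fun σ => ?_)
  have : E.indicator (fun z => extendLp (U (β z.1 - β z.2)) a d (φ z.2)) (t, σ)
      - E.indicator (fun z => extendLp (U (β z.1 - β z.2)) a d (f z.2)) (t, σ)
      = E.indicator (fun z => extendLp (U (β z.1 - β z.2)) a d ((φ - f) z.2)) (t, σ) := by
    by_cases h : (t, σ) ∈ E
    · simp only [Set.indicator_of_mem h, Pi.sub_apply, map_sub]
    · simp only [Set.indicator_of_notMem h, sub_zero]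
  rw [this]
  exact enorm_extInt_integrand_le ha hk t σ

lemma ae_extInt_compatible [IsFiniteMeasure ν] [IsSeparable μ] (hU : IsIsometricFlow U)
    (hβ : Measurable β) (hE : MeasurableSet E) (ha : a ≠ ∞) (hd : d ≠ ∞) (hkm : Measurable k)
    (hk : ∀ t u, eLpNorm (U t u) d μ ≤ k t * eLpNorm u a μ) (hkt : ∀ t, t ≠ 0 → k t ≠ ∞)
    (hY : KernelBound k β ν g') (hf : StronglyMeasurable f) (hfi : eLpNorm f g' ν ≠ ∞)
    {ψ : Z → Lp ℂ 2 μ} (hψ : StronglyMeasurable ψ) (hψi : Integrable ψ ν)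
    (hfψ : ∀ z, f z =ᵐ[μ] ψ z) :
    ∀ᵐ t ∂ν, extInt U β ν E a d f t =ᵐ[μ] pathInt U β ν E ψ t := by
  have h1 : ∀ᵐ t ∂ν, ∫⁻ σ, k (β t - β σ) * 1 ∂ν < ∞ := by
    obtain ⟨A, hA, hY⟩ := hY
    refine ae_lt_top (measurable_lintegral_kernel hkm hβ measurable_one)
      (ne_top_of_le_ne_top ?_ (hY _ measurable_one))
    refine ENNReal.mul_ne_top hA ?_
    exact (memLp_const_enorm (by simp)).2.ne
  filter_upwards [h1, ae_integrable_extInt_integrand hU hβ hE ha hd hkm hk hkt hY hf hfi]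
    with t ht hti
  refine integral_compatible hti (integrable_pathInt_integrand hU hβ hE hψ hψi t) ?_
  have hm : Measurable fun σ => k (β t - β σ) * 1 :=
    (hkm.comp (measurable_const.sub hβ)).mul_const _
  filter_upwards [ae_lt_top hm ht.ne] with σ hσ
  rw [mul_one] at hσ
  by_cases h : (t, σ) ∈ E
  · rw [Set.indicator_of_mem h, Set.indicator_of_mem h]
    exact extendLp_compatible ha hσ.ne (hk _) (hfψ σ)
  · rw [Set.indicator_of_notMem h, Set.indicator_of_notMem h]
    exact (Lp.coeFn_zero ℂ d μ).trans (Lp.coeFn_zero ℂ 2 μ).symm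

lemma exists_simpleFunc_compatible [IsFiniteMeasure ν] [IsSeparable μ] (ha : a ≠ ∞)
    (hg't : g' ≠ ∞) (hf : StronglyMeasurable f) (hfi : eLpNorm f g' ν ≠ ∞) {ε : ℝ≥0∞}
    (hε : 0 < ε) :
    ∃ (φ : SimpleFunc Z (Lp ℂ a μ)) (ψ : SimpleFunc Z (Lp ℂ 2 μ)), (∀ z, φ z =ᵐ[μ] ψ z) ∧
      eLpNorm (⇑φ - f) g' ν < ε := by
  have : Fact (a ≠ ∞) := ⟨ha⟩
  let : MeasurableSpace (Lp ℂ a μ) := borel _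
  have : BorelSpace (Lp ℂ a μ) := ⟨rfl⟩
  let S : Set (Lp ℂ a μ) := {w | ∃ u : Lp ℂ 2 μ, w =ᵐ[μ] u}
  have h0 : (0 : Lp ℂ a μ) ∈ S := ⟨0, (Lp.coeFn_zero ℂ a μ).trans (Lp.coeFn_zero ℂ 2 μ).symm⟩
  have hcl : ∀ v : Lp ℂ a μ, v ∈ closure S := fun v => by
    refine Metric.mem_closure_iff.2 fun ε hε => ?_
    obtain ⟨w, u, hwu, hlt⟩ := exists_compatible_norm_sub_lt (b := 2) ha (by norm_num) v hε
    exact ⟨w, ⟨u, hwu⟩, by rw [dist_eq_norm]; exact hlt⟩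
  have hi : eLpNorm (fun x => f x - 0) g' ν < ∞ := by simpa using hfi.lt_top
  have ht := SimpleFunc.tendsto_approxOn_Lp_eLpNorm hf.measurable h0 hg't
    (ae_of_all ν fun z => hcl (f z)) hi
  obtain ⟨n, hn⟩ := (ht.eventually_lt_const hε).exists
  let φ := SimpleFunc.approxOn f hf.measurable S 0 h0 n
  classical
  let c : Lp ℂ a μ → Lp ℂ 2 μ := fun w => if h : w ∈ S then h.choose else 0
  refine ⟨φ, φ.map c, fun z => ?_, hn⟩
  have hz : φ z ∈ S := SimpleFunc.approxOn_mem _ h0 n z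
  have : c (φ z) = hz.choose := dif_pos hz
  rw [SimpleFunc.map_apply, this]
  exact hz.choose_spec

/-- An estimate for `pathInt` on integrable `L²`-valued functions passes to `extInt`. -/
lemma eLpNorm_extInt_le [IsFiniteMeasure ν] [IsSeparable μ] (hU : IsIsometricFlow U)
    (hβ : Measurable β) (hE : MeasurableSet E) (ha : a ≠ ∞) (hd : d ≠ ∞) (hkm : Measurable k)
    (hk : ∀ t u, eLpNorm (U t u) d μ ≤ k t * eLpNorm u a μ) (hkt : ∀ t, t ≠ 0 → k t ≠ ∞)
    (hg' : 1 ≤ g') (hg't : g' ≠ ∞)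
    (hY : KernelBound k β ν g') (hf : StronglyMeasurable f) (hfi : eLpNorm f g' ν ≠ ∞)
    {Q R B : ℝ≥0∞} (hB : B ≠ ∞)
    (hpath : ∀ ψ : Z → Lp ℂ 2 μ, StronglyMeasurable ψ → Integrable ψ ν →
      eLpNorm (fun t => eLpNorm (pathInt U β ν E ψ t) Q μ) R ν
        ≤ B * eLpNorm (fun z => eLpNorm (ψ z) a μ) g' ν) :
    eLpNorm (fun t => eLpNorm (extInt U β ν E a d f t) Q μ) R ν
      ≤ B * eLpNorm f g' ν := by
  have hε : ∀ n : ℕ, (0 : ℝ≥0∞) < (2⁻¹ : ℝ≥0∞) ^ n := fun n =>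
    ENNReal.pow_pos (by simp) n
  choose φ ψ hφψ hφ using fun n => exists_simpleFunc_compatible ha hg't hf hfi (hε n)
  have hfm : AEStronglyMeasurable f ν := hf.aestronglyMeasurable
  have hφm : ∀ n, StronglyMeasurable (φ n) := fun n => (φ n).stronglyMeasurable
  have hφi : ∀ n, eLpNorm (φ n) g' ν ≠ ∞ := fun n => by
    have := eLpNorm_add_le (p := g') ((hφm n).aestronglyMeasurable.sub hfm) hfm hg'
    rw [sub_add_cancel] at this
    exact ne_top_of_le_ne_top (ENNReal.add_ne_top.2 ⟨((hφ n).trans_le le_top).ne, hfi⟩) this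
  have hconv : ∀ᵐ t ∂ν, Tendsto (fun n => extInt U β ν E a d (φ n) t) atTop
      (𝓝 (extInt U β ν E a d f t)) := by
    obtain ⟨A, hA, hYb⟩ := id hY
    have hmn : ∀ n, Measurable fun σ => ‖φ n σ - f σ‖ₑ := fun n => ((hφm n).sub hf).enorm
    have hs : ∫⁻ t, ∑' n, ∫⁻ σ, k (β t - β σ) * ‖φ n σ - f σ‖ₑ ∂ν ∂ν ≠ ∞ := by
      rw [lintegral_tsum fun n => (measurable_lintegral_kernel hkm hβ (hmn n)).aemeasurable]
      refine ne_top_of_le_ne_top (b := A * ∑' n : ℕ, (2⁻¹ : ℝ≥0∞) ^ n) ?_ ?_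
      · refine ENNReal.mul_ne_top hA ?_
        rw [ENNReal.tsum_geometric, ENNReal.one_sub_inv_two, inv_inv]
        norm_num
      · rw [← ENNReal.tsum_mul_left]
        refine ENNReal.tsum_le_tsum fun n => (hYb _ (hmn n)).trans ?_
        gcongr
        refine le_trans (le_of_eq ?_) (hφ n).le
        exact eLpNorm_enorm (⇑(φ n) - f)
    have hm : Measurable fun t => ∑' n, ∫⁻ σ, k (β t - β σ) * ‖φ n σ - f σ‖ₑ ∂ν :=
      Measurable.tsum fun n => measurable_lintegral_kernel hkm hβ (hmn n)
    filter_upwards [ae_lt_top hm hs,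
      ae_integrable_extInt_integrand hU hβ hE ha hd hkm hk hkt hY hf hfi,
      ae_all_iff.2 fun n =>
        ae_integrable_extInt_integrand hU hβ hE ha hd hkm hk hkt hY (hφm n) (hφi n)]
      with t ht h1 h2
    have h0 := ENNReal.tendsto_atTop_zero_of_tsum_ne_top ht.ne
    rw [tendsto_iff_edist_tendsto_0]
    refine tendsto_of_tendsto_of_tendsto_of_le_of_le tendsto_const_nhds h0
      (fun _ => zero_le) fun n => ?_
    rw [edist_eq_enorm_sub]
    exact enorm_extInt_sub_le ha hk h1 (h2 n)
  have hcomp : ∀ᵐ t ∂ν, ∀ n, extInt U β ν E a d (φ n) t =ᵐ[μ] pathInt U β ν E (ψ n) t :=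
    ae_all_iff.2 fun n => ae_extInt_compatible hU hβ hE ha hd hkm hk hkt hY (hφm n) (hφi n)
      (ψ n).stronglyMeasurable (SimpleFunc.integrable_of_isFiniteMeasure _) (hφψ n)
  have hle : ∀ᵐ t ∂ν, eLpNorm (extInt U β ν E a d f t) Q μ
      ≤ liminf (fun n => eLpNorm (pathInt U β ν E (ψ n) t) Q μ) atTop := by
    filter_upwards [hconv, hcomp] with t h1 h2
    refine (eLpNorm_le_of_tendsto h1).trans_eq ?_
    congr 1
    funext n
    exact eLpNorm_congr_ae (h2 n)
  refine (eLpNorm_mono_enorm_ae (g := fun t =>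
    liminf (fun n => eLpNorm (pathInt U β ν E (ψ n) t) Q μ) atTop) ?_).trans ?_
  · filter_upwards [hle] with t ht
    simpa using ht
  refine eLpNorm_liminf_le_of_tendsto (c := fun n => B * eLpNorm (φ n) g' ν)
    (fun n => measurable_eLpNorm_comp Q
      (stronglyMeasurable_pathInt hU hβ hE (ψ n).stronglyMeasurable)) (fun n => ?_) ?_
  · refine (hpath (ψ n) (ψ n).stronglyMeasurable
      (SimpleFunc.integrable_of_isFiniteMeasure _)).trans_eq ?_
    congr 1
    rw [← eLpNorm_enorm (φ n)]
    congr 1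
    funext z
    rw [Lp.enorm_def, eLpNorm_congr_ae (hφψ n z)]
  · refine ENNReal.Tendsto.const_mul ?_ (Or.inr hB)
    have h0 : Tendsto (fun n : ℕ => (2⁻¹ : ℝ≥0∞) ^ n) atTop (𝓝 0) :=
      ENNReal.tendsto_pow_atTop_nhds_zero_of_lt_one (by simp)
    have hlow : Tendsto (fun n : ℕ => eLpNorm f g' ν - (2⁻¹ : ℝ≥0∞) ^ n) atTop
        (𝓝 (eLpNorm f g' ν)) := by
      simpa using ENNReal.Tendsto.sub (tendsto_const_nhds (x := eLpNorm f g' ν)) h0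
        (Or.inl hfi)
    have hup : Tendsto (fun n : ℕ => (2⁻¹ : ℝ≥0∞) ^ n + eLpNorm f g' ν) atTop
        (𝓝 (eLpNorm f g' ν)) := by
      simpa using h0.add_const (eLpNorm f g' ν)
    refine tendsto_of_tendsto_of_tendsto_of_le_of_le hlow hup (fun n => ?_) fun n => ?_
    · refine tsub_le_iff_right.2 ?_
      have := eLpNorm_sub_le (p := g') (hφm n).aestronglyMeasurable
        ((hφm n).aestronglyMeasurable.sub hfm) hg'
      rw [sub_sub_cancel] at this
      exact this.trans (add_le_add le_rfl (hφ n).le)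
    · have := eLpNorm_add_le (p := g') ((hφm n).aestronglyMeasurable.sub hfm) hfm hg'
      rw [sub_add_cancel] at this
      exact this.trans (add_le_add (hφ n).le le_rfl)

end Closing

section OccupationPower

lemma lintegral_Ioc_mul_lintegral_Ioo_swap {φ ψ : ℝ → ℝ≥0∞} (hφ : Measurable φ)
    (hψ : Measurable ψ) (u e : ℝ) :
    ∫⁻ t in Set.Ioc u e, ψ t * ∫⁻ x in Set.Ioc u t, φ x
      = ∫⁻ x in Set.Ioc u e, φ x * ∫⁻ t in Set.Ioc x e, ψ t := by
  have hD : MeasurableSet {z : ℝ × ℝ | u < z.2 ∧ z.2 < z.1 ∧ z.1 ≤ e} :=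
    (measurableSet_lt measurable_const measurable_snd).inter
      ((measurableSet_lt measurable_snd measurable_fst).inter
        (measurableSet_le measurable_fst measurable_const))
  have hm : Measurable ({z : ℝ × ℝ | u < z.2 ∧ z.2 < z.1 ∧ z.1 ≤ e}.indicator
      fun z => ψ z.1 * φ z.2) :=
    ((hψ.comp measurable_fst).mul (hφ.comp measurable_snd)).indicator hD
  have h1 : ∀ t, (Set.Ioc u e).indicator (fun t => ψ t * ∫⁻ x in Set.Ioc u t, φ x) t
      = ∫⁻ x, ({z : ℝ × ℝ | u < z.2 ∧ z.2 < z.1 ∧ z.1 ≤ e}.indicator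
        fun z => ψ z.1 * φ z.2) (t, x) := by
    intro t
    by_cases ht : t ∈ Set.Ioc u e
    · rw [Set.indicator_of_mem ht, setLIntegral_congr Ioo_ae_eq_Ioc.symm,
        ← lintegral_const_mul _ hφ, ← lintegral_indicator measurableSet_Ioo]
      refine lintegral_congr fun x => ?_
      simp only [Set.indicator_apply, Set.mem_Ioo, Set.mem_ofPred_eq]
      simp [ht.2]
    · rw [Set.indicator_of_notMem ht]
      symm
      refine (lintegral_congr fun x => ?_).trans lintegral_zero
      rw [Set.indicator_of_notMem]
      rintro ⟨h1, h2, h3⟩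
      exact ht ⟨h1.trans h2, h3⟩
  have h2 : ∀ x, (Set.Ioc u e).indicator (fun x => φ x * ∫⁻ t in Set.Ioc x e, ψ t) x
      = ∫⁻ t, ({z : ℝ × ℝ | u < z.2 ∧ z.2 < z.1 ∧ z.1 ≤ e}.indicator
        fun z => ψ z.1 * φ z.2) (t, x) := by
    intro x
    by_cases hx : x ∈ Set.Ioc u e
    · rw [Set.indicator_of_mem hx, ← lintegral_const_mul _ hψ,
        ← lintegral_indicator measurableSet_Ioc]
      refine lintegral_congr fun t => ?_
      simp only [Set.indicator_apply, Set.mem_Ioc, Set.mem_ofPred_eq]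
      simp [hx.1, mul_comm]
    · rw [Set.indicator_of_notMem hx]
      symm
      refine (lintegral_congr fun t => ?_).trans lintegral_zero
      rw [Set.indicator_of_notMem]
      rintro ⟨h1, h2, h3⟩
      exact hx ⟨h1, h2.le.trans h3⟩
  rw [← lintegral_indicator measurableSet_Ioc, ← lintegral_indicator measurableSet_Ioc]
  simp only [h1, h2]
  exact lintegral_lintegral_swap hm.aemeasurable

lemma measurable_lintegral_Ioc (φ : ℝ → ℝ≥0∞) (e : ℝ) :
    Measurable fun t => ∫⁻ x in Set.Ioc t e, φ x := by
  have h : Antitone fun t => ∫⁻ x in Set.Ioc t e, φ x := fun t t' htt =>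
    lintegral_mono_set (Set.Ioc_subset_Ioc_left htt)
  exact h.measurable

/-- Powers of an integral as iterated integrals over ordered times. -/
lemma lintegral_Ioc_pow_succ {φ : ℝ → ℝ≥0∞} (hφ : Measurable φ) (u e : ℝ) (n : ℕ) :
    (∫⁻ t in Set.Ioc u e, φ t) ^ (n + 1)
      = (n + 1) * ∫⁻ t in Set.Ioc u e, φ t * (∫⁻ x in Set.Ioc t e, φ x) ^ n := by
  induction n generalizing u with
  | zero => simp
  | succ n ih =>
    have hF := measurable_lintegral_Ioc φ e
    have hψ : Measurable fun t => φ t * (∫⁻ x in Set.Ioc t e, φ x) ^ n := hφ.mul (hF.pow_const n)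
    have hψ' : Measurable fun t => φ t * (∫⁻ x in Set.Ioc t e, φ x) ^ (n + 1) :=
      hφ.mul (hF.pow_const _)
    have h1 : ∀ t ∈ Set.Ioc u e, (φ t * (∫⁻ x in Set.Ioc t e, φ x) ^ n)
          * (∫⁻ x in Set.Ioc u e, φ x)
        = (φ t * (∫⁻ x in Set.Ioc t e, φ x) ^ n) * (∫⁻ x in Set.Ioc u t, φ x)
          + φ t * (∫⁻ x in Set.Ioc t e, φ x) ^ (n + 1) := by
      intro t ht
      rw [← Set.Ioc_union_Ioc_eq_Ioc ht.1.le ht.2,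
        lintegral_union measurableSet_Ioc (Set.Ioc_disjoint_Ioc_of_le le_rfl)]
      ring
    have h2 : (∫⁻ t in Set.Ioc u e, φ t * (∫⁻ x in Set.Ioc t e, φ x) ^ n)
          * (∫⁻ x in Set.Ioc u e, φ x)
        = (∫⁻ x in Set.Ioc u e, φ x * ∫⁻ t in Set.Ioc x e, φ t * (∫⁻ y in Set.Ioc t e, φ y) ^ n)
          + ∫⁻ t in Set.Ioc u e, φ t * (∫⁻ x in Set.Ioc t e, φ x) ^ (n + 1) := by
      rw [← lintegral_mul_const _ hψ, setLIntegral_congr_fun measurableSet_Ioc h1,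
        lintegral_add_right _ hψ',
        lintegral_Ioc_mul_lintegral_Ioo_swap hφ hψ]
    rw [pow_succ, ih u, mul_assoc, h2, mul_add, ← lintegral_const_mul' _ _ (by finiteness)]
    have h3 : ∀ x, ((n : ℝ≥0∞) + 1)
          * (φ x * ∫⁻ t in Set.Ioc x e, φ t * (∫⁻ y in Set.Ioc t e, φ y) ^ n)
        = φ x * (∫⁻ t in Set.Ioc x e, φ t) ^ (n + 1) := by
      intro x
      rw [ih x]; ring
    simp only [h3]
    push_cast
    ring

end OccupationPower

/-- A measurable adapted process whose conditional laws have densities bounded by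
`(t - u)^(-1/2)`. -/
structure HasTransitionBound {Ω : Type*} {mΩ : MeasurableSpace Ω} (P : Measure Ω)
    (F : ℝ → MeasurableSpace Ω) (b : ℝ → Ω → ℝ) : Prop where
  le : ∀ t, F t ≤ mΩ
  mono : Monotone F
  measurable : Measurable (Function.uncurry b)
  adapted : ∀ t, Measurable[F t] (b t)
  bound : ∀ u t, 0 ≤ u → u < t → ∀ H : Ω → ℝ≥0∞, Measurable[F u] H → ∀ φ : ℝ → ℝ≥0∞,
    Measurable φ → ∫⁻ ω, H ω * φ (b t ω) ∂P
      ≤ ENNReal.ofReal (1 / √(t - u)) * (∫⁻ x, φ x) * ∫⁻ ω, H ω ∂P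

section OccupationMoments

variable {Ω : Type*} {mΩ : MeasurableSpace Ω} {P : Measure Ω} {F : ℝ → MeasurableSpace Ω}
  {b : ℝ → Ω → ℝ}

lemma lintegral_inv_sqrt_le {u e : ℝ} {T : ℝ} (hT : e - u ≤ T) (hue : u ≤ e) :
    ∫⁻ t in Set.Ioc u e, ENNReal.ofReal (1 / √(t - u)) ≤ ENNReal.ofReal (2 * √T) := by
  have h0 : ∀ x : ℝ, 1 / √x = x ^ (-(1 / 2) : ℝ) ∨ x < 0 := fun x => by
    rcases lt_or_ge x 0 with h | h
    · exact Or.inr h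
    · left
      rw [Real.sqrt_eq_rpow, Real.rpow_neg h, one_div]
  have hi : IntervalIntegrable (fun x : ℝ => x ^ (-(1 / 2) : ℝ)) volume (u - u) (e - u) :=
    intervalIntegral.intervalIntegrable_rpow' (by norm_num)
  have hi2 : IntervalIntegrable (fun x : ℝ => (x - u) ^ (-(1 / 2) : ℝ)) volume u e := by
    simpa using hi.comp_sub_right u
  have h1 : ∫⁻ t in Set.Ioc u e, ENNReal.ofReal (1 / √(t - u))
      = ENNReal.ofReal (∫ t in u..e, (t - u) ^ (-(1 / 2) : ℝ)) := by
    rw [intervalIntegral.integral_of_le hue, ofReal_integral_eq_lintegral_ofReal hi2.1]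
    · refine setLIntegral_congr_fun measurableSet_Ioc fun t ht => ?_
      rcases h0 (t - u) with h | h
      · simp only [h]
      · linarith [ht.1]
    · refine (ae_restrict_iff' measurableSet_Ioc).2 (ae_of_all _ fun t ht => ?_)
      exact Real.rpow_nonneg (by linarith [ht.1]) _
  rw [h1]
  refine ENNReal.ofReal_le_ofReal ?_
  rw [intervalIntegral.integral_comp_sub_right (fun x => x ^ (-(1 / 2) : ℝ)),
    integral_rpow (Or.inl (by norm_num)), sub_self, Real.zero_rpow (by norm_num)]
  have : (-(1 / 2) + 1 : ℝ) = 1 / 2 := by norm_num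
  rw [this, ← Real.sqrt_eq_rpow]
  have := Real.sqrt_le_sqrt hT
  linarith

/-- The time that the path spends in `B` after `u` and before `e`. -/
noncomputable def occTime (b : ℝ → Ω → ℝ) (e : ℝ) (B : Set ℝ) (u : ℝ) (ω : Ω) : ℝ≥0∞ :=
  ∫⁻ t in Set.Ioc u e, B.indicator 1 (b t ω)

lemma measurable_occTime (hb : Measurable (Function.uncurry b)) (e : ℝ) {B : Set ℝ}
    (hB : MeasurableSet B) : Measurable (Function.uncurry (occTime b e B)) := by
  have h1 : ∀ z : ℝ × Ω, Function.uncurry (occTime b e B) z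
      = ∫⁻ t, {w : (ℝ × Ω) × ℝ | w.1.1 < w.2 ∧ w.2 ≤ e}.indicator
        (fun w => B.indicator 1 (b w.2 w.1.2)) (z, t) := fun z => by
    rw [Function.uncurry, occTime, ← lintegral_indicator measurableSet_Ioc]
    refine lintegral_congr fun t => ?_
    simp [Set.indicator_apply]
  have h2 : Measurable ({w : (ℝ × Ω) × ℝ | w.1.1 < w.2 ∧ w.2 ≤ e}.indicator
      fun w => B.indicator (1 : ℝ → ℝ≥0∞) (b w.2 w.1.2)) := by
    refine Measurable.indicator ?_ ?_
    · exact (measurable_one.indicator hB).comp (hb.comp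
        (measurable_snd.prodMk (measurable_snd.comp measurable_fst)))
    · exact (measurableSet_lt (measurable_fst.comp measurable_fst) measurable_snd).inter
        (measurableSet_le measurable_snd measurable_const)
  rw [funext h1]
  exact h2.lintegral_prod_right'

lemma occTime_pow_succ (hb : Measurable (Function.uncurry b)) (e : ℝ) {B : Set ℝ}
    (hB : MeasurableSet B) (u : ℝ) (ω : Ω) (n : ℕ) :
    occTime b e B u ω ^ (n + 1)
      = (n + 1) * ∫⁻ t in Set.Ioc u e, B.indicator 1 (b t ω) * occTime b e B t ω ^ n :=
  lintegral_Ioc_pow_succ ((measurable_one.indicator hB).comp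
    (hb.comp (measurable_id.prodMk measurable_const))) u e n

lemma lintegral_mul_occTime_pow_succ [SFinite P] (hb : Measurable (Function.uncurry b)) (e : ℝ)
    {B : Set ℝ} (hB : MeasurableSet B) (u : ℝ) (n : ℕ) {H : Ω → ℝ≥0∞} (hH : Measurable H) :
    ∫⁻ ω, H ω * occTime b e B u ω ^ (n + 1) ∂P = (n + 1) *
      ∫⁻ t in Set.Ioc u e, ∫⁻ ω, (H ω * B.indicator 1 (b t ω)) * occTime b e B t ω ^ n ∂P := by
  have hI : Measurable fun z : Ω × ℝ => B.indicator (1 : ℝ → ℝ≥0∞) (b z.2 z.1) :=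
    (measurable_one.indicator hB).comp (hb.comp measurable_swap)
  have hO : Measurable fun z : Ω × ℝ => occTime b e B z.2 z.1 :=
    (measurable_occTime hb e hB).comp measurable_swap
  have hm : Measurable (Function.uncurry fun (ω : Ω) (t : ℝ) =>
      (H ω * B.indicator 1 (b t ω)) * occTime b e B t ω ^ n) :=
    ((hH.comp measurable_fst).mul hI).mul (hO.pow_const n)
  rw [← lintegral_lintegral_swap hm.aemeasurable, ← lintegral_const_mul' _ _ (by finiteness)]
  refine lintegral_congr fun ω => ?_
  rw [occTime_pow_succ hb e hB, mul_left_comm, ← lintegral_const_mul]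
  · simp only [mul_assoc]
  · exact (hI.comp measurable_prodMk_left).mul ((hO.comp measurable_prodMk_left).pow_const n)

/-- Conditional moments of occupation times. -/
lemma lintegral_mul_occTime_pow_le [SFinite P] (hb : HasTransitionBound P F b) {e T : ℝ}
    {B : Set ℝ} (hB : MeasurableSet B) (n : ℕ) {u : ℝ} (hu : 0 ≤ u) (hue : u ≤ e) (hT : e - u ≤ T)
    {H : Ω → ℝ≥0∞} (hH : Measurable[F u] H) :
    ∫⁻ ω, H ω * occTime b e B u ω ^ n ∂P
      ≤ (n.factorial * (volume B * ENNReal.ofReal (2 * √T)) ^ n) * ∫⁻ ω, H ω ∂P := by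
  induction n generalizing u H with
  | zero => simp
  | succ n ih =>
    rw [lintegral_mul_occTime_pow_succ hb.measurable e hB u n (hH.mono (hb.le u) le_rfl)]
    have hI : ∀ t, Measurable[F t] fun ω => B.indicator (1 : ℝ → ℝ≥0∞) (b t ω) := fun t =>
      (measurable_one.indicator hB).comp (hb.adapted t)
    have h1 : ∀ t ∈ Set.Ioc u e,
        ∫⁻ ω, (H ω * B.indicator 1 (b t ω)) * occTime b e B t ω ^ n ∂P
          ≤ (n.factorial * (volume B * ENNReal.ofReal (2 * √T)) ^ n) * (volume B *
            ∫⁻ ω, H ω ∂P) * ENNReal.ofReal (1 / √(t - u)) := by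
      intro t ht
      refine (ih (hu.trans ht.1.le) ht.2 (by linarith [ht.1])
        ((hH.mono (hb.mono ht.1.le) le_rfl).mul (hI t))).trans ?_
      rw [mul_assoc _ (volume B * _)]
      gcongr
      refine (hb.bound u t hu ht.1 H hH _ (measurable_one.indicator hB)).trans_eq ?_
      rw [lintegral_indicator_one hB]
      ring
    calc _ ≤ ((n : ℝ≥0∞) + 1) * ∫⁻ t in Set.Ioc u e,
          (n.factorial * (volume B * ENNReal.ofReal (2 * √T)) ^ n) * (volume B *
            ∫⁻ ω, H ω ∂P) * ENNReal.ofReal (1 / √(t - u)) := by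
          exact mul_le_mul_right (setLIntegral_mono' measurableSet_Ioc h1) _
      _ = ((n : ℝ≥0∞) + 1) * ((n.factorial * (volume B * ENNReal.ofReal (2 * √T)) ^ n)
          * (volume B * ∫⁻ ω, H ω ∂P)
            * ∫⁻ t in Set.Ioc u e, ENNReal.ofReal (1 / √(t - u))) := by
          rw [lintegral_const_mul _ (by fun_prop)]
      _ ≤ ((n : ℝ≥0∞) + 1) * ((n.factorial * (volume B * ENNReal.ofReal (2 * √T)) ^ n)
          * (volume B * ∫⁻ ω, H ω ∂P) * ENNReal.ofReal (2 * √T)) := by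
          gcongr
          exact lintegral_inv_sqrt_le hT hue
      _ = _ := by
          rw [Nat.factorial_succ, pow_succ]
          push_cast
          ring

/-- Conditional moments of occupation times, summed over a family of sets of bounded overlap. -/
lemma lintegral_mul_tsum_occTime_pow_le [SFinite P] (hb : HasTransitionBound P F b) {e T : ℝ}
    {B : ℤ → Set ℝ} (hB : ∀ z, MeasurableSet (B z)) {m N : ℝ≥0∞} (hm : ∀ z, volume (B z) ≤ m)
    (hN : ∀ x, ∑' z, (B z).indicator 1 x ≤ N) (n : ℕ) {u : ℝ} (hu : 0 ≤ u)
    (hT : e - u ≤ T) {H : Ω → ℝ≥0∞} (hH : Measurable[F u] H) :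
    ∫⁻ ω, H ω * ∑' z, occTime b e (B z) u ω ^ (n + 1) ∂P
      ≤ ((n + 1).factorial * (m * ENNReal.ofReal (2 * √T)) ^ n * N * ENNReal.ofReal T)
        * ∫⁻ ω, H ω ∂P := by
  have hH' : Measurable H := hH.mono (hb.le u) le_rfl
  have hO : ∀ z, Measurable (occTime b e (B z) u) := fun z =>
    (measurable_occTime hb.measurable e (hB z)).comp measurable_prodMk_left
  have hI : ∀ z, Measurable fun w : ℝ × Ω => (B z).indicator (1 : ℝ → ℝ≥0∞) (b w.1 w.2) := fun z =>
    (measurable_one.indicator (hB z)).comp hb.measurable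
  have hI' : ∀ z t, Measurable[F t] fun ω => (B z).indicator (1 : ℝ → ℝ≥0∞) (b t ω) := fun z t =>
    (measurable_one.indicator (hB z)).comp (hb.adapted t)
  have hHO : ∀ z, Measurable fun ω => H ω * occTime b e (B z) u ω ^ (n + 1) := fun z =>
    hH'.mul ((hO z).pow_const _)
  have hHI : ∀ z, Measurable fun w : ℝ × Ω => H w.2 * (B z).indicator 1 (b w.1 w.2) := fun z =>
    (hH'.comp measurable_snd).mul (hI z)
  have hHIt : ∀ z, Measurable fun t => ∫⁻ ω, H ω * (B z).indicator 1 (b t ω) ∂P := fun z =>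
    (hHI z).lintegral_prod_right'
  have hHIω : ∀ z t, Measurable fun ω => H ω * (B z).indicator 1 (b t ω) := fun z t =>
    (hHI z).comp measurable_prodMk_left
  set K : ℝ≥0∞ := n.factorial * (m * ENNReal.ofReal (2 * √T)) ^ n with hK
  have h1 : ∀ z, ∫⁻ ω, H ω * occTime b e (B z) u ω ^ (n + 1) ∂P
      ≤ ((n : ℝ≥0∞) + 1) * K * ∫⁻ t in Set.Ioc u e, ∫⁻ ω, H ω * (B z).indicator 1 (b t ω) ∂P := by
    intro z
    rw [lintegral_mul_occTime_pow_succ hb.measurable e (hB z) u n hH', mul_assoc]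
    gcongr
    rw [← lintegral_const_mul]
    · refine setLIntegral_mono' measurableSet_Ioc fun t ht => ?_
      refine (lintegral_mul_occTime_pow_le hb (hB z) n (hu.trans ht.1.le) ht.2
        (T := T) (by linarith [ht.1])
        ((hH.mono (hb.mono ht.1.le) le_rfl).mul (hI' z t))).trans ?_
      rw [hK]
      gcongr
      · exact hm z
      · exact le_rfl
    · exact hHIt z
  calc _ = ∑' z, ∫⁻ ω, H ω * occTime b e (B z) u ω ^ (n + 1) ∂P := by
        rw [← lintegral_tsum fun z => (hHO z).aemeasurable]
        simp only [ENNReal.tsum_mul_left]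
    _ ≤ ∑' z, ((n : ℝ≥0∞) + 1) * K
          * ∫⁻ t in Set.Ioc u e, ∫⁻ ω, H ω * (B z).indicator 1 (b t ω) ∂P :=
        ENNReal.tsum_le_tsum h1
    _ = ((n : ℝ≥0∞) + 1) * K
          * ∫⁻ t in Set.Ioc u e, ∫⁻ ω, H ω * ∑' z, (B z).indicator 1 (b t ω) ∂P := by
        rw [ENNReal.tsum_mul_left, ← lintegral_tsum fun z => (hHIt z).aemeasurable]
        congr 1
        refine lintegral_congr fun t => ?_
        rw [← lintegral_tsum fun z => (hHIω z t).aemeasurable]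
        simp only [ENNReal.tsum_mul_left]
    _ ≤ ((n : ℝ≥0∞) + 1) * K * ∫⁻ t in Set.Ioc u e, ∫⁻ ω, H ω * N ∂P := by
        gcongr with t ω
        exact hN _
    _ ≤ ((n : ℝ≥0∞) + 1) * K * ((∫⁻ ω, H ω ∂P) * N * ENNReal.ofReal T) := by
        rw [lintegral_mul_const _ hH', lintegral_const, Measure.restrict_apply_univ,
          Real.volume_Ioc]
        gcongr
    _ = _ := by
        rw [hK, Nat.factorial_succ]
        push_cast
        ring

end OccupationMoments

section OccupationSup

/-- Minkowski's inequality for countable sums of functions with values in `[0, ∞]`. -/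
lemma eLpNorm_tsum_le {Z : Type*} [MeasurableSpace Z] {ν : Measure Z} {p : ℝ≥0∞} (hp : 1 ≤ p)
    {F : ℕ → Z → ℝ≥0∞} (hF : ∀ n, Measurable (F n)) :
    eLpNorm (fun z => ∑' j, F j z) p ν ≤ ∑' j, eLpNorm (F j) p ν := by
  have h1 : (fun z => ∑' j, F j z)
      = fun z => liminf (fun n => (∑ j ∈ Finset.range n, F j) z) atTop := by
    funext z
    have := (ENNReal.tendsto_nat_tsum fun j => F j z).liminf_eq
    rw [← this]
    simp only [Finset.sum_apply]
  rw [h1]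
  exact eLpNorm_liminf_le_of_tendsto (F := fun n => ∑ j ∈ Finset.range n, F j)
    (c := fun n => ∑ j ∈ Finset.range n, eLpNorm (F j) p ν)
    (fun n => by
      rw [Finset.sum_fn]
      exact Finset.measurable_sum _ fun i _ => hF i)
    (fun n => eLpNorm_sum_le (fun i _ => (hF i).aestronglyMeasurable) hp)
    (ENNReal.tendsto_nat_tsum _)

lemma eLpNorm_const_mul_le {Z : Type*} [MeasurableSpace Z] {ν : Measure Z} {p : ℝ≥0∞} (hp : p ≠ 0)
    (hpt : p ≠ ∞) (c : ℝ≥0∞) {F : Z → ℝ≥0∞} (hF : Measurable F) :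
    eLpNorm (fun z => c * F z) p ν = c * eLpNorm F p ν := by
  have hp' : 0 < p.toReal := ENNReal.toReal_pos hp hpt
  rw [eLpNorm_ennreal_eq hp hpt, eLpNorm_ennreal_eq hp hpt]
  simp only [ENNReal.mul_rpow_of_nonneg _ _ hp'.le]
  rw [lintegral_const_mul _ (hF.pow_const _), ENNReal.mul_rpow_of_nonneg _ _ (by positivity),
    ← ENNReal.rpow_mul, mul_one_div_cancel hp'.ne', ENNReal.rpow_one]

/-- Dyadic decomposition of the kernel `|x|^(-a)`. -/
lemma abs_rpow_neg_le_tsum {a L : ℝ} (ha : 0 ≤ a) (hL : 0 < L) (x : ℝ) :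
    ENNReal.ofReal |x| ^ (-a) ≤ ENNReal.ofReal L ^ (-a)
      + ∑' j : ℕ, ENNReal.ofReal (L / 2 ^ (j + 1)) ^ (-a)
        * (Metric.ball 0 (L / 2 ^ j)).indicator 1 x := by
  have hanti : ∀ s t : ℝ≥0∞, s ≤ t → t ^ (-a) ≤ s ^ (-a) := fun s t h => by
    rw [ENNReal.rpow_neg, ENNReal.rpow_neg]
    exact ENNReal.inv_le_inv.2 (ENNReal.rpow_le_rpow h ha)
  rcases le_or_gt L |x| with h | h
  · exact (hanti _ _ (ENNReal.ofReal_le_ofReal h)).trans le_self_add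
  refine le_trans ?_ le_add_self
  have hterm : ∀ j : ℕ, |x| < L / 2 ^ j → ENNReal.ofReal (L / 2 ^ (j + 1)) ^ (-a)
        * (Metric.ball 0 (L / 2 ^ j)).indicator 1 x
      = ENNReal.ofReal (L / 2 ^ (j + 1)) ^ (-a) := fun j hj => by
    rw [Set.indicator_of_mem (by simpa using hj), Pi.one_apply, mul_one]
  rcases eq_or_ne x 0 with rfl | hx
  · refine le_of_le_of_eq le_top (Eq.symm ?_)
    refine top_le_iff.1 ?_
    rw [← ENNReal.tsum_const_eq_top_of_ne_zero (α := ℕ)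
      (c := ENNReal.ofReal L ^ (-a)) ?_]
    · refine ENNReal.tsum_le_tsum fun j => ?_
      rw [hterm j (by simp; positivity)]
      refine hanti _ _ (ENNReal.ofReal_le_ofReal ?_)
      exact div_le_self hL.le (one_le_pow₀ (by norm_num))
    · rw [ENNReal.rpow_neg]
      exact ENNReal.inv_ne_zero.2 (ENNReal.rpow_ne_top_of_nonneg ha (by simp))
  · have hx' : 0 < |x| := abs_pos.2 hx
    obtain ⟨j, hj1, hj2⟩ := exists_nat_pow_near (x := L / |x|) (y := 2)
      ((one_le_div hx').2 h.le) (by norm_num)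
    have hj1' : |x| ≤ L / 2 ^ j := by
      rw [le_div_iff₀ hx'] at hj1
      rw [le_div_iff₀ (by positivity)]
      linarith
    have hj2' : L / 2 ^ (j + 1) < |x| := by
      rw [div_lt_iff₀ hx'] at hj2
      rw [div_lt_iff₀ (by positivity)]
      linarith
    rcases hj1'.lt_or_eq with hlt | heq
    · refine le_trans ?_ (ENNReal.le_tsum j)
      rw [hterm j hlt]
      exact hanti _ _ (ENNReal.ofReal_le_ofReal hj2'.le)
    · have hj0 : j ≠ 0 := by
        rintro rfl
        simp at heq
        linarith
      obtain ⟨i, rfl⟩ := Nat.exists_eq_succ_of_ne_zero hj0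
      refine le_trans ?_ (ENNReal.le_tsum i)
      rw [hterm i]
      · rw [heq]
      · rw [heq]
        gcongr
        · norm_num
        · simp

lemma tsum_indicator_ball_le {ε : ℝ} (hε : 0 < ε) (x : ℝ) :
    ∑' z : ℤ, (Metric.ball (ε * z) (2 * ε)).indicator (1 : ℝ → ℝ≥0∞) x ≤ 4 := by
  have hz : ∀ z : ℤ, z ∉ Finset.Icc (⌊x / ε⌋ - 1) (⌊x / ε⌋ + 2) →
      (Metric.ball (ε * z) (2 * ε)).indicator (1 : ℝ → ℝ≥0∞) x = 0 := by
    intro z hz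
    refine Set.indicator_of_notMem (fun hx => hz ?_) _
    rw [Metric.mem_ball, Real.dist_eq, abs_lt] at hx
    have h1 := Int.floor_le (x / ε)
    have h2 := Int.lt_floor_add_one (x / ε)
    rw [le_div_iff₀ hε] at h1
    rw [div_lt_iff₀ hε] at h2
    have h3 : ((⌊x / ε⌋ : ℝ) - 2) < z := by nlinarith
    have h4 : (z : ℝ) < ⌊x / ε⌋ + 3 := by nlinarith
    have h3' : ⌊x / ε⌋ - 2 < z := by exact_mod_cast h3
    have h4' : z < ⌊x / ε⌋ + 3 := by exact_mod_cast h4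
    exact Finset.mem_Icc.2 ⟨by omega, by omega⟩
  rw [tsum_eq_sum hz]
  refine (Finset.sum_le_card_nsmul _ _ 1 fun z _ => ?_).trans ?_
  · exact Set.indicator_le_self' (fun _ _ => zero_le) x
  · rw [Int.card_Icc]
    have : (⌊x / ε⌋ + 2 + 1 - (⌊x / ε⌋ - 1)).toNat = 4 := by
      have : ⌊x / ε⌋ + 2 + 1 - (⌊x / ε⌋ - 1) = 4 := by ring
      rw [this]; rfl
    rw [this]; norm_num

lemma exists_ball_subset {ε : ℝ} (hε : 0 < ε) (y : ℝ) :
    ∃ z : ℤ, Metric.ball y ε ⊆ Metric.ball (ε * z) (2 * ε) := by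
  refine ⟨⌊y / ε⌋, Metric.ball_subset_ball' ?_⟩
  have h1 := Int.floor_le (y / ε)
  have h2 := Int.lt_floor_add_one (y / ε)
  rw [le_div_iff₀ hε] at h1
  rw [div_lt_iff₀ hε] at h2
  have : dist y (ε * ⌊y / ε⌋) ≤ ε := by
    rw [Real.dist_eq, abs_le]
    constructor <;> nlinarith
  linarith

variable {Ω : Type*} {mΩ : MeasurableSpace Ω} {P : Measure Ω} {F : ℝ → MeasurableSpace Ω}
  {b : ℝ → Ω → ℝ}

/-- Moments of occupation times at scale `ε`, summed over space. -/
noncomputable def occSum (b : ℝ → Ω → ℝ) (e : ℝ) (N : ℕ) (ε : ℝ) (u : ℝ) (ω : Ω) : ℝ≥0∞ :=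
  ∑' z : ℤ, occTime b e (Metric.ball (ε * z) (2 * ε)) u ω ^ (N + 1)

/-- An upper bound, with good moments, for `sup_y ∫_u^e |b t - y|^(-a) dt`. -/
noncomputable def occSup (b : ℝ → Ω → ℝ) (e T a : ℝ) (N : ℕ) (u : ℝ) (ω : Ω) : ℝ≥0∞ :=
  ENNReal.ofReal T * ENNReal.ofReal √T ^ (-a) + ∑' j : ℕ, ENNReal.ofReal (√T / 2 ^ (j + 1)) ^ (-a)
    * occSum b e N (√T / 2 ^ j) u ω ^ (1 / ((N : ℝ) + 1))

lemma measurable_occSum (hb : Measurable (Function.uncurry b)) (e : ℝ) (N : ℕ) (ε : ℝ) :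
    Measurable (Function.uncurry (occSum b e N ε)) :=
  Measurable.tsum fun _ => (measurable_occTime hb e measurableSet_ball).pow_const _

lemma measurable_occSup (hb : Measurable (Function.uncurry b)) (e T a : ℝ) (N : ℕ) :
    Measurable (Function.uncurry (occSup b e T a N)) :=
  measurable_const.add (Measurable.tsum fun _ =>
    ((measurable_occSum hb e N _).pow_const _).const_mul _)

lemma occTime_ball_le (b : ℝ → Ω → ℝ) (e : ℝ) (N : ℕ) {ε : ℝ} (hε : 0 < ε) (u : ℝ) (ω : Ω)
    (y : ℝ) : occTime b e (Metric.ball y ε) u ω ≤ occSum b e N ε u ω ^ (1 / ((N : ℝ) + 1)) := by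
  obtain ⟨z, hz⟩ := exists_ball_subset hε y
  have h1 : occTime b e (Metric.ball y ε) u ω ≤ occTime b e (Metric.ball (ε * z) (2 * ε)) u ω := by
    refine lintegral_mono fun t => ?_
    exact Set.indicator_le_indicator_of_subset hz (fun _ => zero_le) _
  have h2 : occTime b e (Metric.ball y ε) u ω ^ ((N : ℝ) + 1) ≤ occSum b e N ε u ω := by
    refine le_trans ?_ (ENNReal.le_tsum z)
    rw [← ENNReal.rpow_natCast]
    push_cast
    exact ENNReal.rpow_le_rpow h1 (by positivity)
  rw [one_div]
  exact (ENNReal.le_rpow_inv_iff (by positivity)).2 h2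

lemma lintegral_kernel_le_occSup (hb : Measurable (Function.uncurry b)) {e T a : ℝ} (ha : 0 ≤ a)
    (hT : 0 < T) (N : ℕ) {u : ℝ} (hu : e - u ≤ T) (ω : Ω) (y : ℝ) :
    ∫⁻ t in Set.Ioc u e, ENNReal.ofReal |b t ω - y| ^ (-a) ≤ occSup b e T a N u ω := by
  have hL : 0 < √T := Real.sqrt_pos.2 hT
  have hbω : Measurable fun t => b t ω := hb.comp (measurable_id.prodMk measurable_const)
  have hm : ∀ j : ℕ, Measurable fun t => (Metric.ball (0 : ℝ) (√T / 2 ^ j)).indicator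
      (1 : ℝ → ℝ≥0∞) (b t ω - y) := fun j =>
    (measurable_one.indicator measurableSet_ball).comp (hbω.sub_const y)
  calc _ ≤ ∫⁻ t in Set.Ioc u e, (ENNReal.ofReal √T ^ (-a)
        + ∑' j : ℕ, ENNReal.ofReal (√T / 2 ^ (j + 1)) ^ (-a)
          * (Metric.ball 0 (√T / 2 ^ j)).indicator 1 (b t ω - y)) :=
        lintegral_mono fun t => abs_rpow_neg_le_tsum ha hL _
    _ = ENNReal.ofReal √T ^ (-a) * ENNReal.ofReal (e - u)
        + ∑' j : ℕ, ENNReal.ofReal (√T / 2 ^ (j + 1)) ^ (-a)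
          * ∫⁻ t in Set.Ioc u e, (Metric.ball 0 (√T / 2 ^ j)).indicator 1 (b t ω - y) := by
        rw [lintegral_add_left measurable_const, lintegral_const, Measure.restrict_apply_univ,
          Real.volume_Ioc, lintegral_tsum fun j => ((hm j).const_mul _).aemeasurable]
        congr 2
        funext j
        rw [lintegral_const_mul _ (hm j)]
    _ ≤ _ := by
        rw [occSup, mul_comm (ENNReal.ofReal √T ^ (-a))]
        gcongr with j
        refine le_trans (le_of_eq ?_) (occTime_ball_le b e N (by positivity) u ω y)
        rw [occTime]
        refine lintegral_congr fun t => ?_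
        by_cases h : b t ω ∈ Metric.ball y (√T / 2 ^ j)
        · rw [Set.indicator_of_mem h, Set.indicator_of_mem (by simpa [Real.dist_eq] using h)]
          rfl
        · rw [Set.indicator_of_notMem h, Set.indicator_of_notMem (by simpa [Real.dist_eq] using h)]

/-- The constant in the moment bound for `occSup`. -/
noncomputable def occConst (a : ℝ) (N : ℕ) : ℝ≥0∞ :=
  1 + ∑' j : ℕ, ENNReal.ofReal (8 * ((N + 1).factorial : ℝ) ^ (1 / ((N : ℝ) + 1))
    * 2 ^ (a * (j + 1)) * 2 ^ (-(j * (N / ((N : ℝ) + 1)))))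

lemma occConst_ne_top {a : ℝ} {N : ℕ} (haN : a * (N + 1) < N) : occConst a N ≠ ∞ := by
  refine ENNReal.add_ne_top.2 ⟨by simp, ?_⟩
  have hN : (0 : ℝ) < (N : ℝ) + 1 := by positivity
  have hneg : a - N / ((N : ℝ) + 1) < 0 := by
    rw [sub_neg, lt_div_iff₀ hN]; exact haN
  have h1 : (2 : ℝ) ^ (a - N / ((N : ℝ) + 1)) < 1 :=
    Real.rpow_lt_one_of_one_lt_of_neg (by norm_num) hneg
  have hs : Summable fun j : ℕ => 8 * ((N + 1).factorial : ℝ) ^ (1 / ((N : ℝ) + 1))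
      * 2 ^ (a * (j + 1)) * 2 ^ (-(j * (N / ((N : ℝ) + 1)))) := by
    have h2 := (summable_geometric_of_lt_one (by positivity) h1).mul_left
      (8 * ((N + 1).factorial : ℝ) ^ (1 / ((N : ℝ) + 1)) * 2 ^ a)
    refine h2.congr fun j => ?_
    rw [← Real.rpow_natCast, ← Real.rpow_mul (by norm_num), mul_assoc, mul_assoc, mul_assoc,
      mul_assoc, ← Real.rpow_add (by norm_num), ← Real.rpow_add (by norm_num)]
    congr 3
    ring
  rw [← ENNReal.ofReal_tsum_of_nonneg (fun j => by positivity) hs]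
  exact ENNReal.ofReal_ne_top

lemma occ_term_le {T a : ℝ} (hT : 0 < T) (N j : ℕ) :
    (√T / 2 ^ (j + 1)) ^ (-a) * (((N + 1).factorial : ℝ) * ((2 * (2 * (√T / 2 ^ j))) * (2 * √T)) ^ N
        * 4 * T) ^ (1 / ((N : ℝ) + 1))
      ≤ (8 * ((N + 1).factorial : ℝ) ^ (1 / ((N : ℝ) + 1))
        * 2 ^ (a * (j + 1)) * 2 ^ (-(j * (N / ((N : ℝ) + 1))))) * T ^ (1 - a / 2) := by
  have hN : (0 : ℝ) < (N : ℝ) + 1 := by positivity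
  have hsq : √T * √T = T := Real.mul_self_sqrt hT.le
  have hsT : 0 < √T := Real.sqrt_pos.2 hT
  have h1 : (√T / 2 ^ (j + 1)) ^ (-a) = T ^ (-(a / 2)) * 2 ^ (a * (j + 1)) := by
    rw [Real.div_rpow hsT.le (by positivity), Real.sqrt_eq_rpow, ← Real.rpow_mul hT.le,
      ← Real.rpow_natCast, ← Real.rpow_mul (by norm_num), div_eq_mul_inv,
      ← Real.rpow_neg (by norm_num)]
    push_cast
    congr 2 <;> ring
  have h2 : ((N + 1).factorial : ℝ) * ((2 * (2 * (√T / 2 ^ j))) * (2 * √T)) ^ N * 4 * T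
      ≤ ((N + 1).factorial : ℝ) * (8 * T) ^ ((N : ℝ) + 1) * 2 ^ (-((j : ℝ) * N)) := by
    have e1 : (2 * (2 * (√T / 2 ^ j))) * (2 * √T) = 8 * T * ((2 : ℝ) ^ j)⁻¹ := by
      field_simp
      nlinarith
    have e2 : (((2 : ℝ) ^ j)⁻¹) ^ N = 2 ^ (-((j : ℝ) * N)) := by
      rw [Real.rpow_neg (by norm_num), inv_pow, ← pow_mul, ← Nat.cast_mul, Real.rpow_natCast]
    have e3 : (8 * T) ^ ((N : ℝ) + 1) = (8 * T) ^ N * (8 * T) := by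
      rw [Real.rpow_add_one (by positivity), Real.rpow_natCast]
    rw [e1, mul_pow, e2, e3]
    have : 0 ≤ ((N + 1).factorial : ℝ) * (8 * T) ^ N * 2 ^ (-((j : ℝ) * N)) * T := by positivity
    nlinarith
  have h3 : (((N + 1).factorial : ℝ) * (8 * T) ^ ((N : ℝ) + 1) * 2 ^ (-((j : ℝ) * N)))
        ^ (1 / ((N : ℝ) + 1))
      = ((N + 1).factorial : ℝ) ^ (1 / ((N : ℝ) + 1)) * (8 * T)
        * 2 ^ (-(j * (N / ((N : ℝ) + 1)))) := by
    rw [Real.mul_rpow (by positivity) (by positivity), Real.mul_rpow (by positivity)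
      (by positivity), ← Real.rpow_mul (by positivity), ← Real.rpow_mul (by positivity),
      mul_one_div_cancel hN.ne', Real.rpow_one]
    congr 2
    ring
  have h4 : T ^ (1 - a / 2) = T * T ^ (-(a / 2)) := by
    rw [sub_eq_add_neg, Real.rpow_add hT, Real.rpow_one]
  calc _ ≤ T ^ (-(a / 2)) * 2 ^ (a * (j + 1)) * ((((N + 1).factorial : ℝ)
        * (8 * T) ^ ((N : ℝ) + 1) * 2 ^ (-((j : ℝ) * N))) ^ (1 / ((N : ℝ) + 1))) := by
        rw [h1]
        gcongr
    _ = _ := by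
        rw [h3, h4]; ring

lemma eLpNorm_occSum_rpow_le [SFinite P] (hb : HasTransitionBound P F b) {e T a : ℝ}
    (hT : 0 < T) (N j : ℕ) {u : ℝ} (hu : 0 ≤ u) (huT : e - u ≤ T) {H : Ω → ℝ≥0∞}
    (hH : Measurable[F u] H) {n : ℝ≥0∞} (hn0 : n ≠ 0) (hnt : n ≠ ∞)
    (hnR : n.toReal = (N : ℝ) + 1) :
    eLpNorm (fun ω => ENNReal.ofReal (√T / 2 ^ (j + 1)) ^ (-a)
        * occSum b e N (√T / 2 ^ j) u ω ^ (1 / ((N : ℝ) + 1))) n (P.withDensity H)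
      ≤ ENNReal.ofReal (8 * ((N + 1).factorial : ℝ) ^ (1 / ((N : ℝ) + 1))
        * 2 ^ (a * (j + 1)) * 2 ^ (-(j * (N / ((N : ℝ) + 1)))))
        * (ENNReal.ofReal (T ^ (1 - a / 2)) * (∫⁻ ω, H ω ∂P) ^ (1 / ((N : ℝ) + 1))) := by
  have hH' : Measurable H := hH.mono (hb.le u) le_rfl
  have hN : (0 : ℝ) < (N : ℝ) + 1 := by positivity
  have hL : 0 < √T := Real.sqrt_pos.2 hT
  have hε : 0 < √T / 2 ^ j := by positivity
  have hOS : Measurable fun ω => occSum b e N (√T / 2 ^ j) u ω :=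
    (measurable_occSum hb.measurable e N _).comp measurable_prodMk_left
  rw [eLpNorm_const_mul_le hn0 hnt _ (hOS.pow_const _), eLpNorm_ennreal_eq hn0 hnt, hnR]
  have h1 : ∫⁻ ω, (occSum b e N (√T / 2 ^ j) u ω ^ (1 / ((N : ℝ) + 1))) ^ ((N : ℝ) + 1)
        ∂(P.withDensity H)
      = ∫⁻ ω, H ω * occSum b e N (√T / 2 ^ j) u ω ∂P := by
    simp only [← ENNReal.rpow_mul, one_div_mul_cancel hN.ne', ENNReal.rpow_one]
    rw [lintegral_withDensity_eq_lintegral_mul _ hH' hOS]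
    rfl
  rw [h1]
  have h2 := lintegral_mul_tsum_occTime_pow_le hb (e := e) (T := T)
    (B := fun z : ℤ => Metric.ball (√T / 2 ^ j * z) (2 * (√T / 2 ^ j)))
    (fun z => measurableSet_ball) (m := ENNReal.ofReal (2 * (2 * (√T / 2 ^ j))))
    (fun z => (Real.volume_ball _ _).le) (tsum_indicator_ball_le hε) N hu huT hH
  have h4 := occ_term_le (a := a) hT N j
  generalize (N + 1).factorial = f at h2 h4 ⊢
  rcases Nat.eq_zero_or_pos f with rfl | hf
  · have h20 : ∫⁻ ω, H ω * occSum b e N (√T / 2 ^ j) u ω ∂P = 0 := by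
      refine le_antisymm (h2.trans_eq (by simp)) zero_le
    rw [h20, ENNReal.zero_rpow_of_pos (by positivity), mul_zero]
    exact zero_le
  set X : ℝ := (2 * (2 * (√T / 2 ^ j))) * (2 * √T) with hX
  have hXp : 0 < X := by positivity
  have hfp : (0 : ℝ) < f := by exact_mod_cast hf
  have h3 : ((f : ℝ≥0∞) * (ENNReal.ofReal (2 * (2 * (√T / 2 ^ j)))
        * ENNReal.ofReal (2 * √T)) ^ N * 4 * ENNReal.ofReal T)
      = ENNReal.ofReal ((f : ℝ) * X ^ N * 4 * T) := by
    have e4 : (4 : ℝ≥0∞) = ENNReal.ofReal 4 := by simp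
    rw [e4, ← ENNReal.ofReal_natCast, ← ENNReal.ofReal_mul (by positivity), ← hX,
      ← ENNReal.ofReal_pow hXp.le, ← ENNReal.ofReal_mul (by positivity),
      ← ENNReal.ofReal_mul (by positivity), ← ENNReal.ofReal_mul (by positivity)]
  rw [h3] at h2
  generalize (∫⁻ ω, H ω ∂P) = W at h2 ⊢
  calc _ ≤ ENNReal.ofReal (√T / 2 ^ (j + 1)) ^ (-a)
        * (ENNReal.ofReal ((f : ℝ) * X ^ N * 4 * T) * W) ^ (1 / ((N : ℝ) + 1)) := by
        gcongr
        exact h2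
    _ = ENNReal.ofReal ((√T / 2 ^ (j + 1)) ^ (-a)
        * ((f : ℝ) * X ^ N * 4 * T) ^ (1 / ((N : ℝ) + 1))) * W ^ (1 / ((N : ℝ) + 1)) := by
        rw [ENNReal.mul_rpow_of_nonneg _ _ (by positivity),
          ENNReal.ofReal_rpow_of_pos (by positivity), ENNReal.ofReal_rpow_of_pos (by positivity),
          ENNReal.ofReal_mul (by positivity)]
        exact (mul_assoc _ _ _).symm
    _ ≤ ENNReal.ofReal ((8 * (f : ℝ) ^ (1 / ((N : ℝ) + 1)) * 2 ^ (a * (j + 1))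
          * 2 ^ (-(j * (N / ((N : ℝ) + 1))))) * T ^ (1 - a / 2)) * W ^ (1 / ((N : ℝ) + 1)) := by
        gcongr
    _ = _ := by
        rw [ENNReal.ofReal_mul (by positivity)]
        exact mul_assoc _ _ _

lemma eLpNorm_occSup_le [SFinite P] (hb : HasTransitionBound P F b) {e T a : ℝ}
    (hT : 0 < T) (N : ℕ) {u : ℝ} (hu : 0 ≤ u) (huT : e - u ≤ T) {H : Ω → ℝ≥0∞}
    (hH : Measurable[F u] H) {n : ℝ≥0∞} (hn0 : n ≠ 0) (hnt : n ≠ ∞) (hn1 : 1 ≤ n)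
    (hnR : n.toReal = (N : ℝ) + 1) :
    eLpNorm (occSup b e T a N u) n (P.withDensity H)
      ≤ occConst a N * (ENNReal.ofReal (T ^ (1 - a / 2))
        * (∫⁻ ω, H ω ∂P) ^ (1 / ((N : ℝ) + 1))) := by
  have hN : (0 : ℝ) < (N : ℝ) + 1 := by positivity
  have hL : 0 < √T := Real.sqrt_pos.2 hT
  have hOSp : ∀ j : ℕ, Measurable fun ω => ENNReal.ofReal (√T / 2 ^ (j + 1)) ^ (-a)
      * occSum b e N (√T / 2 ^ j) u ω ^ (1 / ((N : ℝ) + 1)) := fun j =>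
    (((measurable_occSum hb.measurable e N _).comp measurable_prodMk_left).pow_const _).const_mul _
  have hfirst : eLpNorm (fun _ : Ω => ENNReal.ofReal T * ENNReal.ofReal √T ^ (-a)) n
        (P.withDensity H)
      = ENNReal.ofReal (T ^ (1 - a / 2)) * (∫⁻ ω, H ω ∂P) ^ (1 / ((N : ℝ) + 1)) := by
    rw [eLpNorm_ennreal_eq hn0 hnt, hnR, lintegral_const,
      ENNReal.mul_rpow_of_nonneg _ _ (by positivity), ← ENNReal.rpow_mul,
      mul_one_div_cancel hN.ne', ENNReal.rpow_one, ENNReal.ofReal_rpow_of_pos hL,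
      ← ENNReal.ofReal_mul hT.le, Real.sqrt_eq_rpow, ← Real.rpow_mul hT.le,
      withDensity_apply _ MeasurableSet.univ, Measure.restrict_univ]
    nth_rewrite 1 [← Real.rpow_one T]
    rw [← Real.rpow_add hT]
    congr 3
    ring
  have hsplit : occSup b e T a N u
      = (fun _ : Ω => ENNReal.ofReal T * ENNReal.ofReal √T ^ (-a))
        + fun ω => ∑' j : ℕ, ENNReal.ofReal (√T / 2 ^ (j + 1)) ^ (-a)
          * occSum b e N (√T / 2 ^ j) u ω ^ (1 / ((N : ℝ) + 1)) := rfl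
  have hms : Measurable fun ω => ∑' j : ℕ, ENNReal.ofReal (√T / 2 ^ (j + 1)) ^ (-a)
      * occSum b e N (√T / 2 ^ j) u ω ^ (1 / ((N : ℝ) + 1)) :=
    Measurable.tsum hOSp
  rw [hsplit]
  refine (eLpNorm_add_le aestronglyMeasurable_const hms.aestronglyMeasurable hn1).trans ?_
  rw [hfirst, occConst, add_mul, one_mul, ← ENNReal.tsum_mul_right]
  gcongr
  exact (eLpNorm_tsum_le hn1 hOSp).trans
    (ENNReal.tsum_le_tsum fun j => eLpNorm_occSum_rpow_le hb hT N j hu huT hH hn0 hnt hnR)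

/-- Conditional moments of `occSup`. -/
lemma lintegral_mul_occSup_pow_le [SFinite P] (hb : HasTransitionBound P F b) {e T a : ℝ}
    (hT : 0 < T) (N : ℕ) {u : ℝ} (hu : 0 ≤ u) (huT : e - u ≤ T) {H : Ω → ℝ≥0∞}
    (hH : Measurable[F u] H) :
    ∫⁻ ω, H ω * occSup b e T a N u ω ^ (N + 1) ∂P
      ≤ (occConst a N * ENNReal.ofReal (T ^ (1 - a / 2))) ^ (N + 1) * ∫⁻ ω, H ω ∂P := by
  have hH' : Measurable H := hH.mono (hb.le u) le_rfl
  have hN : (0 : ℝ) < (N : ℝ) + 1 := by positivity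
  obtain ⟨n, hn⟩ : ∃ n : ℝ≥0∞, n = ((N + 1 : ℕ) : ℝ≥0∞) := ⟨_, rfl⟩
  have hn0 : n ≠ 0 := by rw [hn]; exact Nat.cast_ne_zero.2 (Nat.succ_ne_zero N)
  have hnt : n ≠ ∞ := by rw [hn]; exact ENNReal.natCast_ne_top _
  have hn1 : 1 ≤ n := by rw [hn]; exact Nat.one_le_cast.2 (Nat.le_add_left 1 N)
  have hnR : n.toReal = (N : ℝ) + 1 := by
    rw [hn, ENNReal.toReal_natCast]; push_cast; rfl
  have hSm : Measurable (occSup b e T a N u) :=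
    (measurable_occSup hb.measurable e T a N).of_uncurry_left
  have htot := eLpNorm_occSup_le hb (a := a) hT N hu huT hH hn0 hnt hn1 hnR
  rw [eLpNorm_ennreal_eq hn0 hnt, hnR, ← mul_assoc] at htot
  have hfin := ENNReal.rpow_le_rpow htot hN.le
  rw [← ENNReal.rpow_mul, one_div_mul_cancel hN.ne', ENNReal.rpow_one,
    ENNReal.mul_rpow_of_nonneg _ _ hN.le, ← ENNReal.rpow_mul, one_div_mul_cancel hN.ne',
    ENNReal.rpow_one] at hfin
  have hc : ∀ x : ℝ≥0∞, x ^ ((N : ℝ) + 1) = x ^ (N + 1) := fun x => by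
    rw [← ENNReal.rpow_natCast]; push_cast; rfl
  simp only [hc] at hfin
  refine le_trans (le_of_eq ?_) hfin
  rw [lintegral_withDensity_eq_lintegral_mul _ hH' (hSm.pow_const _)]
  simp only [Pi.mul_apply]

end OccupationSup

section Brownian

variable {Ω : Type*} {mΩ : MeasurableSpace Ω} {P : Measure Ω} {ℱ : Filtration ℝ≥0 mΩ}
  {β : ℝ≥0 → Ω → ℝ}

lemma lintegral_gaussianReal_le {v : ℝ≥0} (hv : v ≠ 0) {φ : ℝ → ℝ≥0∞} (hφ : Measurable φ)
    (x : ℝ) : ∫⁻ d, φ (x + d) ∂(gaussianReal 0 v) ≤ ENNReal.ofReal (1 / √v) * ∫⁻ y, φ y := by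
  have hm : Measurable fun d => φ (x + d) := hφ.comp (measurable_const_add x)
  rw [gaussianReal_of_var_ne_zero 0 hv,
    lintegral_withDensity_eq_lintegral_mul _ (measurable_gaussianPDF 0 v) hm]
  have hle : ∀ d, gaussianPDF 0 v d ≤ ENNReal.ofReal (1 / √v) := fun d => by
    refine ENNReal.ofReal_le_ofReal ?_
    rw [gaussianPDFReal]
    have hv' : (0 : ℝ) < v := by positivity
    have h1 : Real.exp (-(d - 0) ^ 2 / (2 * (v : ℝ))) ≤ 1 :=
      Real.exp_le_one_iff.2 (div_nonpos_of_nonpos_of_nonneg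
        (neg_nonpos.2 (sq_nonneg _)) (by positivity))
    have h2 : (√(2 * Real.pi * v))⁻¹ ≤ 1 / √v := by
      rw [one_div]
      refine inv_anti₀ (Real.sqrt_pos.2 hv') (Real.sqrt_le_sqrt ?_)
      nlinarith [Real.pi_gt_three]
    calc _ ≤ (√(2 * Real.pi * v))⁻¹ * 1 := by gcongr
      _ ≤ _ := by rw [mul_one]; exact h2
  calc _ ≤ ∫⁻ d, ENNReal.ofReal (1 / √v) * φ (x + d) :=
        lintegral_mono fun d => mul_le_mul_left (hle d) _
    _ = _ := by rw [lintegral_const_mul _ hm, lintegral_add_left_eq_self]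

lemma IsFilteredBrownian.lintegral_mul_comp_le [IsProbabilityMeasure P]
    (hβ : IsFilteredBrownian ℱ P β) {u t : ℝ≥0} (hut : u < t) {H : Ω → ℝ≥0∞}
    (hH : Measurable[ℱ u] H) {φ : ℝ → ℝ≥0∞} (hφ : Measurable φ) :
    ∫⁻ ω, H ω * φ (β t ω) ∂P
      ≤ ENNReal.ofReal (1 / √((t : ℝ) - u)) * (∫⁻ x, φ x) * ∫⁻ ω, H ω ∂P := by
  let D : Ω → ℝ := fun ω => β t ω - β u ω
  let W : Ω → ℝ≥0∞ × ℝ := fun ω => (H ω, β u ω)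
  have hW' : Measurable[ℱ u] W := hH.prodMk (hβ.adapted u)
  have hW : Measurable W := hW'.mono (ℱ.le u) le_rfl
  have hDm : Measurable D := ((hβ.adapted t).mono (ℱ.le t) le_rfl).sub
    ((hβ.adapted u).mono (ℱ.le u) le_rfl)
  have hind : IndepFun W D P := by
    refine IndepFun.symm ?_
    rw [IndepFun_iff_Indep]
    exact indep_of_indep_of_le_right (hβ.indep u t hut.le) hW'.comap_le
  have hlaw : Measure.map D P = gaussianReal 0 (nndist (t : ℝ) u) :=
    (hβ.brownian.toIsPreBrownianReal.hasLaw_sub t u).map_eq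
  have hv : ((nndist (t : ℝ) u : ℝ≥0) : ℝ) = (t : ℝ) - u := by
    rw [coe_nndist, Real.dist_eq, abs_of_pos (sub_pos.2 (NNReal.coe_lt_coe.2 hut))]
  have hv0 : nndist (t : ℝ) u ≠ 0 := by
    rw [Ne, nndist_eq_zero]
    exact fun h => hut.ne' (NNReal.coe_injective h)
  have hmap := (indepFun_iff_map_prod_eq_prod_map_map hW.aemeasurable hDm.aemeasurable).1 hind
  have hg : Measurable fun z : (ℝ≥0∞ × ℝ) × ℝ => z.1.1 * φ (z.1.2 + z.2) :=
    (measurable_fst.comp measurable_fst).mul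
      (hφ.comp ((measurable_snd.comp measurable_fst).add measurable_snd))
  have hP1 : IsProbabilityMeasure (Measure.map D P) := Measure.isProbabilityMeasure_map hDm.aemeasurable
  calc ∫⁻ ω, H ω * φ (β t ω) ∂P
      = ∫⁻ z, z.1.1 * φ (z.1.2 + z.2) ∂(Measure.map (fun ω => (W ω, D ω)) P) := by
        rw [lintegral_map hg (hW.prodMk hDm)]
        refine lintegral_congr fun ω => ?_
        simp only [W, D, add_sub_cancel]
    _ = ∫⁻ w, ∫⁻ d, w.1 * φ (w.2 + d) ∂(Measure.map D P) ∂(Measure.map W P) := by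
        rw [hmap, lintegral_prod _ hg.aemeasurable]
    _ ≤ ∫⁻ w, w.1 * (ENNReal.ofReal (1 / √((t : ℝ) - u)) * ∫⁻ x, φ x) ∂(Measure.map W P) := by
        refine lintegral_mono fun w => ?_
        have hm : Measurable fun d => φ (w.2 + d) := hφ.comp (measurable_const_add _)
        rw [lintegral_const_mul _ hm, hlaw]
        refine mul_le_mul_right ?_ _
        refine (lintegral_gaussianReal_le hv0 hφ _).trans_eq ?_
        rw [hv]
    _ = _ := by
        rw [lintegral_mul_const _ measurable_fst, lintegral_map measurable_fst hW, mul_comm]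

lemma IsFilteredBrownian.hasTransitionBound [IsProbabilityMeasure P]
    (hβ : IsFilteredBrownian ℱ P β) (hc : ∀ ω, Continuous fun t => β t ω) :
    HasTransitionBound P (fun t => ℱ t.toNNReal) fun t ω => β t.toNNReal ω where
  le t := ℱ.le _
  mono := fun s t hst => ℱ.mono (Real.toNNReal_le_toNNReal hst)
  measurable := by
    have h : Measurable (Function.uncurry fun (ω : Ω) (t : ℝ≥0) => β t ω) :=
      measurable_uncurry_of_continuous_of_measurable (u := fun (t : ℝ≥0) ω => β t ω) hc
        (fun t => (hβ.adapted t).mono (ℱ.le t) le_rfl) |>.comp measurable_swap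
    exact h.comp (measurable_snd.prodMk (measurable_real_toNNReal.comp measurable_fst))
  adapted t := hβ.adapted _
  bound u t hu hut H hH φ hφ := by
    have h1 : u.toNNReal < t.toNNReal := (Real.toNNReal_lt_toNNReal_iff (hu.trans_lt hut)).2 hut
    have := hβ.lintegral_mul_comp_le h1 hH hφ
    rwa [Real.coe_toNNReal _ hu, Real.coe_toNNReal _ (hu.trans hut.le)] at this

lemma indep_comap_congr {m : MeasurableSpace Ω} {f g : Ω → ℝ}
    (h : Indep (MeasurableSpace.comap f inferInstance) m P) (hfg : f =ᵐ[P] g) :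
    Indep (MeasurableSpace.comap g inferInstance) m P := by
  have h1 := @IndepFun_iff_Indep Ω ℝ Ω mΩ _ m f id P
  have h2 := @IndepFun_iff_Indep Ω ℝ Ω mΩ _ m g id P
  rw [MeasurableSpace.comap_id] at h1 h2
  exact h2.1 ((h1.2 h).congr hfg EventuallyEq.rfl)

/-- A Brownian motion has a version with continuous paths, adapted to the same filtration. -/
lemma IsFilteredBrownian.exists_continuous (hℱ : UsualHypotheses ℱ P)
    (hβ : IsFilteredBrownian ℱ P β) :
    ∃ β' : ℝ≥0 → Ω → ℝ, IsFilteredBrownian ℱ P β' ∧ (∀ ω, Continuous fun t => β' t ω) ∧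
      ∀ᵐ ω ∂P, ∀ t, β t ω = β' t ω := by
  classical
  let S : Set Ω := {ω | Continuous fun t => β t ω}
  have hS : P Sᶜ = 0 := hβ.brownian.cont
  have hSm : ∀ t, MeasurableSet[ℱ t] S := fun t => by
    have := (hℱ.complete _ hS).compl
    rw [compl_compl] at this
    exact ℱ.mono (zero_le (a := t)) _ this
  let β' : ℝ≥0 → Ω → ℝ := fun t => S.indicator (β t)
  have hae : ∀ᵐ ω ∂P, ∀ t, β t ω = β' t ω := by
    filter_upwards [hβ.brownian.cont] with ω hω t
    exact (Set.indicator_of_mem (show ω ∈ S from hω) _).symm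
  refine ⟨β', ⟨?_, fun t => (hβ.adapted t).indicator (hSm t), fun s t hst => ?_⟩, fun ω => ?_, hae⟩
  · refine { hasLaw := fun I => ?_, cont := ?_ }
    · refine (hβ.brownian.hasLaw I).congr ?_
      filter_upwards [hae] with ω hω
      funext i
      exact (hω i).symm
    · filter_upwards [hβ.brownian.cont, hae] with ω hω h
      simpa only [← h] using hω
  · refine indep_comap_congr (hβ.indep s t hst) ?_
    filter_upwards [hae] with ω hω
    rw [hω, hω]
  · by_cases h : ω ∈ S
    · have : (fun t => β' t ω) = fun t => β t ω := funext fun t => Set.indicator_of_mem h _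
      rw [this]; exact h
    · have : (fun t => β' t ω) = fun _ => 0 := funext fun t => Set.indicator_of_notMem h _
      rw [this]; exact continuous_const

end Brownian

section DyadicLevels

lemma tsum_sqrt_div_le {B : ℝ≥0∞} (hB0 : B ≠ 0) (hB : B ≠ ∞) :
    ∑' k : ℤ, {k : ℤ | (2 : ℝ≥0∞) ^ k < B}.indicator
      (fun k => ((2 : ℝ≥0∞) ^ k / B) ^ (1 / 2 : ℝ)) k ≤ 4 := by
  obtain ⟨m, hm1, hm2⟩ := ENNReal.exists_mem_Ioc_zpow hB0 hB (y := 2) (by norm_num) (by norm_num)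
  let g : ℤ → ℝ≥0∞ := {k : ℤ | (2 : ℝ≥0∞) ^ k < B}.indicator
    (fun k => ((2 : ℝ≥0∞) ^ k / B) ^ (1 / 2 : ℝ))
  have hinj : Function.Injective fun l : ℕ => m - (l : ℤ) := fun a b h => by
    simpa using h
  have hsupp : Function.support g ⊆ Set.range fun l : ℕ => m - (l : ℤ) := by
    intro k hk
    have hk' : k ∈ {k : ℤ | (2 : ℝ≥0∞) ^ k < B} := Set.support_indicator_subset hk
    replace hk' : (2 : ℝ≥0∞) ^ k < B := hk'
    have hkm : k < m + 1 := by
      by_contra hcon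
      push Not at hcon
      exact absurd (hk'.trans_le hm2)
        (not_lt.2 (ENNReal.zpow_le_of_le (by norm_num) hcon))
    refine ⟨(m - k).toNat, ?_⟩
    simp only
    rw [Int.toNat_of_nonneg (by omega)]
    ring
  have hr : ((2 : ℝ≥0∞)⁻¹) ^ (1 / 2 : ℝ) ≤ ENNReal.ofReal (3 / 4) := by
    have h1 : (2 : ℝ≥0∞)⁻¹ ≤ ENNReal.ofReal (3 / 4) ^ (2 : ℝ) := by
      rw [ENNReal.ofReal_rpow_of_pos (by norm_num)]
      have : (2 : ℝ≥0∞)⁻¹ = ENNReal.ofReal (1 / 2) := by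
        rw [one_div, ENNReal.ofReal_inv_of_pos (by norm_num)]; simp
      rw [this]
      refine ENNReal.ofReal_le_ofReal ?_
      norm_num
    refine (ENNReal.rpow_le_rpow h1 (by norm_num)).trans_eq ?_
    rw [← ENNReal.rpow_mul]; norm_num
  have hgl : ∀ l : ℕ, g (m - l) ≤ ENNReal.ofReal (3 / 4) ^ l := by
    intro l
    refine (Set.indicator_le_self' (fun _ _ => zero_le) _).trans ?_
    have h1 : (2 : ℝ≥0∞) ^ (m - (l : ℤ)) / B ≤ (2⁻¹ : ℝ≥0∞) ^ l := by
      refine ENNReal.div_le_of_le_mul ?_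
      rw [sub_eq_add_neg, ENNReal.zpow_add (by norm_num) (by norm_num), mul_comm]
      have : (2 : ℝ≥0∞) ^ (-(l : ℤ)) = (2⁻¹ : ℝ≥0∞) ^ l := by
        rw [ENNReal.zpow_neg, zpow_natCast, ENNReal.inv_pow]
      rw [this]
      gcongr
    refine (ENNReal.rpow_le_rpow h1 (by norm_num)).trans ?_
    rw [← ENNReal.rpow_natCast, ← ENNReal.rpow_mul, mul_comm, ENNReal.rpow_mul,
      ENNReal.rpow_natCast]
    gcongr
  change ∑' k, g k ≤ 4
  rw [← hinj.tsum_eq hsupp]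
  refine (ENNReal.tsum_le_tsum hgl).trans ?_
  rw [ENNReal.tsum_geometric]
  have : (1 : ℝ≥0∞) - ENNReal.ofReal (3 / 4) = ENNReal.ofReal (1 / 4) := by
    rw [← ENNReal.ofReal_one, ← ENNReal.ofReal_sub _ (by norm_num)]
    norm_num
  rw [this, one_div, ENNReal.ofReal_inv_of_pos (by norm_num), inv_inv]
  norm_num

lemma tsum_rpow_indicator_le {ρ : ℝ} (hρ : 1 / 2 ≤ ρ) (B : ℝ≥0∞) :
    ∑' k : ℤ, {k : ℤ | (2 : ℝ≥0∞) ^ k < B}.indicator (fun k => ((2 : ℝ≥0∞) ^ k) ^ ρ) k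
      ≤ 4 * B ^ ρ := by
  have hρ0 : 0 < ρ := by linarith
  rcases eq_or_ne B 0 with rfl | hB0
  · simp
  rcases eq_or_ne B ∞ with rfl | hB
  · rw [ENNReal.top_rpow_of_pos hρ0, ENNReal.mul_top (by norm_num)]; exact le_top
  calc _ ≤ ∑' k : ℤ, {k : ℤ | (2 : ℝ≥0∞) ^ k < B}.indicator
        (fun k => ((2 : ℝ≥0∞) ^ k / B) ^ (1 / 2 : ℝ)) k * B ^ ρ := by
        refine ENNReal.tsum_le_tsum fun k => ?_
        by_cases hk : k ∈ {k : ℤ | (2 : ℝ≥0∞) ^ k < B}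
        · rw [Set.indicator_of_mem hk, Set.indicator_of_mem hk]
          have hk' : (2 : ℝ≥0∞) ^ k < B := hk
          have hw : (2 : ℝ≥0∞) ^ k / B ≤ 1 := ENNReal.div_le_of_le_mul (by rw [one_mul]; exact hk'.le)
          have h1 : ((2 : ℝ≥0∞) ^ k) ^ ρ = ((2 : ℝ≥0∞) ^ k / B) ^ ρ * B ^ ρ := by
            rw [← ENNReal.mul_rpow_of_nonneg _ _ hρ0.le, ENNReal.div_mul_cancel hB0 hB]
          rw [h1]
          exact mul_le_mul_left (ENNReal.rpow_le_rpow_of_exponent_ge hw hρ) _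
        · rw [Set.indicator_of_notMem hk]
          exact zero_le
    _ ≤ 4 * B ^ ρ := by
        rw [ENNReal.tsum_mul_right]
        gcongr
        exact tsum_sqrt_div_le hB0 hB

/-- Summation of a dyadic series with random factors, for one realisation. -/
lemma rpow_tsum_dyadic_le {ρ q : ℝ} (hρ : 0 < ρ) (hq : 2 * ρ ≤ q) {K : ℝ≥0∞} (hK0 : K ≠ 0)
    (hK : K ≠ ∞) (B : ℝ≥0∞) (M : ℤ → ℝ≥0∞) :
    (∑' k : ℤ, {k : ℤ | (2 : ℝ≥0∞) ^ k < B}.indicator (fun k => 2 ^ (k + 1) * M k) k) ^ ρ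
      ≤ 8 ^ ρ * K ^ ρ * (B ^ ρ + (K ^ q)⁻¹ * ∑' k : ℤ, {k : ℤ | (2 : ℝ≥0∞) ^ k < B}.indicator
        (fun k => ((2 : ℝ≥0∞) ^ k) ^ ρ * M k ^ q) k) := by
  rcases eq_or_ne B 0 with rfl | hB0
  · simp [hρ]
  rcases eq_or_ne B ∞ with rfl | hB
  · rw [ENNReal.top_rpow_of_pos hρ, top_add, ENNReal.mul_top]
    · exact le_top
    · refine mul_ne_zero ?_ ?_
      · simp
      · simp [hK0, hK]
  set w : ℤ → ℝ≥0∞ := fun k => (2 : ℝ≥0∞) ^ k / B with hw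
  set s : Set ℤ := {k : ℤ | (2 : ℝ≥0∞) ^ k < B} with hs
  set A : ℝ≥0∞ := ∑' k : ℤ, s.indicator (fun k => ((2 : ℝ≥0∞) ^ k) ^ ρ * M k ^ q) k with hA
  have hwB : ∀ k, w k * B = 2 ^ k := fun k => ENNReal.div_mul_cancel hB0 hB
  have hw1 : ∀ k ∈ s, w k ≤ 1 := fun k hk => by
    have hk' : (2 : ℝ≥0∞) ^ k < B := hk
    exact ENNReal.div_le_of_le_mul (by rw [one_mul]; exact hk'.le)
  have hsup : ∀ k ∈ s, w k ^ (1 / 2 : ℝ) * M k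
      ≤ (K ^ ρ * (1 + (K ^ q)⁻¹ * ((B ^ ρ)⁻¹ * A))) ^ (1 / ρ) := by
    intro k hk
    rw [one_div ρ, ENNReal.le_rpow_inv_iff hρ]
    have hq0 : 0 < q := by linarith
    set y := w k ^ (1 / 2 : ℝ) * M k * K⁻¹ with hy
    have hyM : w k ^ (1 / 2 : ℝ) * M k = K * y := by
      rw [hy, mul_comm K, mul_assoc, ENNReal.inv_mul_cancel hK0 hK, mul_one]
    have hyρ : y ^ ρ ≤ 1 + y ^ q := by
      rcases le_total y 1 with h | h
      · exact (ENNReal.rpow_le_one h hρ.le).trans le_self_add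
      · exact (ENNReal.rpow_le_rpow_of_exponent_le h (by linarith)).trans le_add_self
    have hyq : y ^ q ≤ (K ^ q)⁻¹ * ((B ^ ρ)⁻¹ * A) := by
      have e1 : y ^ q = (K ^ q)⁻¹ * (w k ^ (q / 2) * M k ^ q) := by
        rw [hy, ENNReal.mul_rpow_of_nonneg _ _ hq0.le, ENNReal.mul_rpow_of_nonneg _ _ hq0.le,
          ← ENNReal.rpow_mul, ENNReal.inv_rpow, mul_comm, one_div_mul_eq_div]
      have e2 : w k ^ (q / 2) ≤ (B ^ ρ)⁻¹ * (2 ^ k) ^ ρ := by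
        refine (ENNReal.rpow_le_rpow_of_exponent_ge (hw1 k hk) (by linarith : ρ ≤ q / 2)).trans ?_
        rw [hw]
        simp only
        rw [ENNReal.div_rpow_of_nonneg _ _ hρ.le, div_eq_mul_inv, mul_comm]
      rw [e1]
      refine mul_le_mul_right ?_ _
      calc w k ^ (q / 2) * M k ^ q ≤ (B ^ ρ)⁻¹ * (2 ^ k) ^ ρ * M k ^ q := by gcongr
        _ = (B ^ ρ)⁻¹ * (s.indicator (fun k => ((2 : ℝ≥0∞) ^ k) ^ ρ * M k ^ q) k) := by
            rw [Set.indicator_of_mem hk, mul_assoc]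
        _ ≤ _ := by
            gcongr
            exact ENNReal.le_tsum k
    rw [hyM, ENNReal.mul_rpow_of_nonneg _ _ hρ.le]
    gcongr
    exact hyρ.trans (by gcongr)
  have hsum : ∑' k : ℤ, s.indicator (fun k => 2 ^ (k + 1) * M k) k
      ≤ 8 * B * (K ^ ρ * (1 + (K ^ q)⁻¹ * ((B ^ ρ)⁻¹ * A))) ^ (1 / ρ) := by
    set R := (K ^ ρ * (1 + (K ^ q)⁻¹ * ((B ^ ρ)⁻¹ * A))) ^ (1 / ρ) with hR
    calc _ ≤ ∑' k : ℤ, 2 * B * R * s.indicator (fun k => w k ^ (1 / 2 : ℝ)) k := by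
          refine ENNReal.tsum_le_tsum fun k => ?_
          by_cases hk : k ∈ s
          · rw [Set.indicator_of_mem hk, Set.indicator_of_mem hk]
            have e1 : (2 : ℝ≥0∞) ^ (k + 1) = 2 * B * (w k ^ (1 / 2 : ℝ) * w k ^ (1 / 2 : ℝ)) := by
              rw [← ENNReal.rpow_add_of_nonneg _ _ (by norm_num) (by norm_num), add_halves,
                ENNReal.rpow_one, mul_assoc, mul_comm B, hwB,
                ENNReal.zpow_add (by norm_num) (by norm_num), zpow_one, mul_comm]
            rw [e1]
            calc 2 * B * (w k ^ (1 / 2 : ℝ) * w k ^ (1 / 2 : ℝ)) * M k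
                = 2 * B * (w k ^ (1 / 2 : ℝ) * M k) * w k ^ (1 / 2 : ℝ) := by ring
              _ ≤ _ := by
                  gcongr
                  exact hsup k hk
          · rw [Set.indicator_of_notMem hk]
            exact zero_le
      _ ≤ 2 * B * R * 4 := by
          rw [ENNReal.tsum_mul_left]
          gcongr
          exact tsum_sqrt_div_le hB0 hB
      _ = 8 * B * R := by ring
  refine (ENNReal.rpow_le_rpow hsum hρ.le).trans_eq ?_
  rw [ENNReal.mul_rpow_of_nonneg _ _ hρ.le, ENNReal.mul_rpow_of_nonneg _ _ hρ.le,
    ← ENNReal.rpow_mul, one_div_mul_cancel hρ.ne', ENNReal.rpow_one]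
  have hBρ0 : B ^ ρ ≠ 0 := by simp [hB0, hB]
  have hBρ : B ^ ρ ≠ ∞ := ENNReal.rpow_ne_top_of_nonneg hρ.le hB
  have e3 : (K ^ q)⁻¹ * A = B ^ ρ * ((K ^ q)⁻¹ * ((B ^ ρ)⁻¹ * A)) := by
    calc (K ^ q)⁻¹ * A = (K ^ q)⁻¹ * ((B ^ ρ * (B ^ ρ)⁻¹) * A) := by
          rw [ENNReal.mul_inv_cancel hBρ0 hBρ, one_mul]
      _ = _ := by ring
  rw [e3]
  ring

end DyadicLevels

section Stopping

variable {Ω : Type*} {mΩ : MeasurableSpace Ω} {P : Measure Ω} {F : ℝ → MeasurableSpace Ω}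

/-- The points of an equidistant grid in `[s, e]`. -/
noncomputable def gridPoint (s e : ℝ) (n i : ℕ) : ℝ := s + (e - s) * (i / (n + 1))

/-- The event that the level `c` is passed by `B` in the `i`-th interval of the grid. -/
def crossing (s e : ℝ) (B : ℝ → Ω → ℝ≥0∞) (c : ℝ≥0∞) (n i : ℕ) : Set Ω :=
  {ω | B (gridPoint s e n i) ω ≤ c ∧ c < B (gridPoint s e n (i + 1)) ω}

/-- The process `S` at the first point of the grid where `B` exceeds `c`. -/
noncomputable def stopped (s e : ℝ) (B S : ℝ → Ω → ℝ≥0∞) (c : ℝ≥0∞) (n : ℕ) (ω : Ω) : ℝ≥0∞ :=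
  ∑ i ∈ Finset.range (n + 1),
    (crossing s e B c n i).indicator (S (gridPoint s e n (i + 1))) ω

/-- The process `S` at the time when `B` exceeds `c`. -/
noncomputable def levelBound (s e : ℝ) (B S : ℝ → Ω → ℝ≥0∞) (c : ℝ≥0∞) (ω : Ω) : ℝ≥0∞ :=
  liminf (fun n => stopped s e B S c n ω) atTop

variable {s e : ℝ} {B S : ℝ → Ω → ℝ≥0∞} {c : ℝ≥0∞}

lemma gridPoint_mono (hse : s ≤ e) (n : ℕ) : Monotone (gridPoint s e n) := fun i j hij => by
  unfold gridPoint
  have : 0 ≤ e - s := sub_nonneg.2 hse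
  gcongr

lemma gridPoint_zero (n : ℕ) : gridPoint s e n 0 = s := by simp [gridPoint]

lemma gridPoint_last (n : ℕ) : gridPoint s e n (n + 1) = e := by
  have : (n : ℝ) + 1 ≠ 0 := by positivity
  simp [gridPoint, this]

lemma gridPoint_mem (hse : s ≤ e) {n i : ℕ} (hi : i ≤ n + 1) :
    gridPoint s e n i ∈ Set.Icc s e := by
  constructor
  · have := gridPoint_mono hse n (Nat.zero_le i)
    rwa [gridPoint_zero] at this
  · have := gridPoint_mono hse n hi
    rwa [gridPoint_last] at this

lemma crossing_disjoint (hse : s ≤ e) (hB : ∀ ω, Monotone fun t => B t ω) {n i j : ℕ} {ω : Ω}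
    (hi : ω ∈ crossing s e B c n i) (hj : ω ∈ crossing s e B c n j) : i = j := by
  by_contra hne
  rcases lt_or_gt_of_ne hne with h | h
  · exact absurd (hi.2.trans_le (hB ω (gridPoint_mono hse n h))) (not_lt.2 hj.1)
  · exact absurd (hj.2.trans_le (hB ω (gridPoint_mono hse n h))) (not_lt.2 hi.1)

lemma stopped_eq (hse : s ≤ e) (hB : ∀ ω, Monotone fun t => B t ω) {n i : ℕ}
    (hin : i ∈ Finset.range (n + 1)) {ω : Ω} (hi : ω ∈ crossing s e B c n i) :
    stopped s e B S c n ω = S (gridPoint s e n (i + 1)) ω := by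
  rw [stopped, Finset.sum_eq_single_of_mem i hin fun j _ hji => ?_, Set.indicator_of_mem hi]
  exact Set.indicator_of_notMem (fun hj => hji (crossing_disjoint hse hB hj hi)) _

lemma exists_crossing {n : ℕ} {ω : Ω} (h0 : B s ω ≤ c) (h1 : c < B e ω) :
    ∃ i ∈ Finset.range (n + 1), ω ∈ crossing s e B c n i := by
  by_contra hcon
  push Not at hcon
  have : ∀ i, i ≤ n + 1 → B (gridPoint s e n i) ω ≤ c := by
    intro i
    induction i with
    | zero => intro _; rwa [gridPoint_zero]
    | succ i ih =>
      intro hi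
      by_contra h
      exact hcon i (Finset.mem_range.2 (by omega)) ⟨ih (by omega), not_le.1 h⟩
  have h2 := this (n + 1) le_rfl
  rw [gridPoint_last] at h2
  exact absurd h1 (not_lt.2 h2)

lemma measurableSet_crossing (hse : s ≤ e) (hF : Monotone F)
    (hBm : ∀ t ∈ Set.Icc s e, Measurable[F t] (B t)) {n i : ℕ} (hi : i ≤ n) :
    MeasurableSet[F (gridPoint s e n (i + 1))] (crossing s e B c n i) := by
  have h1 : Measurable[F (gridPoint s e n (i + 1))] (B (gridPoint s e n i)) :=
    (hBm _ (gridPoint_mem hse (by omega))).mono (hF (gridPoint_mono hse n (Nat.le_succ i))) le_rfl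
  have h2 := hBm _ (gridPoint_mem hse (show i + 1 ≤ n + 1 by omega))
  exact (h1 measurableSet_Iic).inter (h2 measurableSet_Ioi)

lemma measurable_stopped (hse : s ≤ e) (hFle : ∀ t, F t ≤ mΩ) (hF : Monotone F)
    (hBm : ∀ t ∈ Set.Icc s e, Measurable[F t] (B t)) (hSm : ∀ t, Measurable (S t)) (n : ℕ) :
    Measurable (stopped s e B S c n) :=
  Finset.measurable_sum _ fun _ hi => (hSm _).indicator
    (hFle _ _ (measurableSet_crossing hse hF hBm (Nat.lt_succ_iff.1 (Finset.mem_range.1 hi))))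

lemma lintegral_stopped_le (hse : s ≤ e) (hFle : ∀ t, F t ≤ mΩ) (hF : Monotone F)
    (hB : ∀ ω, Monotone fun t => B t ω)
    (hBm : ∀ t ∈ Set.Icc s e, Measurable[F t] (B t)) (hSm : ∀ t, Measurable (S t)) {m : ℝ}
    (hm : 0 < m) {K : ℝ≥0∞}
    (hS : ∀ u ∈ Set.Icc s e, ∀ D, MeasurableSet[F u] D → ∫⁻ ω in D, S u ω ^ m ∂P ≤ K * P D)
    (n : ℕ) : ∫⁻ ω, stopped s e B S c n ω ^ m ∂P ≤ K * P {ω | c < B e ω} := by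
  have hcm : ∀ i ∈ Finset.range (n + 1), MeasurableSet (crossing s e B c n i) := fun i hi =>
    hFle _ _ (measurableSet_crossing hse hF hBm (Nat.lt_succ_iff.1 (Finset.mem_range.1 hi)))
  have h1 : ∀ ω, stopped s e B S c n ω ^ m
      ≤ ∑ i ∈ Finset.range (n + 1),
        (crossing s e B c n i).indicator (fun ω => S (gridPoint s e n (i + 1)) ω ^ m) ω := by
    intro ω
    by_cases h : ∃ i ∈ Finset.range (n + 1), ω ∈ crossing s e B c n i
    · obtain ⟨i, hi, hω⟩ := h
      rw [stopped_eq hse hB hi hω]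
      refine le_trans (le_of_eq ?_) (Finset.single_le_sum (fun _ _ => zero_le) hi)
      rw [Set.indicator_of_mem hω]
    · push Not at h
      have : stopped s e B S c n ω = 0 :=
        Finset.sum_eq_zero fun i hi => Set.indicator_of_notMem (h i hi) _
      rw [this, ENNReal.zero_rpow_of_pos hm]
      exact zero_le
  calc _ ≤ ∫⁻ ω, ∑ i ∈ Finset.range (n + 1),
        (crossing s e B c n i).indicator (fun ω => S (gridPoint s e n (i + 1)) ω ^ m) ω ∂P :=
        lintegral_mono h1
    _ = ∑ i ∈ Finset.range (n + 1),
        ∫⁻ ω in crossing s e B c n i, S (gridPoint s e n (i + 1)) ω ^ m ∂P := by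
        rw [lintegral_finsetSum']
        · exact Finset.sum_congr rfl fun i hi => lintegral_indicator (hcm i hi) _
        · exact fun _ hi => (((hSm _).pow_const _).indicator (hcm _ hi)).aemeasurable
    _ ≤ ∑ i ∈ Finset.range (n + 1), K * P (crossing s e B c n i) := by
        refine Finset.sum_le_sum fun i hi => ?_
        have hi' := Nat.lt_succ_iff.1 (Finset.mem_range.1 hi)
        exact hS _ (gridPoint_mem hse (by omega)) _ (measurableSet_crossing hse hF hBm hi')
    _ = K * P (⋃ i ∈ Finset.range (n + 1), crossing s e B c n i) := by
        rw [← Finset.mul_sum, measure_biUnion_finset _ hcm]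
        intro i _ j _ hij
        exact Set.disjoint_left.2 fun ω hi hj => hij (crossing_disjoint hse hB hi hj)
    _ ≤ _ := by
        gcongr
        refine Set.iUnion₂_subset fun i hi ω hω => ?_
        refine hω.2.trans_le (hB ω (gridPoint_mem hse ?_).2)
        have := Finset.mem_range.1 hi
        omega

lemma measurable_levelBound (hse : s ≤ e) (hFle : ∀ t, F t ≤ mΩ) (hF : Monotone F)
    (hBm : ∀ t ∈ Set.Icc s e, Measurable[F t] (B t)) (hSm : ∀ t, Measurable (S t)) :
    Measurable (levelBound s e B S c) :=
  Measurable.liminf fun n => measurable_stopped hse hFle hF hBm hSm n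

lemma lintegral_levelBound_le (hse : s ≤ e) (hFle : ∀ t, F t ≤ mΩ) (hF : Monotone F)
    (hB : ∀ ω, Monotone fun t => B t ω)
    (hBm : ∀ t ∈ Set.Icc s e, Measurable[F t] (B t)) (hSm : ∀ t, Measurable (S t)) {m : ℝ}
    (hm : 0 < m) {K : ℝ≥0∞}
    (hS : ∀ u ∈ Set.Icc s e, ∀ D, MeasurableSet[F u] D → ∫⁻ ω in D, S u ω ^ m ∂P ≤ K * P D) :
    ∫⁻ ω, levelBound s e B S c ω ^ m ∂P ≤ K * P {ω | c < B e ω} := by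
  have h1 : ∀ ω, levelBound s e B S c ω ^ m
      = liminf (fun n => stopped s e B S c n ω ^ m) atTop := fun ω =>
    (ENNReal.orderIsoRpow m hm).liminf_apply (u := fun n => stopped s e B S c n ω) (f := atTop)
  simp only [h1]
  refine (lintegral_liminf_le fun n =>
    (measurable_stopped hse hFle hF hBm hSm n).pow_const m).trans ?_
  exact liminf_le_of_le (by isBoundedDefault) fun b hb => by
    obtain ⟨n, hn⟩ := hb.exists
    exact hn.trans (lintegral_stopped_le hse hFle hF hB hBm hSm hm hS n)

/-- Integrals after the time when `B` exceeds `c` are bounded by `levelBound`. -/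
lemma setLIntegral_level_le (hse : s < e) (hB : ∀ ω, Monotone fun t => B t ω) {ω : Ω}
    (h0 : B s ω ≤ c)
    (hleft : ∀ σ, s < σ → c < B σ ω → ∃ t < σ, s ≤ t ∧ c < B t ω) {h : ℝ → ℝ≥0∞}
    (hh : Measurable h) (hS : ∀ u ∈ Set.Icc s e, ∫⁻ t in Set.Ioc u e, h t ≤ S u ω) :
    ∫⁻ t in {t | t ∈ Set.Ioc s e ∧ c < B t ω}, h t ≤ levelBound s e B S c ω := by
  have hV : MeasurableSet {t | t ∈ Set.Ioc s e ∧ c < B t ω} :=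
    measurableSet_Ioc.inter ((hB ω).measurable measurableSet_Ioi)
  by_cases h1 : c < B e ω
  swap
  · have : {t | t ∈ Set.Ioc s e ∧ c < B t ω} = ∅ := by
      ext t
      simp only [Set.mem_ofPred_eq, Set.mem_empty_iff_false, iff_false]
      rintro ⟨ht, hc⟩
      exact h1 (hc.trans_le (hB ω ht.2))
    rw [this]; simp
  choose i hin hi using fun n : ℕ => exists_crossing (n := n) h0 h1
  have hlev : levelBound s e B S c ω
      = liminf (fun n => S (gridPoint s e n (i n + 1)) ω) atTop := by
    rw [levelBound]
    congr 1
    funext n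
    exact stopped_eq hse.le hB (hin n) (hi n)
  rw [hlev, ← lintegral_indicator hV]
  calc _ ≤ ∫⁻ t, liminf (fun n => (Set.Ioc (gridPoint s e n (i n + 1)) e).indicator h t) atTop := by
        refine lintegral_mono fun σ => ?_
        by_cases hσ : σ ∈ {t | t ∈ Set.Ioc s e ∧ c < B t ω}
        swap
        · rw [Set.indicator_of_notMem hσ]; exact zero_le
        rw [Set.indicator_of_mem hσ]
        obtain ⟨t, htσ, hst, hct⟩ := hleft σ hσ.1.1 hσ.2
        have hev : ∀ᶠ n : ℕ in atTop, (e - s) / ((n : ℝ) + 1) < σ - t := by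
          have : Tendsto (fun n : ℕ => (e - s) / ((n : ℝ) + 1)) atTop (𝓝 0) := by
            have := tendsto_one_div_add_atTop_nhds_zero_nat.const_mul (e - s)
            simpa [div_eq_mul_inv] using this
          exact this.eventually_lt_const (sub_pos.2 htσ)
        refine le_liminf_of_le (by isBoundedDefault) ?_
        filter_upwards [hev] with n hn
        have hgt : gridPoint s e n (i n) < t := by
          by_contra hcon
          push Not at hcon
          exact absurd (hct.trans_le (hB ω hcon)) (not_lt.2 (hi n).1)
        have hg : gridPoint s e n (i n + 1) = gridPoint s e n (i n) + (e - s) / ((n : ℝ) + 1) := by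
          unfold gridPoint
          push_cast
          ring
        rw [Set.indicator_of_mem]
        exact ⟨by rw [hg]; linarith, hσ.1.2⟩
    _ ≤ liminf (fun n => ∫⁻ t, (Set.Ioc (gridPoint s e n (i n + 1)) e).indicator h t) atTop :=
        lintegral_liminf_le fun n => hh.indicator measurableSet_Ioc
    _ ≤ _ := by
        refine liminf_le_liminf (Eventually.of_forall fun n => ?_)
        rw [lintegral_indicator measurableSet_Ioc]
        refine hS _ (gridPoint_mem hse.le ?_)
        have := Finset.mem_range.1 (hin n)
        omega

/-- Moments of a quantity that is controlled level by level. -/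
lemma lintegral_rpow_le_of_levels (hse : s ≤ e) (hFle : ∀ t, F t ≤ mΩ) (hF : Monotone F)
    (hB : ∀ ω, Monotone fun t => B t ω)
    (hBm : ∀ t ∈ Set.Icc s e, Measurable[F t] (B t)) (hSm : ∀ t, Measurable (S t)) {m : ℝ}
    {K : ℝ≥0∞} (hK0 : K ≠ 0) (hK : K ≠ ∞)
    (hS : ∀ u ∈ Set.Icc s e, ∀ D, MeasurableSet[F u] D → ∫⁻ ω in D, S u ω ^ m ∂P ≤ K ^ m * P D)
    {κ ρ : ℝ} (hκ : 0 < κ) (hρ : 1 ≤ ρ) (hm : 2 * ρ * κ ≤ m) {Y : Ω → ℝ≥0∞}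
    (hY : ∀ᵐ ω ∂P, Y ω ≤ ∑' k : ℤ, {k : ℤ | (2 : ℝ≥0∞) ^ k < B e ω}.indicator
      (fun k => 2 ^ (k + 1) * levelBound s e B S (2 ^ k) ω ^ κ) k) :
    ∫⁻ ω, Y ω ^ ρ ∂P ≤ 5 * 8 ^ ρ * (K ^ κ) ^ ρ * ∫⁻ ω, B e ω ^ ρ ∂P := by
  have hρ0 : 0 < ρ := by linarith
  have hm0 : 0 < m := lt_of_lt_of_le (by positivity) hm
  have hBe : Measurable (B e) := (hBm e ⟨hse, le_rfl⟩).mono (hFle e) le_rfl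
  have hlm : ∀ c, Measurable (levelBound s e B S c) := fun c =>
    measurable_levelBound hse hFle hF hBm hSm
  have hq : 2 * ρ ≤ m / κ := by rw [le_div_iff₀ hκ]; exact hm
  have hKκ0 : K ^ κ ≠ 0 := by simp [hK0, hK]
  have hKκ : K ^ κ ≠ ∞ := ENNReal.rpow_ne_top_of_nonneg hκ.le hK
  have hKq : (K ^ κ) ^ (m / κ) = K ^ m := by
    rw [← ENNReal.rpow_mul, mul_div_cancel₀ _ hκ.ne']
  have hD : ∀ k : ℤ, MeasurableSet {ω | (2 : ℝ≥0∞) ^ k < B e ω} := fun k => hBe measurableSet_Ioi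
  have hind : ∀ (k : ℤ) (ω : Ω) (g : ℤ → Ω → ℝ≥0∞),
      {k : ℤ | (2 : ℝ≥0∞) ^ k < B e ω}.indicator (fun k => g k ω) k
        = {ω | (2 : ℝ≥0∞) ^ k < B e ω}.indicator (g k) ω := fun k ω g => by
    by_cases h : (2 : ℝ≥0∞) ^ k < B e ω
    · rw [Set.indicator_of_mem (show k ∈ {k : ℤ | (2 : ℝ≥0∞) ^ k < B e ω} from h),
        Set.indicator_of_mem (show ω ∈ {ω | (2 : ℝ≥0∞) ^ k < B e ω} from h)]
    · rw [Set.indicator_of_notMem (show k ∉ {k : ℤ | (2 : ℝ≥0∞) ^ k < B e ω} from h),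
        Set.indicator_of_notMem (show ω ∉ {ω | (2 : ℝ≥0∞) ^ k < B e ω} from h)]
  let G : ℤ → Ω → ℝ≥0∞ := fun k ω =>
    ((2 : ℝ≥0∞) ^ k) ^ ρ * (levelBound s e B S (2 ^ k) ω ^ κ) ^ (m / κ)
  have hGm : ∀ k, Measurable ({ω | (2 : ℝ≥0∞) ^ k < B e ω}.indicator (G k)) := fun k =>
    ((((hlm _).pow_const _).pow_const _).const_mul _).indicator (hD k)
  have hpt : ∀ᵐ ω ∂P, Y ω ^ ρ ≤ 8 ^ ρ * (K ^ κ) ^ ρ * (B e ω ^ ρ + (K ^ m)⁻¹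
      * ∑' k : ℤ, {ω | (2 : ℝ≥0∞) ^ k < B e ω}.indicator (G k) ω) := by
    filter_upwards [hY] with ω hω
    refine (ENNReal.rpow_le_rpow hω hρ0.le).trans ?_
    refine (rpow_tsum_dyadic_le hρ0 hq hKκ0 hKκ (B e ω) _).trans_eq ?_
    rw [hKq]
    simp only [← hind]
    rfl
  have hsum : ∫⁻ ω, ∑' k : ℤ, {ω | (2 : ℝ≥0∞) ^ k < B e ω}.indicator (G k) ω ∂P
      ≤ K ^ m * (4 * ∫⁻ ω, B e ω ^ ρ ∂P) := by
    rw [lintegral_tsum fun k => (hGm k).aemeasurable]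
    have h1 : ∀ k : ℤ, ∫⁻ ω, {ω | (2 : ℝ≥0∞) ^ k < B e ω}.indicator (G k) ω ∂P
        ≤ K ^ m * ∫⁻ ω, {ω | (2 : ℝ≥0∞) ^ k < B e ω}.indicator
          (fun _ => ((2 : ℝ≥0∞) ^ k) ^ ρ) ω ∂P := by
      intro k
      have h2 := lintegral_levelBound_le (c := 2 ^ k) hse hFle hF hB hBm hSm hm0 hS
      have h3 : ∀ ω, G k ω = ((2 : ℝ≥0∞) ^ k) ^ ρ * levelBound s e B S (2 ^ k) ω ^ m := fun ω => by
        simp only [G]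
        rw [← ENNReal.rpow_mul, mul_div_cancel₀ _ hκ.ne']
      calc _ ≤ ∫⁻ ω, ((2 : ℝ≥0∞) ^ k) ^ ρ * levelBound s e B S (2 ^ k) ω ^ m ∂P := by
            refine lintegral_mono fun ω => ?_
            rw [← h3]
            exact Set.indicator_le_self' (fun _ _ => zero_le) _
        _ = ((2 : ℝ≥0∞) ^ k) ^ ρ * ∫⁻ ω, levelBound s e B S (2 ^ k) ω ^ m ∂P :=
            lintegral_const_mul _ ((hlm _).pow_const _)
        _ ≤ ((2 : ℝ≥0∞) ^ k) ^ ρ * (K ^ m * P {ω | (2 : ℝ≥0∞) ^ k < B e ω}) := by gcongr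
        _ = _ := by
            rw [lintegral_indicator (hD k), setLIntegral_const]
            ring
    refine (ENNReal.tsum_le_tsum h1).trans ?_
    rw [ENNReal.tsum_mul_left]
    gcongr
    rw [← lintegral_tsum fun k => (measurable_const.indicator (hD k)).aemeasurable,
      ← lintegral_const_mul _ (hBe.pow_const _)]
    refine lintegral_mono fun ω => ?_
    have := tsum_rpow_indicator_le (by linarith : 1 / 2 ≤ ρ) (B e ω)
    simpa only [hind _ ω fun k _ => ((2 : ℝ≥0∞) ^ k) ^ ρ] using this
  have hKm0 : K ^ m ≠ 0 := by simp [hK0, hK]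
  have hKm : K ^ m ≠ ∞ := ENNReal.rpow_ne_top_of_nonneg hm0.le hK
  have hGs : Measurable fun ω => ∑' k : ℤ, {ω | (2 : ℝ≥0∞) ^ k < B e ω}.indicator (G k) ω :=
    Measurable.tsum hGm
  have hc8 : (8 : ℝ≥0∞) ^ ρ * (K ^ κ) ^ ρ ≠ ∞ :=
    ENNReal.mul_ne_top (ENNReal.rpow_ne_top_of_nonneg hρ0.le (by norm_num))
      (ENNReal.rpow_ne_top_of_nonneg hρ0.le hKκ)
  calc _ ≤ ∫⁻ ω, 8 ^ ρ * (K ^ κ) ^ ρ * (B e ω ^ ρ + (K ^ m)⁻¹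
        * ∑' k : ℤ, {ω | (2 : ℝ≥0∞) ^ k < B e ω}.indicator (G k) ω) ∂P := lintegral_mono_ae hpt
    _ = 8 ^ ρ * (K ^ κ) ^ ρ * (∫⁻ ω, B e ω ^ ρ ∂P + (K ^ m)⁻¹
        * ∫⁻ ω, ∑' k : ℤ, {ω | (2 : ℝ≥0∞) ^ k < B e ω}.indicator (G k) ω ∂P) := by
        rw [lintegral_const_mul' _ _ hc8, lintegral_add_left (hBe.pow_const _),
          lintegral_const_mul _ hGs]
    _ ≤ 8 ^ ρ * (K ^ κ) ^ ρ * (∫⁻ ω, B e ω ^ ρ ∂P + (K ^ m)⁻¹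
        * (K ^ m * (4 * ∫⁻ ω, B e ω ^ ρ ∂P))) := by gcongr
    _ = _ := by
        rw [← mul_assoc (K ^ m)⁻¹, ENNReal.inv_mul_cancel hKm0 hKm, one_mul]
        ring

end Stopping

section UnitaryGroup

variable {H : Type*} [NormedAddCommGroup H] [InnerProductSpace ℂ H] {A : H →ₗ.[ℂ] H}
  {U : ℝ → H →L[ℂ] H}

lemma IsUnitaryGroup.apply_mem_graph (hU : IsUnitaryGroup A U) (t : ℝ) {u v : H}
    (h : (u, v) ∈ A.graph) : (U t u, U t v) ∈ A.graph := by
  rw [hU.generator] at h ⊢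
  have h1 := ((U t).continuous.tendsto _).comp h
  rw [map_smul] at h1
  refine h1.congr fun x => ?_
  have hc : U x (U t u) = U t (U x u) := by
    rw [← mul_apply_eq_comp, ← mul_apply_eq_comp, ← hU.add, ← hU.add,
      add_comm]
  rw [Function.comp_apply, map_smul, map_sub, hc]

end UnitaryGroup

namespace MetricGraph

variable {G : MetricGraph} {K : G.Coupling}

instance (G : MetricGraph) : SFinite G.measure := by
  unfold measure; infer_instance

lemma enorm_le_of_primitive {f g : ℝ → ℂ} (hf : MemLp f 2 (volume.restrict (Set.Ici 0)))
    (hg : MemLp g 2 (volume.restrict (Set.Ici 0)))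
    (h : ∀ x ∈ Set.Ici (0 : ℝ), f x = f 0 + ∫ y in (0 : ℝ)..x, g y) {x : ℝ}
    (hx : x ∈ Set.Ici (0 : ℝ)) :
    ‖f x‖ₑ ≤ eLpNorm f 2 (volume.restrict (Set.Ici 0))
      + eLpNorm g 2 (volume.restrict (Set.Ici 0)) := by
  have hx0 : 0 ≤ x := hx
  have hsub : Set.Ioc x (x + 1) ⊆ Set.Ici 0 := fun y hy => hx0.trans hy.1.le
  have hle : volume.restrict (Set.Ioc x (x + 1)) ≤ volume.restrict (Set.Ici (0 : ℝ)) :=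
    Measure.restrict_mono hsub le_rfl
  have hprob : IsProbabilityMeasure (volume.restrict (Set.Ioc x (x + 1))) :=
    ⟨by rw [Measure.restrict_apply_univ, Real.volume_Ioc]; simp⟩
  have hL : ∀ {k : ℝ → ℂ}, MemLp k 2 (volume.restrict (Set.Ici 0)) →
      ∫⁻ y in Set.Ioc x (x + 1), ‖k y‖ₑ ≤ eLpNorm k 2 (volume.restrict (Set.Ici 0)) :=
    fun {k} hk => by
      rw [← eLpNorm_one_eq_lintegral_enorm]
      exact (eLpNorm_le_eLpNorm_of_exponent_le (by norm_num) (hk.1.mono_measure hle)).trans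
        (eLpNorm_mono_measure _ hle)
  have hint : ∀ {a b : ℝ}, 0 ≤ a → 0 ≤ b → IntervalIntegrable g volume a b := fun {a b} ha hb => by
    have h1 : MemLp g 2 (volume.restrict (Set.uIcc a b)) :=
      hg.mono_measure (Measure.restrict_mono (fun y hy => (le_min ha hb).trans hy.1) le_rfl)
    have : IsFiniteMeasure ((volume : Measure ℝ).restrict (Set.uIcc a b)) := ⟨by simp⟩
    have : IntegrableOn g (Set.uIcc a b) volume := h1.integrable (by norm_num)
    exact this.intervalIntegrable
  have hpt : ∀ y ∈ Set.Ioc x (x + 1), ‖f x‖ₑ ≤ ‖f y‖ₑ + ∫⁻ z in Set.Ioc x (x + 1), ‖g z‖ₑ := by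
    intro y hy
    have hy0 : 0 ≤ y := hx0.trans hy.1.le
    have h1 : f x = f y - ∫ z in x..y, g z := by
      rw [h x hx, h y hy0, ← intervalIntegral.integral_add_adjacent_intervals
        (hint le_rfl hx0) (hint hx0 hy0)]
      ring
    rw [h1]
    refine (enorm_sub_le).trans ?_
    gcongr
    rw [intervalIntegral.integral_of_le hy.1.le]
    refine (enorm_integral_le_lintegral_enorm _).trans ?_
    exact lintegral_mono_set (Set.Ioc_subset_Ioc_right hy.2)
  calc ‖f x‖ₑ = ∫⁻ _ in Set.Ioc x (x + 1), ‖f x‖ₑ := by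
        rw [setLIntegral_const, Real.volume_Ioc]; simp
    _ ≤ ∫⁻ y in Set.Ioc x (x + 1), (‖f y‖ₑ + ∫⁻ z in Set.Ioc x (x + 1), ‖g z‖ₑ) :=
        setLIntegral_mono' measurableSet_Ioc hpt
    _ = (∫⁻ y in Set.Ioc x (x + 1), ‖f y‖ₑ) + ∫⁻ z in Set.Ioc x (x + 1), ‖g z‖ₑ := by
        rw [lintegral_add_right _ measurable_const, lintegral_const, measure_univ, mul_one]
    _ ≤ _ := add_le_add (hL hf) (hL hg)

/-- Elements of the domain of the Laplacian are bounded. -/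
lemma Coupling.eLpNorm_top_lt_of_mem_domain {u : G.L2} (hu : u ∈ K.laplacian.domain) :
    eLpNorm u ∞ G.measure < ∞ := by
  have hz : (u, K.laplacian ⟨u, hu⟩) ∈ K.laplacianGraph := by
    rw [← K.laplacian_graph]
    exact (LinearPMap.mem_graph_iff _).2 ⟨⟨u, hu⟩, rfl, rfl⟩
  obtain ⟨f, g, hf, h, -⟩ := hz
  have hfe : ∀ e, (fun x => u (e, x)) =ᵐ[volume.restrict (G.interval e)] f e := fun e =>
    G.ae_edge hf e
  have hfL : ∀ e, MemLp (f e) 2 (volume.restrict (G.interval e)) := fun e =>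
    (memLp_congr_ae (hfe e)).1 (G.memLp_edge (Lp.memLp u) e)
  have hb : ∀ e, ∃ M : ℝ≥0, ∀ x ∈ G.interval e, ‖f e x‖ₑ ≤ M := by
    intro e
    rcases e with i | j
    · have hc := G.continuousOn_of_primitive (h.1 (Sum.inl i)) (h.2 (Sum.inl i))
      obtain ⟨M, hM⟩ := (isCompact_Icc (a := (0 : ℝ)) (b := G.len i)).exists_bound_of_continuousOn hc
      refine ⟨M.toNNReal, fun x hx => ?_⟩
      rw [← ofReal_norm]
      exact ENNReal.ofReal_le_ofReal (hM x hx)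
    · refine ⟨(eLpNorm (f (Sum.inr j)) 2 (volume.restrict (Set.Ici 0))
        + eLpNorm (g (Sum.inr j)) 2 (volume.restrict (Set.Ici 0))).toNNReal, fun x hx => ?_⟩
      rw [ENNReal.coe_toNNReal]
      · exact enorm_le_of_primitive (hfL (Sum.inr j)) (h.1 (Sum.inr j)) (h.2 (Sum.inr j)) hx
      · exact ENNReal.add_ne_top.2 ⟨(hfL (Sum.inr j)).2.ne, (h.1 (Sum.inr j)).2.ne⟩
  choose M hM using hb
  obtain ⟨M', hM'⟩ := Finite.exists_le M
  refine lt_of_le_of_lt (b := (M' : ℝ≥0∞)) ?_ ENNReal.coe_lt_top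
  rw [eLpNorm_exponent_top]
  refine essSup_le_of_ae_le _ ?_
  refine (G.ae_measure_iff (measurableSet_le (Lp.stronglyMeasurable u).enorm
    measurable_const)).2 fun e => ?_
  filter_upwards [hfe e, ae_restrict_mem (G.measurableSet_interval e)] with x hx hxe
  have hx' : u (e, x) = f e x := hx
  rw [hx']
  exact (hM e x hxe).trans (ENNReal.coe_le_coe.2 (hM' e))

lemma Coupling.eLpNorm_top_lt_of_mem_pointSpace {u : G.L2} (hu : u ∈ K.pointSpace) :
    eLpNorm u ∞ G.measure < ∞ := by
  refine Submodule.span_induction (p := fun (u : G.L2) _ => eLpNorm u ∞ G.measure < ∞) ?_ ?_ ?_ ?_ hu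
  · rintro u ⟨hu, -⟩
    exact K.eLpNorm_top_lt_of_mem_domain hu
  · rw [eLpNorm_congr_ae (Lp.coeFn_zero ℂ 2 G.measure)]; simp
  · intro u v _ _ hu hv
    rw [eLpNorm_congr_ae (Lp.coeFn_add u v)]
    exact (eLpNorm_add_le (Lp.aestronglyMeasurable _) (Lp.aestronglyMeasurable _) (by simp)).trans_lt
      (ENNReal.add_lt_top.2 ⟨hu, hv⟩)
  · intro c u _ hu
    rw [eLpNorm_congr_ae (Lp.coeFn_smul c u)]
    exact (eLpNorm_const_smul_le).trans_lt (ENNReal.mul_lt_top (by simp) hu)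

/-- On a finite-dimensional point space the sup norm is bounded by the `L²` norm. -/
lemma Coupling.exists_eLpNorm_top_le (hfin : FiniteDimensional ℂ K.pointSpace) :
    ∃ c : ℝ≥0, ∀ u ∈ K.pointSpace, eLpNorm u ∞ G.measure ≤ c * ‖u‖ₑ := by
  have hmem : ∀ u : K.pointSpace, MemLp (u : G.L2) ∞ G.measure := fun u =>
    ⟨Lp.aestronglyMeasurable _, K.eLpNorm_top_lt_of_mem_pointSpace u.2⟩
  let L : K.pointSpace →ₗ[ℂ] Lp ℂ ∞ G.measure :=
    { toFun := fun u => (hmem u).toLp _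
      map_add' := fun u v => by
        rw [← MemLp.toLp_add]
        exact MemLp.toLp_congr _ _ (Lp.coeFn_add _ _)
      map_smul' := fun s u => by
        rw [RingHom.id_apply, ← MemLp.toLp_const_smul]
        exact MemLp.toLp_congr _ _ (Lp.coeFn_smul _ _) }
  let L' : K.pointSpace →L[ℂ] Lp ℂ ∞ G.measure := LinearMap.toContinuousLinearMap L
  refine ⟨‖L'‖₊, fun u hu => ?_⟩
  have h1 := L'.le_opENorm ⟨u, hu⟩
  have h2 : ‖L' ⟨u, hu⟩‖ₑ = eLpNorm u ∞ G.measure := by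
    rw [Lp.enorm_def]
    exact eLpNorm_congr_ae (hmem ⟨u, hu⟩).coeFn_toLp
  rw [h2] at h1
  exact h1

lemma Coupling.apply_mem_pointSpace {U : ℝ → G.L2 →L[ℂ] G.L2} (hU : IsUnitaryGroup K.laplacian U)
    (t : ℝ) {u : G.L2} (hu : u ∈ K.pointSpace) : U t u ∈ K.pointSpace := by
  refine Submodule.span_induction (p := fun u _ => U t u ∈ K.pointSpace) ?_ ?_ ?_ ?_ hu
  · rintro u ⟨hu, l, hl⟩
    refine Submodule.subset_span ?_
    have hg : (u, K.laplacian ⟨u, hu⟩) ∈ K.laplacian.graph :=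
      (LinearPMap.mem_graph_iff _).2 ⟨⟨u, hu⟩, rfl, rfl⟩
    obtain ⟨y, hy1, hy2⟩ := (LinearPMap.mem_graph_iff _).1 (hU.apply_mem_graph t hg)
    have hy1' : (y : G.L2) = U t u := hy1
    have hmem : U t u ∈ K.laplacian.domain := hy1' ▸ y.2
    refine ⟨hmem, l, ?_⟩
    have hy : (⟨U t u, hmem⟩ : K.laplacian.domain) = y := Subtype.ext hy1'.symm
    rw [hy, hy2]
    change -(U t (K.laplacian ⟨u, hu⟩)) = _
    rw [← map_neg, hl, map_smul]
  · rw [map_zero]; exact zero_mem _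
  · intro u v _ _ hu hv
    rw [map_add]; exact add_mem hu hv
  · intro c u _ hu
    rw [map_smul]; exact Submodule.smul_mem _ c hu

/-- The dispersive estimate for the whole group. -/
lemma Coupling.H1.exists_dispersive (hH1 : K.H1) (hU : IsUnitaryGroup K.laplacian K.group) :
    ∃ C c : ℝ≥0, 1 ≤ C ∧ (K.pointSpace = ⊥ → c = 0) ∧ ∀ (t : ℝ), t ≠ 0 → ∀ u : G.L2,
      eLpNorm (K.group t u) ∞ G.measure
        ≤ C * (ENNReal.ofReal |t| ^ (-(1 / 2) : ℝ) + c) * eLpNorm u 1 G.measure := by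
  obtain ⟨hfin, C, hC, hdisp⟩ := hH1
  obtain ⟨c, hc⟩ := K.exists_eLpNorm_top_le hfin
  have hclosed : K.pointSpace.topologicalClosure = K.pointSpace :=
    (Submodule.closed_of_finiteDimensional K.pointSpace).submodule_topologicalClosure_eq
  have hPp : ∀ u : G.L2, K.pointSpace.topologicalClosure.starProjection u ∈ K.pointSpace :=
    fun u => by
      exact hclosed.le (Submodule.starProjection_apply_mem K.pointSpace.topologicalClosure u)
  set Pp := K.pointSpace.topologicalClosure.starProjection with hPpdef
  have hflow := hU.isIsometricFlow
  have hproj : ∀ u, ‖Pp u‖ₑ ≤ c * eLpNorm u 1 G.measure := by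
    intro u
    rcases eq_or_ne (Pp u) 0 with h0 | h0
    · rw [h0, enorm_zero]; exact zero_le
    have h1 : ‖Pp u‖ₑ * ‖Pp u‖ₑ ≤ ‖Pp u‖ₑ * (c * eLpNorm u 1 G.measure) := by
      have e1 : ‖Pp u‖ₑ * ‖Pp u‖ₑ = ‖inner ℂ u (Pp u)‖ₑ := by
        have : inner ℂ u (Pp u) = inner ℂ (Pp u) (Pp u) := by
          have h2 : Pp (Pp u) = Pp u :=
            Submodule.starProjection_eq_self_iff.2 (hclosed.ge (hPp u))
          have h3 := Submodule.inner_starProjection_left_eq_right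
            K.pointSpace.topologicalClosure u (Pp u)
          rw [← hPpdef, h2] at h3
          exact h3.symm
        rw [this, inner_self_eq_norm_sq_to_K, enorm_pow, sq]
        congr 1 <;> rw [← ofReal_norm, ← ofReal_norm] <;> simp
      rw [e1]
      refine (enorm_inner_le_eLpNorm_mul ∞ 1 _ _).trans ?_
      calc eLpNorm u 1 G.measure * eLpNorm (Pp u) ∞ G.measure
          ≤ eLpNorm u 1 G.measure * (c * ‖Pp u‖ₑ) := by
            gcongr
            exact hc _ (hPp u)
        _ = _ := by ring
    exact (ENNReal.mul_le_mul_iff_right (by simpa using h0) (by simp)).1 h1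
  refine ⟨max 1 C.toNNReal, if K.pointSpace = ⊥ then 0 else c * c, le_max_left _ _,
    fun h => if_pos h, fun t ht u => ?_⟩
  rcases eq_or_ne (eLpNorm u 1 G.measure) ∞ with hinf | hinf
  · rw [hinf, ENNReal.mul_top]
    · exact le_top
    · refine mul_ne_zero (by simp) ?_
      refine (lt_of_lt_of_le ?_ le_self_add).ne'
      exact ENNReal.rpow_pos (by simpa using ht) (by simp)
  have hmem : MemLp u 1 G.measure := ⟨Lp.aestronglyMeasurable _, hinf.lt_top⟩
  have hdec : K.group t u = K.group t (K.Pc u) + K.group t (Pp u) := by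
    rw [← map_add, Coupling.Pc, sub_apply, one_apply_eq_self,
      sub_add_cancel]
  have hcont : eLpNorm (K.group t (K.Pc u)) ∞ G.measure
      ≤ (max 1 C.toNNReal : ℝ≥0) * ENNReal.ofReal |t| ^ (-(1 / 2) : ℝ) * eLpNorm u 1 G.measure := by
    refine (hdisp u hmem t ht).trans ?_
    gcongr
    have ht' : 0 < |t| := abs_pos.2 ht
    rw [ENNReal.ofReal_rpow_of_pos ht', Real.rpow_neg ht'.le, ← Real.sqrt_eq_rpow, div_eq_mul_inv,
      ENNReal.ofReal_mul hC.le]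
    gcongr
    exact ENNReal.coe_le_coe.2 (le_max_right _ _)
  have hpoint : eLpNorm (K.group t (Pp u)) ∞ G.measure
      ≤ ((if K.pointSpace = ⊥ then 0 else c * c : ℝ≥0) : ℝ≥0∞) * eLpNorm u 1 G.measure := by
    split_ifs with hbot
    · have h0 : Pp u = 0 := by
        have := hPp u
        rw [hbot] at this
        simpa using this
      rw [h0, map_zero, eLpNorm_congr_ae (Lp.coeFn_zero ℂ 2 G.measure)]
      simp
    · refine (hc _ (K.apply_mem_pointSpace hU t (hPp u))).trans ?_
      rw [enorm_apply_eq hflow, ENNReal.coe_mul, mul_assoc]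
      gcongr
      exact hproj u
  rw [hdec, eLpNorm_congr_ae (Lp.coeFn_add _ _)]
  refine (eLpNorm_add_le (Lp.aestronglyMeasurable _) (Lp.aestronglyMeasurable _)
    (by simp)).trans ?_
  refine (add_le_add hcont hpoint).trans ?_
  rw [mul_add, add_mul]
  gcongr
  refine le_mul_of_one_le_left' ?_
  exact_mod_cast le_max_left 1 C.toNNReal

end MetricGraph

/-- The kernel `C (|τ|^(-α) + c)`. -/
noncomputable def dispKernel (C c : ℝ≥0) (α τ : ℝ) : ℝ≥0∞ :=
  C * (ENNReal.ofReal |τ| ^ (-α) + c)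

lemma measurable_dispKernel (C c : ℝ≥0) (α : ℝ) : Measurable (dispKernel C c α) := by
  unfold dispKernel
  fun_prop

lemma dispKernel_neg (C c : ℝ≥0) (α τ : ℝ) : dispKernel C c α (-τ) = dispKernel C c α τ := by
  rw [dispKernel, abs_neg, dispKernel]

lemma dispKernel_ne_top (C c : ℝ≥0) (α : ℝ) {τ : ℝ} (hτ : τ ≠ 0) : dispKernel C c α τ ≠ ∞ := by
  refine ENNReal.mul_ne_top ENNReal.coe_ne_top (ENNReal.add_ne_top.2 ⟨?_, ENNReal.coe_ne_top⟩)
  refine ENNReal.rpow_ne_top_of_ne_zero ?_ ENNReal.ofReal_ne_top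
  simpa using hτ

/-- The `L^q → L^p` dispersive estimate for the group. -/
lemma MetricGraph.Coupling.H1.exists_dispKernel {G : MetricGraph} {K : G.Coupling} (hH1 : K.H1)
    (hU : IsUnitaryGroup K.laplacian K.group) {p : ℝ≥0∞} (hp : 2 ≤ p) (hpt : p ≠ ∞) :
    ∃ C c : ℝ≥0, 1 ≤ C ∧ (K.pointSpace = ⊥ → c = 0) ∧ ∀ (q : ℝ≥0∞), p.HolderConjugate q →
      ∀ (t : ℝ) (u : G.L2), eLpNorm (K.group t u) p G.measure
        ≤ dispKernel C c (1 / 2 - (p⁻¹).toReal) t * eLpNorm u q G.measure := by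
  have hflow := hU.isIsometricFlow
  rcases eq_or_ne p 2 with rfl | hp2
  · refine ⟨1, 0, le_rfl, fun _ => rfl, fun q hq t u => ?_⟩
    have hq2 : q = 2 := by
      have h1 := hq.inv_add_inv_eq_one
      rw [← ENNReal.inv_two_add_inv_two] at h1
      exact inv_injective (ENNReal.add_right_inj (by simp) |>.1 h1)
    subst hq2
    rw [← Lp.enorm_def, ← Lp.enorm_def, enorm_apply_eq hflow, dispKernel]
    simp
  obtain ⟨C, c, hC, hc, hdisp⟩ := hH1.exists_dispersive hU
  have hp2' := two_le_toReal hp hpt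
  have hp2r : 2 < p.toReal := lt_of_le_of_ne hp2' fun h => hp2 (by
    rw [← ENNReal.ofReal_toReal hpt, ← h]; simp)
  set θ := 1 - 2 / p.toReal with hθ
  have hθ0 : 0 < θ := by
    rw [hθ, sub_pos, div_lt_one (by linarith)]; exact hp2r
  have hθ1 : θ ≤ 1 := by
    rw [hθ]; have : 0 ≤ 2 / p.toReal := by positivity
    linarith
  have hα : 1 / 2 - (p⁻¹).toReal = θ / 2 := by
    rw [ENNReal.toReal_inv, hθ]; ring
  refine ⟨C ^ θ, c ^ θ, NNReal.one_le_rpow hC hθ0.le, fun h => ?_, fun q hq t u => ?_⟩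
  · rw [hc h, NNReal.zero_rpow hθ0.ne']
  rcases eq_or_ne t 0 with rfl | ht
  · rcases eq_or_ne u 0 with rfl | hu
    · rw [map_zero, eLpNorm_congr_ae (Lp.coeFn_zero ℂ 2 G.measure)]; simp
    · have hq0 : q ≠ 0 := (lt_of_lt_of_le one_pos hq.symm.one_le).ne'
      have hu0 : eLpNorm u q G.measure ≠ 0 := by
        rw [Ne, eLpNorm_eq_zero_iff (Lp.aestronglyMeasurable _) hq0]
        intro h
        exact hu (Lp.ext (h.trans (Lp.coeFn_zero ℂ 2 G.measure).symm))
      rw [dispKernel, abs_zero, ENNReal.ofReal_zero, hα,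
        ENNReal.zero_rpow_of_neg (by linarith), top_add, ENNReal.mul_top, ENNReal.top_mul hu0]
      · exact le_top
      · have := NNReal.one_le_rpow hC hθ0.le
        exact_mod_cast (lt_of_lt_of_le one_pos this).ne'
  · have hne : (C : ℝ≥0∞) * (ENNReal.ofReal |t| ^ (-(1 / 2) : ℝ) + c) ≠ ∞ :=
      dispKernel_ne_top C c (1 / 2) ht
    have hpos : 0 < ((C : ℝ≥0∞) * (ENNReal.ofReal |t| ^ (-(1 / 2) : ℝ) + c)).toReal := by
      refine ENNReal.toReal_pos (mul_ne_zero ?_ ?_) hne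
      · exact_mod_cast (lt_of_lt_of_le one_pos hC).ne'
      · refine (lt_of_lt_of_le ?_ le_self_add).ne'
        exact ENNReal.rpow_pos (by simpa using ht) (by simp)
    have h1 := eLpNorm_apply_le_interpolate hq hp hpt (K.group t) hpos
      (fun u => (hflow.norm_eq t u).le) (fun u => by
        rw [ENNReal.ofReal_toReal hne]; exact hdisp t ht u) u
    refine h1.trans ?_
    gcongr
    rw [← hθ, ← ENNReal.ofReal_rpow_of_pos hpos, ENNReal.ofReal_toReal hne, dispKernel,
      ENNReal.mul_rpow_of_nonneg _ _ hθ0.le, ENNReal.coe_rpow_of_nonneg _ hθ0.le,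
      ENNReal.coe_rpow_of_nonneg _ hθ0.le]
    gcongr
    refine (ENNReal.rpow_add_le_add_rpow _ _ hθ0.le hθ1).trans_eq ?_
    rw [← ENNReal.rpow_mul, hα]
    congr 2
    ring

section KernelMoments

variable {Ω : Type*} {mΩ : MeasurableSpace Ω} {P : Measure Ω} {F : ℝ → MeasurableSpace Ω}
  {b : ℝ → Ω → ℝ}

lemma ENNReal.add_pow_succ_le (x y : ℝ≥0∞) (N : ℕ) :
    (x + y) ^ (N + 1) ≤ 2 ^ (N + 1) * (x ^ (N + 1) + y ^ (N + 1)) := by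
  have h := ENNReal.rpow_add_le_mul_rpow_add_rpow x y (p := (N + 1 : ℕ))
    (by push_cast; linarith [(Nat.cast_nonneg N : (0 : ℝ) ≤ N)])
  simp only [ENNReal.rpow_natCast] at h
  refine h.trans ?_
  gcongr
  rw [← ENNReal.rpow_natCast]
  exact ENNReal.rpow_le_rpow_of_exponent_le (by norm_num) (by linarith)

/-- A bound for `sup_y ∫_u^e k(b t - y)^(R/2) dt`, where `k` is the dispersive kernel. -/
noncomputable def kernelSup (b : ℝ → Ω → ℝ) (C c : ℝ≥0) (R a e T : ℝ) (N : ℕ) (u : ℝ) (ω : Ω) :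
    ℝ≥0∞ :=
  (2 * C) ^ (R / 2) * (occSup b e T a N u ω + (c : ℝ≥0∞) ^ (R / 2) * ENNReal.ofReal T)

/-- The constant in the moment bound for `kernelSup`. -/
noncomputable def kernelConst (C c : ℝ≥0) (R a : ℝ) (N : ℕ) (T₀ : ℝ≥0∞) : ℝ≥0∞ :=
  2 * (2 * C) ^ (R / 2) * (occConst a N + (c : ℝ≥0∞) ^ (R / 2) * T₀ ^ (a / 2))

lemma kernelConst_ne_top {C c : ℝ≥0} {R a : ℝ} {N : ℕ} {T₀ : ℝ≥0∞} (hR : 2 ≤ R) (ha : 0 ≤ a)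
    (haN : a * (N + 1) < N) (hT₀ : T₀ = ∞ → c = 0) : kernelConst C c R a N T₀ ≠ ∞ := by
  refine ENNReal.mul_ne_top (ENNReal.mul_ne_top (by norm_num) ?_)
    (ENNReal.add_ne_top.2 ⟨occConst_ne_top haN, ?_⟩)
  · exact ENNReal.rpow_ne_top_of_nonneg (by linarith) (ENNReal.mul_ne_top (by norm_num) (by simp))
  · rcases eq_or_ne T₀ ∞ with h | h
    · rw [hT₀ h, ENNReal.coe_zero, ENNReal.zero_rpow_of_pos (by linarith), zero_mul]
      exact ENNReal.zero_ne_top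
    · exact ENNReal.mul_ne_top (ENNReal.rpow_ne_top_of_nonneg (by linarith) (by simp))
        (ENNReal.rpow_ne_top_of_nonneg (by linarith) h)

lemma kernelConst_ne_zero {C c : ℝ≥0} {R a : ℝ} {N : ℕ} {T₀ : ℝ≥0∞} (hC : 1 ≤ C) :
    kernelConst C c R a N T₀ ≠ 0 := by
  refine mul_ne_zero (mul_ne_zero (by norm_num) ?_) ?_
  · refine (ENNReal.rpow_pos (pos_iff_ne_zero.2 (mul_ne_zero (by norm_num) ?_)) ?_).ne'
    · exact_mod_cast (lt_of_lt_of_le one_pos hC).ne'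
    · exact ENNReal.mul_ne_top (by norm_num) (by simp)
  · rw [occConst, add_assoc]
    exact (lt_of_lt_of_le one_pos le_self_add).ne'

lemma measurable_kernelSup (hb : Measurable (Function.uncurry b)) (C c : ℝ≥0) (R a e T : ℝ) (N : ℕ)
    (u : ℝ) : Measurable (kernelSup b C c R a e T N u) :=
  ((measurable_occSup hb e T a N).of_uncurry_left.add_const _).const_mul _

lemma lintegral_dispKernel_le_kernelSup (hb : Measurable (Function.uncurry b)) {C c : ℝ≥0}
    {R α e T : ℝ} (hR : 2 ≤ R) (hα : 0 ≤ α) (hT : 0 < T) (N : ℕ) {u : ℝ} (hu : e - u ≤ T) (ω : Ω)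
    (y : ℝ) : ∫⁻ t in Set.Ioc u e, dispKernel C c α (b t ω - y) ^ (R / 2)
      ≤ kernelSup b C c R (α * R / 2) e T N u ω := by
  have hR0 : 0 ≤ R / 2 := by linarith
  have hbω : Measurable fun t => b t ω := hb.comp (measurable_id.prodMk measurable_const)
  have hm : Measurable fun t => ENNReal.ofReal |b t ω - y| ^ (-(α * R / 2)) := by fun_prop
  have hpt : ∀ x : ℝ, dispKernel C c α x ^ (R / 2) ≤ (2 * C) ^ (R / 2)
      * (ENNReal.ofReal |x| ^ (-(α * R / 2)) + (c : ℝ≥0∞) ^ (R / 2)) := fun x => by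
    rw [dispKernel, ENNReal.mul_rpow_of_nonneg _ _ hR0, ENNReal.mul_rpow_of_nonneg _ _ hR0,
      mul_comm (2 ^ (R / 2)), mul_assoc]
    gcongr
    refine (ENNReal.rpow_add_le_mul_rpow_add_rpow _ _ (by linarith)).trans ?_
    rw [← ENNReal.rpow_mul]
    have : -α * (R / 2) = -(α * R / 2) := by ring
    rw [this]
    gcongr
    · norm_num
    · linarith
  calc _ ≤ ∫⁻ t in Set.Ioc u e, (2 * C) ^ (R / 2)
        * (ENNReal.ofReal |b t ω - y| ^ (-(α * R / 2)) + (c : ℝ≥0∞) ^ (R / 2)) :=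
        lintegral_mono fun t => hpt _
    _ = (2 * C) ^ (R / 2) * ((∫⁻ t in Set.Ioc u e, ENNReal.ofReal |b t ω - y| ^ (-(α * R / 2)))
        + (c : ℝ≥0∞) ^ (R / 2) * ENNReal.ofReal (e - u)) := by
        rw [lintegral_const_mul _ (hm.add_const _), lintegral_add_left hm, setLIntegral_const,
          Real.volume_Ioc]
    _ ≤ _ := by
        unfold kernelSup
        gcongr
        exact lintegral_kernel_le_occSup hb (by positivity) hT N hu ω y

lemma lintegral_mul_kernelSup_pow_le [SFinite P] (hb : HasTransitionBound P F b) {C c : ℝ≥0}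
    {R a e T : ℝ} {T₀ : ℝ≥0∞} (ha : 0 ≤ a) (hT : 0 < T) (hTT : ENNReal.ofReal T ≤ T₀) (N : ℕ)
    {u : ℝ} (hu : 0 ≤ u) (huT : e - u ≤ T) {H : Ω → ℝ≥0∞} (hH : Measurable[F u] H) :
    ∫⁻ ω, H ω * kernelSup b C c R a e T N u ω ^ (N + 1) ∂P
      ≤ (kernelConst C c R a N T₀ * ENNReal.ofReal (T ^ (1 - a / 2))) ^ (N + 1)
        * ∫⁻ ω, H ω ∂P := by
  have hH' : Measurable H := hH.mono (hb.le u) le_rfl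
  have hSm : Measurable (occSup b e T a N u) :=
    (measurable_occSup hb.measurable e T a N).of_uncurry_left
  set D : ℝ≥0∞ := (2 * C) ^ (R / 2) with hD
  set w : ℝ≥0∞ := (c : ℝ≥0∞) ^ (R / 2) * ENNReal.ofReal T with hw
  set E : ℝ≥0∞ := ENNReal.ofReal (T ^ (1 - a / 2)) with hE
  have hwle : w ≤ (c : ℝ≥0∞) ^ (R / 2) * T₀ ^ (a / 2) * E := by
    have h1 : ENNReal.ofReal T = ENNReal.ofReal T ^ (a / 2) * E := by
      rw [hE, ENNReal.ofReal_rpow_of_pos hT, ← ENNReal.ofReal_mul (by positivity),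
        ← Real.rpow_add hT]
      simp
    rw [hw, h1, mul_assoc]
    gcongr
  have hpt : ∀ ω, H ω * kernelSup b C c R a e T N u ω ^ (N + 1)
      ≤ (2 * D) ^ (N + 1) * (H ω * occSup b e T a N u ω ^ (N + 1) + w ^ (N + 1) * H ω) := by
    intro ω
    have e1 : kernelSup b C c R a e T N u ω = D * (occSup b e T a N u ω + w) := rfl
    rw [e1, mul_pow, mul_pow]
    calc H ω * (D ^ (N + 1) * (occSup b e T a N u ω + w) ^ (N + 1))
        ≤ H ω * (D ^ (N + 1) * (2 ^ (N + 1) * (occSup b e T a N u ω ^ (N + 1) + w ^ (N + 1)))) := by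
          gcongr
          exact ENNReal.add_pow_succ_le _ _ N
      _ = _ := by ring
  have hm1 : Measurable fun ω => H ω * occSup b e T a N u ω ^ (N + 1) :=
    hH'.mul (hSm.pow_const _)
  have hm2 : Measurable fun ω => w ^ (N + 1) * H ω := hH'.const_mul _
  have hm12 : Measurable fun ω => H ω * occSup b e T a N u ω ^ (N + 1) + w ^ (N + 1) * H ω :=
    hm1.add hm2
  calc _ ≤ ∫⁻ ω, (2 * D) ^ (N + 1)
        * (H ω * occSup b e T a N u ω ^ (N + 1) + w ^ (N + 1) * H ω) ∂P := lintegral_mono hpt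
    _ = (2 * D) ^ (N + 1) * ((∫⁻ ω, H ω * occSup b e T a N u ω ^ (N + 1) ∂P)
        + w ^ (N + 1) * ∫⁻ ω, H ω ∂P) := by
        rw [lintegral_const_mul _ hm12, lintegral_add_left hm1, lintegral_const_mul _ hH']
    _ ≤ (2 * D) ^ (N + 1) * ((occConst a N * E) ^ (N + 1) * ∫⁻ ω, H ω ∂P
        + ((c : ℝ≥0∞) ^ (R / 2) * T₀ ^ (a / 2) * E) ^ (N + 1) * ∫⁻ ω, H ω ∂P) := by
        gcongr
        exact lintegral_mul_occSup_pow_le hb hT N hu huT hH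
    _ ≤ (2 * D) ^ (N + 1) * ((occConst a N * E + (c : ℝ≥0∞) ^ (R / 2) * T₀ ^ (a / 2) * E) ^ (N + 1)
        * ∫⁻ ω, H ω ∂P) := by
        rw [← add_mul]
        gcongr
        exact pow_add_pow_le zero_le zero_le (Nat.succ_ne_zero N)
    _ = _ := by
        rw [kernelConst, ← hD, ← add_mul, ← mul_assoc, ← mul_pow]
        ring

end KernelMoments

section CumulativeNorm

/-- The `L^g` norm of `h` on `(s, t]`. -/
noncomputable def cumNorm (s g : ℝ) (h : ℝ → ℝ≥0∞) (t : ℝ) : ℝ≥0∞ :=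
  (∫⁻ σ in Set.Ioc s t, h σ ^ g) ^ (1 / g)

variable {s g : ℝ} {h : ℝ → ℝ≥0∞}

lemma cumNorm_mono (hg : 0 < g) : Monotone (cumNorm s g h) := fun _ _ huv =>
  ENNReal.rpow_le_rpow (lintegral_mono_set (Set.Ioc_subset_Ioc_right huv)) (by positivity)

lemma cumNorm_self (hg : 0 < g) : cumNorm s g h s = 0 := by
  simp [cumNorm, hg]

lemma cumNorm_rpow (hg : 0 < g) (t : ℝ) : cumNorm s g h t ^ g = ∫⁻ σ in Set.Ioc s t, h σ ^ g := by
  rw [cumNorm, ← ENNReal.rpow_mul, one_div_mul_cancel hg.ne', ENNReal.rpow_one]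

lemma exists_lt_cumNorm (hg : 0 < g) {σ : ℝ} (hσ : s < σ) {c : ℝ≥0∞} (hc : c < cumNorm s g h σ) :
    ∃ t < σ, s ≤ t ∧ c < cumNorm s g h t := by
  obtain ⟨u, hu, huσ, hlim⟩ := exists_seq_strictMono_tendsto' hσ
  have hU : ⋃ n, Set.Ioc s (u n) = Set.Ioo s σ := by
    ext x
    simp only [Set.mem_iUnion, Set.mem_Ioc, Set.mem_Ioo]
    constructor
    · rintro ⟨n, h1, h2⟩
      exact ⟨h1, h2.trans_lt (huσ n).2⟩
    · rintro ⟨h1, h2⟩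
      obtain ⟨n, hn⟩ := ((tendsto_order.1 hlim).1 x h2).exists
      exact ⟨n, h1, hn.le⟩
  have h1 : c ^ g < ⨆ n, ∫⁻ x in Set.Ioc s (u n), h x ^ g := by
    rw [← setLIntegral_iUnion_of_directed, hU, setLIntegral_congr Ioo_ae_eq_Ioc, ← cumNorm_rpow hg]
    · exact ENNReal.rpow_lt_rpow hc hg
    · exact Monotone.directed_le fun m n hmn => Set.Ioc_subset_Ioc_right (hu.monotone hmn)
  obtain ⟨n, hn⟩ := lt_iSup_iff.1 h1
  refine ⟨u n, (huσ n).2, (huσ n).1.le, ?_⟩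
  rw [← cumNorm_rpow hg] at hn
  exact (ENNReal.rpow_lt_rpow_iff hg).1 hn

lemma setLIntegral_cumNorm_le (hg : 0 < g) (e : ℝ) (C : ℝ≥0∞) :
    ∫⁻ σ in Set.Ioc s e ∩ {σ | cumNorm s g h σ ≤ C}, h σ ^ g ≤ C ^ g := by
  set W := Set.Ioc s e ∩ {σ | cumNorm s g h σ ≤ C} with hW
  rcases W.eq_empty_or_nonempty with h0 | hne
  · rw [h0]; simp
  have hbdd : BddAbove W := ⟨e, fun x hx => hx.1.2⟩
  have hle : cumNorm s g h (sSup W) ≤ C := by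
    by_contra! hcon
    obtain ⟨w, hw⟩ := hne
    obtain ⟨t, htW, -, htC⟩ := exists_lt_cumNorm hg (hw.1.1.trans_le (le_csSup hbdd hw)) hcon
    obtain ⟨w', hw', htw⟩ := exists_lt_of_lt_csSup ⟨w, hw⟩ htW
    exact absurd (htC.trans_le (cumNorm_mono hg htw.le)) (not_lt.2 hw'.2)
  calc _ ≤ ∫⁻ σ in Set.Ioc s (sSup W), h σ ^ g :=
        lintegral_mono_set fun x hx => ⟨hx.1.1, le_csSup hbdd hx⟩
    _ = cumNorm s g h (sSup W) ^ g := (cumNorm_rpow hg _).symm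
    _ ≤ _ := by gcongr

lemma measurableSet_cumNorm_le (hg : 0 < g) (C : ℝ≥0∞) : MeasurableSet {σ | cumNorm s g h σ ≤ C} :=
  (cumNorm_mono hg).measurable measurableSet_Iic

lemma ae_eq_zero_of_cumNorm_eq_zero (hg : 0 < g) (hh : Measurable h) (e : ℝ) :
    ∀ᵐ σ ∂volume.restrict (Set.Ioc s e), cumNorm s g h σ = 0 → h σ = 0 := by
  have h1 := setLIntegral_cumNorm_le (s := s) (h := h) hg e 0
  rw [ENNReal.zero_rpow_of_pos hg, nonpos_iff_eq_zero, Set.inter_comm,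
    ← Measure.restrict_restrict (measurableSet_cumNorm_le hg 0),
    lintegral_eq_zero_iff (hh.pow_const g)] at h1
  have h2 := (ae_restrict_iff' (measurableSet_cumNorm_le hg 0)).1 h1
  filter_upwards [h2] with σ hσ h0
  have := hσ (show cumNorm s g h σ ≤ 0 from h0.le)
  simpa [not_lt.2 hg.le, hg] using this

end CumulativeNorm

section LevelDecomposition

variable {X : Type*} [MeasurableSpace X] {μ : Measure X} {ν : Measure ℝ}
  {U : ℝ → Lp ℂ 2 μ →L[ℂ] Lp ℂ 2 μ} {b : ℝ → ℝ} {k : ℝ → ℝ≥0∞}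
  {a d : ℝ≥0∞} [Fact (1 ≤ a)] [Fact (1 ≤ d)] {f : ℝ → Lp ℂ a μ} {g' : ℝ≥0∞}

lemma KernelBound.restrict {Z : Type*} [MeasurableSpace Z] {ν : Measure Z} {β : Z → ℝ}
    (h : KernelBound k β ν g') {V : Set Z} (hV : MeasurableSet V) :
    KernelBound k β (ν.restrict V) g' := by
  obtain ⟨A, hA, h⟩ := h
  refine ⟨A, hA, fun c hc => ?_⟩
  have h1 := h (V.indicator c) (hc.indicator hV)
  rw [eLpNorm_indicator_eq_eLpNorm_restrict hV] at h1
  refine le_trans ?_ h1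
  calc _ ≤ ∫⁻ t, ∫⁻ σ in V, k (β t - β σ) * c σ ∂ν ∂ν := setLIntegral_le_lintegral _ _
    _ = _ := by
        congr with t
        rw [← lintegral_indicator hV]
        congr with σ
        by_cases hσ : σ ∈ V <;> simp [hσ]

lemma eLpNorm_coeFn_sum_le {d Q : ℝ≥0∞} (hQ : 1 ≤ Q) {ι : Type*} (S : Finset ι) (u : ι → Lp ℂ d μ) :
    eLpNorm (∑ i ∈ S, u i : Lp ℂ d μ) Q μ ≤ ∑ i ∈ S, eLpNorm (u i) Q μ := by
  classical
  induction S using Finset.induction_on with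
  | empty =>
    rw [Finset.sum_empty, eLpNorm_congr_ae (Lp.coeFn_zero ℂ d μ)]
    simp
  | insert i S hi ih =>
    rw [Finset.sum_insert hi, Finset.sum_insert hi, eLpNorm_congr_ae (Lp.coeFn_add _ _)]
    refine (eLpNorm_add_le (Lp.aestronglyMeasurable _) (Lp.aestronglyMeasurable _) hQ).trans ?_
    gcongr

lemma eLpNorm_le_tsum_of_hasSum {Q : ℝ≥0∞} (hQ : 1 ≤ Q) {u : ℤ → Lp ℂ d μ} {w : Lp ℂ d μ}
    (h : HasSum u w) : eLpNorm w Q μ ≤ ∑' j, eLpNorm (u j) Q μ := by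
  have h1 := ((Equiv.intEquivNat.symm.hasSum_iff).2 h).tendsto_sum_nat
  refine (eLpNorm_le_of_tendsto (p := Q) h1).trans ?_
  refine liminf_le_of_le (by isBoundedDefault) fun c hc => ?_
  obtain ⟨n, hn⟩ := hc.exists
  refine hn.trans ((eLpNorm_coeFn_sum_le hQ _ _).trans ?_)
  rw [← Equiv.intEquivNat.symm.tsum_eq]
  exact ENNReal.sum_le_tsum _

lemma eLpNorm_int_tsum_le {Z : Type*} [MeasurableSpace Z] {ν : Measure Z} {p : ℝ≥0∞} (hp : 1 ≤ p)
    {F : ℤ → Z → ℝ≥0∞} (hF : ∀ n, Measurable (F n)) :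
    eLpNorm (fun z => ∑' j, F j z) p ν ≤ ∑' j, eLpNorm (F j) p ν := by
  have h := eLpNorm_tsum_le (ν := ν) hp (F := fun n => F (Equiv.intEquivNat.symm n))
    fun n => hF _
  rw [Equiv.intEquivNat.symm.tsum_eq (fun j => eLpNorm (F j) p ν)] at h
  refine le_trans (le_of_eq ?_) h
  congr with z
  exact (Equiv.intEquivNat.symm.tsum_eq fun j => F j z).symm

/-- The set of pairs `(t, σ)` with `σ ≤ t`. -/
def retarded : Set (ℝ × ℝ) := {z | z.2 ≤ z.1}

lemma measurableSet_retarded : MeasurableSet retarded := measurableSet_le measurable_snd measurable_fst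

lemma stronglyMeasurable_extInt [SFinite ν] [IsSeparable μ] (hU : IsIsometricFlow U)
    (hb : Measurable b) (ha : a ≠ ∞) (hd : d ≠ ∞)
    (hk : ∀ t u, eLpNorm (U t u) d μ ≤ k t * eLpNorm u a μ) (hkt : ∀ t, t ≠ 0 → k t ≠ ∞)
    (hf : StronglyMeasurable f) : StronglyMeasurable (extInt U b ν retarded a d f) :=
  (stronglyMeasurable_extInt_integrand hU hb measurableSet_retarded ha hd hk hkt
    hf).integral_prod_right'

/-- The estimate for a retarded integral follows from the estimates on the parts of the time
interval on which `B` exceeds a power of two. -/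
lemma eLpNorm_extInt_le_tsum [SFinite ν] [IsSeparable μ] (hU : IsIsometricFlow U)
    (hb : Measurable b) (ha : a ≠ ∞) (hd : d ≠ ∞)
    (hk : ∀ t u, eLpNorm (U t u) d μ ≤ k t * eLpNorm u a μ) (hkt : ∀ t, t ≠ 0 → k t ≠ ∞)
    (hf : StronglyMeasurable f) (hfi : ∀ᵐ t ∂ν, Integrable (fun σ =>
      retarded.indicator (fun z => extendLp (U (b z.1 - b z.2)) a d (f z.2)) (t, σ)) ν)
    {B : ℝ → ℝ≥0∞} (hB : Monotone B) {Be : ℝ≥0∞} (hBe : Be ≠ ∞) (hBle : ∀ᵐ σ ∂ν, B σ ≤ Be)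
    (hB0 : ∀ᵐ σ ∂ν, B σ = 0 → f σ = 0)
    (hBf : ∀ C, C ≠ ∞ → eLpNorm ({σ | B σ ≤ C}.indicator f) g' ν ≤ C)
    {Q R : ℝ≥0∞} (hQ : 1 ≤ Q) (hR : 1 ≤ R) {Λ : ℤ → ℝ≥0∞}
    (hest : ∀ j : ℤ, Λ j ≠ ∞ → ∀ ψ : ℝ → Lp ℂ a μ, StronglyMeasurable ψ → eLpNorm ψ g' ν ≠ ∞ →
      eLpNorm (fun t => eLpNorm (extInt U b (ν.restrict {t | 2 ^ j < B t}) retarded a d ψ t) Q μ) R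
        (ν.restrict {t | 2 ^ j < B t}) ≤ Λ j * eLpNorm ψ g' ν) :
    eLpNorm (fun t => eLpNorm (extInt U b ν retarded a d f t) Q μ) R ν
      ≤ ∑' j : ℤ, {j : ℤ | (2 : ℝ≥0∞) ^ j < Be}.indicator (fun j => 2 ^ (j + 1) * Λ j) j := by
  set V : ℤ → Set ℝ := fun j => {t | 2 ^ j < B t} with hVdef
  have hVm : ∀ j, MeasurableSet (V j) := fun j => hB.measurable measurableSet_Ioi
  set W : ℤ → Set ℝ := fun j => {t | 2 ^ j < B t ∧ B t ≤ 2 ^ (j + 1)} with hWdef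
  have hWm : ∀ j, MeasurableSet (W j) := fun j =>
    (hVm j).inter (hB.measurable measurableSet_Iic)
  have hWV : ∀ j, W j ⊆ V j := fun j t ht => ht.1
  have hfm : ∀ j, StronglyMeasurable ((W j).indicator f) := fun j => hf.indicator (hWm j)
  have hmF : ∀ j, Measurable fun t =>
      eLpNorm (extInt U b ν retarded a d ((W j).indicator f) t) Q μ := fun j =>
    measurable_eLpNorm_comp Q (stronglyMeasurable_extInt hU hb ha hd hk hkt (hfm j))
  have h2top : ∀ j : ℤ, (2 : ℝ≥0∞) ^ j ≠ ∞ := fun j => ENNReal.zpow_ne_top (by norm_num) (by norm_num) j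
  have hint : ∀ (j : ℤ) (t σ : ℝ),
      retarded.indicator (fun z => extendLp (U (b z.1 - b z.2)) a d ((W j).indicator f z.2)) (t, σ)
        = (W j).indicator (fun σ => retarded.indicator
          (fun z => extendLp (U (b z.1 - b z.2)) a d (f z.2)) (t, σ)) σ := by
    intro j t σ
    by_cases h1 : (t, σ) ∈ retarded
    · rw [Set.indicator_of_mem h1]
      by_cases h2 : σ ∈ W j
      · simp only [Set.indicator_of_mem h2, Set.indicator_of_mem h1]
      · simp only [Set.indicator_of_notMem h2, map_zero]
    · rw [Set.indicator_of_notMem h1]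
      by_cases h2 : σ ∈ W j
      · simp only [Set.indicator_of_mem h2, Set.indicator_of_notMem h1]
      · simp only [Set.indicator_of_notMem h2]
  have hpiece : ∀ j, eLpNorm (fun t => eLpNorm (extInt U b ν retarded a d ((W j).indicator f) t) Q μ)
      R ν ≤ {j : ℤ | (2 : ℝ≥0∞) ^ j < Be}.indicator (fun j => 2 ^ (j + 1) * Λ j) j := by
    intro j
    have hloc : (fun t => eLpNorm (extInt U b ν retarded a d ((W j).indicator f) t) Q μ)
        = (V j).indicator fun t =>
          eLpNorm (extInt U b (ν.restrict (V j)) retarded a d ((W j).indicator f) t) Q μ := by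
      funext t
      by_cases ht : t ∈ V j
      · rw [Set.indicator_of_mem ht]
        have e1 : extInt U b (ν.restrict (V j)) retarded a d ((W j).indicator f) t
            = extInt U b ν retarded a d ((W j).indicator f) t := by
          unfold extInt
          apply setIntegral_eq_integral_of_forall_compl_eq_zero
          intro σ hσ
          rw [hint, Set.indicator_of_notMem fun h => hσ (hWV j h)]
        rw [e1]
      · rw [Set.indicator_of_notMem ht]
        have h0 : extInt U b ν retarded a d ((W j).indicator f) t = 0 := by
          unfold extInt
          refine integral_eq_zero_of_ae (ae_of_all _ fun σ => ?_)
          change retarded.indicator _ (t, σ) = 0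
          rw [hint]
          by_cases h2 : σ ∈ W j
          · rw [Set.indicator_of_mem h2, Set.indicator_of_notMem]
            intro (h3 : σ ≤ t)
            exact ht (lt_of_lt_of_le h2.1 (hB h3))
          · rw [Set.indicator_of_notMem h2]
        rw [h0, eLpNorm_congr_ae (Lp.coeFn_zero ℂ d μ)]
        simp
    rw [hloc, eLpNorm_indicator_eq_eLpNorm_restrict (hVm j)]
    by_cases hj : (2 : ℝ≥0∞) ^ j < Be
    swap
    · have h0 : ν (V j) = 0 := by
        refine measure_eq_zero_iff_ae_notMem.2 ?_
        filter_upwards [hBle] with σ hσ h1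
        exact hj (lt_of_lt_of_le h1 hσ)
      rw [Measure.restrict_eq_zero.2 h0]
      simp
    rw [Set.indicator_of_mem (show j ∈ {j : ℤ | (2 : ℝ≥0∞) ^ j < Be} from hj)]
    by_cases hΛ : Λ j = ∞
    · rw [hΛ, ENNReal.mul_top (ENNReal.zpow_pos (by norm_num) (by norm_num) _).ne']
      exact le_top
    have hle : eLpNorm ((W j).indicator f) g' ν ≤ 2 ^ (j + 1) := by
      refine le_trans (eLpNorm_mono_enorm fun σ => ?_) (hBf _ (h2top (j + 1)))
      by_cases h2 : σ ∈ W j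
      · rw [Set.indicator_of_mem h2,
          Set.indicator_of_mem (show σ ∈ {σ | B σ ≤ 2 ^ (j + 1)} from h2.2)]
      · rw [Set.indicator_of_notMem h2, enorm_zero]
        exact zero_le
    refine (hest j hΛ _ (hfm j) (ne_top_of_le_ne_top (h2top _) hle)).trans ?_
    rw [mul_comm]
    gcongr
  have hsum : ∀ᵐ t ∂ν, eLpNorm (extInt U b ν retarded a d f t) Q μ
      ≤ ∑' j, eLpNorm (extInt U b ν retarded a d ((W j).indicator f) t) Q μ := by
    filter_upwards [hfi] with t ht
    refine eLpNorm_le_tsum_of_hasSum hQ ?_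
    have hdisj : Pairwise (Function.onFun Disjoint W) := by
      have key : ∀ i j : ℤ, i < j → Disjoint (W i) (W j) := fun i j hij => by
        refine Set.disjoint_left.2 fun x hx hy => ?_
        have h3 : (2 : ℝ≥0∞) ^ (i + 1) ≤ 2 ^ j := ENNReal.zpow_le_of_le (by norm_num) (by omega)
        exact absurd (hy.1.trans_le (hx.2.trans h3)) (lt_irrefl _)
      intro i j hij
      rcases lt_or_gt_of_ne hij with h | h
      · exact key i j h
      · exact (key j i h).symm
    have h1 := hasSum_integral_iUnion hWm hdisj ht.integrableOn
    have h2 : ∫ σ in ⋃ j, W j, retarded.indicator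
        (fun z => extendLp (U (b z.1 - b z.2)) a d (f z.2)) (t, σ) ∂ν
        = extInt U b ν retarded a d f t := by
      unfold extInt
      refine setIntegral_eq_integral_of_ae_compl_eq_zero ?_
      filter_upwards [hBle, hB0] with σ hσ1 hσ2 hσ
      have h0 : B σ = 0 := by
        by_contra h0
        obtain ⟨j, hj⟩ := ENNReal.exists_mem_Ioc_zpow h0 (ne_top_of_le_ne_top hBe hσ1)
          (y := 2) (by norm_num) (by norm_num)
        exact hσ (Set.mem_iUnion.2 ⟨j, hj.1, hj.2⟩)
      by_cases h3 : (t, σ) ∈ retarded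
      · rw [Set.indicator_of_mem h3, hσ2 h0, map_zero]
      · rw [Set.indicator_of_notMem h3]
    rw [h2] at h1
    convert h1 using 2 with j
    unfold extInt
    rw [← integral_indicator (hWm j)]
    congr with σ : 1
    exact hint j t σ
  calc _ ≤ eLpNorm (fun t => ∑' j, eLpNorm (extInt U b ν retarded a d ((W j).indicator f) t) Q μ)
        R ν := eLpNorm_mono_enorm_ae (by simpa using hsum)
    _ ≤ ∑' j, eLpNorm (fun t => eLpNorm (extInt U b ν retarded a d ((W j).indicator f) t) Q μ) R ν :=
        eLpNorm_int_tsum_le hR hmF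
    _ ≤ _ := ENNReal.tsum_le_tsum hpiece

end LevelDecomposition

section Pathwise

variable {X : Type*} [MeasurableSpace X] {μ : Measure X}
  {U : ℝ → Lp ℂ 2 μ →L[ℂ] Lp ℂ 2 μ} {k k₀ : ℝ → ℝ≥0∞}
  {a d : ℝ≥0∞} [Fact (1 ≤ a)] [Fact (1 ≤ d)] {g' Q R : ℝ≥0∞} {r₀ κ : ℝ}

/-- A retarded estimate along arbitrary paths `b`, with a constant that depends on
`sup_y ∫ k₀(b t - y)^(r₀/2) dν(t)`. -/
def RetardedEstimate (U : ℝ → Lp ℂ 2 μ →L[ℂ] Lp ℂ 2 μ) (k₀ : ℝ → ℝ≥0∞) (r₀ : ℝ)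
    (a g' Q R : ℝ≥0∞) (κ : ℝ) : Prop :=
  ∀ (ν : Measure ℝ) [IsFiniteMeasure ν] (b : ℝ → ℝ), Measurable b → ∀ A : ℝ≥0∞,
    (∀ y, ∫⁻ z, k₀ (b z - y) ^ (r₀ / 2) ∂ν ≤ A) →
    ∀ ψ : ℝ → Lp ℂ 2 μ, StronglyMeasurable ψ → Integrable ψ ν →
      eLpNorm (fun t => eLpNorm (pathInt U b ν retarded ψ t) Q μ) R ν
        ≤ A ^ κ * eLpNorm (fun z => eLpNorm (ψ z) a μ) g' ν

lemma eLpNorm_restrict_eq_cumNorm {V : Type*} [NormedAddCommGroup V] (hg0 : g' ≠ 0)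
    (hgt : g' ≠ ∞) (f : ℝ → V) (s e : ℝ) :
    eLpNorm f g' (volume.restrict (Set.Ioc s e)) = cumNorm s g'.toReal (fun σ => ‖f σ‖ₑ) e := by
  rw [eLpNorm_eq_lintegral_rpow_enorm_toReal hg0 hgt, cumNorm]

lemma eLpNorm_indicator_cumNorm_le {V : Type*} [NormedAddCommGroup V] (hg0 : g' ≠ 0)
    (hgt : g' ≠ ∞) (f : ℝ → V) (s e : ℝ) (C : ℝ≥0∞) :
    eLpNorm ({σ | cumNorm s g'.toReal (fun σ => ‖f σ‖ₑ) σ ≤ C}.indicator f) g'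
      (volume.restrict (Set.Ioc s e)) ≤ C := by
  have hg : 0 < g'.toReal := ENNReal.toReal_pos hg0 hgt
  have hm := measurableSet_cumNorm_le (s := s) (h := fun σ => ‖f σ‖ₑ) hg C
  rw [eLpNorm_indicator_eq_eLpNorm_restrict hm, eLpNorm_eq_lintegral_rpow_enorm_toReal hg0 hgt,
    Measure.restrict_restrict hm, Set.inter_comm]
  refine (ENNReal.rpow_le_rpow (setLIntegral_cumNorm_le hg e C) (by positivity)).trans_eq ?_
  rw [← ENNReal.rpow_mul, mul_one_div_cancel hg.ne', ENNReal.rpow_one]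

/-- A pathwise retarded estimate in terms of the values of `S` at the times at which the norm of `f`
passes the powers of two. -/
lemma eLpNorm_extInt_le_levels {Ω : Type*} [IsSeparable μ] (hU : IsIsometricFlow U)
    (hest : RetardedEstimate U k₀ r₀ a g' Q R κ) (hk₀ : Measurable k₀)
    (ha : a ≠ ∞) (hd : d ≠ ∞) (hkm : Measurable k)
    (hk : ∀ t u, eLpNorm (U t u) d μ ≤ k t * eLpNorm u a μ) (hkt : ∀ t, t ≠ 0 → k t ≠ ∞)
    (hg' : 1 ≤ g') (hgt : g' ≠ ∞) (hQ : 1 ≤ Q) (hR : 1 ≤ R) {s e : ℝ} (hse : s < e)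
    {b : ℝ → Ω → ℝ} {f : ℝ → Ω → Lp ℂ a μ} {S : ℝ → Ω → ℝ≥0∞} {ω : Ω}
    (hb : Measurable fun t => b t ω) (hf : StronglyMeasurable fun t => f t ω)
    (hY : KernelBound k (fun t => b t ω) (volume.restrict (Set.Ioc s e)) g')
    (hfi : eLpNorm (fun t => f t ω) g' (volume.restrict (Set.Ioc s e)) ≠ ∞)
    (hS : ∀ u ∈ Set.Icc s e, ∀ y, ∫⁻ t in Set.Ioc u e, k₀ (b t ω - y) ^ (r₀ / 2) ≤ S u ω) :
    eLpNorm (fun t => eLpNorm (extInt U (fun t => b t ω) (volume.restrict (Set.Ioc s e)) retarded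
        a d (fun t => f t ω) t) Q μ) R (volume.restrict (Set.Ioc s e))
      ≤ ∑' j : ℤ, {j : ℤ | (2 : ℝ≥0∞) ^ j < cumNorm s g'.toReal (fun σ => ‖f σ ω‖ₑ) e}.indicator
        (fun j => 2 ^ (j + 1) * levelBound s e
          (fun t ω => cumNorm s g'.toReal (fun σ => ‖f σ ω‖ₑ) t) S (2 ^ j) ω ^ κ) j := by
  have hg0 : g' ≠ 0 := (lt_of_lt_of_le one_pos hg').ne'
  have hg : 0 < g'.toReal := ENNReal.toReal_pos hg0 hgt
  have hmono : ∀ ω, Monotone fun t => cumNorm s g'.toReal (fun σ => ‖f σ ω‖ₑ) t :=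
    fun ω => cumNorm_mono hg
  have hint := ae_integrable_extInt_integrand hU hb measurableSet_retarded ha hd hkm hk hkt hY hf hfi
  refine eLpNorm_extInt_le_tsum (k := k) (g' := g') (b := fun t => b t ω) (f := fun t => f t ω)
    (ν := volume.restrict (Set.Ioc s e)) (B := cumNorm s g'.toReal fun σ => ‖f σ ω‖ₑ)
    (Λ := fun j => levelBound s e
      (fun t ω => cumNorm s g'.toReal (fun σ => ‖f σ ω‖ₑ) t) S (2 ^ j) ω ^ κ)
    hU hb ha hd hk hkt hf hint (hmono ω) (by rwa [← eLpNorm_restrict_eq_cumNorm hg0 hgt]) ?_ ?_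
    (fun C _ => eLpNorm_indicator_cumNorm_le hg0 hgt _ s e C) hQ hR ?_
  · filter_upwards [ae_restrict_mem measurableSet_Ioc] with σ hσ using hmono ω hσ.2
  · filter_upwards [ae_eq_zero_of_cumNorm_eq_zero hg hf.enorm e] with σ hσ h0
    exact enorm_eq_zero.1 (hσ h0)
  · intro j hj ψ hψ hψi
    set V := {t | 2 ^ j < cumNorm s g'.toReal (fun σ => ‖f σ ω‖ₑ) t} with hV
    have hVm : MeasurableSet V := (hmono ω).measurable measurableSet_Ioi
    have hA : ∀ y, ∫⁻ z, k₀ (b z ω - y) ^ (r₀ / 2) ∂((volume.restrict (Set.Ioc s e)).restrict V)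
        ≤ levelBound s e (fun t ω => cumNorm s g'.toReal (fun σ => ‖f σ ω‖ₑ) t) S (2 ^ j) ω := by
      intro y
      rw [Measure.restrict_restrict hVm, Set.inter_comm]
      refine setLIntegral_level_le hse hmono ?_ (fun σ h1 h2 => exists_lt_cumNorm hg h1 h2)
        ((hk₀.comp (hb.sub_const y)).pow_const _) fun u hu => hS u hu y
      rw [cumNorm_self hg]
      exact zero_le
    have hψV : eLpNorm ψ g' ((volume.restrict (Set.Ioc s e)).restrict V) ≠ ∞ :=
      ne_top_of_le_ne_top hψi (eLpNorm_restrict_le _ _ _ _)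
    have hpath := hest ((volume.restrict (Set.Ioc s e)).restrict V) _ hb _ hA
    refine (eLpNorm_extInt_le (k := k) hU hb measurableSet_retarded ha hd hkm hk hkt hg' hgt
      (hY.restrict hVm) hψ hψV hj hpath).trans ?_
    exact mul_le_mul_right (eLpNorm_restrict_le ψ g' _ V) _

end Pathwise

section Moments

lemma ae_ne_top_of_eLpNorm_ne_top {Z : Type*} [MeasurableSpace Z] {ν : Measure Z} {ρ : ℝ≥0∞}
    (hρ : ρ ≠ 0) {h : Z → ℝ≥0∞} (hh : Measurable h) (hi : eLpNorm h ρ ν ≠ ∞) :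
    ∀ᵐ z ∂ν, h z ≠ ∞ := by
  rcases eq_or_ne ρ ∞ with rfl | hρt
  · rw [eLpNorm_exponent_top] at hi
    filter_upwards [ae_le_eLpNormEssSup (f := h) (μ := ν)] with z hz
    exact ne_top_of_le_ne_top hi (by simpa using hz)
  · have hρp : 0 < ρ.toReal := ENNReal.toReal_pos hρ hρt
    rw [eLpNorm_ennreal_eq hρ hρt] at hi
    have h1 : ∫⁻ z, h z ^ ρ.toReal ∂ν ≠ ∞ := fun h1 => by
      rw [h1, ENNReal.top_rpow_of_pos (by positivity)] at hi
      exact hi rfl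
    filter_upwards [ae_lt_top (hh.pow_const _) h1] with z hz h2
    rw [h2, ENNReal.top_rpow_of_pos hρp] at hz
    exact lt_irrefl _ hz

variable {X : Type*} [MeasurableSpace X] {μ : Measure X}
  {U : ℝ → Lp ℂ 2 μ →L[ℂ] Lp ℂ 2 μ} {k : ℝ → ℝ≥0∞}
  {a d : ℝ≥0∞} [Fact (1 ≤ a)] [Fact (1 ≤ d)] {g' Q R : ℝ≥0∞} {κ : ℝ}
  {Ω : Type*} {mΩ : MeasurableSpace Ω} {P : Measure Ω} {F : ℝ → MeasurableSpace Ω} {b : ℝ → Ω → ℝ}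

/-- The retarded estimate along the paths of a process with transition densities. -/
lemma eLpNorm_eLpNorm_extInt_le [IsSeparable μ] [IsProbabilityMeasure P] (hU : IsIsometricFlow U)
    (hb : HasTransitionBound P F b) {C c : ℝ≥0} {α r₀ : ℝ} (hC : 1 ≤ C) (hα : 0 ≤ α) (hr₀ : 2 ≤ r₀)
    (hest : RetardedEstimate U (dispKernel C c α) r₀ a g' Q R κ) (hκ : 0 < κ) (hκ1 : κ ≤ 1)
    (ha : a ≠ ∞) (hd : d ≠ ∞) (hkm : Measurable k)
    (hk : ∀ t u, eLpNorm (U t u) d μ ≤ k t * eLpNorm u a μ) (hkt : ∀ t, t ≠ 0 → k t ≠ ∞)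
    (hg' : 1 ≤ g') (hgt : g' ≠ ∞) (hQ : 1 ≤ Q) (hR : 1 ≤ R) {s T : ℝ} (hs : 0 ≤ s) (hT : 0 < T)
    {T₀ : ℝ≥0∞} (hTT : ENNReal.ofReal T ≤ T₀) (hT₀ : T₀ = ∞ → c = 0)
    {ρ : ℝ≥0∞} (hρ : 1 ≤ ρ) (hρt : ρ ≠ ∞) {N : ℕ} (hN : α * r₀ / 2 * (N + 1) < N)
    (hNρ : 2 * ρ.toReal ≤ N + 1) {f : ℝ → Ω → Lp ℂ a μ}
    (hf : StronglyMeasurable (Function.uncurry f))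
    (hfF : ∀ t ∈ Set.Icc s (s + T),
      Measurable[F t] fun ω => cumNorm s g'.toReal (fun σ => ‖f σ ω‖ₑ) t)
    (hY : ∀ᵐ ω ∂P, KernelBound k (fun t => b t ω) (volume.restrict (Set.Ioc s (s + T))) g')
    (hfi : eLpNorm (fun ω => eLpNorm (fun t => f t ω) g' (volume.restrict (Set.Ioc s (s + T)))) ρ P
      ≠ ∞) :
    eLpNorm (fun ω => eLpNorm (fun t => eLpNorm (extInt U (fun t => b t ω)
        (volume.restrict (Set.Ioc s (s + T))) retarded a d (fun t => f t ω) t) Q μ) R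
        (volume.restrict (Set.Ioc s (s + T)))) ρ P
      ≤ 40 * (kernelConst C c r₀ (α * r₀ / 2) N T₀
          * ENNReal.ofReal (T ^ (1 - α * r₀ / 2 / 2))) ^ κ
        * eLpNorm (fun ω => eLpNorm (fun t => f t ω) g' (volume.restrict (Set.Ioc s (s + T)))) ρ P := by
  set e := s + T with he
  have hse : s < e := by linarith
  have hg0 : g' ≠ 0 := (lt_of_lt_of_le one_pos hg').ne'
  have hg : 0 < g'.toReal := ENNReal.toReal_pos hg0 hgt
  have hρ0 : ρ ≠ 0 := (lt_of_lt_of_le one_pos hρ).ne'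
  have hρ1 : 1 ≤ ρ.toReal := by
    rw [← ENNReal.toReal_one]
    exact (ENNReal.toReal_le_toReal (by simp) hρt).2 hρ
  have hρp : 0 < ρ.toReal := by linarith
  have ha0 : 0 ≤ α * r₀ / 2 := by positivity
  set A := kernelConst C c r₀ (α * r₀ / 2) N T₀ * ENNReal.ofReal (T ^ (1 - α * r₀ / 2 / 2)) with hA
  have hA0 : A ≠ 0 := mul_ne_zero (kernelConst_ne_zero hC) (by simp; positivity)
  have hAt : A ≠ ∞ := ENNReal.mul_ne_top (kernelConst_ne_top hr₀ ha0 hN hT₀) (by simp)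
  set B : ℝ → Ω → ℝ≥0∞ := fun t ω => cumNorm s g'.toReal (fun σ => ‖f σ ω‖ₑ) t with hB
  have hBe : ∀ ω, eLpNorm (fun t => f t ω) g' (volume.restrict (Set.Ioc s e)) = B e ω := fun ω =>
    eLpNorm_restrict_eq_cumNorm hg0 hgt _ s e
  simp only [hBe] at hfi ⊢
  have hBm : Measurable (B e) := (hfF e ⟨hse.le, le_rfl⟩).mono (hb.le e) le_rfl
  have hBfin : ∀ᵐ ω ∂P, B e ω ≠ ∞ := ae_ne_top_of_eLpNorm_ne_top hρ0 hBm hfi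
  set S : ℝ → Ω → ℝ≥0∞ := kernelSup b C c r₀ (α * r₀ / 2) e T N with hS
  set Y : Ω → ℝ≥0∞ := fun ω => eLpNorm (fun t => eLpNorm (extInt U (fun t => b t ω)
        (volume.restrict (Set.Ioc s e)) retarded a d (fun t => f t ω) t) Q μ) R
        (volume.restrict (Set.Ioc s e)) with hYdef
  have hmain := lintegral_rpow_le_of_levels (P := P) (F := F) (B := B) (S := S) (Y := Y)
    (m := ((N + 1 : ℕ) : ℝ)) (K := A) (κ := κ) (ρ := ρ.toReal) hse.le hb.le hb.mono
    (fun ω => cumNorm_mono hg) hfF (fun t => measurable_kernelSup hb.measurable C c _ _ _ _ N t)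
    hA0 hAt ?_ hκ hρ1 ?_ ?_
  · rw [eLpNorm_ennreal_eq hρ0 hρt, eLpNorm_ennreal_eq hρ0 hρt]
    refine (ENNReal.rpow_le_rpow hmain (by positivity)).trans ?_
    have h5 : (5 : ℝ≥0∞) * 8 ^ ρ.toReal ≤ 40 ^ ρ.toReal := by
      have : (40 : ℝ≥0∞) = 5 * 8 := by norm_num
      rw [this, ENNReal.mul_rpow_of_nonneg _ _ hρp.le]
      gcongr
      simpa using ENNReal.rpow_le_rpow_of_exponent_le (x := 5) (by norm_num) hρ1
    rw [ENNReal.mul_rpow_of_nonneg _ _ (by positivity)]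
    gcongr
    refine (ENNReal.rpow_le_rpow (mul_le_mul_left h5 _) (by positivity)).trans_eq ?_
    rw [← ENNReal.mul_rpow_of_nonneg _ _ hρp.le, ← ENNReal.rpow_mul, mul_one_div_cancel hρp.ne',
      ENNReal.rpow_one]
  · intro u hu D hD
    have hDm : Measurable[F u] (D.indicator (1 : Ω → ℝ≥0∞)) :=
      Measurable.indicator (@measurable_const _ _ _ (F u) 1) hD
    have h1 := lintegral_mul_kernelSup_pow_le (R := r₀) (C := C) (c := c) (e := e) hb ha0 hT hTT N
      (hs.trans hu.1) (by linarith [hu.1]) hDm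
    have hD' : MeasurableSet D := hb.le u _ hD
    rw [lintegral_indicator_one hD'] at h1
    simp only [ENNReal.rpow_natCast]
    refine le_trans (le_of_eq ?_) h1
    rw [← lintegral_indicator hD']
    congr with ω
    by_cases hω : ω ∈ D <;> simp [hω, hS]
  · push_cast
    nlinarith
  · filter_upwards [hY, hBfin] with ω hYω hBω
    refine eLpNorm_extInt_le_levels (k := k) hU hest (measurable_dispKernel C c α) ha hd hkm hk
      hkt hg' hgt hQ hR hse (hb.measurable.comp (measurable_id.prodMk measurable_const))
      (hf.comp_measurable (measurable_id.prodMk measurable_const)) hYω ?_ fun u hu y =>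
        lintegral_dispKernel_le_kernelSup hb.measurable hr₀ hα hT N (by linarith [hu.1]) ω y
    rwa [hBe]

end Moments

section Estimates

variable {X : Type*} [MeasurableSpace X] {μ : Measure X}
  {U : ℝ → Lp ℂ 2 μ →L[ℂ] Lp ℂ 2 μ} {k : ℝ → ℝ≥0∞} {p q r : ℝ≥0∞}

lemma retardedEstimate_interpolate [IsSeparable μ] (hU : IsIsometricFlow U)
    (hpq : p.HolderConjugate q) (hp : 2 ≤ p) (hp' : p ≠ ∞)
    (hk : ∀ t u, eLpNorm (U t u) p μ ≤ k t * eLpNorm u q μ) (hkm : Measurable k)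
    (hke : ∀ t, k (-t) = k t) (hr : 2 ≤ r) (hrt : r ≠ ∞) {r' : ℝ≥0∞} (hrr : r.HolderConjugate r')
    {g d : ℝ≥0∞} (hg0 : g ≠ 0) (hd : 2 ≤ d) (hdt : d ≠ ∞) {l : ℝ} (hl : l ∈ Set.Icc (0 : ℝ) 1)
    (hg : (g⁻¹).toReal = (1 - l) * (r⁻¹).toReal)
    (hdl : (d⁻¹).toReal = l / 2 + (1 - l) * (p⁻¹).toReal) :
    RetardedEstimate U k r.toReal q r' d g (2 / r.toReal * (1 - l / 2)) :=
  fun _ _ _ hb _ hA _ hψ hψi => eLpNorm_pathInt_le_interpolate hU hpq hp hp' hk hkm hke hb hr hrt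
    hrr hA measurableSet_retarded hg0 hd hdt hl hg hdl hψ hψi

lemma retardedEstimate_dual [IsSeparable μ] (hU : IsIsometricFlow U)
    (hpq : p.HolderConjugate q) (hp : 2 ≤ p) (hp' : p ≠ ∞)
    (hk : ∀ t u, eLpNorm (U t u) p μ ≤ k t * eLpNorm u q μ) (hkm : Measurable k)
    (hke : ∀ t, k (-t) = k t) (hr : 2 ≤ r) (hrt : r ≠ ∞)
    {g g' d d' : ℝ≥0∞} (hgg : g.HolderConjugate g') (hdd : d.HolderConjugate d')
    (hd : 2 ≤ d) (hdt : d ≠ ∞) {l : ℝ} (hl : l ∈ Set.Icc (0 : ℝ) 1)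
    (hg : (g⁻¹).toReal = (1 - l) * (r⁻¹).toReal)
    (hdl : (d⁻¹).toReal = l / 2 + (1 - l) * (p⁻¹).toReal) :
    RetardedEstimate U k r.toReal d' g' p r (2 / r.toReal * (1 - l / 2)) :=
  fun _ _ _ hb _ hA _ hψ hψi => eLpNorm_pathInt_le_dual hU hpq hp hp' hk hkm hke hb hr hrt
    hA measurableSet_retarded hgg hdd hd hdt hl hg hdl hψ hψi

lemma exists_nat_mul_lt {a : ℝ} (ha : a < 1) (x : ℝ) : ∃ N : ℕ, a * (N + 1) < N ∧ x ≤ N + 1 := by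
  obtain ⟨N, hN⟩ := exists_nat_gt (max (a / (1 - a)) x)
  refine ⟨N, ?_, ?_⟩
  · have h1 := (le_max_left _ _).trans_lt hN
    rw [div_lt_iff₀ (by linarith)] at h1
    linarith
  · linarith [(le_max_right _ _).trans_lt hN]

variable {Ω : Type*} {mΩ : MeasurableSpace Ω} {P : Measure Ω} {F : ℝ → MeasurableSpace Ω}
  {b : ℝ → Ω → ℝ}

lemma kernelBound_of_forall_le {Z : Type*} [MeasurableSpace Z] {ν : Measure Z} [IsFiniteMeasure ν]
    {β : Z → ℝ} (hkm : Measurable k) (hke : ∀ t, k (-t) = k t) (hβ : Measurable β)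
    (hr : 2 ≤ r) (hrt : r ≠ ∞) {r' : ℝ≥0∞} (hrr : r.HolderConjugate r') {A : ℝ≥0∞} (hAt : A ≠ ∞)
    (hA : ∀ y, ∫⁻ z, k (β z - y) ^ (r.toReal / 2) ∂ν ≤ A) : KernelBound k β ν r' := by
  have hr2 := two_le_toReal hr hrt
  refine ⟨A ^ (2 / r.toReal) * eLpNorm (fun _ : Z => (1 : ℝ≥0∞)) r' ν, ENNReal.mul_ne_top
    (ENNReal.rpow_ne_top_of_nonneg (by positivity) hAt) ?_, fun c hc => ?_⟩
  · exact (memLp_const_enorm (c := (1 : ℝ≥0∞)) (by simp)).2.ne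
  · have h1 := lintegral_lintegral_kernel_le (ν := ν) hr hrt hrr (K := fun z z' => k (β z - β z'))
      (hkm.comp ((hβ.comp measurable_fst).sub (hβ.comp measurable_snd))) (A := A) (fun z => ?_)
      (fun z' => hA _) (a := fun _ => 1) measurable_const hc
    · simpa using h1
    · refine le_trans (le_of_eq ?_) (hA (β z))
      congr with z'
      rw [← hke, neg_sub]

lemma ae_kernelBound [IsProbabilityMeasure P] (hb : HasTransitionBound P F b) (C c : ℝ≥0) {α : ℝ}
    (hα : 0 ≤ α) (hr : 2 ≤ r) (hrt : r ≠ ∞) {r' : ℝ≥0∞} (hrr : r.HolderConjugate r')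
    (ha : α * r.toReal / 2 < 1) {s T : ℝ} (hs : 0 ≤ s) (hT : 0 < T) :
    ∀ᵐ ω ∂P, KernelBound (dispKernel C c α) (fun t => b t ω)
      (volume.restrict (Set.Ioc s (s + T))) r' := by
  have hr2 := two_le_toReal hr hrt
  have ha0 : 0 ≤ α * r.toReal / 2 := by positivity
  obtain ⟨N, hN, -⟩ := exists_nat_mul_lt ha 0
  have h1 := lintegral_mul_kernelSup_pow_le (R := r.toReal) (C := C) (c := c) (e := s + T) hb ha0 hT
    le_rfl N hs (by linarith) (H := fun _ => 1) measurable_const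
  have hm := measurable_kernelSup hb.measurable C c r.toReal (α * r.toReal / 2) (s + T) T N s
  simp only [one_mul, lintegral_one, measure_univ, mul_one] at h1
  have hfin := ae_lt_top (hm.pow_const (N + 1)) (ne_top_of_le_ne_top (ENNReal.pow_ne_top
    (ENNReal.mul_ne_top (kernelConst_ne_top hr2 ha0 hN (by simp)) (by simp))) h1)
  filter_upwards [hfin] with ω hω
  have hω' : kernelSup b C c r.toReal (α * r.toReal / 2) (s + T) T N s ω ≠ ∞ := fun h => by
    rw [h, ENNReal.top_pow (Nat.succ_ne_zero N)] at hω
    exact lt_irrefl _ hω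
  exact kernelBound_of_forall_le (measurable_dispKernel C c α) (dispKernel_neg C c α)
    (hb.measurable.comp (measurable_id.prodMk measurable_const)) hr hrt hrr hω' fun y =>
      lintegral_dispKernel_le_kernelSup hb.measurable hr2 hα hT N (by linarith) ω y

lemma lintegral_mul_le_of_lintegral_mul_pow_le {H S : Ω → ℝ≥0∞} (hH : Measurable H)
    (hS : Measurable S) {K : ℝ≥0∞} (hK0 : K ≠ 0) (hK : K ≠ ∞) {N : ℕ}
    (h : ∫⁻ ω, H ω * S ω ^ (N + 1) ∂P ≤ K ^ (N + 1) * ∫⁻ ω, H ω ∂P) :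
    ∫⁻ ω, H ω * S ω ∂P ≤ 2 * K * ∫⁻ ω, H ω ∂P := by
  have hm : Measurable fun ω => H ω * S ω ^ (N + 1) := hH.mul (hS.pow_const _)
  have hpt : ∀ ω, H ω * S ω ≤ K * H ω + K * (K ^ (N + 1))⁻¹ * (H ω * S ω ^ (N + 1)) := by
    intro ω
    have h1 : S ω / K ≤ 1 + (S ω / K) ^ (N + 1) := by
      rcases le_total (S ω / K) 1 with h1 | h1
      · exact h1.trans le_self_add
      · exact (le_self_pow₀ h1 (Nat.succ_ne_zero N)).trans le_add_self
    have h2 : S ω = K * (S ω / K) := (ENNReal.mul_div_cancel hK0 hK).symm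
    calc H ω * S ω = H ω * (K * (S ω / K)) := by rw [← h2]
      _ ≤ H ω * (K * (1 + (S ω / K) ^ (N + 1))) := by gcongr
      _ = _ := by
        rw [div_eq_mul_inv, mul_pow, ENNReal.inv_pow]
        ring
  calc _ ≤ ∫⁻ ω, (K * H ω + K * (K ^ (N + 1))⁻¹ * (H ω * S ω ^ (N + 1))) ∂P := lintegral_mono hpt
    _ = K * ∫⁻ ω, H ω ∂P + K * (K ^ (N + 1))⁻¹ * ∫⁻ ω, H ω * S ω ^ (N + 1) ∂P := by
        rw [lintegral_add_left (hH.const_mul K), lintegral_const_mul _ hH, lintegral_const_mul _ hm]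
    _ ≤ K * ∫⁻ ω, H ω ∂P + K * (K ^ (N + 1))⁻¹ * (K ^ (N + 1) * ∫⁻ ω, H ω ∂P) := by gcongr
    _ = _ := by
        rw [mul_assoc K, ← mul_assoc _ (K ^ (N + 1)),
          ENNReal.inv_mul_cancel (pow_ne_zero _ hK0) (ENNReal.pow_ne_top hK), one_mul]
        ring

/-- The homogeneous estimate along the paths of a process with transition densities. -/
lemma eLpNorm_eLpNorm_flow_le [IsSeparable μ] [IsProbabilityMeasure P] (hU : IsIsometricFlow U)
    (hb : HasTransitionBound P F b) {C c : ℝ≥0} {α : ℝ} (hC : 1 ≤ C) (hα : 0 ≤ α)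
    (hpq : p.HolderConjugate q) (hp : 2 ≤ p) (hp' : p ≠ ∞) (hr : 2 ≤ r) (hrt : r ≠ ∞)
    (hk : ∀ t u, eLpNorm (U t u) p μ ≤ dispKernel C c α t * eLpNorm u q μ)
    {s T : ℝ} (hs : 0 ≤ s) (hT : 0 < T)
    {T₀ : ℝ≥0∞} (hTT : ENNReal.ofReal T ≤ T₀) (hT₀ : T₀ = ∞ → c = 0) {N : ℕ}
    (hN : α * r.toReal / 2 * (N + 1) < N) {x : Ω → Lp ℂ 2 μ} (hx : StronglyMeasurable[F s] x) :
    eLpNorm (fun ω => eLpNorm (fun t => eLpNorm (U (b t ω - b s ω) (x ω)) p μ) r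
        (volume.restrict (Set.Ioc s (s + T)))) r P
      ≤ (2 * (kernelConst C c r.toReal (α * r.toReal / 2) N T₀
          * ENNReal.ofReal (T ^ (1 - α * r.toReal / 2 / 2)))) ^ (1 / r.toReal) * eLpNorm x r P := by
  have hr2 := two_le_toReal hr hrt
  have hrp : 0 < r.toReal := by linarith
  have hr0 : r ≠ 0 := (lt_of_lt_of_le (by norm_num) hr).ne'
  have ha0 : 0 ≤ α * r.toReal / 2 := by positivity
  set A := kernelConst C c r.toReal (α * r.toReal / 2) N T₀
    * ENNReal.ofReal (T ^ (1 - α * r.toReal / 2 / 2)) with hA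
  have hA0 : A ≠ 0 := mul_ne_zero (kernelConst_ne_zero hC) (by simp; positivity)
  have hAt : A ≠ ∞ := ENNReal.mul_ne_top (kernelConst_ne_top hr2 ha0 hN hT₀) (by simp)
  set S := kernelSup b C c r.toReal (α * r.toReal / 2) (s + T) T N s with hS
  have hSm : Measurable S := measurable_kernelSup hb.measurable _ _ _ _ _ _ _ _
  have hpath : ∀ ω, eLpNorm (fun t => eLpNorm (U (b t ω - b s ω) (x ω)) p μ) r
      (volume.restrict (Set.Ioc s (s + T))) ≤ S ω ^ (1 / r.toReal) * ‖x ω‖ₑ := fun ω =>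
    eLpNorm_flow_le (ν := volume.restrict (Set.Ioc s (s + T))) (β := fun t => b t ω) hU hpq hp hp' hk
      (measurable_dispKernel C c α) (dispKernel_neg C c α)
      (hb.measurable.comp (measurable_id.prodMk measurable_const)) hr hrt
      (fun y => lintegral_dispKernel_le_kernelSup hb.measurable hr2 hα hT N (by linarith) ω y) _ _
  have hHm : Measurable[F s] fun ω => ‖x ω‖ₑ ^ r.toReal :=
    hx.enorm.pow_const _
  have h1 := lintegral_mul_le_of_lintegral_mul_pow_le (hHm.mono (hb.le s) le_rfl) hSm hA0 hAt
    (lintegral_mul_kernelSup_pow_le (R := r.toReal) (C := C) (c := c) (e := s + T) hb ha0 hT hTT N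
      hs (by linarith) hHm)
  rw [eLpNorm_ennreal_eq hr0 hrt, eLpNorm_eq_lintegral_rpow_enorm_toReal hr0 hrt,
    ← ENNReal.mul_rpow_of_nonneg _ _ (by positivity)]
  refine ENNReal.rpow_le_rpow (le_trans (lintegral_mono fun ω => ?_) h1) (by positivity)
  refine (ENNReal.rpow_le_rpow (hpath ω) hrp.le).trans_eq ?_
  rw [ENNReal.mul_rpow_of_nonneg _ _ hrp.le, ← ENNReal.rpow_mul, one_div_mul_cancel hrp.ne',
    ENNReal.rpow_one, mul_comm]

lemma eLpNorm_extInt_le_eLpNorm_one {Z : Type*} [MeasurableSpace Z] {ν : Measure Z} {β : Z → ℝ}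
    {E : Set (Z × Z)} {a d : ℝ≥0∞} [Fact (1 ≤ a)] [Fact (1 ≤ d)] (ha : a ≠ ∞)
    (hk : ∀ t u, eLpNorm (U t u) d μ ≤ 1 * eLpNorm u a μ) (f : Z → Lp ℂ a μ) :
    eLpNorm (fun t => eLpNorm (extInt U β ν E a d f t) d μ) ∞ ν ≤ eLpNorm f 1 ν := by
  rw [eLpNorm_exponent_top]
  refine essSup_le_of_ae_le _ (ae_of_all _ fun t => ?_)
  simp only [enorm_eq_self]
  rw [← Lp.enorm_def, eLpNorm_one_eq_lintegral_enorm]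
  refine (enorm_integral_le_lintegral_enorm _).trans (lintegral_mono fun σ => ?_)
  simpa using enorm_extInt_integrand_le (k := fun _ => 1) (β := β) (E := E) (f := f) ha hk t σ

lemma kernelBound_one {Z : Type*} [MeasurableSpace Z] {ν : Measure Z} [IsFiniteMeasure ν]
    (β : Z → ℝ) : KernelBound (fun _ => 1) β ν 1 :=
  ⟨ν Set.univ, measure_ne_top _ _, fun c _ => by simp [eLpNorm_one_eq_lintegral_enorm, mul_comm]⟩

end Estimates

section Predictable

variable {Ω : Type*} {mΩ : MeasurableSpace Ω} {ℱ : Filtration ℝ≥0 mΩ} {V : Type*}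
  [NormedAddCommGroup V] {f : ℝ≥0 → Ω → V}

lemma predictable_le_prod (ℱ : Filtration ℝ≥0 mΩ) :
    ℱ.predictable ≤ (inferInstance : MeasurableSpace (ℝ≥0 × Ω)) := by
  refine MeasurableSpace.generateFrom_le ?_
  rintro - (⟨A, hA, rfl⟩ | ⟨i, A, hA, rfl⟩)
  · exact (measurableSet_singleton _).prod (ℱ.le _ _ hA)
  · exact measurableSet_Ioi.prod (ℱ.le _ _ hA)

lemma MeasureTheory.IsStronglyPredictable.stronglyMeasurable_toNNReal (hf : IsStronglyPredictable ℱ f) :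
    StronglyMeasurable (Function.uncurry fun (t : ℝ) ω => f t.toNNReal ω) := by
  have h1 : StronglyMeasurable (Function.uncurry f) := hf.mono (predictable_le_prod ℱ)
  exact h1.comp_measurable ((measurable_real_toNNReal.comp measurable_fst).prodMk measurable_snd)

lemma measurable_setLIntegral_of_uncurry {m : MeasurableSpace Ω} {H : ℝ → Ω → ℝ≥0∞}
    (hH : Measurable (Function.uncurry H)) (s t : ℝ) :
    Measurable fun ω => ∫⁻ σ in Set.Ioc s t, H σ ω :=
  (hH.comp measurable_swap).lintegral_prod_right'

lemma measurable_comp_min {m : MeasurableSpace Ω} {i : ℝ≥0}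
    (hf : StronglyMeasurable fun p : Set.Iic i × Ω => f p.1 p.2) :
    Measurable (Function.uncurry fun (σ : ℝ) ω => ‖f (min σ.toNNReal i) ω‖ₑ) := by
  have h : Measurable fun z : ℝ × Ω => ((⟨min z.1.toNNReal i, Set.mem_Iic.2 (min_le_right _ _)⟩ : Set.Iic i), z.2) :=
    (Measurable.subtype_mk ((measurable_real_toNNReal.comp measurable_fst).min
      measurable_const)).prodMk measurable_snd
  exact (hf.comp_measurable h).enorm

lemma MeasureTheory.IsStronglyPredictable.measurable_cumNorm (hf : IsStronglyPredictable ℱ f) (s g t : ℝ) :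
    Measurable[ℱ t.toNNReal] fun ω => cumNorm s g (fun σ => ‖f σ.toNNReal ω‖ₑ) t := by
  have h1 := measurable_setLIntegral_of_uncurry (m := ℱ t.toNNReal)
    (H := fun σ ω => ‖f (min σ.toNNReal t.toNNReal) ω‖ₑ ^ g)
    (Measurable.pow_const (measurable_comp_min (m := ℱ t.toNNReal)
      (hf.isStronglyProgressive t.toNNReal)) g) s t
  have h2 : (fun ω => cumNorm s g (fun σ => ‖f σ.toNNReal ω‖ₑ) t)
      = fun ω => (∫⁻ σ in Set.Ioc s t, ‖f (min σ.toNNReal t.toNNReal) ω‖ₑ ^ g) ^ (1 / g) := by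
    funext ω
    unfold cumNorm
    congr 1
    refine setLIntegral_congr_fun measurableSet_Ioc fun σ hσ => ?_
    simp only
    rw [min_eq_left (Real.toNNReal_le_toNNReal hσ.2)]
  rw [h2]
  exact h1.pow_const _

end Predictable

namespace MetricGraph

variable {G : MetricGraph} {K : G.Coupling} {Ω : Type*} {mΩ : MeasurableSpace Ω} {P : Measure Ω}

lemma restrict_Icc_eq (s T : ℝ) :
    (volume : Measure ℝ).restrict (Set.Icc s (s + T)) = volume.restrict (Set.Ioc s (s + T)) :=
  Measure.restrict_congr_set Ioc_ae_eq_Icc.symm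

lemma mixedNorm_coeFn (ρ g a : ℝ≥0∞) [Fact (1 ≤ a)] (s T : ℝ≥0) (f : ℝ≥0 → Ω → Lp ℂ a G.measure) :
    G.mixedNorm P ρ g a s T (fun t ω => f t ω)
      = eLpNorm (fun ω => eLpNorm (fun t : ℝ => f t.toNNReal ω) g
        (volume.restrict (Set.Ioc (s : ℝ) (s + T)))) ρ P := by
  unfold mixedNorm
  simp only [restrict_Icc_eq, ← Lp.enorm_def, eLpNorm_enorm]

lemma Coupling.duhamel_eq_extInt {β : ℝ≥0 → Ω → ℝ} {q : ℝ≥0∞} [Fact (1 ≤ q)]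
    (f : ℝ≥0 → Ω → Lp ℂ q.conjExponent G.measure) {s T : ℝ≥0} {t : ℝ}
    (ht : t ∈ Set.Ioc (s : ℝ) (s + T)) (ω : Ω) :
    K.duhamel β q f s t.toNNReal ω = extInt K.group (fun t => β t.toNNReal ω)
      (volume.restrict (Set.Ioc (s : ℝ) (s + T))) retarded q.conjExponent q
      (fun σ => f σ.toNNReal ω) t := by
  have h1 : ∀ σ, retarded.indicator (fun z : ℝ × ℝ =>
      extendLp (K.group (β z.1.toNNReal ω - β z.2.toNNReal ω)) q.conjExponent q (f z.2.toNNReal ω))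
      (t, σ) = (Set.Iic t).indicator (fun σ => K.duhamelIntegrand β q f ω t.toNNReal σ.toNNReal) σ := by
    intro σ
    by_cases h : σ ≤ t
    · rw [Set.indicator_of_mem (show (t, σ) ∈ retarded from h), Set.indicator_of_mem (Set.mem_Iic.2 h)]
      rfl
    · rw [Set.indicator_of_notMem (show (t, σ) ∉ retarded from h),
        Set.indicator_of_notMem (show σ ∉ Set.Iic t from h)]
  unfold extInt duhamel
  simp only [h1]
  rw [setIntegral_indicator measurableSet_Iic, Set.Ioc_inter_Iic, min_eq_right ht.2,
    Real.coe_toNNReal _ (s.2.trans ht.1.le)]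

lemma Coupling.integrableOn_duhamelIntegrand {β : ℝ≥0 → Ω → ℝ} {q : ℝ≥0∞} [Fact (1 ≤ q)]
    {f : ℝ≥0 → Ω → Lp ℂ q.conjExponent G.measure} {s T : ℝ≥0} {t : ℝ}
    (ht : t ∈ Set.Ioc (s : ℝ) (s + T)) {ω : Ω}
    (h : Integrable (fun σ => retarded.indicator (fun z : ℝ × ℝ =>
      extendLp (K.group (β z.1.toNNReal ω - β z.2.toNNReal ω)) q.conjExponent q (f z.2.toNNReal ω))
      (t, σ)) (volume.restrict (Set.Ioc (s : ℝ) (s + T)))) :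
    IntegrableOn (fun σ : ℝ => K.duhamelIntegrand β q f ω t.toNNReal σ.toNNReal)
      (Set.Ioc (s : ℝ) t) := by
  have h1 : IntegrableOn _ (Set.Ioc (s : ℝ) t) volume :=
    IntegrableOn.mono_set h (Set.Ioc_subset_Ioc_right ht.2)
  refine h1.congr_fun (fun σ hσ => ?_) measurableSet_Ioc
  simp only
  rw [Set.indicator_of_mem (show (t, σ) ∈ retarded from hσ.2)]
  rfl

lemma Coupling.stronglyMeasurable_extInt (hU : IsIsometricFlow K.group) {b : ℝ → Ω → ℝ}
    (hb : Measurable (Function.uncurry b)) {a d : ℝ≥0∞} [Fact (1 ≤ a)] [Fact (1 ≤ d)] (ha : a ≠ ∞)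
    (hd : d ≠ ∞) {k : ℝ → ℝ≥0∞}
    (hk : ∀ t u, eLpNorm (K.group t u) d G.measure ≤ k t * eLpNorm u a G.measure)
    (hkt : ∀ t, t ≠ 0 → k t ≠ ∞) {f : ℝ → Ω → Lp ℂ a G.measure}
    (hf : StronglyMeasurable (Function.uncurry f)) (ν : Measure ℝ) [SFinite ν] :
    StronglyMeasurable fun z : Ω × ℝ =>
      extInt K.group (fun t => b t z.1) ν retarded a d (fun t => f t z.1) z.2 := by
  have h1 : Measurable fun y : (Ω × ℝ) × ℝ => b y.1.2 y.1.1 - b y.2 y.1.1 :=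
    (hb.comp ((measurable_snd.comp measurable_fst).prodMk (measurable_fst.comp measurable_fst))).sub
      (hb.comp (measurable_snd.prodMk (measurable_fst.comp measurable_fst)))
  have h2 : StronglyMeasurable fun y : (Ω × ℝ) × ℝ => f y.2 y.1.1 :=
    hf.comp_measurable (measurable_snd.prodMk (measurable_fst.comp measurable_fst))
  have hE : MeasurableSet {y : (Ω × ℝ) × ℝ | (y.1.2, y.2) ∈ retarded} :=
    measurableSet_le measurable_snd (measurable_snd.comp measurable_fst)
  exact ((stronglyMeasurable_extendLp hU ha hd hk hkt h1 h2).indicator hE).integral_prod_right'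
    (ν := ν)

variable {ℱ : Filtration ℝ≥0 mΩ} {β β' : ℝ≥0 → Ω → ℝ}

/-- Well-definedness of the Duhamel integral, and its norm in terms of a continuous version of the
Brownian motion. -/
lemma Coupling.duhamel_wellDefined [SFinite P] (hU : IsIsometricFlow K.group)
    (hb : Measurable (Function.uncurry fun (t : ℝ) ω => β' t.toNNReal ω))
    (hββ : ∀ᵐ ω ∂P, ∀ t, β t ω = β' t ω) {q : ℝ≥0∞} [Fact (1 ≤ q)] (hq : 2 ≤ q) (hqt : q ≠ ∞)
    {k : ℝ → ℝ≥0∞} (hkm : Measurable k)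
    (hk : ∀ t u, eLpNorm (K.group t u) q G.measure ≤ k t * eLpNorm u q.conjExponent G.measure)
    (hkt : ∀ t, t ≠ 0 → k t ≠ ∞) {g' ρ : ℝ≥0∞} (hg0 : g' ≠ 0) (hgt : g' ≠ ∞) (hρ : ρ ≠ 0) {s T : ℝ≥0}
    (hY : ∀ᵐ ω ∂P, KernelBound k (fun t => β' t.toNNReal ω)
      (volume.restrict (Set.Ioc (s : ℝ) (s + T))) g')
    {f : ℝ≥0 → Ω → Lp ℂ q.conjExponent G.measure} (hf : IsStronglyPredictable ℱ f)
    (hfi : G.mixedNorm P ρ g' q.conjExponent s T (fun t ω => f t ω) < ∞) :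
    K.DuhamelWellDefined P β q f s T ∧ ∀ Q R, G.mixedNorm P ρ R Q s T
      (fun t ω => K.duhamel β q f s t ω) = eLpNorm (fun ω => eLpNorm (fun t => eLpNorm
        (extInt K.group (fun t => β' t.toNNReal ω) (volume.restrict (Set.Ioc (s : ℝ) (s + T)))
          retarded q.conjExponent q (fun t => f t.toNNReal ω) t) Q G.measure) R
        (volume.restrict (Set.Ioc (s : ℝ) (s + T)))) ρ P := by
  have ha : q.conjExponent ≠ ∞ := holderConjugate_ne_top
    (ENNReal.HolderConjugate.conjExponent (le_trans (by norm_num) hq)) hq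
  have hfm := hf.stronglyMeasurable_toNNReal
  rw [mixedNorm_coeFn] at hfi
  have hfin : ∀ᵐ ω ∂P, eLpNorm (fun t : ℝ => f t.toNNReal ω) g'
      (volume.restrict (Set.Ioc (s : ℝ) (s + T))) ≠ ∞ := by
    refine ae_ne_top_of_eLpNorm_ne_top hρ ?_ hfi.ne
    simp only [eLpNorm_restrict_eq_cumNorm hg0 hgt]
    exact (hf.measurable_cumNorm s g'.toReal (s + T)).mono (ℱ.le _) le_rfl
  have hext : ∀ᵐ ω ∂P, ∀ t ∈ Set.Ioc (s : ℝ) (s + T), K.duhamel β q f s t.toNNReal ω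
      = extInt K.group (fun t => β' t.toNNReal ω) (volume.restrict (Set.Ioc (s : ℝ) (s + T)))
        retarded q.conjExponent q (fun σ => f σ.toNNReal ω) t := by
    filter_upwards [hββ] with ω hω t ht
    rw [duhamel_eq_extInt f ht]
    simp only [hω]
  refine ⟨⟨?_, ?_⟩, fun Q R => ?_⟩
  · filter_upwards [hββ, hY, hfin] with ω hω hYω hfω
    rw [restrict_Icc_eq]
    filter_upwards [ae_integrable_extInt_integrand hU
      (hb.comp (measurable_id.prodMk measurable_const)) measurableSet_retarded ha hqt hkm hk hkt hYω
      (hfm.comp_measurable (measurable_id.prodMk measurable_const)) hfω,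
      ae_restrict_mem measurableSet_Ioc] with t h1 ht
    refine integrableOn_duhamelIntegrand ht ?_
    simp only [hω]
    exact h1
  · rw [restrict_Icc_eq]
    refine (stronglyMeasurable_extInt hU hb ha hqt hk hkt hfm
      (volume.restrict (Set.Ioc (s : ℝ) (s + T)))).aestronglyMeasurable.congr ?_
    have h1 : ∀ᵐ z ∂(P.prod (volume.restrict (Set.Ioc (s : ℝ) (s + T)))), ∀ t ∈ Set.Ioc (s : ℝ) (s + T),
        K.duhamel β q f s t.toNNReal z.1
          = extInt K.group (fun t => β' t.toNNReal z.1) (volume.restrict (Set.Ioc (s : ℝ) (s + T)))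
            retarded q.conjExponent q (fun σ => f σ.toNNReal z.1) t :=
      Measure.quasiMeasurePreserving_fst.ae hext
    have h2 : ∀ᵐ z ∂(P.prod (volume.restrict (Set.Ioc (s : ℝ) (s + T)))),
        z.2 ∈ Set.Ioc (s : ℝ) (s + T) :=
      Measure.quasiMeasurePreserving_snd.ae (ae_restrict_mem measurableSet_Ioc)
    filter_upwards [h1, h2] with z hz1 hz2
    exact (hz1 _ hz2).symm
  · unfold mixedNorm
    refine eLpNorm_congr_ae ?_
    filter_upwards [hext] with ω hω
    rw [restrict_Icc_eq]
    refine eLpNorm_congr_ae ?_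
    filter_upwards [ae_restrict_mem measurableSet_Ioc] with t ht
    rw [hω t ht]

end MetricGraph

section Exponents

variable {r p γ δ : ℝ≥0∞}

lemma Admissible.two_le_left (h : Admissible r p) : 2 ≤ r := by
  rcases h with ⟨rfl, -⟩ | h
  · exact le_top
  · exact h.1

lemma Admissible.two_le_right (h : Admissible r p) : 2 ≤ p := by
  rcases h with ⟨-, rfl⟩ | h
  · exact le_rfl
  · exact h.2.2.1

lemma Admissible.right_ne_top (h : Admissible r p) : p ≠ ∞ := by
  rcases h with ⟨-, rfl⟩ | h
  · norm_num
  · exact h.2.2.2.1.ne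

lemma Admissible.right_eq_two (h : Admissible ∞ p) : p = 2 := by
  rcases h with ⟨-, h⟩ | h
  · exact h
  · exact absurd h.2.1 (lt_irrefl _)

lemma two_le_exponent_nonneg (hp : 2 ≤ p) : 0 ≤ 1 / 2 - (p⁻¹).toReal := by
  have h1 : p⁻¹ ≤ 2⁻¹ := ENNReal.inv_le_inv.2 hp
  have h2 := ENNReal.toReal_mono (by simp) h1
  simp only [ENNReal.toReal_inv, ENNReal.toReal_ofNat] at h2 ⊢
  linarith

lemma Admissible.exponent_lt_one (h : Admissible r p) (hr : r ≠ ∞) :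
    (1 / 2 - (p⁻¹).toReal) * r.toReal / 2 < 1 := by
  have hr2 := two_le_toReal h.two_le_left hr
  rcases h with ⟨h, -⟩ | ⟨h2r, -, h2p, -, h⟩
  · exact absurd h hr
  · have hr0 : r⁻¹ ≠ ∞ := ENNReal.inv_ne_top.2 (lt_of_lt_of_le (by norm_num) h2r).ne'
    have hp0 : p⁻¹ ≠ ∞ := ENNReal.inv_ne_top.2 (lt_of_lt_of_le (by norm_num) h2p).ne'
    have h2r0 : 2 * r⁻¹ ≠ ∞ := ENNReal.mul_ne_top (by norm_num) hr0
    have h1 := (ENNReal.toReal_lt_toReal (by simp) (ENNReal.add_ne_top.2 ⟨h2r0, hp0⟩)).2 h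
    rw [ENNReal.toReal_add h2r0 hp0, ENNReal.toReal_mul, ENNReal.toReal_inv, ENNReal.toReal_inv r]
      at h1
    simp only [ENNReal.toReal_ofNat] at h1
    have h3 : (1 / 2 - (p⁻¹).toReal) * r.toReal < 2 * r.toReal⁻¹ * r.toReal := by
      gcongr
      linarith
    rw [mul_assoc, inv_mul_cancel₀ (by linarith)] at h3
    linarith

lemma eq_top_of_toReal_inv_eq_zero (hγ : 2 ≤ γ) (h : (γ⁻¹).toReal = 0) : γ = ∞ := by
  rcases (ENNReal.toReal_eq_zero_iff _).1 h with h | h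
  · exact ENNReal.inv_eq_zero.1 h
  · rw [ENNReal.inv_eq_top] at h
    rw [h] at hγ
    exact absurd hγ (by norm_num)

lemma conjExponent_two : ENNReal.conjExponent 2 = 2 := by
  have : ENNReal.HolderConjugate 2 2 := ⟨by simp [ENNReal.inv_two_add_inv_two]⟩
  exact this.conjExponent_eq

lemma conjExponent_top : ENNReal.conjExponent ∞ = 1 := by simp [ENNReal.conjExponent]

lemma strichartzExponent_top_two : strichartzExponent ∞ 2 = 0 := by
  simp [strichartzExponent]

lemma one_le_kernelConst {C c : ℝ≥0} {R a : ℝ} {N : ℕ} {T₀ : ℝ≥0∞} (hC : 1 ≤ C) (hR : 0 < R) :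
    1 ≤ kernelConst C c R a N T₀ := by
  have h1 : (1 : ℝ≥0∞) ≤ (2 * C) ^ (R / 2) := by
    refine ENNReal.one_le_rpow ?_ (by positivity)
    exact one_le_mul (by norm_num) (by exact_mod_cast hC)
  have h2 : (1 : ℝ≥0∞) ≤ occConst a N + (c : ℝ≥0∞) ^ (R / 2) * T₀ ^ (a / 2) := by
    rw [occConst, add_assoc]
    exact le_self_add
  exact one_le_mul (one_le_mul (by norm_num) h1) h2

/-- Absorption of the exponent of the constant. -/
lemma rpow_mul_ofReal_le {A : ℝ≥0∞} (hA : 1 ≤ A) {T x κ : ℝ} (hT : 0 < T) (hκ : 0 ≤ κ)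
    (hκ1 : κ ≤ 1) : (A * ENNReal.ofReal (T ^ x)) ^ κ ≤ A * ENNReal.ofReal (T ^ (x * κ)) := by
  rw [ENNReal.mul_rpow_of_nonneg _ _ hκ, ENNReal.ofReal_rpow_of_pos (by positivity),
    ← Real.rpow_mul hT.le]
  gcongr
  simpa using ENNReal.rpow_le_rpow_of_exponent_le hA hκ1

end Exponents

namespace MetricGraph

variable {G : MetricGraph} {K : G.Coupling} {Ω : Type*} {mΩ : MeasurableSpace Ω} {P : Measure Ω}
  {F : ℝ → MeasurableSpace Ω} {b : ℝ → Ω → ℝ}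

lemma Coupling.eLpNorm_group_le (hU : IsIsometricFlow K.group) (t : ℝ) (u : G.L2) :
    eLpNorm (K.group t u) 2 G.measure ≤ 1 * eLpNorm u (ENNReal.conjExponent 2) G.measure := by
  rw [conjExponent_two, one_mul, ← Lp.enorm_def, ← Lp.enorm_def, enorm_apply_eq hU]

/-- For an admissible pair, the kernel of the extension of `e^{itΔ}` acts along almost all paths. -/
lemma Coupling.H1.exists_kernelBound [IsProbabilityMeasure P] (hH1 : K.H1)
    (hU : IsUnitaryGroup K.laplacian K.group) (hb : HasTransitionBound P F b) {γ δ : ℝ≥0∞}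
    (h : Admissible γ δ) : ∃ k : ℝ → ℝ≥0∞, Measurable k ∧
      (∀ t u, eLpNorm (K.group t u) δ G.measure ≤ k t * eLpNorm u δ.conjExponent G.measure) ∧
      (∀ t, t ≠ 0 → k t ≠ ∞) ∧ ∀ s T : ℝ, 0 ≤ s → 0 < T → ∀ᵐ ω ∂P, KernelBound k (fun t => b t ω)
        (volume.restrict (Set.Ioc s (s + T))) γ.conjExponent := by
  rcases eq_or_ne γ ∞ with rfl | hγ
  · rw [h.right_eq_two]
    refine ⟨fun _ => 1, measurable_const, eLpNorm_group_le hU.isIsometricFlow, by simp,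
      fun s T _ _ => ae_of_all _ fun ω => ?_⟩
    rw [conjExponent_top]
    exact kernelBound_one _
  · obtain ⟨C, c, -, -, hk⟩ := hH1.exists_dispKernel hU h.two_le_right h.right_ne_top
    have hδ : 1 ≤ δ := le_trans (by norm_num) h.two_le_right
    have hγ1 : 1 ≤ γ := le_trans (by norm_num) h.two_le_left
    exact ⟨_, measurable_dispKernel C c _, hk _ (ENNReal.HolderConjugate.conjExponent hδ),
      fun t => dispKernel_ne_top C c _, fun s T hs hT => ae_kernelBound hb C c
        (two_le_exponent_nonneg h.two_le_right) h.two_le_left hγ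
        (ENNReal.HolderConjugate.conjExponent hγ1) (h.exponent_lt_one hγ) hs hT⟩

variable {ℱ : Filtration ℝ≥0 mΩ} {β β' : ℝ≥0 → Ω → ℝ}

/-- The Duhamel estimate for the endpoint pair `(∞, 2)`. -/
lemma Coupling.H1.duhamel_top [IsProbabilityMeasure P] (hH1 : K.H1)
    (hU : IsUnitaryGroup K.laplacian K.group)
    (hb : HasTransitionBound P F fun t ω => β' t.toNNReal ω)
    (hββ : ∀ᵐ ω ∂P, ∀ t, β t ω = β' t ω) {ρ : ℝ≥0∞} (hρ : 1 ≤ ρ) {s T : ℝ≥0} (hT : 0 < T)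
    {f : ℝ≥0 → Ω → Lp ℂ (ENNReal.conjExponent 2) G.measure} (hf : IsStronglyPredictable ℱ f)
    (hfi : G.mixedNorm P ρ (ENNReal.conjExponent ∞) (ENNReal.conjExponent 2) s T
      (fun t ω => f t ω) < ∞) :
    K.DuhamelWellDefined P β 2 f s T ∧
      G.mixedNorm P ρ ∞ 2 s T (fun t ω => K.duhamel β 2 f s t ω)
        ≤ G.mixedNorm P ρ (ENNReal.conjExponent ∞) (ENNReal.conjExponent 2) s T
          (fun t ω => f t ω) := by
  have hflow := hU.isIsometricFlow
  obtain ⟨k, hkm, hk, hkt, hY⟩ := hH1.exists_kernelBound hU hb (γ := ∞) (δ := 2) (Or.inl ⟨rfl, rfl⟩)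
  obtain ⟨h1, h2⟩ := duhamel_wellDefined hflow hb.measurable hββ le_rfl (by norm_num) hkm hk hkt
    (by simp [conjExponent_top]) (by simp [conjExponent_top]) (lt_of_lt_of_le one_pos hρ).ne'
    (hY s T s.coe_nonneg hT) hf hfi
  refine ⟨h1, ?_⟩
  rw [h2, mixedNorm_coeFn, conjExponent_top]
  refine eLpNorm_mono_enorm fun ω => ?_
  simp only [enorm_eq_self]
  exact eLpNorm_extInt_le_eLpNorm_one (by simp [conjExponent_two]) (eLpNorm_group_le hflow) _

/-- The Duhamel estimate, given a pathwise retarded estimate. -/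
lemma Coupling.H1.duhamel_le [IsProbabilityMeasure P] (hH1 : K.H1)
    (hU : IsUnitaryGroup K.laplacian K.group)
    (hb : HasTransitionBound P (fun t => ℱ t.toNNReal) fun t ω => β' t.toNNReal ω)
    (hββ : ∀ᵐ ω ∂P, ∀ t, β t ω = β' t ω) {g q : ℝ≥0∞} [Fact (1 ≤ q)] (hgq : Admissible g q)
    {C c : ℝ≥0} {α r₀ : ℝ} (hC : 1 ≤ C) (hα : 0 ≤ α) (hr₀ : 2 ≤ r₀) {Q R : ℝ≥0∞} {κ : ℝ}
    (hest : RetardedEstimate K.group (dispKernel C c α) r₀ q.conjExponent g.conjExponent Q R κ)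
    (hκ : 0 < κ) (hκ1 : κ ≤ 1) (hQ : 1 ≤ Q) (hR : 1 ≤ R) {s T : ℝ≥0} (hT : 0 < T) {T₀ : ℝ≥0∞}
    (hTT : (T : ℝ≥0∞) ≤ T₀) (hT₀ : T₀ = ∞ → c = 0) {ρ : ℝ≥0∞} (hρ : 1 ≤ ρ) (hρt : ρ ≠ ∞) {N : ℕ}
    (hN : α * r₀ / 2 * (N + 1) < N) (hNρ : 2 * ρ.toReal ≤ N + 1)
    {f : ℝ≥0 → Ω → Lp ℂ q.conjExponent G.measure} (hf : IsStronglyPredictable ℱ f)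
    (hfi : G.mixedNorm P ρ g.conjExponent q.conjExponent s T (fun t ω => f t ω) < ∞) :
    K.DuhamelWellDefined P β q f s T ∧ G.mixedNorm P ρ R Q s T (fun t ω => K.duhamel β q f s t ω)
      ≤ ENNReal.ofReal ((40 * kernelConst C c r₀ (α * r₀ / 2) N T₀).toReal
          * (T : ℝ) ^ ((1 - α * r₀ / 2 / 2) * κ))
        * G.mixedNorm P ρ g.conjExponent q.conjExponent s T (fun t ω => f t ω) := by
  have hflow := hU.isIsometricFlow
  have hg1 : 1 ≤ g := le_trans (by norm_num) hgq.two_le_left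
  have hq1 : 1 ≤ q := Fact.out
  have hgg := ENNReal.HolderConjugate.conjExponent hg1
  have hgt := holderConjugate_ne_top hgg hgq.two_le_left
  have hqt := holderConjugate_ne_top (ENNReal.HolderConjugate.conjExponent hq1) hgq.two_le_right
  obtain ⟨k, hkm, hk, hkt, hY⟩ := hH1.exists_kernelBound hU hb hgq
  obtain ⟨h1, h2⟩ := duhamel_wellDefined hflow hb.measurable hββ hgq.two_le_right hgq.right_ne_top
    hkm hk hkt hgg.symm.ne_zero hgt (lt_of_lt_of_le one_pos hρ).ne' (hY s T s.coe_nonneg hT) hf hfi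
  refine ⟨h1, ?_⟩
  have hT' : (0 : ℝ) < T := hT
  rw [h2, mixedNorm_coeFn]
  rw [mixedNorm_coeFn] at hfi
  have ha0 : 0 ≤ α * r₀ / 2 := by positivity
  refine (eLpNorm_eLpNorm_extInt_le (k := k) (T₀ := T₀) hflow hb hC hα hr₀ hest hκ hκ1 hqt
    hgq.right_ne_top hkm hk hkt hgg.symm.one_le hgt hQ hR s.coe_nonneg hT' (by simpa using hTT) hT₀ hρ hρt hN
    hNρ hf.stronglyMeasurable_toNNReal (fun t _ => hf.measurable_cumNorm s _ t) (hY s T s.coe_nonneg hT)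
    hfi.ne).trans ?_
  refine mul_le_mul_left ?_ _
  rw [ENNReal.ofReal_mul ENNReal.toReal_nonneg, ENNReal.ofReal_toReal (ENNReal.mul_ne_top (by norm_num)
    (kernelConst_ne_top hr₀ ha0 hN hT₀)), mul_assoc]
  refine mul_le_mul_right ?_ _
  exact rpow_mul_ofReal_le (one_le_kernelConst hC (by linarith)) hT' hκ.le hκ1

/-- The homogeneous estimate. -/
lemma Coupling.H1.propagator_le [IsProbabilityMeasure P] (hH1 : K.H1)
    (hU : IsUnitaryGroup K.laplacian K.group)
    (hb : HasTransitionBound P (fun t => ℱ t.toNNReal) fun t ω => β' t.toNNReal ω)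
    (hββ : ∀ᵐ ω ∂P, ∀ t, β t ω = β' t ω) {r p : ℝ≥0∞} (hrp : Admissible r p)
    {T₀ : ℝ≥0∞} (hT₀ : T₀ = ∞ → K.pointSpace = ⊥) :
    ∃ c : ℝ, 0 < c ∧ ∀ s T : ℝ≥0, 0 < T → (T : ℝ≥0∞) ≤ T₀ →
      ∀ X : Ω → G.L2, StronglyMeasurable[ℱ s] X →
        AEStronglyMeasurable (fun z : Ω × ℝ => K.propagator β z.2.toNNReal s z.1 (X z.1))
          (P.prod (volume.restrict (Set.Icc (s : ℝ) (s + T)))) ∧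
        G.mixedNorm P r r p s T (fun t ω => K.propagator β t s ω (X ω))
          ≤ ENNReal.ofReal (c * (T : ℝ) ^ (strichartzExponent r p / 2)) * eLpNorm X r P := by
  have hflow := hU.isIsometricFlow
  have hmeas : ∀ s T : ℝ≥0, ∀ X : Ω → G.L2, StronglyMeasurable[ℱ s] X →
      AEStronglyMeasurable (fun z : Ω × ℝ => K.propagator β z.2.toNNReal s z.1 (X z.1))
        (P.prod (volume.restrict (Set.Icc (s : ℝ) (s + T)))) := by
    intro s T X hX
    have h1 : Measurable fun z : Ω × ℝ => β' z.2.toNNReal z.1 - β' (s : ℝ).toNNReal z.1 :=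
      (hb.measurable.comp measurable_swap).sub
        (hb.measurable.comp (measurable_const.prodMk measurable_fst))
    have h2 := hflow.continuous_uncurry.comp_stronglyMeasurable
      (h1.stronglyMeasurable.prodMk ((hX.mono (ℱ.le s)).comp_measurable measurable_fst))
    refine h2.aestronglyMeasurable.congr ?_
    have h3 : ∀ᵐ z ∂(P.prod (volume.restrict (Set.Icc (s : ℝ) (s + T)))), ∀ t, β t z.1 = β' t z.1 :=
      Measure.quasiMeasurePreserving_fst.ae hββ
    filter_upwards [h3] with z hz
    simp [propagator, hz]
  have hnorm : ∀ (s T : ℝ≥0) (X : Ω → G.L2),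
      G.mixedNorm P r r p s T (fun t ω => K.propagator β t s ω (X ω))
        = eLpNorm (fun ω => eLpNorm (fun t : ℝ => eLpNorm
          (K.group (β' t.toNNReal ω - β' (s : ℝ).toNNReal ω) (X ω)) p G.measure) r
          (volume.restrict (Set.Ioc (s : ℝ) (s + T)))) r P := by
    intro s T X
    unfold mixedNorm
    refine eLpNorm_congr_ae ?_
    filter_upwards [hββ] with ω hω
    rw [restrict_Icc_eq]
    simp [propagator, hω]
  rcases eq_or_ne r ∞ with rfl | hrt
  · obtain rfl := hrp.right_eq_two
    refine ⟨1, one_pos, fun s T hT hTT X hX => ⟨hmeas s T X hX, ?_⟩⟩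
    rw [hnorm, strichartzExponent_top_two]
    simp only [zero_div, Real.rpow_zero, mul_one, ENNReal.ofReal_one, one_mul, ← Lp.enorm_def,
      enorm_apply_eq hflow]
    refine eLpNorm_mono_enorm fun ω => ?_
    rw [enorm_eq_self, eLpNorm_exponent_top]
    exact essSup_le_of_ae_le _ (ae_of_all _ fun t => by simp)
  · have hr2 := two_le_toReal hrp.two_le_left hrt
    have hp1 : 1 ≤ p := le_trans (by norm_num) hrp.two_le_right
    obtain ⟨C, c, hC, hc, hk⟩ := hH1.exists_dispKernel hU hrp.two_le_right hrp.right_ne_top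
    obtain ⟨N, hN, -⟩ := exists_nat_mul_lt (hrp.exponent_lt_one hrt) 0
    have hα := two_le_exponent_nonneg hrp.two_le_right
    set α := 1 / 2 - (p⁻¹).toReal with hαdef
    have ha0 : 0 ≤ α * r.toReal / 2 := by positivity
    have hcT : T₀ = ∞ → c = 0 := fun h => hc (hT₀ h)
    have hKt : 2 * kernelConst C c r.toReal (α * r.toReal / 2) N T₀ ≠ ∞ :=
      ENNReal.mul_ne_top (by norm_num) (kernelConst_ne_top hr2 ha0 hN hcT)
    refine ⟨(2 * kernelConst C c r.toReal (α * r.toReal / 2) N T₀).toReal, ENNReal.toReal_pos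
      (mul_ne_zero (by norm_num) (kernelConst_ne_zero hC)) hKt,
      fun s T hT hTT X hX => ⟨hmeas s T X hX, ?_⟩⟩
    have hT' : (0 : ℝ) < T := hT
    have hXs : StronglyMeasurable[ℱ (s : ℝ).toNNReal] X := by rwa [Real.toNNReal_coe]
    rw [hnorm]
    refine (eLpNorm_eLpNorm_flow_le (T₀ := T₀) hflow hb hC hα
      (ENNReal.HolderConjugate.conjExponent hp1) hrp.two_le_right hrp.right_ne_top hrp.two_le_left hrt
      (hk _ (ENNReal.HolderConjugate.conjExponent hp1)) s.coe_nonneg hT' (by simpa using hTT) hcT hN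
      (x := X) hXs).trans ?_
    gcongr
    rw [ENNReal.ofReal_mul ENNReal.toReal_nonneg, ENNReal.ofReal_toReal hKt, ← mul_assoc]
    refine (rpow_mul_ofReal_le (one_le_mul (by norm_num) (one_le_kernelConst hC (by linarith))) hT'
      (by positivity) ?_).trans_eq ?_
    · rw [div_le_one (by linarith)]
      linarith
    · congr 3
      rw [strichartzExponent, ← hαdef, ENNReal.toReal_inv]
      field_simp

end MetricGraph

section Stone

variable {H : Type*} [NormedAddCommGroup H] [InnerProductSpace ℂ H]

/-- A self-adjoint relation. -/
def IsSelfAdjointGraph (Γ : Submodule ℂ (H × H)) : Prop :=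
  ∀ u v, (u, v) ∈ Γ ↔ ∀ x y, (x, y) ∈ Γ → inner ℂ y u = inner ℂ x v

namespace IsSelfAdjointGraph

variable {Γ : Submodule ℂ (H × H)}

lemma norm_sub_sq (hΓ : IsSelfAdjointGraph Γ) (a : ℝ) {x y : H} (h : (x, y) ∈ Γ) :
    ‖x - (Complex.I * a) • y‖ ^ 2 = ‖x‖ ^ 2 + a ^ 2 * ‖y‖ ^ 2 := by
  have h1 : inner ℂ y x = inner ℂ x y := (hΓ x y).1 h x y h
  have h2 : (inner ℂ x y).im = 0 := by
    rw [← inner_conj_symm] at h1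
    exact Complex.conj_eq_iff_im.1 h1
  rw [@_root_.norm_sub_sq ℂ, inner_smul_right, norm_smul]
  have h3 : RCLike.re (Complex.I * a * inner ℂ x y) = 0 := by
    simp [h2]
  rw [h3]
  simp [mul_pow]

lemma norm_le (hΓ : IsSelfAdjointGraph Γ) (a : ℝ) {x y : H} (h : (x, y) ∈ Γ) :
    ‖x‖ ≤ ‖x - (Complex.I * a) • y‖ := by
  refine le_of_sq_le_sq ?_ (norm_nonneg _)
  rw [hΓ.norm_sub_sq a h]
  nlinarith [mul_nonneg (sq_nonneg a) (sq_nonneg ‖y‖)]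

lemma abs_mul_norm_le (hΓ : IsSelfAdjointGraph Γ) (a : ℝ) {x y : H} (h : (x, y) ∈ Γ) :
    |a| * ‖y‖ ≤ ‖x - (Complex.I * a) • y‖ := by
  refine le_of_sq_le_sq ?_ (norm_nonneg _)
  rw [hΓ.norm_sub_sq a h, mul_pow, sq_abs]
  nlinarith [sq_nonneg ‖x‖]

lemma isClosed (hΓ : IsSelfAdjointGraph Γ) : IsClosed (Γ : Set (H × H)) := by
  have : (Γ : Set (H × H)) = ⋂ z : Γ, {w : H × H | inner ℂ z.1.2 w.1 = inner ℂ z.1.1 w.2} := by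
    ext ⟨u, v⟩
    simp only [SetLike.mem_coe, Set.mem_iInter, Set.mem_ofPred_eq, Subtype.forall, Prod.forall]
    exact hΓ u v
  rw [this]
  exact isClosed_iInter fun z => isClosed_eq (by fun_prop) (by fun_prop)

variable [CompleteSpace H]

lemma exists_sub_eq (hΓ : IsSelfAdjointGraph Γ) {a : ℝ} (ha : a ≠ 0) (h : H) :
    ∃ x y, (x, y) ∈ Γ ∧ x - (Complex.I * a) • y = h := by
  let Φ : Γ →L[ℂ] H := (ContinuousLinearMap.fst ℂ H H
    - (Complex.I * a) • ContinuousLinearMap.snd ℂ H H).comp Γ.subtypeL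
  have hΦ : ∀ z : Γ, Φ z = z.1.1 - (Complex.I * a) • z.1.2 := fun z => rfl
  have : CompleteSpace Γ := hΓ.isClosed.completeSpace_coe
  have ha' : 0 < |a| := abs_pos.2 ha
  have hanti : AntilipschitzWith (Real.toNNReal (max 1 |a|⁻¹)) Φ := by
    refine Φ.antilipschitz_of_bound fun z => ?_
    rw [Real.coe_toNNReal _ (by positivity), hΦ]
    change max ‖z.1.1‖ ‖z.1.2‖ ≤ _
    refine max_le ?_ ?_
    · refine (hΓ.norm_le a z.2).trans (le_mul_of_one_le_left (norm_nonneg _) (le_max_left _ _))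
    · have h1 : ‖z.1.2‖ ≤ |a|⁻¹ * ‖z.1.1 - (Complex.I * a) • z.1.2‖ := by
        rw [inv_mul_eq_div, le_div_iff₀ ha', mul_comm]
        exact hΓ.abs_mul_norm_le a z.2
      exact h1.trans (by gcongr; exact le_max_right _ _)
  have hcl : IsClosed (LinearMap.range Φ.toLinearMap : Set H) := by
    rw [LinearMap.coe_range]
    exact hanti.isClosed_range Φ.uniformContinuous
  have htop : LinearMap.range Φ.toLinearMap = ⊤ := by
    rw [← hcl.submodule_topologicalClosure_eq, Submodule.topologicalClosure_eq_top_iff,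
      Submodule.eq_bot_iff]
    intro z hz
    have h0 : ∀ x y, (x, y) ∈ Γ → inner ℂ (x - (Complex.I * a) • y) z = 0 := fun x y hxy =>
      (Submodule.mem_orthogonal _ z).1 hz _ ⟨⟨(x, y), hxy⟩, rfl⟩
    have haC : (a : ℂ) ≠ 0 := by exact_mod_cast ha
    have hz' : (z, (Complex.I * (a : ℂ)⁻¹) • z) ∈ Γ := by
      refine (hΓ _ _).2 fun x y hxy => ?_
      have h1 := h0 x y hxy
      rw [inner_sub_left, inner_smul_left, sub_eq_zero] at h1
      rw [inner_smul_right, h1]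
      simp only [map_mul, Complex.conj_I, Complex.conj_ofReal]
      have : Complex.I * (a : ℂ)⁻¹ * (-Complex.I * a * inner ℂ y z)
          = -(Complex.I * Complex.I) * ((a : ℂ)⁻¹ * a) * inner ℂ y z := by ring
      rw [this, Complex.I_mul_I, inv_mul_cancel₀ haC]
      ring
    have h2 := hΓ.norm_le (-a) hz'
    have h3 : z - (Complex.I * ((-a : ℝ) : ℂ)) • (Complex.I * (a : ℂ)⁻¹) • z = 0 := by
      rw [smul_smul]
      have : Complex.I * ((-a : ℝ) : ℂ) * (Complex.I * (a : ℂ)⁻¹)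
          = -(Complex.I * Complex.I) * ((a : ℂ) * (a : ℂ)⁻¹) := by push_cast; ring
      rw [this, Complex.I_mul_I, mul_inv_cancel₀ haC]
      simp
    rw [h3, norm_zero] at h2
    exact norm_le_zero_iff.1 h2
  obtain ⟨z, hz⟩ : h ∈ LinearMap.range Φ.toLinearMap := htop ▸ Submodule.mem_top
  exact ⟨z.1.1, z.1.2, z.2, hz⟩

/-- The resolvent `(1 - i a A)⁻¹`. -/
lemma exists_resolvent (hΓ : IsSelfAdjointGraph Γ) {a : ℝ} (ha : a ≠ 0) :
    ∃ R : H →L[ℂ] H, (∀ h, ‖R h‖ ≤ ‖h‖) ∧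
      (∀ h, ∃ y, (R h, y) ∈ Γ ∧ R h - (Complex.I * a) • y = h) ∧
      ∀ x y, (x, y) ∈ Γ → R (x - (Complex.I * a) • y) = x := by
  choose x y hxy hh using fun h => hΓ.exists_sub_eq ha h
  have huniq : ∀ h u v, (u, v) ∈ Γ → u - (Complex.I * a) • v = h → u = x h := fun h u v huv e => by
    have h1 := hΓ.norm_le a (Γ.sub_mem huv (hxy h))
    have h2 : u - x h - (Complex.I * a) • (v - y h) = 0 := by
      rw [smul_sub, sub_sub_sub_comm, e, hh, sub_self]
    rw [h2, norm_zero] at h1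
    exact sub_eq_zero.1 (norm_le_zero_iff.1 h1)
  let R₀ : H →ₗ[ℂ] H :=
    { toFun := x
      map_add' := fun h k => (huniq _ _ _ (Γ.add_mem (hxy h) (hxy k)) (by
        rw [smul_add, add_sub_add_comm, hh, hh])).symm
      map_smul' := fun c h => (huniq _ _ _ (Γ.smul_mem c (hxy h)) (by
        rw [smul_comm (Complex.I * (a : ℂ)) c, ← smul_sub, hh])).symm }
  have hbd : ∀ h, ‖R₀ h‖ ≤ 1 * ‖h‖ := fun h => by
    have := hΓ.norm_le a (hxy h)
    rw [hh] at this
    rwa [one_mul]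
  refine ⟨R₀.mkContinuous 1 hbd, fun h => by simpa using hbd h, fun h => ⟨y h, hxy h, hh h⟩,
    fun u v huv => (huniq _ u v huv rfl).symm⟩

end IsSelfAdjointGraph

section BoundedGenerator

variable [CompleteSpace H]

open NormedSpace in
lemma norm_exp_smul_apply {B : H →L[ℂ] H} (hB : star B = -B) (t : ℝ) (x : H) :
    ‖exp (t • B) x‖ = ‖x‖ := by
  have h1 : exp (t • B) ∈ unitary (H →L[ℂ] H) := by
    let : NormedAlgebra ℚ (H →L[ℂ] H) := NormedAlgebra.restrictScalars ℚ ℂ _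
    refine exp_mem_unitary_of_mem_skewAdjoint ?_
    rw [skewAdjoint.mem_iff, star_smul, hB]
    simp
  have h2 := ContinuousLinearMap.inner_map_map_of_mem_unitary h1 x x
  rw [inner_self_eq_norm_sq_to_K, inner_self_eq_norm_sq_to_K] at h2
  have h3 : ‖exp (t • B) x‖ ^ 2 = ‖x‖ ^ 2 := by exact_mod_cast h2
  exact (pow_left_inj₀ (norm_nonneg _) (norm_nonneg _) two_ne_zero).1 h3

open NormedSpace in
lemma hasDerivAt_exp_smul_apply (B : H →L[ℂ] H) (t : ℝ) (x : H) :
    HasDerivAt (fun t : ℝ => exp (t • B) x) (exp (t • B) (B x)) t := by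
  have h := hasDerivAt_exp_smul_const (𝕂 := ℝ) B t
  exact (ContinuousLinearMap.apply ℂ H x).restrictScalars ℝ |>.hasFDerivAt.comp_hasDerivAt t h

open NormedSpace in
lemma norm_exp_smul_sub_le {B : H →L[ℂ] H} (hB : star B = -B) (t : ℝ) (x : H) :
    ‖exp (t • B) x - x‖ ≤ |t| * ‖B x‖ := by
  have h := convex_univ.norm_image_sub_le_of_norm_hasDerivWithin_le (𝕜 := ℝ)
    (f := fun t : ℝ => exp (t • B) x) (f' := fun t => exp (t • B) (B x)) (C := ‖B x‖) (x := 0)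
    (y := t) (fun u _ => (hasDerivAt_exp_smul_apply B u x).hasDerivWithinAt)
    (fun u _ => (norm_exp_smul_apply hB u _).le) trivial trivial
  simpa [mul_comm] using h

open NormedSpace in
lemma norm_exp_smul_sub_exp_smul_le {B C : H →L[ℂ] H} (hB : star B = -B) (hC : star C = -C)
    (hBC : Commute B C) (t : ℝ) (x : H) :
    ‖exp (t • B) x - exp (t • C) x‖ ≤ |t| * ‖B x - C x‖ := by
  have h1 : exp (t • B) = exp (t • C) * exp (t • (B - C)) := by
    let : NormedAlgebra ℚ (H →L[ℂ] H) := NormedAlgebra.restrictScalars ℚ ℂ _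
    rw [← exp_add_of_commute, ← smul_add, add_sub_cancel]
    exact ((hBC.symm.sub_right (Commute.refl C)).smul_right t).smul_left t
  have h2 : star (B - C) = -(B - C) := by rw [star_sub, hB, hC]; abel
  have h3 : exp (t • B) x - exp (t • C) x = exp (t • C) (exp (t • (B - C)) x - x) := by
    rw [h1, map_sub]; rfl
  rw [h3, norm_exp_smul_apply hC]
  simpa using norm_exp_smul_sub_le h2 t x

end BoundedGenerator

section Limits

lemma tendsto_apply_of_dense {D : Set H} (hD : Dense D) {T : ℕ → H →L[ℂ] H}
    (hT : ∀ n x, ‖T n x‖ ≤ ‖x‖) (h : ∀ x ∈ D, Tendsto (fun n => T n x) atTop (𝓝 x)) (x : H) :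
    Tendsto (fun n => T n x) atTop (𝓝 x) := by
  refine Metric.tendsto_atTop.2 fun ε hε => ?_
  obtain ⟨z, hz, hxz⟩ := hD.exists_dist_lt x (by positivity : 0 < ε / 3)
  obtain ⟨N, hN⟩ := Metric.tendsto_atTop.1 (h z hz) (ε / 3) (by positivity)
  refine ⟨N, fun n hn => ?_⟩
  have h1 : dist (T n x) (T n z) ≤ dist x z := by
    rw [dist_eq_norm, dist_eq_norm, ← map_sub]
    exact hT n _
  have h2 := dist_triangle4 (T n x) (T n z) z x
  rw [dist_comm z x] at h2
  linarith [hN n hn]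

lemma cauchySeq_apply_of_dense {D : Set H} (hD : Dense D) {T : ℕ → H →L[ℂ] H}
    (hT : ∀ n x, ‖T n x‖ ≤ ‖x‖) (h : ∀ x ∈ D, CauchySeq fun n => T n x) (x : H) :
    CauchySeq fun n => T n x := by
  refine Metric.cauchySeq_iff'.2 fun ε hε => ?_
  obtain ⟨z, hz, hxz⟩ := hD.exists_dist_lt x (by positivity : 0 < ε / 3)
  obtain ⟨N, hN⟩ := Metric.cauchySeq_iff'.1 (h z hz) (ε / 3) (by positivity)
  refine ⟨N, fun n hn => ?_⟩
  have h1 : ∀ m, dist (T m x) (T m z) ≤ dist x z := fun m => by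
    rw [dist_eq_norm, dist_eq_norm, ← map_sub]
    exact hT m _
  have h2 := dist_triangle4 (T n x) (T n z) (T N z) (T N x)
  rw [dist_comm (T N z)] at h2
  linarith [hN n hn, h1 n, h1 N]

end Limits

namespace IsSelfAdjointGraph

variable [CompleteSpace H] {Γ : Submodule ℂ (H × H)}

/-- Approximation of `i A` by bounded skew-adjoint operators. -/
lemma exists_approximation (hΓ : IsSelfAdjointGraph Γ) (hd : Dense {x | ∃ y, (x, y) ∈ Γ}) :
    ∃ B : ℕ → H →L[ℂ] H, (∀ n, star (B n) = -B n) ∧ (∀ m n, Commute (B m) (B n)) ∧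
      ∀ x y, (x, y) ∈ Γ → Tendsto (fun n => B n x) atTop (𝓝 (Complex.I • y)) := by
  choose R hR1 hR2 hR3 using fun a : {a : ℝ // a ≠ 0} => hΓ.exists_resolvent a.2
  have hsub : ∀ a x y, (x, y) ∈ Γ → R a x - (Complex.I * a.1) • R a y = x := fun a x y hxy => by
    rw [← map_smul, ← map_sub]
    exact hR3 a x y hxy
  have hmem : ∀ a x y, (x, y) ∈ Γ → (R a x, R a y) ∈ Γ := fun a x y hxy => by
    obtain ⟨y', hy', h1⟩ := hR2 a x
    have h2 := hsub a x y hxy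
    have ha : Complex.I * (a.1 : ℂ) ≠ 0 := mul_ne_zero Complex.I_ne_zero (by exact_mod_cast a.2)
    have h3 : (Complex.I * (a.1 : ℂ)) • y' = (Complex.I * (a.1 : ℂ)) • R a y :=
      sub_right_injective (h1.trans h2.symm)
    rwa [smul_right_injective H ha h3] at hy'
  have hcomm : ∀ a b, Commute (R a) (R b) := fun a b => by
    refine ContinuousLinearMap.ext fun h => ?_
    change R a (R b h) = R b (R a h)
    obtain ⟨y, hy, h1⟩ := hR2 b h
    have h2 := hR3 b _ _ (hmem a _ _ hy)
    rw [← map_smul, ← map_sub, h1] at h2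
    exact h2.symm
  have hadj : ∀ a b, b.1 = -a.1 → star (R a) = R b := fun a b hab => by
    rw [ContinuousLinearMap.star_eq_adjoint]
    refine ((ContinuousLinearMap.eq_adjoint_iff _ _).2 fun k h => ?_).symm
    obtain ⟨y, hy, h1⟩ := hR2 b k
    obtain ⟨y', hy', h2⟩ := hR2 a h
    have h3 := (hΓ _ _).1 hy' _ _ hy
    conv_lhs => rw [← h2]
    conv_rhs => rw [← h1]
    rw [inner_sub_right, inner_sub_left, inner_smul_right, inner_smul_left, h3, hab]
    simp
  have hlim : ∀ a : ℕ → {a : ℝ // a ≠ 0}, Tendsto (fun n => (a n).1) atTop (𝓝 0) →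
      ∀ x, Tendsto (fun n => R (a n) x) atTop (𝓝 x) := fun a ha x => by
    refine tendsto_apply_of_dense hd (fun n => hR1 (a n)) (fun z ⟨y, hz⟩ => ?_) x
    rw [tendsto_iff_norm_sub_tendsto_zero]
    refine squeeze_zero (fun n => norm_nonneg _) (g := fun n => |(a n).1| * ‖y‖) (fun n => ?_) ?_
    · have h1 := hsub (a n) z y hz
      have h2 : R (a n) z - z = (Complex.I * (a n).1) • R (a n) y := by
        rw [sub_eq_iff_eq_add, add_comm, ← sub_eq_iff_eq_add]
        exact h1
      rw [h2, norm_smul]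
      simp only [norm_mul, Complex.norm_I, one_mul, Complex.norm_real, Real.norm_eq_abs]
      gcongr
      exact hR1 _ _
    · simpa using ha.abs.mul_const ‖y‖
  let a : ℕ → {a : ℝ // a ≠ 0} := fun n => ⟨1 / ((n : ℝ) + 1), by positivity⟩
  let b : ℕ → {a : ℝ // a ≠ 0} := fun n => ⟨-(1 / ((n : ℝ) + 1)), neg_ne_zero.2 (by positivity)⟩
  have ha : Tendsto (fun n => (a n).1) atTop (𝓝 0) := tendsto_one_div_add_atTop_nhds_zero_nat
  have hb : Tendsto (fun n => (b n).1) atTop (𝓝 0) := by simpa using ha.neg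
  refine ⟨fun n => (((n : ℝ) + 1) / 2) • (R (a n) - R (b n)), fun n => ?_, fun m n => ?_,
    fun x y hxy => ?_⟩
  · rw [star_smul, star_sub, hadj (a n) (b n) rfl, hadj (b n) (a n) (by simp [a, b]), ← smul_neg,
      neg_sub]
    simp
  · refine (Commute.smul_right ?_ _).smul_left _
    exact ((hcomm _ _).sub_right (hcomm _ _)).sub_left ((hcomm _ _).sub_right (hcomm _ _))
  · have h1 : ∀ n : ℕ, ((((n : ℝ) + 1) / 2) • (R (a n) - R (b n))) x
        = (Complex.I * (1 / 2 : ℂ)) • (R (a n) y + R (b n) y) := fun n => by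
      have e1 := hsub (a n) x y hxy
      have e2 := hsub (b n) x y hxy
      have hn : ((n : ℂ) + 1) ≠ 0 := by exact_mod_cast Nat.succ_ne_zero n
      have e3 : R (a n) x - R (b n) x = (Complex.I * (1 / ((n : ℂ) + 1))) • (R (a n) y + R (b n) y) := by
        have e4 : R (a n) x = x + (Complex.I * (a n).1) • R (a n) y := sub_eq_iff_eq_add.1 e1
        have e5 : R (b n) x = x + (Complex.I * (b n).1) • R (b n) y := sub_eq_iff_eq_add.1 e2
        rw [e4, e5]
        simp only [a, b]
        push_cast
        rw [smul_add, mul_neg, neg_smul]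
        abel
      rw [smul_apply, sub_apply, e3, ← Complex.coe_smul, smul_smul]
      congr 1
      push_cast
      field_simp
    simp only [h1]
    have h2 := ((hlim a ha y).add (hlim b hb y)).const_smul (Complex.I * (1 / 2 : ℂ))
    convert h2 using 2
    rw [← two_smul ℂ y, smul_smul]
    congr 1
    ring

open NormedSpace in
/-- Stone's theorem. -/
theorem exists_group (hΓ : IsSelfAdjointGraph Γ) (hd : Dense {x | ∃ y, (x, y) ∈ Γ}) :
    ∃ U : ℝ → H →L[ℂ] H, IsIsometricFlow U ∧
      ∀ u v, (u, v) ∈ Γ ↔ HasDerivAt (fun t => U t u) (Complex.I • v) 0 := by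
  obtain ⟨B, hB, hBB, hBlim⟩ := hΓ.exists_approximation hd
  have hnorm : ∀ t n x, ‖exp (t • B n) x‖ = ‖x‖ := fun t n x => norm_exp_smul_apply (hB n) t x
  have hcau : ∀ t x, CauchySeq fun n => exp (t • B n) x := fun t x => by
    refine cauchySeq_apply_of_dense hd (fun n x => (hnorm t n x).le) (fun z ⟨y, hz⟩ => ?_) x
    have h1 := (hBlim z y hz).cauchySeq
    refine Metric.cauchySeq_iff'.2 fun ε hε => ?_
    obtain ⟨N, hN⟩ := Metric.cauchySeq_iff'.1 h1 (ε / (|t| + 1)) (by positivity)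
    refine ⟨N, fun n hn => ?_⟩
    have h2 := hN n hn
    rw [dist_eq_norm, lt_div_iff₀ (by positivity)] at h2
    rw [dist_eq_norm]
    refine (norm_exp_smul_sub_exp_smul_le (hB n) (hB N) (hBB n N) t z).trans_lt ?_
    nlinarith [norm_nonneg (B n z - B N z)]
  choose f hf using fun t x => cauchySeq_tendsto_of_complete (hcau t x)
  let U : ℝ → H →L[ℂ] H := fun t =>
    continuousLinearMapOfTendsto (fun n => exp (t • B n)) (tendsto_pi_nhds.2 (hf t))
  have hU : ∀ t x, Tendsto (fun n => exp (t • B n) x) atTop (𝓝 (U t x)) := hf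
  have hUnorm : ∀ t x, ‖U t x‖ = ‖x‖ := fun t x => by
    have h1 := (hU t x).norm
    simp only [hnorm] at h1
    exact (tendsto_nhds_unique h1 tendsto_const_nhds)
  have hadd : ∀ s t x, U (s + t) x = U s (U t x) := fun s t x => by
    refine tendsto_nhds_unique (hU (s + t) x) ?_
    have h1 : ∀ n, exp ((s + t) • B n) x = exp (s • B n) (exp (t • B n) x - U t x)
        + exp (s • B n) (U t x) := fun n => by
      let : NormedAlgebra ℚ (H →L[ℂ] H) := NormedAlgebra.restrictScalars ℚ ℂ _
      rw [add_smul, exp_add_of_commute (((Commute.refl (B n)).smul_right t).smul_left s), ← map_add,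
        sub_add_cancel]
      rfl
    simp only [h1]
    rw [← zero_add (U s (U t x))]
    refine Tendsto.add ?_ (hU s _)
    rw [tendsto_zero_iff_norm_tendsto_zero]
    simp only [hnorm]
    exact tendsto_iff_norm_sub_tendsto_zero.1 (hU t x)
  have hzero : U 0 = 1 := by
    refine ContinuousLinearMap.ext fun x => tendsto_nhds_unique (hU 0 x) ?_
    simp
  have hlip : ∀ x y, (x, y) ∈ Γ → ∀ s t, ‖U t x - U s x‖ ≤ |t - s| * ‖y‖ := fun x y hxy s t => by
    have h1 : U t x - U s x = U s (U (t - s) x - x) := by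
      rw [map_sub, ← hadd, add_sub_cancel]
    rw [h1, hUnorm]
    have h2 := ((hU (t - s) x).sub_const x).norm
    have h3 := ((hBlim x y hxy).norm.const_mul |t - s|)
    rw [norm_smul, Complex.norm_I, one_mul] at h3
    exact le_of_tendsto_of_tendsto' h2 h3 fun n => norm_exp_smul_sub_le (hB n) _ x
  have hcont : ∀ x, Continuous fun t => U t x := fun x => by
    refine continuous_of_uniform_approx_of_continuous fun u hu => ?_
    obtain ⟨ε, hε, hεu⟩ := Metric.mem_uniformity_dist.1 hu
    obtain ⟨z, ⟨y, hz⟩, hxz⟩ := hd.exists_dist_lt x hε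
    refine ⟨fun t => U t z, ?_, fun t => hεu ?_⟩
    · refine (LipschitzWith.of_dist_le_mul (K := ‖y‖₊) fun t s => ?_).continuous
      rw [dist_eq_norm, dist_eq_norm, mul_comm, coe_nnnorm]
      exact hlip z y hz s t
    · rwa [dist_eq_norm, ← map_sub, hUnorm, ← dist_eq_norm]
  have hflow : IsIsometricFlow U :=
    ⟨hzero, fun s t => ContinuousLinearMap.ext fun x => hadd s t x, hUnorm, hcont⟩
  have hfwd : ∀ x y, (x, y) ∈ Γ → HasDerivAt (fun t => U t x) (Complex.I • y) 0 := fun x y hxy => by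
    have hint : ∀ t : ℝ, U t x = x + ∫ s in (0 : ℝ)..t, U s (Complex.I • y) := fun t => by
      have h1 : ∀ n, ∫ s in (0 : ℝ)..t, exp (s • B n) (B n x) = exp (t • B n) x - x := fun n => by
        have hc : Continuous fun s : ℝ => exp (s • B n) (B n x) :=
          continuous_iff_continuousAt.2 fun s => (hasDerivAt_exp_smul_apply (B n) s _).continuousAt
        rw [intervalIntegral.integral_eq_sub_of_hasDerivAt
          (fun s _ => hasDerivAt_exp_smul_apply (B n) s x) (hc.intervalIntegrable _ _)]
        simp
      have h2 : Tendsto (fun n => ∫ s in (0 : ℝ)..t, exp (s • B n) (B n x)) atTop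
          (𝓝 (∫ s in (0 : ℝ)..t, U s (Complex.I • y))) := by
        refine intervalIntegral.tendsto_integral_filter_of_dominated_convergence
          (fun _ => ‖Complex.I • y‖ + 1) (Eventually.of_forall fun n => ?_) ?_
          intervalIntegrable_const (ae_of_all _ fun s _ => ?_)
        · have hc : Continuous fun s : ℝ => exp (s • B n) (B n x) :=
            continuous_iff_continuousAt.2 fun s => (hasDerivAt_exp_smul_apply (B n) s _).continuousAt
          exact hc.aestronglyMeasurable
        · filter_upwards [(hBlim x y hxy).norm.eventually_le_const (lt_add_one _)] with n hn
          exact ae_of_all _ fun s _ => by rw [hnorm]; exact hn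
        · have h3 : ∀ n, exp (s • B n) (B n x) = exp (s • B n) (B n x - Complex.I • y)
              + exp (s • B n) (Complex.I • y) := fun n => by rw [← map_add, sub_add_cancel]
          simp only [h3]
          rw [← zero_add (U s (Complex.I • y))]
          refine Tendsto.add ?_ (hU s _)
          rw [tendsto_zero_iff_norm_tendsto_zero]
          simp only [hnorm]
          exact tendsto_iff_norm_sub_tendsto_zero.1 (hBlim x y hxy)
      simp only [h1] at h2
      have h4 := tendsto_nhds_unique h2 ((hU t x).sub_const x)
      rw [h4]
      abel
    have h5 := (intervalIntegral.integral_hasDerivAt_right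
      ((hcont (Complex.I • y)).intervalIntegrable (0 : ℝ) 0)
      ((hcont (Complex.I • y)).stronglyMeasurableAtFilter _ _)
      (hcont (Complex.I • y)).continuousAt).const_add x
    simp only [hzero] at h5
    refine HasDerivAt.congr_of_eventuallyEq h5 (Eventually.of_forall hint)
  refine ⟨U, hflow, fun u v => ⟨hfwd u v, fun huv => (hΓ u v).2 fun x y hxy => ?_⟩⟩
  have h1 := (hfwd x y hxy).inner ℂ huv
  simp only [hflow.inner_map_map, hzero] at h1
  have h2 := h1.unique (hasDerivAt_const (0 : ℝ) (inner ℂ x u))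
  simp only [one_apply_eq_self] at h2
  rw [inner_smul_left, inner_smul_right, Complex.conj_I, neg_mul, ← sub_eq_add_neg, ← mul_sub] at h2
  have h3 := (mul_eq_zero.1 h2).resolve_left Complex.I_ne_zero
  exact (sub_eq_zero.1 h3).symm

end IsSelfAdjointGraph

/-- A self-adjoint operator `A` generates the group `e^{itA}`. -/
theorem isUnitaryGroup_unitaryGroup [CompleteSpace H] {A : H →ₗ.[ℂ] H} (hA : IsSelfAdjoint A) :
    IsUnitaryGroup A (unitaryGroup A) := by
  have hex : ∃ U : ℝ → H →L[ℂ] H, IsUnitaryGroup A U := by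
    have hΓ : IsSelfAdjointGraph A.graph := fun u v => by
      have h1 := LinearPMap.adjoint_graph_eq_graph_adjoint hA.dense_domain
      rw [LinearPMap.isSelfAdjoint_def.1 hA] at h1
      conv_lhs => rw [h1]
      simp only [Submodule.mem_adjoint_iff, sub_eq_zero]
    have hd : Dense {x | ∃ y, (x, y) ∈ A.graph} := by
      refine hA.dense_domain.mono fun x hx => ⟨A ⟨x, hx⟩, ?_⟩
      exact A.mem_graph ⟨x, hx⟩
    obtain ⟨U, hU, hgen⟩ := hΓ.exists_group hd
    refine ⟨U, hU.zero, hU.add, hU.norm_eq, hU.continuous, fun u v => ?_⟩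
    rw [hgen, hasDerivAt_iff_tendsto_slope_zero]
    simp [hU.zero, ← Complex.ofReal_inv, Complex.coe_smul]
  rw [unitaryGroup, dif_pos hex]
  exact hex.choose_spec

end Stone

section DuhamelExponent

variable {r p : ℝ≥0∞}

lemma duhamelExponent_pos {r₀ l : ℝ} (hr : 2 ≤ r₀) (hl : l ∈ Set.Icc (0 : ℝ) 1) :
    0 < 2 / r₀ * (1 - l / 2) :=
  mul_pos (by positivity) (by linarith [hl.2])

lemma duhamelExponent_le_one {r₀ l : ℝ} (hr : 2 ≤ r₀) (hl : l ∈ Set.Icc (0 : ℝ) 1) :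
    2 / r₀ * (1 - l / 2) ≤ 1 :=
  mul_le_one₀ ((div_le_one (by linarith)).2 hr) (by linarith [hl.2]) (by linarith [hl.1])

lemma duhamelExponent_eq (hr : 2 ≤ r) (hrt : r ≠ ∞) (p : ℝ≥0∞) (l : ℝ) :
    (1 - (1 / 2 - (p⁻¹).toReal) * r.toReal / 2 / 2) * (2 / r.toReal * (1 - l / 2))
      = strichartzExponent r p * (1 - l / 2) := by
  have hr2 := two_le_toReal hr hrt
  rw [strichartzExponent, ENNReal.toReal_inv r]
  field_simp

end DuhamelExponent

theorem theorem2p4 (G : MetricGraph) (K : G.Coupling)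
    (hK : IsSelfAdjoint K.laplacian) (hH1 : K.H1)
    {Ω : Type*} [mΩ : MeasurableSpace Ω] (P : Measure Ω) [IsProbabilityMeasure P]
    (ℱ : Filtration ℝ≥0 mΩ) (hℱ : UsualHypotheses ℱ P)
    (β : ℝ≥0 → Ω → ℝ) (hβ : IsFilteredBrownian ℱ P β)
    (r p : ℝ≥0∞) [Fact (1 ≤ p)] (hrp : Admissible r p)
    (T₀ : ℝ≥0∞) (hT₀ : T₀ = ∞ → K.pointSpace = ⊥) :
    -- (i)
    (∃ c : ℝ, 0 < c ∧ ∀ s T : ℝ≥0, 0 < T → (T : ℝ≥0∞) ≤ T₀ →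
      ∀ X : Ω → G.L2, StronglyMeasurable[ℱ s] X → eLpNorm X r P < ∞ →
        AEStronglyMeasurable (fun z : Ω × ℝ => K.propagator β z.2.toNNReal s z.1 (X z.1))
          (P.prod (volume.restrict (Set.Icc (s : ℝ) (s + T)))) ∧
        G.mixedNorm P r r p s T (fun t ω => K.propagator β t s ω (X ω))
          ≤ ENNReal.ofReal (c * (T : ℝ) ^ (strichartzExponent r p / 2)) * eLpNorm X r P) ∧
    -- (ii)
    (∀ (γ δ : ℝ≥0∞) [Fact (1 ≤ δ)], Admissible γ δ → ∀ ρ : ℝ≥0∞, 1 ≤ ρ →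
      -- (ii.1)
      (max ρ ρ.conjExponent ≤ r →
        ∃ c : ℝ, 0 < c ∧ ∀ l ∈ Set.Icc (0 : ℝ) 1,
          (γ⁻¹).toReal = (1 - l) * (r⁻¹).toReal →
          (δ⁻¹).toReal = l / 2 + (1 - l) * (p⁻¹).toReal →
          ∀ s T : ℝ≥0, 0 < T → (T : ℝ≥0∞) ≤ T₀ →
          ∀ f : ℝ≥0 → Ω → Lp ℂ δ.conjExponent G.measure, IsStronglyPredictable ℱ f →
            G.mixedNorm P ρ γ.conjExponent δ.conjExponent s T (fun t ω => f t ω) < ∞ →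
            K.DuhamelWellDefined P β δ f s T ∧
            G.mixedNorm P ρ r p s T (fun t ω => K.duhamel β δ f s t ω)
              ≤ ENNReal.ofReal (c * (T : ℝ) ^ (strichartzExponent r p * (1 - l / 2)))
                * G.mixedNorm P ρ γ.conjExponent δ.conjExponent s T (fun t ω => f t ω)) ∧
      -- (ii.2)
      (r.conjExponent ≤ ρ → ρ ≤ r →
        ∃ c : ℝ, 0 < c ∧ ∀ l ∈ Set.Icc (0 : ℝ) 1,
          (γ⁻¹).toReal = (1 - l) * (r⁻¹).toReal →
          (δ⁻¹).toReal = l / 2 + (1 - l) * (p⁻¹).toReal →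
          ∀ s T : ℝ≥0, 0 < T → (T : ℝ≥0∞) ≤ T₀ →
          ∀ f : ℝ≥0 → Ω → Lp ℂ p.conjExponent G.measure, IsStronglyPredictable ℱ f →
            G.mixedNorm P ρ r.conjExponent p.conjExponent s T (fun t ω => f t ω) < ∞ →
            K.DuhamelWellDefined P β p f s T ∧
            G.mixedNorm P ρ γ δ s T (fun t ω => K.duhamel β p f s t ω)
              ≤ ENNReal.ofReal (c * (T : ℝ) ^ (strichartzExponent r p * (1 - l / 2)))
                * G.mixedNorm P ρ r.conjExponent p.conjExponent s T (fun t ω => f t ω))) := by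
  have hU : IsUnitaryGroup K.laplacian K.group := isUnitaryGroup_unitaryGroup hK
  obtain ⟨β', hβ', hc', hββ⟩ := hβ.exists_continuous hℱ
  have hb := hβ'.hasTransitionBound hc'
  refine ⟨?_, fun γ δ _ hγδ ρ hρ => ?_⟩
  · obtain ⟨c, hc, h⟩ := hH1.propagator_le hU hb hββ hrp hT₀
    exact ⟨c, hc, fun s T hT hTT X hX _ => h s T hT hTT X hX⟩
  rcases eq_or_ne r ∞ with rfl | hrt
  · obtain rfl := hrp.right_eq_two
    have hpair : ∀ l : ℝ, (γ⁻¹).toReal = (1 - l) * (∞⁻¹ : ℝ≥0∞).toReal → γ = ∞ ∧ δ = 2 :=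
      fun l h => by
        obtain rfl := eq_top_of_toReal_inv_eq_zero hγδ.two_le_left (by simpa using h)
        exact ⟨rfl, hγδ.right_eq_two⟩
    have hone : ∀ (l : ℝ) (T : ℝ≥0),
        ENNReal.ofReal (1 * (T : ℝ) ^ (strichartzExponent ∞ 2 * (1 - l / 2))) = 1 := fun l T => by
      simp [strichartzExponent_top_two]
    refine ⟨fun _ => ⟨1, one_pos, fun l _ hγ _ s T hT _ f hf hfi => ?_⟩,
      fun _ _ => ⟨1, one_pos, fun l _ hγ _ s T hT _ f hf hfi => ?_⟩⟩
    · obtain ⟨rfl, rfl⟩ := hpair l hγ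
      rw [hone, one_mul]
      exact hH1.duhamel_top hU hb hββ hρ hT hf hfi
    · obtain ⟨rfl, rfl⟩ := hpair l hγ
      rw [hone, one_mul]
      exact hH1.duhamel_top hU hb hββ hρ hT hf hfi
  have hflow := hU.isIsometricFlow
  have hr2 := two_le_toReal hrp.two_le_left hrt
  have hα := two_le_exponent_nonneg hrp.two_le_right
  obtain ⟨C, c, hC, hc, hk⟩ := hH1.exists_dispKernel hU hrp.two_le_right hrp.right_ne_top
  have hcT : T₀ = ∞ → c = 0 := fun h => hc (hT₀ h)
  obtain ⟨N, hN, hNρ⟩ := exists_nat_mul_lt (hrp.exponent_lt_one hrt) (2 * ρ.toReal)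
  have hp1 : 1 ≤ p := Fact.out
  have hpq := ENNReal.HolderConjugate.conjExponent hp1
  have hrr := ENNReal.HolderConjugate.conjExponent
    (le_trans (by norm_num) hrp.two_le_left : (1 : ℝ≥0∞) ≤ r)
  have hδδ := ENNReal.HolderConjugate.conjExponent (Fact.out : 1 ≤ δ)
  have hγ1 : 1 ≤ γ := le_trans (by norm_num) hγδ.two_le_left
  have hγγ := ENNReal.HolderConjugate.conjExponent hγ1
  have hcpos : 0 < (40 * kernelConst C c r.toReal ((1 / 2 - (p⁻¹).toReal) * r.toReal / 2) N
      T₀).toReal :=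
    ENNReal.toReal_pos (mul_ne_zero (by norm_num) (kernelConst_ne_zero hC)) (ENNReal.mul_ne_top
      (by norm_num) (kernelConst_ne_top hr2 (by positivity) hN hcT))
  refine ⟨fun hρr => ⟨_, hcpos, fun l hl hγ hδ s T hT hTT f hf hfi => ?_⟩,
    fun _ hρr => ⟨_, hcpos, fun l hl hγ hδ s T hT hTT f hf hfi => ?_⟩⟩
  · rw [← duhamelExponent_eq hrp.two_le_left hrt]
    exact hH1.duhamel_le hU hb hββ hγδ hC hα hr2
      (retardedEstimate_dual hflow hpq hrp.two_le_right hrp.right_ne_top (hk _ hpq)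
        (measurable_dispKernel C c _) (dispKernel_neg C c _) hrp.two_le_left hrt hγγ hδδ
        hγδ.two_le_right hγδ.right_ne_top hl hγ hδ)
      (duhamelExponent_pos hr2 hl) (duhamelExponent_le_one hr2 hl) hp1 hrr.one_le hT hTT hcT hρ
      (ne_top_of_le_ne_top hrt ((le_max_left _ _).trans hρr)) hN hNρ hf hfi
  · rw [← duhamelExponent_eq hrp.two_le_left hrt]
    exact hH1.duhamel_le hU hb hββ hrp hC hα hr2
      (retardedEstimate_interpolate hflow hpq hrp.two_le_right hrp.right_ne_top (hk _ hpq)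
        (measurable_dispKernel C c _) (dispKernel_neg C c _) hrp.two_le_left hrt hrr hγγ.ne_zero
        hγδ.two_le_right hγδ.right_ne_top hl hγ hδ)
      (duhamelExponent_pos hr2 hl) (duhamelExponent_le_one hr2 hl) hδδ.one_le hγ1 hT hTT hcT hρ
      (ne_top_of_le_ne_top hrt hρr) hN hNρ hf hfi
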